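/- Let $d\ge 2$, $n\ge 1$, $a_1,\dots,a_d>0$, $A_i=a_iI_n$, $\bar u\in\mathbb R^n$, $\bar v=(\bar v_1,\dots,\bar v_d)\in(\mathbb R^n)^d$, and let $f_1,\dots,f_d:\mathbb R^n\to\mathbb R^n$ be $C^\infty$ with $f_i(\bar u)=\bar v_i$ and $f_i'(\bar u)=0$ for all $i$. Besov spaces: fix a smooth, radial, non-increasing $\chi:\mathbb R^d\to\mathbb R$ with compact support in $B(0,\frac43)$ and $\chi=1$ on $B(0,\frac34)$, put $\varphi(\xi)=\chi(\xi/2)-\chi(\xi)$, and for $j\in\mathbb Z$ let $\dot\Delta_j$, $\dot S_j$ be the Fourier multipliers with symbols $\varphi(2^{-j}\xi)$, $\chi(2^{-j}\xi)$. $\mathcal S_h'$ is the set of tempered distributions $w$ with $\lim_{j\to-\infty}\|\dot S_jw\|_{L^\infty}=0$, and $\dot B^s_{2,1}=\{w\in\mathcal S_h' : \|w\|_{\dot B^s_{2,1}}=\sum_{j}2^{js}\|\dot\Delta_jw\|_{L^2}<\infty\}$. Intersections carry the sum of the norms, and $\mathcal C_b(\mathbb R_+;\dot B^{s}_{2,1})$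 is the set of $w\in\mathcal C(\mathbb R_+;\dot B^s_{2,1})$ with $\sum_j2^{js}\sup_{t\ge0}\|\dot\Delta_jw(t)\|_{L^2}<\infty$. There are constants $\eta_1>0$ and $C>0$ (independent of the initial datum and of time) such that, for every real ($\mathbb R^n$-valued) $u_0^*$ with $u_0^*-\bar u\in\dot B^{d/2-1}_{2,1}\cap\dot B^{d/2}_{2,1}$ and $\|u_0^*-\bar u\|_{\dot B^{d/2-1}_{2,1}\cap\dot B^{d/2}_{2,1}}\le\eta_1$, the Cauchy problem $$\partial_tu^*+\sum_{i=1}^d\partial_{x_i}f_i(u^*)=\sum_{i=1}^d\partial_{x_i}(A_i\partial_{x_i}u^*),\qquad u^*|_{t=0}=u_0^*,$$ has a global strong solution $u^*$ (it satisfies the equation in the sense of distributions, and all terms of the equation belong to $L^1_{loc}([0,\infty);\dot B^{d/2-1}_{2,1}\cap\dot B^{d/2}_{2,1})$) with $u^*-\bar u\in\mathcal C_b(\mathbb R_+;\dot B^{d/2-1}_{2,1}\cap\dot B^{d/2}_{2,1})$. It is the unique solution with this last property, even among solutions in the sense of distributions. Moreover, with $v_i^*=-A_i\partial_{x_i}u^*+f_i(u^*)$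 for $i=1,\dots,d$ (Darcy's law), for all $t\ge0$, $$\|u^*-\bar u\|_{L^\infty_t(\dot B^{d/2-1}_{2,1}\cap\dot B^{d/2}_{2,1})}+\|u^*-\bar u\|_{L^1_t(\dot B^{d/2+1}_{2,1}\cap\dot B^{d/2+2}_{2,1})}+\|v^*-\bar v\|_{L^1_t(\dot B^{d/2}_{2,1}\cap\dot B^{d/2+1}_{2,1})}\le C\,\|u_0^*-\bar u\|_{\dot B^{d/2-1}_{2,1}\cap\dot B^{d/2}_{2,1}}.$$ -/

import Mathlib

open MeasureTheory Filter Topology Set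
open scoped ENNReal SchwartzMap LineDeriv BoundedContinuousFunction

noncomputable section

namespace JinXin

/-- The space `ℝ^d` of positions and frequencies. -/
abbrev Dom (d : ℕ) := EuclideanSpace ℝ (Fin d)

/-- The space `ℝ^n` of states. -/
abbrev Val (n : ℕ) := EuclideanSpace ℝ (Fin n)

/-- The complexification `ℂ^n` of the space of states. -/
abbrev CVal (n : ℕ) := EuclideanSpace ℂ (Fin n)

/-! ### Functions as tempered distributions -/

/-- The inclusion of `ℝ^n` into `ℂ^n`. -/
def complexify {n : ℕ} (y : Val n) : CVal n := WithLp.toLp 2 (fun k => (y k : ℂ))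

lemma continuous_complexify {n : ℕ} : Continuous (complexify (n := n)) := by
  unfold complexify
  fun_prop

lemma norm_complexify {n : ℕ} (y : Val n) : ‖complexify y‖ = ‖y‖ := by
  simp [complexify, EuclideanSpace.norm_eq]

lemma memLp_top_complexify {d n : ℕ} (g : Dom d →ᵇ Val n) :
    MemLp (fun x => complexify (g x)) ⊤ (volume : Measure (Dom d)) := by
  refine memLp_top_of_bound
    (continuous_complexify.comp g.continuous).aestronglyMeasurable ‖g‖ ?_
  exact Eventually.of_forall fun x => by
    rw [norm_complexify]
    exact g.norm_coe_le_norm x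

/-- The tempered distribution `ψ ↦ ∫ ψ(x) g(x) dx` of a bounded continuous `ℝ^n`-valued `g`. -/
def distOf {d n : ℕ} (g : Dom d →ᵇ Val n) : 𝓢'(Dom d, CVal n) :=
  Lp.toTemperedDistribution ((memLp_top_complexify g).toLp _)

/-- The composition `x ↦ F (g x)` of a bounded continuous `g` with a continuous `F`. -/
def comp {d n : ℕ} (F : C(Val n, Val n)) (g : Dom d →ᵇ Val n) : Dom d →ᵇ Val n :=
  BoundedContinuousFunction.mkOfBound (F.comp g.toContinuousMap)
    (Classical.choose (isBounded_iff_forall_norm_le.1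
      ((isCompact_closedBall (0 : Val n) ‖g‖).image F.continuous).isBounded) +
     Classical.choose (isBounded_iff_forall_norm_le.1
      ((isCompact_closedBall (0 : Val n) ‖g‖).image F.continuous).isBounded)) (by
    intro x y
    have h := Classical.choose_spec (isBounded_iff_forall_norm_le.1
      ((isCompact_closedBall (0 : Val n) ‖g‖).image F.continuous).isBounded)
    have hx := h (F (g x)) (mem_image_of_mem _ (by simpa using g.norm_coe_le_norm x))
    have hy := h (F (g y)) (mem_image_of_mem _ (by simpa using g.norm_coe_le_norm y))
    exact (dist_le_norm_add_norm _ _).trans (add_le_add hx hy))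

@[simp] lemma comp_apply {d n : ℕ} (F : C(Val n, Val n)) (g : Dom d →ᵇ Val n) (x : Dom d) :
    comp F g x = F (g x) := rfl

/-- The tempered distribution of the constant function with value `y`. -/
def constDist (d : ℕ) {n : ℕ} (y : Val n) : 𝓢'(Dom d, CVal n) :=
  distOf (BoundedContinuousFunction.const (Dom d) y)

/-- A distribution is real valued (that is, `ℝ^n`-valued) if it takes values in `ℝ^n` on
real-valued test functions. -/
def IsRealValued {d n : ℕ} (T : 𝓢'(Dom d, CVal n)) : Prop :=
  ∀ ψ : 𝓢(Dom d, ℂ), (∀ x, (ψ x).im = 0) → ∀ k, (T ψ k).im = 0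

/-- The `i`-th partial derivative of a tempered distribution. -/
def partialD {d n : ℕ} (i : Fin d) (T : 𝓢'(Dom d, CVal n)) : 𝓢'(Dom d, CVal n) :=
  ∂_{(EuclideanSpace.single i (1 : ℝ) : Dom d)} T

/-! ### Littlewood-Paley decomposition and homogeneous Besov spaces -/

/-- A low-frequency cut-off: smooth, radial and non-increasing, compactly supported in the ball
`B(0, 4/3)` and equal to one on `B(0, 3/4)`. -/
structure IsCutoff {d : ℕ} (χ : Dom d → ℝ) : Prop where
  smooth : ContDiff ℝ (⊤ : ℕ∞) χ
  radial_antitone : ∀ ξ ζ : Dom d, ‖ξ‖ ≤ ‖ζ‖ → χ ζ ≤ χ ξ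
  support : tsupport χ ⊆ Metric.ball 0 (4 / 3)
  eq_one : ∀ ξ ∈ Metric.ball (0 : Dom d) (3 / 4), χ ξ = 1

section LittlewoodPaley

variable {d n : ℕ} (χ : Dom d → ℝ)

/-- `φ(ξ) = χ(ξ/2) - χ(ξ)`. -/
def annulus (ξ : Dom d) : ℝ := χ ((2 : ℝ)⁻¹ • ξ) - χ ξ

/-- The homogeneous dyadic block: the Fourier multiplier with symbol `φ(2^{-j} ξ)`. -/
def block (j : ℤ) (T : 𝓢'(Dom d, CVal n)) : 𝓢'(Dom d, CVal n) :=
  TemperedDistribution.fourierMultiplierCLM (CVal n)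
    (fun ξ => ((annulus χ ((2 : ℝ) ^ (-j) • ξ) : ℝ) : ℂ)) T

/-- The low-frequency cut-off operator: the Fourier multiplier with symbol `χ(2^{-j} ξ)`. -/
def lowCut (j : ℤ) (T : 𝓢'(Dom d, CVal n)) : 𝓢'(Dom d, CVal n) :=
  TemperedDistribution.fourierMultiplierCLM (CVal n)
    (fun ξ => ((χ ((2 : ℝ) ^ (-j) • ξ) : ℝ) : ℂ)) T

/-- The `L^p` norm of a tempered distribution, equal to `∞` if it is not an `L^p` function. -/
def distLpNorm (p : ℝ≥0∞) [Fact (1 ≤ p)] (T : 𝓢'(Dom d, CVal n)) : ℝ≥0∞ :=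
  ⨅ (g : Lp (CVal n) p (volume : Measure (Dom d))) (_ : Lp.toTemperedDistribution g = T), ‖g‖ₑ

/-- The space `S'_h` of tempered distributions with `‖S_j T‖_{L^∞} → 0` as `j → -∞`. -/
def InSh (T : 𝓢'(Dom d, CVal n)) : Prop :=
  Tendsto (fun j : ℤ => distLpNorm ⊤ (lowCut χ j T)) atBot (𝓝 0)

open Classical in
/-- The norm of the homogeneous Besov space `Ḃ^s_{2,1}`, equal to `∞` outside of that space. -/
def besovNorm (s : ℝ) (T : 𝓢'(Dom d, CVal n)) : ℝ≥0∞ :=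
  if InSh χ T then ∑' j : ℤ, (2 : ℝ≥0∞) ^ ((j : ℝ) * s) * distLpNorm 2 (block χ j T) else ⊤

/-- The norm of `Ḃ^s_{2,1} ∩ Ḃ^{s'}_{2,1}`. -/
def capNorm (s s' : ℝ) (T : 𝓢'(Dom d, CVal n)) : ℝ≥0∞ := besovNorm χ s T + besovNorm χ s' T

/-- The Chemin-Lerner seminorm of `L̃^∞(ℝ₊; Ḃ^s_{2,1})`. -/
def cheminLernerNorm (s : ℝ) (w : ℝ → 𝓢'(Dom d, CVal n)) : ℝ≥0∞ :=
  ∑' j : ℤ, (2 : ℝ≥0∞) ^ ((j : ℝ) * s) *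
    ⨆ (t : ℝ) (_ : 0 ≤ t), distLpNorm 2 (block χ j (w t))

/-- The space `C_b(ℝ₊; Ḃ^s_{2,1} ∩ Ḃ^{s'}_{2,1})`: continuous functions of time `t ≥ 0` with
values in the Besov space, whose Chemin-Lerner norm is finite. -/
structure InCb (s s' : ℝ) (w : ℝ → 𝓢'(Dom d, CVal n)) : Prop where
  mem : ∀ t, 0 ≤ t → capNorm χ s s' (w t) < ⊤
  cont : ∀ t, 0 ≤ t → Tendsto (fun τ => capNorm χ s s' (w τ - w t)) (𝓝[Ici 0] t) (𝓝 0)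
  bdd : cheminLernerNorm χ s w < ⊤
  bdd' : cheminLernerNorm χ s' w < ⊤

/-- The norm of `L^∞(0, t; Ḃ^s_{2,1} ∩ Ḃ^{s'}_{2,1})`, for continuous functions of time. -/
def supNorm (s s' : ℝ) (t : ℝ) (w : ℝ → 𝓢'(Dom d, CVal n)) : ℝ≥0∞ :=
  ⨆ τ ∈ Icc 0 t, capNorm χ s s' (w τ)

/-- The norm of `L^1(0, t; Ḃ^s_{2,1} ∩ Ḃ^{s'}_{2,1})`. -/
def intNorm (s s' : ℝ) (t : ℝ) (w : ℝ → 𝓢'(Dom d, CVal n)) : ℝ≥0∞ :=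
  ∫⁻ τ in Ioc 0 t, capNorm χ s s' (w τ)

end LittlewoodPaley

/-! ### The viscous conservation law -/

section Equation

variable {d n : ℕ} (a : Fin d → ℝ) (f : Fin d → C(Val n, Val n))

/-- The diffusion term `∂_i (A_i ∂_i g)`, with `A_i = a_i I_n`. -/
def diffusion (i : Fin d) (g : Dom d →ᵇ Val n) : 𝓢'(Dom d, CVal n) :=
  partialD i ((a i : ℂ) • partialD i (distOf g))

/-- The convection term `∂_i f_i(g)`. -/
def convection (i : Fin d) (g : Dom d →ᵇ Val n) : 𝓢'(Dom d, CVal n) :=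
  partialD i (distOf (comp (f i) g))

/-- `u` solves `∂_t u + ∑ ∂_i f_i(u) = ∑ ∂_i (A_i ∂_i u)` for `t > 0` in the sense of tempered
distributions, with initial datum `u₀`. -/
structure IsSolution (u₀ : 𝓢'(Dom d, CVal n)) (u : ℝ → (Dom d →ᵇ Val n)) : Prop where
  init : distOf (u 0) = u₀
  eqn : ∀ t, 0 < t → ∀ ψ : 𝓢(Dom d, ℂ),
    HasDerivAt (fun τ => distOf (u τ) ψ)
      ((∑ i, diffusion a i (u t) - ∑ i, convection f i (u t)) ψ) t

/-- A strong solution: moreover all terms of the equation (hence also `∂_t u`, which is equal to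
a sum of the others) are locally integrable in time on `[0, ∞)` with values in the space
`Ḃ^{d/2-1}_{2,1} ∩ Ḃ^{d/2}_{2,1}`, so that the equation is an identity between functions. -/
structure IsStrongSolution (χ : Dom d → ℝ) (u₀ : 𝓢'(Dom d, CVal n))
    (u : ℝ → (Dom d →ᵇ Val n)) : Prop extends IsSolution a f u₀ u where
  diffusion_int : ∀ T, 0 ≤ T → ∀ i,
    intNorm χ ((d : ℝ) / 2 - 1) ((d : ℝ) / 2) T (fun t => diffusion a i (u t)) < ⊤
  convection_int : ∀ T, 0 ≤ T → ∀ i,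
    intNorm χ ((d : ℝ) / 2 - 1) ((d : ℝ) / 2) T (fun t => convection f i (u t)) < ⊤

/-- The perturbation `u(t) - ū`. -/
def pert (ubar : Val n) (u : ℝ → (Dom d →ᵇ Val n)) (t : ℝ) : 𝓢'(Dom d, CVal n) :=
  distOf (u t) - constDist d ubar

/-- Darcy's law `v_i = -A_i ∂_i u + f_i(u)`. -/
def darcy (i : Fin d) (u : ℝ → (Dom d →ᵇ Val n)) (t : ℝ) : 𝓢'(Dom d, CVal n) :=
  -((a i : ℂ) • partialD i (distOf (u t))) + distOf (comp (f i) (u t))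

end Equation

end JinXin

end

open JinXin

set_option linter.unusedSectionVars false

noncomputable section

namespace JinXin

/-! The unknown is y = u - ū, and the whole argument is carried out on its Fourier transform V. The
critical space Ḃ^{d/2}_{2,1} embeds into the Wiener algebra: Cauchy-Schwarz on each dyadic shell
gives ∫|V| ≤ C‖V‖_{d/2} (`lintegral_le_specNorm`). Conversely, every distribution in that space is
the inverse transform of an integrable function, because the condition defining S'_h excludes a
contribution concentrated at frequency zero (`exists_eq_specDist`). Smooth and sharp dyadic cut-offs
give equivalent norms, so sharp shells are used throughout.

Since f_i'(ū) = 0, the fluxes g_i(y) = f_i(ū + y) - f_i(ū) vanish to second order. Composition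
estimates come from the telescoping series of g(S_{j+1}y) - g(S_j y): its j-th term oscillates at
scale 2^{-j}, so its transform on the shell k is damped by min(1, 2^{-(k-j)N})
(`exists_comp_bound`). The mass of V itself serves as the small amplitude, which makes the estimate
quadratic (`exists_comp_real_bound`). With ‖y‖²_{d/2} ≤ ‖y‖_{d/2-1}‖y‖_{d/2+1} (`specNorm_sq_le`),
the nonlinear term is bounded in Ḃ^{d/2-1} ∩ Ḃ^{d/2} by a factor bounded in time and a factor
integrable in time.

On the shell j the heat flow decays at rate c4^j. Duhamel's formula therefore controls both the
supremum in time and 4^j times the time integral of each shell norm, and their weighted sum is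
`energy` (`energy_duhamel_le`). For small data the solution map preserves the set where the energy
is at most a constant times the norm of the datum (`exists_energy_picard_le`). Contraction is proved
in a weaker distance, sup_t e^{-lt}∫|V - W|: composition is Lipschitz in the Wiener algebra
(`exists_comp_lipschitz`), the outer derivative costs only (t-s)^{-1/2}, and a large l makes the
factor 1/2 (`exists_contraction`). The limit of the Picard iterates keeps the energy bound by
Fatou's lemma (`exists_fixedPoint`), and the energy controls all norms of the conclusion.

The contraction needs boundedness of the trajectories but no smallness, so it also gives uniqueness.
A distributional solution in C_b is tested against Schwartz functions, which yields the integrated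
equation for almost every frequency; this is turned into Duhamel's formula, and any two fixed points
agree (`eq_of_isSolution`). Two precautions recur: Fourier transforms are given by one explicit
formula, so that they are jointly measurable in time and frequency, and Hermitian parts are taken,
so that the functions stay real. -/

/-! ### Dyadic shells in frequency space -/

/-- The dyadic shell `2^j ≤ |ξ| < 2^{j+1}`. -/
def shell (d : ℕ) (j : ℤ) : Set (Dom d) := {ξ | (2 : ℝ) ^ j ≤ ‖ξ‖ ∧ ‖ξ‖ < (2 : ℝ) ^ (j + 1)}

/-- The `L²` norm on a dyadic shell. -/
def shellNorm {d : ℕ} {E : Type*} [NormedAddCommGroup E] (j : ℤ) (V : Dom d → E) : ℝ≥0∞ :=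
  eLpNorm V 2 (volume.restrict (shell d j))

/-- The homogeneous Besov norm of a function given on the Fourier side, with sharp cut-offs. -/
def specNorm {d : ℕ} {E : Type*} [NormedAddCommGroup E] (s : ℝ) (V : Dom d → E) : ℝ≥0∞ :=
  ∑' j : ℤ, (2 : ℝ≥0∞) ^ ((j : ℝ) * s) * shellNorm j V

lemma two_rpow_ne_zero (x : ℝ) : (2 : ℝ≥0∞) ^ x ≠ 0 := by simp [ENNReal.rpow_eq_zero_iff]

lemma two_rpow_ne_top (x : ℝ) : (2 : ℝ≥0∞) ^ x ≠ ⊤ := by simp [ENNReal.rpow_eq_top_iff]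

lemma two_rpow_add (x y : ℝ) : (2 : ℝ≥0∞) ^ (x + y) = 2 ^ x * 2 ^ y :=
  ENNReal.rpow_add _ _ (by simp) (by simp)

lemma ofReal_two_rpow (x : ℝ) : ENNReal.ofReal ((2 : ℝ) ^ x) = (2 : ℝ≥0∞) ^ x := by
  rw [← ENNReal.ofReal_rpow_of_pos (by norm_num)]; norm_num

section Shell

variable {d : ℕ} {E F : Type*} [NormedAddCommGroup E] [NormedAddCommGroup F]

lemma measurableSet_shell (j : ℤ) : MeasurableSet (shell d j) :=
  (measurableSet_le measurable_const measurable_norm).inter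
    (measurableSet_lt measurable_norm measurable_const)

lemma shell_disjoint : Pairwise (Function.onFun Disjoint (shell d)) := by
  intro i j hij
  refine Set.disjoint_left.2 fun ξ hi hj => hij ?_
  have h1 : (2 : ℝ) ^ i < 2 ^ (j + 1) := hi.1.trans_lt hj.2
  have h2 : (2 : ℝ) ^ j < 2 ^ (i + 1) := hj.1.trans_lt hi.2
  rw [zpow_lt_zpow_iff_right₀ (by norm_num)] at h1 h2
  omega

lemma iUnion_shell : ⋃ j, shell d j = {0}ᶜ := by
  ext ξ
  simp only [mem_iUnion, mem_compl_iff, mem_singleton_iff]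
  constructor
  · rintro ⟨j, hj⟩ rfl
    have := hj.1
    rw [norm_zero] at this
    exact absurd this (not_le.2 (by positivity))
  · intro h
    obtain ⟨j, hj⟩ := exists_mem_Ico_zpow (norm_pos_iff.2 h) (one_lt_two (α := ℝ))
    exact ⟨j, hj.1, hj.2⟩

instance instNontrivialDom [NeZero d] : Nontrivial (Dom d) := by
  have : Nonempty (Fin d) := ⟨0⟩
  infer_instance

lemma lintegral_eq_tsum_shell [NeZero d] (f : Dom d → ℝ≥0∞) :
    ∫⁻ ξ, f ξ = ∑' j, ∫⁻ ξ in shell d j, f ξ := by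
  rw [← lintegral_iUnion measurableSet_shell shell_disjoint, iUnion_shell,
    restrict_compl_singleton]

/-- The constant in Bernstein's inequality `‖V‖_{L¹} ≤ C ‖V‖_{d/2}`. -/
def massConst (d : ℕ) : ℝ≥0∞ := ((2 : ℝ≥0∞) ^ (d : ℝ) * volume (Metric.ball (0 : Dom d) 1)) ^ (1 / 2 : ℝ)

lemma massConst_ne_top : massConst d ≠ ⊤ := by
  refine ENNReal.rpow_ne_top_of_nonneg (by norm_num) (ENNReal.mul_ne_top (two_rpow_ne_top _) ?_)
  exact measure_ball_lt_top.ne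

lemma volume_shell_le (j : ℤ) :
    volume (shell d j) ≤ (2 : ℝ≥0∞) ^ ((j : ℝ) * d) *
      ((2 : ℝ≥0∞) ^ (d : ℝ) * volume (Metric.ball (0 : Dom d) 1)) := by
  have h : shell d j ⊆ Metric.ball 0 ((2 : ℝ) ^ (j + 1)) := fun ξ hξ => by simpa using hξ.2
  refine (measure_mono h).trans ?_
  rw [Measure.addHaar_ball_of_pos _ _ (by positivity), ← mul_assoc, ← two_rpow_add, ← ofReal_two_rpow]
  gcongr
  simp only [finrank_euclideanSpace, Fintype.card_fin]
  rw [← Real.rpow_intCast, ← Real.rpow_natCast, ← Real.rpow_mul (by norm_num)]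
  refine le_of_eq ?_
  congr 1
  push_cast
  ring

/-- Cauchy-Schwarz on a set of volume at most a constant times 2^{jd}. -/
lemma lintegral_shell_le {V : Dom d → E} (hV : AEStronglyMeasurable V) (j : ℤ) :
    ∫⁻ ξ in shell d j, ‖V ξ‖ₑ ≤
      massConst d * ((2 : ℝ≥0∞) ^ ((j : ℝ) * (d / 2)) * shellNorm j V) := by
  have h := eLpNorm_le_eLpNorm_mul_rpow_measure_univ (p := 1) (q := 2)
    (μ := volume.restrict (shell d j)) (by norm_num) hV.restrict
  rw [eLpNorm_one_eq_lintegral_enorm] at h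
  refine h.trans ?_
  rw [shellNorm, mul_comm, ← mul_assoc]
  gcongr
  simp only [Measure.restrict_apply_univ, ENNReal.toReal_one, ENNReal.toReal_ofNat]
  have : (1 / 1 - 1 / 2 : ℝ) = 1 / 2 := by norm_num
  rw [this]
  refine (ENNReal.rpow_le_rpow (volume_shell_le j) (by norm_num)).trans (le_of_eq ?_)
  rw [ENNReal.mul_rpow_of_nonneg _ _ (by norm_num), mul_comm, massConst, ← ENNReal.rpow_mul]
  congr 2
  ring

/-- The embedding of `Ḃ^{d/2}_{2,1}` into the Wiener algebra. -/
lemma lintegral_le_specNorm [NeZero d] {V : Dom d → E} (hV : AEStronglyMeasurable V) :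
    ∫⁻ ξ, ‖V ξ‖ₑ ≤ massConst d * specNorm (d / 2 : ℝ) V := by
  rw [lintegral_eq_tsum_shell, specNorm, ← ENNReal.tsum_mul_left]
  exact ENNReal.tsum_le_tsum fun j => lintegral_shell_le hV j

lemma integrable_of_specNorm [NeZero d] {V : Dom d → E} (hV : AEStronglyMeasurable V)
    (h : specNorm (d / 2 : ℝ) V ≠ ⊤) : Integrable V :=
  ⟨hV, (lintegral_le_specNorm hV).trans_lt
    (ENNReal.mul_lt_top massConst_ne_top.lt_top h.lt_top)⟩

lemma shellNorm_congr {V W : Dom d → E} (h : V =ᵐ[volume] W) (j : ℤ) :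
    shellNorm j V = shellNorm j W := eLpNorm_congr_ae (ae_restrict_of_ae h)

lemma specNorm_congr {V W : Dom d → E} (h : V =ᵐ[volume] W) (s : ℝ) :
    specNorm s V = specNorm s W := by simp only [specNorm, shellNorm_congr h]

lemma shellNorm_le_of_le {V : Dom d → E} {W : Dom d → F} {c : ℝ} {j : ℤ}
    (h : ∀ ξ ∈ shell d j, ‖W ξ‖ ≤ c * ‖V ξ‖) :
    shellNorm j W ≤ ENNReal.ofReal c * shellNorm j V :=
  eLpNorm_le_mul_eLpNorm_of_ae_le_mul
    ((ae_restrict_iff' (measurableSet_shell j)).2 (Eventually.of_forall h)) 2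

lemma shellNorm_mono {V : Dom d → E} {W : Dom d → F} {j : ℤ}
    (h : ∀ ξ, ‖W ξ‖ ≤ ‖V ξ‖) : shellNorm j W ≤ shellNorm j V := by
  simpa using shellNorm_le_of_le (c := 1) (j := j) (V := V) (W := W) fun ξ _ => by simpa using h ξ

lemma specNorm_mono {V : Dom d → E} {W : Dom d → F} (s : ℝ)
    (h : ∀ ξ, ‖W ξ‖ ≤ ‖V ξ‖) : specNorm s W ≤ specNorm s V :=
  ENNReal.tsum_le_tsum fun j => by gcongr; exact shellNorm_mono h

lemma shellNorm_add_le {V W : Dom d → E} (hV : AEStronglyMeasurable V)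
    (hW : AEStronglyMeasurable W) (j : ℤ) :
    shellNorm j (V + W) ≤ shellNorm j V + shellNorm j W :=
  eLpNorm_add_le hV.restrict hW.restrict (by norm_num)

lemma shellNorm_sub_le {V W : Dom d → E} (hV : AEStronglyMeasurable V)
    (hW : AEStronglyMeasurable W) (j : ℤ) :
    shellNorm j (V - W) ≤ shellNorm j V + shellNorm j W :=
  eLpNorm_sub_le hV.restrict hW.restrict (by norm_num)

lemma shellNorm_sum_le {ι : Type*} (t : Finset ι) {V : ι → Dom d → E}
    (hV : ∀ i ∈ t, AEStronglyMeasurable (V i)) (j : ℤ) :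
    shellNorm j (∑ i ∈ t, V i) ≤ ∑ i ∈ t, shellNorm j (V i) :=
  eLpNorm_sum_le (fun i hi => (hV i hi).restrict) (by norm_num)

lemma specNorm_sum (s : ℝ) {ι : Type*} (t : Finset ι) (V : ι → Dom d → E) :
    ∑ i ∈ t, specNorm s (V i) =
      ∑' j : ℤ, (2 : ℝ≥0∞) ^ ((j : ℝ) * s) * ∑ i ∈ t, shellNorm j (V i) := by
  simp only [specNorm, Finset.mul_sum]
  rw [Summable.tsum_finsetSum fun i _ => ENNReal.summable]

lemma specNorm_sum_le (s : ℝ) {ι : Type*} (t : Finset ι) {V : ι → Dom d → E}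
    (hV : ∀ i ∈ t, AEStronglyMeasurable (V i)) :
    specNorm s (∑ i ∈ t, V i) ≤ ∑ i ∈ t, specNorm s (V i) := by
  rw [specNorm_sum]
  exact ENNReal.tsum_le_tsum fun j => by gcongr; exact shellNorm_sum_le t hV j

lemma specNorm_add_le {V W : Dom d → E} (s : ℝ) (hV : AEStronglyMeasurable V)
    (hW : AEStronglyMeasurable W) :
    specNorm s (V + W) ≤ specNorm s V + specNorm s W := by
  simp only [specNorm]
  rw [← ENNReal.tsum_add]
  refine ENNReal.tsum_le_tsum fun j => ?_
  rw [← mul_add]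
  gcongr
  exact shellNorm_add_le hV hW j

lemma specNorm_sub_le {V W : Dom d → E} (s : ℝ) (hV : AEStronglyMeasurable V)
    (hW : AEStronglyMeasurable W) :
    specNorm s (V - W) ≤ specNorm s V + specNorm s W := by
  simp only [specNorm]
  rw [← ENNReal.tsum_add]
  refine ENNReal.tsum_le_tsum fun j => ?_
  rw [← mul_add]
  gcongr
  exact shellNorm_sub_le hV hW j

lemma shellNorm_mul_pow_le {V : Dom d → E} {W : Dom d → F} {c : ℝ} (hc : 0 ≤ c) (r : ℕ) (j : ℤ)
    (h : ∀ ξ, ‖W ξ‖ ≤ c * ‖ξ‖ ^ r * ‖V ξ‖) :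
    shellNorm j W ≤
      ENNReal.ofReal (c * 2 ^ r) * ((2 : ℝ≥0∞) ^ ((j : ℝ) * r) * shellNorm j V) := by
  have h1 : shellNorm j W ≤ ENNReal.ofReal (c * 2 ^ r * 2 ^ ((j : ℝ) * r)) * shellNorm j V := by
    refine shellNorm_le_of_le fun ξ hξ => (h ξ).trans ?_
    have h2 : ‖ξ‖ ^ r ≤ 2 ^ r * 2 ^ ((j : ℝ) * r) := by
      refine (pow_le_pow_left₀ (norm_nonneg _) hξ.2.le r).trans (le_of_eq ?_)
      rw [zpow_add₀ (by norm_num), mul_pow, zpow_one, mul_comm, Real.rpow_mul (by norm_num),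
        Real.rpow_natCast, Real.rpow_intCast]
    rw [mul_assoc c ((2 : ℝ) ^ r)]
    gcongr
  rwa [ENNReal.ofReal_mul (by positivity), ofReal_two_rpow, mul_assoc] at h1

/-- A multiplier of order `r` loses `r` derivatives. -/
lemma specNorm_mul_pow_le {V : Dom d → E} {W : Dom d → F} {c : ℝ} (hc : 0 ≤ c) (r : ℕ) (s : ℝ)
    (h : ∀ ξ, ‖W ξ‖ ≤ c * ‖ξ‖ ^ r * ‖V ξ‖) :
    specNorm s W ≤ ENNReal.ofReal (c * 2 ^ r) * specNorm (s + r) V := by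
  rw [specNorm, specNorm, ← ENNReal.tsum_mul_left]
  refine ENNReal.tsum_le_tsum fun j => ?_
  refine (mul_le_mul_right (shellNorm_mul_pow_le hc r j h) _).trans (le_of_eq ?_)
  rw [mul_add, two_rpow_add]
  ring

/-- Interpolation between `Ḃ^{s-1}_{2,1}` and `Ḃ^{s+1}_{2,1}`. -/
lemma specNorm_sq_le (s : ℝ) (V : Dom d → E) :
    specNorm s V ^ 2 ≤ specNorm (s - 1) V * specNorm (s + 1) V := by
  have hpt : ∀ j k : ℤ,
      2 * (((2 : ℝ≥0∞) ^ ((j : ℝ) * s) * shellNorm j V) *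
        ((2 : ℝ≥0∞) ^ ((k : ℝ) * s) * shellNorm k V)) ≤
      ((2 : ℝ≥0∞) ^ ((j : ℝ) * (s - 1)) * shellNorm j V) *
        ((2 : ℝ≥0∞) ^ ((k : ℝ) * (s + 1)) * shellNorm k V) +
      ((2 : ℝ≥0∞) ^ ((k : ℝ) * (s - 1)) * shellNorm k V) *
        ((2 : ℝ≥0∞) ^ ((j : ℝ) * (s + 1)) * shellNorm j V) := by
    intro j k
    -- x + 1/x ≥ 2. The square of the sum is a double series over (j, k); after symmetrising in j
    -- and k, each term is dominated by the matching terms of the product. The factor 2 on both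
    -- sides avoids a division.
    have h1 : (2 : ℝ≥0∞) ≤ 2 ^ ((k : ℝ) - j) + 2 ^ ((j : ℝ) - k) := by
      rw [← ofReal_two_rpow, ← ofReal_two_rpow, ← ENNReal.ofReal_add (by positivity)
        (by positivity)]
      have : (2 : ℝ≥0∞) = ENNReal.ofReal 2 := by norm_num
      rw [this]
      refine ENNReal.ofReal_le_ofReal ?_
      have h2 : (2 : ℝ) ^ ((k : ℝ) - j) * (2 : ℝ) ^ ((j : ℝ) - k) = 1 := by
        rw [← Real.rpow_add (by norm_num)]; simp
      nlinarith [sq_nonneg ((2 : ℝ) ^ ((k : ℝ) - j) - (2 : ℝ) ^ ((j : ℝ) - k)),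
        Real.rpow_pos_of_pos two_pos ((k : ℝ) - j), Real.rpow_pos_of_pos two_pos ((j : ℝ) - k)]
    have e1 : (2 : ℝ≥0∞) ^ ((j : ℝ) * (s - 1)) * 2 ^ ((k : ℝ) * (s + 1)) =
        2 ^ ((k : ℝ) - j) * (2 ^ ((j : ℝ) * s) * 2 ^ ((k : ℝ) * s)) := by
      simp only [← two_rpow_add]; congr 1; ring
    have e2 : (2 : ℝ≥0∞) ^ ((k : ℝ) * (s - 1)) * 2 ^ ((j : ℝ) * (s + 1)) =
        2 ^ ((j : ℝ) - k) * (2 ^ ((j : ℝ) * s) * 2 ^ ((k : ℝ) * s)) := by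
      simp only [← two_rpow_add]; congr 1; ring
    calc _ ≤ (2 ^ ((k : ℝ) - j) + 2 ^ ((j : ℝ) - k)) * (((2 : ℝ≥0∞) ^ ((j : ℝ) * s) *
          shellNorm j V) * ((2 : ℝ≥0∞) ^ ((k : ℝ) * s) * shellNorm k V)) := by gcongr
      _ = ((2 : ℝ≥0∞) ^ ((j : ℝ) * (s - 1)) * 2 ^ ((k : ℝ) * (s + 1)) +
          (2 : ℝ≥0∞) ^ ((k : ℝ) * (s - 1)) * 2 ^ ((j : ℝ) * (s + 1))) *
          (shellNorm j V * shellNorm k V) := by rw [e1, e2]; ring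
      _ = _ := by ring
  have h2 : 2 * specNorm s V ^ 2 ≤ 2 * (specNorm (s - 1) V * specNorm (s + 1) V) := by
    calc 2 * specNorm s V ^ 2 = ∑' j : ℤ, ∑' k : ℤ,
          2 * (((2 : ℝ≥0∞) ^ ((j : ℝ) * s) * shellNorm j V) *
          ((2 : ℝ≥0∞) ^ ((k : ℝ) * s) * shellNorm k V)) := by
          simp only [ENNReal.tsum_mul_left, ENNReal.tsum_mul_right, specNorm, sq]
      _ ≤ ∑' j : ℤ, ∑' k : ℤ, _ := ENNReal.tsum_le_tsum fun j => ENNReal.tsum_le_tsum fun k =>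
          hpt j k
      _ = 2 * (specNorm (s - 1) V * specNorm (s + 1) V) := by
          simp only [ENNReal.tsum_add, ENNReal.tsum_mul_left, ENNReal.tsum_mul_right, specNorm]
          ring
  exact (ENNReal.mul_le_mul_iff_right (by norm_num) (by norm_num)).1 h2

end Shell

/-! ### Minkowski's integral inequality -/

/-- The square of the inner integral is an integral over pairs (x, x'). Tonelli's theorem moves the
integral in y inside, and Cauchy-Schwarz in y factors the result. It is used both for time integrals
and, with counting measure, for series. -/
lemma lintegral_sq_lintegral_le {α β : Type*} [MeasurableSpace α] [MeasurableSpace β]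
    {μ : Measure α} {ν : Measure β} [SFinite μ] [SFinite ν] {f : α → β → ℝ≥0∞}
    (hf : Measurable (Function.uncurry f)) :
    (∫⁻ y, (∫⁻ x, f x y ∂μ) ^ 2 ∂ν) ^ (1 / 2 : ℝ) ≤ ∫⁻ x, (∫⁻ y, f x y ^ 2 ∂ν) ^ (1 / 2 : ℝ) ∂μ := by
  set N : α → ℝ≥0∞ := fun x => (∫⁻ y, f x y ^ 2 ∂ν) ^ (1 / 2 : ℝ)
  have hsq : ∫⁻ y, (∫⁻ x, f x y ∂μ) ^ 2 ∂ν ≤ (∫⁻ x, N x ∂μ) ^ 2 := by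
    have hm : ∀ x, Measurable (f x) := fun x => hf.comp measurable_prodMk_left
    have hm' : ∀ y, Measurable fun x => f x y := fun y => hf.comp measurable_prodMk_right
    have hN : Measurable N := by
      have : Measurable fun x => ∫⁻ y, f x y ^ 2 ∂ν :=
        (Measurable.lintegral_prod_right' (f := fun p : α × β => f p.1 p.2 ^ 2)
          (Measurable.pow_const hf 2))
      exact this.pow_const _
    calc ∫⁻ y, (∫⁻ x, f x y ∂μ) ^ 2 ∂ν
        = ∫⁻ y, ∫⁻ x, ∫⁻ x', f x y * f x' y ∂μ ∂μ ∂ν := by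
          refine lintegral_congr fun y => ?_
          rw [sq, ← lintegral_mul_const _ (hm' y)]
          refine lintegral_congr fun x => ?_
          rw [lintegral_const_mul _ (hm' y)]
      _ = ∫⁻ x, ∫⁻ y, ∫⁻ x', f x y * f x' y ∂μ ∂ν ∂μ := by
          refine lintegral_lintegral_swap ?_
          refine Measurable.aemeasurable ?_
          refine Measurable.lintegral_prod_right'
            (f := fun p : (β × α) × α => f p.1.2 p.1.1 * f p.2 p.1.1) ?_
          exact (hf.comp (by fun_prop : Measurable fun p : (β × α) × α => (p.1.2, p.1.1))).mul
            (hf.comp (by fun_prop : Measurable fun p : (β × α) × α => (p.2, p.1.1)))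
      _ = ∫⁻ x, ∫⁻ x', ∫⁻ y, f x y * f x' y ∂ν ∂μ ∂μ := by
          refine lintegral_congr fun x => ?_
          refine lintegral_lintegral_swap ?_
          refine Measurable.aemeasurable ?_
          exact (hf.comp (by fun_prop : Measurable fun p : β × α => (x, p.1))).mul
            (hf.comp (by fun_prop : Measurable fun p : β × α => (p.2, p.1)))
      _ ≤ ∫⁻ x, ∫⁻ x', N x * N x' ∂μ ∂μ := by
          refine lintegral_mono fun x => lintegral_mono fun x' => ?_
          have := ENNReal.lintegral_mul_le_Lp_mul_Lq ν Real.HolderConjugate.two_two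
            (hm x).aemeasurable (hm x').aemeasurable
          simpa [N] using this
      _ = (∫⁻ x, N x ∂μ) ^ 2 := by
          simp only [lintegral_const_mul _ hN, lintegral_mul_const _ hN, sq]
  calc _ ≤ ((∫⁻ x, N x ∂μ) ^ 2) ^ (1 / 2 : ℝ) := ENNReal.rpow_le_rpow hsq (by norm_num)
    _ = ∫⁻ x, N x ∂μ := by
      rw [← ENNReal.rpow_natCast, ← ENNReal.rpow_mul]; norm_num

/-! ### Shell norms of time-dependent functions -/

section Time

variable {d : ℕ} {E : Type*} [NormedAddCommGroup E]

lemma shellNorm_eq (j : ℤ) (V : Dom d → E) :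
    shellNorm j V = (∫⁻ ξ in shell d j, ‖V ξ‖ₑ ^ 2) ^ (1 / 2 : ℝ) := by
  simp [shellNorm, eLpNorm_eq_lintegral_rpow_enorm_toReal]

lemma measurable_shellNorm {V : ℝ → Dom d → E}
    (hV : StronglyMeasurable (Function.uncurry V)) (j : ℤ) :
    Measurable fun t => shellNorm j (V t) := by
  simp only [shellNorm_eq]
  refine Measurable.pow_const ?_ _
  exact Measurable.lintegral_prod_right' (f := fun p : ℝ × Dom d => ‖V p.1 p.2‖ₑ ^ 2)
    (hV.enorm.pow_const 2)

lemma measurable_specNorm {V : ℝ → Dom d → E}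
    (hV : StronglyMeasurable (Function.uncurry V)) (s : ℝ) :
    Measurable fun t => specNorm s (V t) :=
  Measurable.tsum fun j => (measurable_shellNorm hV j).const_mul _

/-- Minkowski's inequality for time integrals of functions on the Fourier side. -/
lemma shellNorm_le_lintegral {V : ℝ → Dom d → E} (hV : StronglyMeasurable (Function.uncurry V))
    {W : Dom d → E} (j : ℤ) (S : Set ℝ)
    (h : ∀ ξ ∈ shell d j, ‖W ξ‖ₑ ≤ ∫⁻ τ in S, ‖V τ ξ‖ₑ) :
    shellNorm j W ≤ ∫⁻ τ in S, shellNorm j (V τ) := by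
  simp only [shellNorm_eq]
  refine le_trans (ENNReal.rpow_le_rpow ?_ (by norm_num))
    (lintegral_sq_lintegral_le (f := fun τ ξ => ‖V τ ξ‖ₑ) hV.enorm)
  refine setLIntegral_mono' (measurableSet_shell j) fun ξ hξ => ?_
  gcongr
  exact h ξ hξ

end Time

section

/-! ### Distributions with integrable Fourier transform -/

open FourierTransform

section Spec

variable {d : ℕ} {E : Type*} [NormedAddCommGroup E] [NormedSpace ℂ E]

lemma continuous_fourierInv {V : Dom d → E} (hV : Integrable V) : Continuous (𝓕⁻ V) := by
  have h : 𝓕⁻ V = fun x => 𝓕 V (-x) := funext fun x => Real.fourierInv_eq_fourier_neg V x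
  rw [h]
  exact (VectorFourier.fourierIntegral_continuous Real.continuous_fourierChar
    (L := innerₗ (Dom d)) continuous_inner hV).comp continuous_neg

lemma norm_fourierInv_le (V : Dom d → E) (x : Dom d) : ‖𝓕⁻ V x‖ ≤ ∫ ξ, ‖V ξ‖ := by
  rw [Real.fourierInv_eq]
  refine (norm_integral_le_integral_norm _).trans (le_of_eq ?_)
  simp only [Circle.norm_smul]

lemma enorm_fourierInv_le (V : Dom d → E) (x : Dom d) : ‖𝓕⁻ V x‖ₑ ≤ ∫⁻ ξ, ‖V ξ‖ₑ := by
  rw [Real.fourierInv_eq]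
  refine (enorm_integral_le_lintegral_enorm _).trans (le_of_eq ?_)
  refine lintegral_congr fun ξ => ?_
  rw [← ofReal_norm, ← ofReal_norm, Circle.norm_smul]

lemma integrable_fourierInv_integrand {V : Dom d → E} (hV : Integrable V) (x : Dom d) :
    Integrable fun ξ => Real.fourierChar (inner ℝ ξ x) • V ξ := by
  have h := (Real.fourierIntegral_convergent_iff (f := V) (μ := volume) (-x)).2 hV
  simpa using h

lemma fourierInv_add {V W : Dom d → E} (hV : Integrable V) (hW : Integrable W) (x : Dom d) :
    𝓕⁻ (V + W) x = 𝓕⁻ V x + 𝓕⁻ W x := by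
  simp only [Real.fourierInv_eq, Pi.add_apply, smul_add]
  exact integral_add (integrable_fourierInv_integrand hV x) (integrable_fourierInv_integrand hW x)

lemma fourierInv_sub {V W : Dom d → E} (hV : Integrable V) (hW : Integrable W) (x : Dom d) :
    𝓕⁻ (V - W) x = 𝓕⁻ V x - 𝓕⁻ W x := by
  simp only [Real.fourierInv_eq, Pi.sub_apply, smul_sub]
  exact integral_sub (integrable_fourierInv_integrand hV x) (integrable_fourierInv_integrand hW x)

variable [CompleteSpace E]

/-- Fubini's theorem for the inverse transform, deduced from the identity for the forward transform
by reflecting the frequency variable. -/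
lemma integral_fourierInv_smul {ψ : Dom d → ℂ} {V : Dom d → E} (hψ : Integrable ψ)
    (hV : Integrable V) : ∫ ξ, 𝓕⁻ ψ ξ • V ξ = ∫ x, ψ x • 𝓕⁻ V x := by
  have h := VectorFourier.integral_fourierIntegral_smul_eq_flip (L := innerₗ (Dom d))
    (μ := volume) (ν := volume) Real.continuous_fourierChar continuous_inner hψ hV.comp_neg
  simp only [flip_innerₗ] at h
  have e1 : ∀ x, 𝓕⁻ V x = VectorFourier.fourierIntegral Real.fourierChar volume (innerₗ (Dom d))
      (fun ξ => V (-ξ)) x := fun x => congrFun (Real.fourierInv_eq_fourier_comp_neg V) x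
  have e2 : ∀ ξ, 𝓕⁻ ψ ξ =
      VectorFourier.fourierIntegral Real.fourierChar volume (innerₗ (Dom d)) ψ (-ξ) :=
    fun ξ => Real.fourierInv_eq_fourier_neg ψ ξ
  simp only [e1, e2]
  rw [← h, ← integral_neg_eq_self]
  simp

/-- Two locally integrable functions with the same integrals against Schwartz functions agree. -/
lemma ae_eq_of_schwartz {V W : Dom d → E} (hV : LocallyIntegrable V) (hW : LocallyIntegrable W)
    (h : ∀ ψ : 𝓢(Dom d, ℂ), ∫ ξ, ψ ξ • V ξ = ∫ ξ, ψ ξ • W ξ) : V =ᵐ[volume] W := by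
  refine ae_eq_of_integral_contDiff_smul_eq hV hW fun g hg hc => ?_
  have hg₁ : HasCompactSupport (Complex.ofRealCLM ∘ g) := hc.comp_left rfl
  have hg₂ : ContDiff ℝ (⊤ : ℕ∞) (Complex.ofRealCLM ∘ g) := by fun_prop
  simpa using h (hg₁.toSchwartzMap hg₂)

/-- Each Schwartz function is an inverse transform, and the transform can be moved onto V and W. -/
lemma fourierInv_injective {V W : Dom d → E} (hV : Integrable V) (hW : Integrable W)
    (h : ∀ x, 𝓕⁻ V x = 𝓕⁻ W x) : V =ᵐ[volume] W := by
  refine ae_eq_of_schwartz hV.locallyIntegrable hW.locallyIntegrable fun ψ => ?_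
  have e : ∀ ξ, ψ ξ = 𝓕⁻ (⇑(𝓕 ψ : 𝓢(Dom d, ℂ))) ξ := fun ξ => by
    rw [← SchwartzMap.fourierInv_coe, FourierTransform.fourierInv_fourier_eq]
  simp only [e]
  rw [integral_fourierInv_smul (𝓕 ψ).integrable hV, integral_fourierInv_smul (𝓕 ψ).integrable hW]
  simp only [h]

open Classical in
/-- The tempered distribution with Fourier transform `V`, for integrable `V`. -/
def specDist (V : Dom d → E) : 𝓢'(Dom d, E) :=
  if h : Integrable V then
    𝓕⁻ (Lp.toTemperedDistribution ((memLp_one_iff_integrable.2 h).toLp V)) else 0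

lemma specDist_apply {V : Dom d → E} (hV : Integrable V) (ψ : 𝓢(Dom d, ℂ)) :
    specDist V ψ = ∫ ξ, (𝓕⁻ ψ : 𝓢(Dom d, ℂ)) ξ • V ξ := by
  rw [specDist, dif_pos hV, TemperedDistribution.fourierInv_apply, Lp.toTemperedDistribution_apply]
  refine integral_congr_ae ?_
  filter_upwards [(memLp_one_iff_integrable.2 hV).coeFn_toLp] with ξ hξ
  rw [hξ]

lemma specDist_apply' {V : Dom d → E} (hV : Integrable V) (ψ : 𝓢(Dom d, ℂ)) :
    specDist V ψ = ∫ x, ψ x • 𝓕⁻ V x := by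
  rw [specDist_apply hV, ← integral_fourierInv_smul ψ.integrable hV, ← SchwartzMap.fourierInv_coe]

lemma fourier_specDist_apply {V : Dom d → E} (hV : Integrable V) (ψ : 𝓢(Dom d, ℂ)) :
    (𝓕 (specDist V) : 𝓢'(Dom d, E)) ψ = ∫ ξ, ψ ξ • V ξ := by
  rw [TemperedDistribution.fourier_apply, specDist_apply hV, FourierTransform.fourierInv_fourier_eq]

lemma specDist_congr {V W : Dom d → E} (hV : Integrable V) (hW : Integrable W)
    (h : V =ᵐ[volume] W) : specDist V = specDist W := by
  ext1 ψ
  rw [specDist_apply hV, specDist_apply hW]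
  exact integral_congr_ae (h.mono fun ξ hξ => by simp only [hξ])

lemma specDist_sub {V W : Dom d → E} (hV : Integrable V) (hW : Integrable W) :
    specDist V - specDist W = specDist (V - W) := by
  ext1 ψ
  have hb : ∀ ψ : 𝓢(Dom d, ℂ), ∃ C, ∀ x, ‖ψ x‖ ≤ C := fun ψ => by
    obtain ⟨C, -, hC⟩ := ψ.decay 0 0
    exact ⟨C, fun x => by simpa using hC x⟩
  have hi : ∀ {U : Dom d → E}, Integrable U →
      Integrable fun ξ => (𝓕⁻ ψ : 𝓢(Dom d, ℂ)) ξ • U ξ := fun hU => by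
    obtain ⟨C, hC⟩ := hb (𝓕⁻ ψ)
    exact hU.bdd_smul C (𝓕⁻ ψ : 𝓢(Dom d, ℂ)).continuous.aestronglyMeasurable
      (Eventually.of_forall hC)
  rw [specDist_apply (hV.sub hW)]
  simp only [Pi.sub_apply, smul_sub]
  rw [integral_sub (hi hV) (hi hW), ← specDist_apply hV, ← specDist_apply hW]
  rfl

lemma specDist_injective {V W : Dom d → E} (hV : Integrable V) (hW : Integrable W)
    (h : specDist V = specDist W) : V =ᵐ[volume] W := by
  refine ae_eq_of_schwartz hV.locallyIntegrable hW.locallyIntegrable fun ψ => ?_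
  rw [← fourier_specDist_apply hV, ← fourier_specDist_apply hW, h]

lemma fourierMultiplier_specDist {m : Dom d → ℂ} (hm : m.HasTemperateGrowth) {V : Dom d → E}
    (hV : Integrable V) (hmV : Integrable fun ξ => m ξ • V ξ) :
    TemperedDistribution.fourierMultiplierCLM E m (specDist V) = specDist fun ξ => m ξ • V ξ := by
  ext1 ψ
  rw [TemperedDistribution.fourierMultiplierCLM_apply_apply, specDist_apply hV, specDist_apply hmV,
    FourierTransform.fourierInv_fourier_eq]
  refine integral_congr_ae (Eventually.of_forall fun ξ => ?_)
  simp only [SchwartzMap.smulLeftCLM_apply_apply hm, smul_smul, smul_eq_mul, mul_comm]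

lemma lineDeriv_specDist {V : Dom d → E} (m : Dom d) (hV : Integrable V)
    (hmV : Integrable fun ξ => (2 * Real.pi * Complex.I * (inner ℝ ξ m : ℝ) : ℂ) • V ξ) :
    ∂_{m} (specDist V) =
      specDist fun ξ => (2 * Real.pi * Complex.I * (inner ℝ ξ m : ℝ) : ℂ) • V ξ := by
  have h0 : (2 * Real.pi * Complex.I : ℂ) ≠ 0 := by
    simp [Real.pi_ne_zero]
  have hmV' : Integrable fun ξ => ((inner ℝ ξ m : ℝ) : ℂ) • V ξ := by
    refine (hmV.smul (2 * Real.pi * Complex.I : ℂ)⁻¹).congr (Eventually.of_forall fun ξ => ?_)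
    simp only [Pi.smul_apply, smul_smul]
    congr 1
    field_simp
  rw [TemperedDistribution.lineDeriv_eq_fourierMultiplierCLM, fourierMultiplier_specDist
    (by fun_prop) hV hmV']
  ext1 ψ
  change (2 * Real.pi * Complex.I : ℂ) • specDist (fun ξ => ((inner ℝ ξ m : ℝ) : ℂ) • V ξ) ψ = _
  rw [specDist_apply hmV', specDist_apply hmV, ← integral_smul]
  refine integral_congr_ae (Eventually.of_forall fun ξ => ?_)
  simp only [smul_smul]
  congr 1
  ring

end Spec

/-! ### Lebesgue norms of distributions -/

section DistLp

variable {d n : ℕ}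

lemma toTemperedDistribution_injective {p q : ℝ≥0∞} [Fact (1 ≤ p)] [Fact (1 ≤ q)]
    {E : Type*} [NormedAddCommGroup E] [NormedSpace ℂ E] [CompleteSpace E]
    {f : Lp E p (volume : Measure (Dom d))} {g : Lp E q (volume : Measure (Dom d))}
    (h : Lp.toTemperedDistribution f = Lp.toTemperedDistribution g) : f =ᵐ[volume] g := by
  refine ae_eq_of_schwartz ((Lp.memLp f).locallyIntegrable Fact.out)
    ((Lp.memLp g).locallyIntegrable Fact.out) fun ψ => ?_
  rw [← Lp.toTemperedDistribution_apply, ← Lp.toTemperedDistribution_apply, h]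

/-- A distribution is represented by at most one class in L^p, so the infimum defining `distLpNorm`
has a single competitor. -/
lemma distLpNorm_toTemperedDistribution {p : ℝ≥0∞} [Fact (1 ≤ p)]
    (f : Lp (CVal n) p (volume : Measure (Dom d))) :
    distLpNorm p (Lp.toTemperedDistribution f) = ‖f‖ₑ := by
  refine le_antisymm (iInf₂_le (f := fun (g : Lp (CVal n) p (volume : Measure (Dom d))) _ => ‖g‖ₑ)
    f rfl) (le_iInf₂ fun g hg => ?_)
  rw [Lp.ext (toTemperedDistribution_injective hg)]

lemma exists_of_distLpNorm_lt_top {p : ℝ≥0∞} [Fact (1 ≤ p)] {T : 𝓢'(Dom d, CVal n)}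
    (h : distLpNorm p T < ⊤) :
    ∃ f : Lp (CVal n) p (volume : Measure (Dom d)), Lp.toTemperedDistribution f = T := by
  by_contra! hne
  have : distLpNorm p T = ⊤ := by
    simp only [distLpNorm, iInf_eq_top]
    exact fun f hf => absurd hf (hne f)
  exact h.ne this

lemma specDist_eq_toTemperedDistribution_two {E : Type*} [NormedAddCommGroup E]
    [InnerProductSpace ℂ E] [CompleteSpace E] {V : Dom d → E} (hV : Integrable V)
    (h2 : MemLp V 2 volume) :
    specDist V = Lp.toTemperedDistribution (𝓕⁻ (h2.toLp V) : Lp E 2 (volume : Measure (Dom d))) := by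
  rw [← Lp.fourierInv_toTemperedDistribution_eq]
  ext1 ψ
  rw [specDist_apply hV, TemperedDistribution.fourierInv_apply, Lp.toTemperedDistribution_apply]
  refine integral_congr_ae ?_
  filter_upwards [h2.coeFn_toLp] with ξ hξ
  rw [hξ]

/-- Plancherel's identity. -/
lemma distLpNorm_two_specDist {V : Dom d → CVal n} (hV : Integrable V) :
    distLpNorm 2 (specDist V) = eLpNorm V 2 volume := by
  by_cases h2 : MemLp V 2 volume
  · rw [specDist_eq_toTemperedDistribution_two hV h2, distLpNorm_toTemperedDistribution]
    have : ‖(𝓕⁻ (h2.toLp V) : Lp (CVal n) 2 (volume : Measure (Dom d)))‖ = ‖h2.toLp V‖ :=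
      (Lp.fourierTransformₗᵢ (Dom d) (CVal n)).symm.norm_map _
    rw [← ofReal_norm, this, ofReal_norm, Lp.enorm_def]
    exact eLpNorm_congr_ae h2.coeFn_toLp
  -- If V is not square integrable, both sides are infinite: an L² function representing `specDist
  -- V` would have an L² Fourier transform, which would be V.
  · have h3 : eLpNorm V 2 volume = ⊤ := by
      by_contra h
      exact h2 ⟨hV.1, lt_top_iff_ne_top.2 h⟩
    rw [h3]
    by_contra h
    obtain ⟨g, hg⟩ := exists_of_distLpNorm_lt_top (lt_top_iff_ne_top.2 h)
    refine h2 ((Lp.memLp (𝓕 g)).ae_eq ?_)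
    refine ae_eq_of_schwartz ((Lp.memLp _).locallyIntegrable (by norm_num)) hV.locallyIntegrable
      fun ψ => ?_
    rw [← fourier_specDist_apply hV, ← hg, Lp.fourier_toTemperedDistribution_eq,
      Lp.toTemperedDistribution_apply]

lemma memLp_top_fourierInv {E : Type*} [NormedAddCommGroup E] [NormedSpace ℂ E]
    {V : Dom d → E} (hV : Integrable V) : MemLp (𝓕⁻ V) ⊤ volume :=
  memLp_top_of_bound (continuous_fourierInv hV).aestronglyMeasurable (∫ ξ, ‖V ξ‖)
    (Eventually.of_forall fun x => norm_fourierInv_le V x)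

lemma distLpNorm_top_specDist_le {V : Dom d → CVal n} (hV : Integrable V) :
    distLpNorm ⊤ (specDist V) ≤ ∫⁻ ξ, ‖V ξ‖ₑ := by
  have h : specDist V = Lp.toTemperedDistribution ((memLp_top_fourierInv hV).toLp _) := by
    ext1 ψ
    rw [specDist_apply' hV, Lp.toTemperedDistribution_apply]
    refine integral_congr_ae ?_
    filter_upwards [(memLp_top_fourierInv hV).coeFn_toLp] with x hx
    rw [hx]
  rw [h, distLpNorm_toTemperedDistribution, Lp.enorm_def,
    eLpNorm_congr_ae (memLp_top_fourierInv hV).coeFn_toLp, eLpNorm_exponent_top]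
  exact eLpNormEssSup_le_of_ae_enorm_bound
    (Eventually.of_forall fun x => enorm_fourierInv_le V x)

lemma distOf_apply (g : Dom d →ᵇ Val n) (ψ : 𝓢(Dom d, ℂ)) :
    distOf g ψ = ∫ x, ψ x • complexify (g x) := by
  rw [distOf, Lp.toTemperedDistribution_apply]
  refine integral_congr_ae ?_
  filter_upwards [(memLp_top_complexify g).coeFn_toLp] with x hx
  rw [hx]

lemma complexify_add (y z : Val n) : complexify (y + z) = complexify y + complexify z := by
  ext k; simp [complexify]

lemma complexify_sub (y z : Val n) : complexify (y - z) = complexify y - complexify z := by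
  ext k; simp [complexify]

lemma integrable_schwartz_smul_complexify (g : Dom d →ᵇ Val n) (ψ : 𝓢(Dom d, ℂ)) :
    Integrable fun x => ψ x • complexify (g x) :=
  ψ.integrable.smul_bdd ‖g‖ (continuous_complexify.comp g.continuous).aestronglyMeasurable
    (Eventually.of_forall fun x => by
      rw [norm_complexify]; exact g.norm_coe_le_norm x)

lemma distOf_sub (g h : Dom d →ᵇ Val n) : distOf g - distOf h = distOf (g - h) := by
  ext1 ψ
  change distOf g ψ - distOf h ψ = _
  rw [distOf_apply, distOf_apply, distOf_apply,
    ← integral_sub (integrable_schwartz_smul_complexify g ψ)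
      (integrable_schwartz_smul_complexify h ψ)]
  simp only [BoundedContinuousFunction.coe_sub, Pi.sub_apply, complexify_sub, smul_sub]

/-- Both sides are continuous functions, so equality as distributions is equality at every point.
This is the bridge between the solution in physical space and its transform. -/
lemma distOf_eq_specDist_iff {g : Dom d →ᵇ Val n} {V : Dom d → CVal n} (hV : Integrable V) :
    distOf g = specDist V ↔ ∀ x, complexify (g x) = 𝓕⁻ V x := by
  constructor
  · intro h
    have hg : Continuous fun x => complexify (g x) := continuous_complexify.comp g.continuous
    have : (fun x => complexify (g x)) =ᵐ[volume] 𝓕⁻ V := by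
      refine ae_eq_of_schwartz ((memLp_top_complexify g).locallyIntegrable le_top)
        ((memLp_top_fourierInv hV).locallyIntegrable le_top) fun ψ => ?_
      rw [← distOf_apply, h, specDist_apply' hV]
    exact congrFun ((hg.ae_eq_iff_eq volume (continuous_fourierInv hV)).1 this)
  · intro h
    ext1 ψ
    rw [distOf_apply, specDist_apply' hV]
    simp only [h]

end DistLp

end

/-! ### The Littlewood-Paley cut-offs -/

section Cutoff

variable {d n : ℕ} [NeZero d] {χ : Dom d → ℝ}

/-- The dilated cut-off `χ(2^{-j} ξ)`. -/
def low (χ : Dom d → ℝ) (j : ℤ) (ξ : Dom d) : ℝ := χ ((2 : ℝ) ^ (-j) • ξ)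

/-- The dilated annulus function `φ(2^{-j} ξ)`. -/
def band (χ : Dom d → ℝ) (j : ℤ) (ξ : Dom d) : ℝ := annulus χ ((2 : ℝ) ^ (-j) • ξ)

lemma band_eq (j : ℤ) (ξ : Dom d) : band χ j ξ = low χ (j + 1) ξ - low χ j ξ := by
  rw [band, annulus, low, low, smul_smul]
  congr 3
  rw [← zpow_neg_one, ← zpow_add₀ two_ne_zero]
  congr 1
  ring

lemma IsCutoff.eq_zero (hχ : IsCutoff χ) {ξ : Dom d} (h : 4 / 3 ≤ ‖ξ‖) : χ ξ = 0 := by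
  by_contra hne
  have := hχ.support (subset_tsupport χ hne)
  rw [mem_ball_zero_iff] at this
  linarith

lemma IsCutoff.map_zero (hχ : IsCutoff χ) : χ 0 = 1 := hχ.eq_one 0 (by simp)

lemma IsCutoff.le_one (hχ : IsCutoff χ) (ξ : Dom d) : χ ξ ≤ 1 :=
  hχ.map_zero ▸ hχ.radial_antitone 0 ξ (by simp)

/-- A radially non-increasing function that vanishes far away is nonnegative; ζ lies beyond both ξ
and the support. -/
lemma IsCutoff.nonneg (hχ : IsCutoff χ) (ξ : Dom d) : 0 ≤ χ ξ := by
  obtain ⟨ζ, hζ⟩ := NormedSpace.exists_lt_norm ℝ (Dom d) (max ‖ξ‖ (4 / 3))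
  rw [← hχ.eq_zero ((le_max_right _ _).trans hζ.le)]
  exact hχ.radial_antitone _ _ ((le_max_left _ _).trans hζ.le)

lemma IsCutoff.hasCompactSupport (hχ : IsCutoff χ) : HasCompactSupport χ :=
  Metric.isCompact_of_isClosed_isBounded (isClosed_tsupport χ)
    (Metric.isBounded_ball.subset hχ.support)

lemma IsCutoff.hasTemperateGrowth (hχ : IsCutoff χ) : χ.HasTemperateGrowth :=
  (hχ.hasCompactSupport.toSchwartzMap hχ.smooth).hasTemperateGrowth

lemma IsCutoff.low_hasTemperateGrowth (hχ : IsCutoff χ) (j : ℤ) :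
    (fun ξ => ((low χ j ξ : ℝ) : ℂ)).HasTemperateGrowth :=
  Complex.ofRealCLM.hasTemperateGrowth.comp
    (hχ.hasTemperateGrowth.comp (f := fun ξ : Dom d => (2 : ℝ) ^ (-j) • ξ) (by fun_prop))

lemma IsCutoff.band_hasTemperateGrowth (hχ : IsCutoff χ) (j : ℤ) :
    (fun ξ => ((band χ j ξ : ℝ) : ℂ)).HasTemperateGrowth := by
  simp only [band_eq, Complex.ofReal_sub]
  exact (hχ.low_hasTemperateGrowth _).sub (hχ.low_hasTemperateGrowth _)

lemma IsCutoff.continuous_low (hχ : IsCutoff χ) (j : ℤ) : Continuous (low χ j) :=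
  hχ.smooth.continuous.comp (continuous_const_smul _)

lemma IsCutoff.continuous_band (hχ : IsCutoff χ) (j : ℤ) : Continuous (band χ j) := by
  simp only [funext (band_eq (χ := χ) j)]
  exact (hχ.continuous_low _).sub (hχ.continuous_low _)

lemma norm_dilate (j : ℤ) (ξ : Dom d) : ‖(2 : ℝ) ^ (-j) • ξ‖ = (2 : ℝ) ^ (-j) * ‖ξ‖ := by
  rw [norm_smul, Real.norm_of_nonneg (by positivity)]

lemma IsCutoff.low_eq_one (hχ : IsCutoff χ) {j : ℤ} {ξ : Dom d} (h : ‖ξ‖ < 3 / 4 * 2 ^ j) :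
    low χ j ξ = 1 := by
  refine hχ.eq_one _ ?_
  rw [mem_ball_zero_iff, norm_dilate, zpow_neg, inv_mul_lt_iff₀ (by positivity)]
  linarith

lemma IsCutoff.low_eq_zero (hχ : IsCutoff χ) {j : ℤ} {ξ : Dom d} (h : 4 / 3 * 2 ^ j ≤ ‖ξ‖) :
    low χ j ξ = 0 := by
  refine hχ.eq_zero ?_
  rw [norm_dilate, zpow_neg, le_inv_mul_iff₀ (by positivity)]
  linarith

lemma IsCutoff.low_nonneg (hχ : IsCutoff χ) (j : ℤ) (ξ : Dom d) : 0 ≤ low χ j ξ := hχ.nonneg _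

lemma IsCutoff.low_le_one (hχ : IsCutoff χ) (j : ℤ) (ξ : Dom d) : low χ j ξ ≤ 1 := hχ.le_one _

lemma IsCutoff.abs_low_le (hχ : IsCutoff χ) (j : ℤ) (ξ : Dom d) : |low χ j ξ| ≤ 1 := by
  rw [abs_of_nonneg (hχ.low_nonneg j ξ)]; exact hχ.low_le_one j ξ

lemma IsCutoff.abs_band_le (hχ : IsCutoff χ) (j : ℤ) (ξ : Dom d) : |band χ j ξ| ≤ 1 := by
  rw [band_eq, abs_le]
  constructor <;> linarith [hχ.low_nonneg j ξ, hχ.low_nonneg (j + 1) ξ, hχ.low_le_one j ξ,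
    hχ.low_le_one (j + 1) ξ]

lemma IsCutoff.band_eq_zero_of_lt (hχ : IsCutoff χ) {j : ℤ} {ξ : Dom d} (h : ‖ξ‖ < 3 / 4 * 2 ^ j) :
    band χ j ξ = 0 := by
  rw [band_eq, hχ.low_eq_one h, hχ.low_eq_one, sub_self]
  rw [zpow_add_one₀ two_ne_zero]
  have : (0 : ℝ) < 2 ^ j := by positivity
  linarith

lemma IsCutoff.band_eq_zero_of_le (hχ : IsCutoff χ) {j : ℤ} {ξ : Dom d} (h : 8 / 3 * 2 ^ j ≤ ‖ξ‖) :
    band χ j ξ = 0 := by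
  have : (0 : ℝ) < 2 ^ j := by positivity
  rw [band_eq, hχ.low_eq_zero, hχ.low_eq_zero, sub_self]
  · linarith
  · rw [zpow_add_one₀ two_ne_zero]; linarith

variable {E : Type*} [NormedAddCommGroup E] [NormedSpace ℂ E]

lemma IsCutoff.norm_low_smul_le (hχ : IsCutoff χ) (j : ℤ) (V : Dom d → E) (ξ : Dom d) :
    ‖((low χ j ξ : ℝ) : ℂ) • V ξ‖ ≤ ‖V ξ‖ := by
  rw [norm_smul, Complex.norm_real, Real.norm_eq_abs]
  exact mul_le_of_le_one_left (norm_nonneg _) (hχ.abs_low_le j ξ)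

lemma IsCutoff.norm_band_smul_le (hχ : IsCutoff χ) (j : ℤ) (V : Dom d → E) (ξ : Dom d) :
    ‖((band χ j ξ : ℝ) : ℂ) • V ξ‖ ≤ ‖V ξ‖ := by
  rw [norm_smul, Complex.norm_real, Real.norm_eq_abs]
  exact mul_le_of_le_one_left (norm_nonneg _) (hχ.abs_band_le j ξ)

lemma IsCutoff.aestronglyMeasurable_band (hχ : IsCutoff χ) (j : ℤ) {V : Dom d → E}
    (hV : AEStronglyMeasurable V) :
    AEStronglyMeasurable fun ξ => ((band χ j ξ : ℝ) : ℂ) • V ξ :=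
  (Complex.continuous_ofReal.comp (hχ.continuous_band j)).aestronglyMeasurable.smul hV

lemma IsCutoff.integrable_low (hχ : IsCutoff χ) (j : ℤ) {V : Dom d → E} (hV : Integrable V) :
    Integrable fun ξ => ((low χ j ξ : ℝ) : ℂ) • V ξ :=
  hV.mono ((Complex.continuous_ofReal.comp (hχ.continuous_low j)).aestronglyMeasurable.smul hV.1)
    (Eventually.of_forall (hχ.norm_low_smul_le j V))

lemma IsCutoff.integrable_band (hχ : IsCutoff χ) (j : ℤ) {V : Dom d → E} (hV : Integrable V) :
    Integrable fun ξ => ((band χ j ξ : ℝ) : ℂ) • V ξ :=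
  hV.mono (hχ.aestronglyMeasurable_band j hV.1) (Eventually.of_forall (hχ.norm_band_smul_le j V))

lemma block_specDist (hχ : IsCutoff χ) (j : ℤ) {V : Dom d → CVal n} (hV : Integrable V) :
    block χ j (specDist V) = specDist fun ξ => ((band χ j ξ : ℝ) : ℂ) • V ξ :=
  fourierMultiplier_specDist (hχ.band_hasTemperateGrowth j) hV (hχ.integrable_band j hV)

lemma lowCut_specDist (hχ : IsCutoff χ) (j : ℤ) {V : Dom d → CVal n} (hV : Integrable V) :
    lowCut χ j (specDist V) = specDist fun ξ => ((low χ j ξ : ℝ) : ℂ) • V ξ :=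
  fourierMultiplier_specDist (hχ.low_hasTemperateGrowth j) hV (hχ.integrable_low j hV)

lemma distLpNorm_block (hχ : IsCutoff χ) (j : ℤ) {V : Dom d → CVal n} (hV : Integrable V) :
    distLpNorm 2 (block χ j (specDist V)) =
      eLpNorm (fun ξ => ((band χ j ξ : ℝ) : ℂ) • V ξ) 2 volume := by
  rw [block_specDist hχ j hV, distLpNorm_two_specDist (hχ.integrable_band j hV)]

lemma tendsto_zpow_two_atBot : Tendsto (fun j : ℤ => (2 : ℝ) ^ j) atBot (𝓝 0) := by
  refine ((tendsto_rpow_atBot_of_base_gt_one 2 one_lt_two).comp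
    (tendsto_intCast_atBot_iff (R := ℝ).2 tendsto_id)).congr fun j => ?_
  simp

/-- The supremum norm is at most the mass of the transform on a ball shrinking to the origin, a null
set; dominated convergence applies. -/
lemma inSh_specDist (hχ : IsCutoff χ) {V : Dom d → CVal n} (hV : Integrable V) :
    InSh χ (specDist V) := by
  have hlim : Tendsto (fun j : ℤ => ∫⁻ ξ, ‖((low χ j ξ : ℝ) : ℂ) • V ξ‖ₑ) atBot (𝓝 0) := by
    rw [← lintegral_zero (μ := (volume : Measure (Dom d)))]
    refine tendsto_lintegral_filter_of_dominated_convergence' (fun ξ => ‖V ξ‖ₑ)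
      (Eventually.of_forall fun j => (hχ.integrable_low j hV).1.enorm)
      (Eventually.of_forall fun j => Eventually.of_forall fun ξ =>
        enorm_le_iff_norm_le.2 (hχ.norm_low_smul_le j V ξ)) hV.2.ne ?_
    have h0 : ∀ᵐ ξ : Dom d, ξ ≠ 0 := by simp [ae_iff, measure_singleton]
    filter_upwards [h0] with ξ hξ
    refine tendsto_const_nhds.congr' ?_
    have := tendsto_zpow_two_atBot.const_mul (4 / 3 : ℝ)
    rw [mul_zero] at this
    filter_upwards [this.eventually_le_const (norm_pos_iff.2 hξ)] with j hj
    rw [hχ.low_eq_zero hj]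
    simp
  refine tendsto_of_tendsto_of_tendsto_of_le_of_le tendsto_const_nhds hlim
    (fun j => bot_le) fun j => ?_
  rw [lowCut_specDist hχ j hV]
  exact distLpNorm_top_specDist_le (hχ.integrable_low j hV)

lemma besovNorm_specDist (hχ : IsCutoff χ) (s : ℝ) {V : Dom d → CVal n} (hV : Integrable V) :
    besovNorm χ s (specDist V) = ∑' j : ℤ, (2 : ℝ≥0∞) ^ ((j : ℝ) * s) *
      eLpNorm (fun ξ => ((band χ j ξ : ℝ) : ℂ) • V ξ) 2 volume := by
  rw [besovNorm, if_pos (inSh_specDist hχ hV)]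
  simp only [distLpNorm_block hχ _ hV]

/-! ### Equivalence of smooth and sharp dyadic norms -/

/-- The constant in the equivalence of smooth and sharp dyadic decompositions. -/
def shiftConst (s : ℝ) : ℝ≥0∞ := 2 ^ s + 1 + 2 ^ (-s)

lemma shiftConst_ne_top (s : ℝ) : shiftConst s ≠ ⊤ := by
  simp [shiftConst]

lemma tsum_shift (s : ℝ) (a : ℤ → ℝ≥0∞) (m : ℤ) :
    ∑' j : ℤ, (2 : ℝ≥0∞) ^ ((j : ℝ) * s) * a (j + m) =
      2 ^ (-(m : ℝ) * s) * ∑' j : ℤ, (2 : ℝ≥0∞) ^ ((j : ℝ) * s) * a j := by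
  rw [← ENNReal.tsum_mul_left, ← Equiv.tsum_eq (Equiv.addRight (-m))]
  refine tsum_congr fun j => ?_
  simp only [Equiv.coe_addRight, neg_add_cancel_right, ← mul_assoc, ← two_rpow_add]
  congr 2
  push_cast
  ring

lemma tsum_neighbours (s : ℝ) (a : ℤ → ℝ≥0∞) :
    ∑' j : ℤ, (2 : ℝ≥0∞) ^ ((j : ℝ) * s) * (a (j - 1) + a j + a (j + 1)) =
      shiftConst s * ∑' j : ℤ, (2 : ℝ≥0∞) ^ ((j : ℝ) * s) * a j := by
  simp only [mul_add, ENNReal.tsum_add]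
  have h1 := tsum_shift s a 1
  have h2 := tsum_shift s a (-1)
  simp only [← sub_eq_add_neg] at h2
  rw [h1, h2, shiftConst]
  push_cast
  simp only [neg_neg, one_mul, neg_mul]
  ring

/-- The j-th band lives where (3/4)2^j ≤ |ξ| < (8/3)2^j, which three consecutive shells cover. -/
lemma eLpNorm_band_le (hχ : IsCutoff χ) (j : ℤ) {V : Dom d → E} (hV : AEStronglyMeasurable V) :
    eLpNorm (fun ξ => ((band χ j ξ : ℝ) : ℂ) • V ξ) 2 volume ≤
      shellNorm (j - 1) V + shellNorm j V + shellNorm (j + 1) V := by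
  have hm : ∀ k : ℤ, AEStronglyMeasurable ((shell d k).indicator V) := fun k =>
    hV.indicator (measurableSet_shell k)
  have e : ∀ k, shellNorm k V = eLpNorm ((shell d k).indicator V) 2 volume := fun k =>
    (eLpNorm_indicator_eq_eLpNorm_restrict (measurableSet_shell k)).symm
  rw [e, e, e]
  refine le_trans ?_ ((eLpNorm_add_le ((hm _).add (hm _)) (hm _) (by norm_num)).trans
    (add_le_add (eLpNorm_add_le (hm _) (hm _) (by norm_num)) le_rfl))
  refine eLpNorm_mono_ae (Eventually.of_forall fun ξ => ?_)
  by_cases hξ : ‖ξ‖ < 3 / 4 * 2 ^ j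
  · simp [hχ.band_eq_zero_of_lt hξ]
  by_cases hξ' : 8 / 3 * 2 ^ j ≤ ‖ξ‖
  · simp [hχ.band_eq_zero_of_le hξ']
  refine (hχ.norm_band_smul_le j V ξ).trans ?_
  have hp : (0 : ℝ) < 2 ^ j := by positivity
  have h1 : (2 : ℝ) ^ (j - 1) = 2 ^ j / 2 := zpow_sub_one₀ two_ne_zero _
  have h2 : (2 : ℝ) ^ (j + 1) = 2 ^ j * 2 := zpow_add_one₀ two_ne_zero _
  have h3 : (2 : ℝ) ^ (j + 1 + 1) = 2 ^ j * 2 * 2 := by rw [zpow_add_one₀ two_ne_zero, h2]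
  push Not at hξ hξ'
  have hU : ξ ∈ shell d (j - 1) ∨ ξ ∈ shell d j ∨ ξ ∈ shell d (j + 1) := by
    simp only [shell, mem_ofPred_eq, sub_add_cancel, h1, h2, h3]
    by_cases c1 : ‖ξ‖ < 2 ^ j
    · left; constructor <;> linarith
    by_cases c2 : ‖ξ‖ < 2 ^ j * 2
    · right; left; constructor <;> linarith
    · right; right; constructor <;> linarith
  have hd : ∀ {a b : ℤ}, a ≠ b → ξ ∈ shell d a → ξ ∉ shell d b := fun hab ha hb =>
    Set.disjoint_left.1 (shell_disjoint hab) ha hb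
  simp only [Pi.add_apply]
  rcases hU with h | h | h
  · simp [h, hd (show j - 1 ≠ j by omega) h, hd (show j - 1 ≠ j + 1 by omega) h]
  · simp [h, hd (show j ≠ j - 1 by omega) h, hd (show j ≠ j + 1 by omega) h]
  · simp [h, hd (show j + 1 ≠ j by omega) h, hd (show j + 1 ≠ j - 1 by omega) h]

/-- Three consecutive bands telescope to `low χ (j + 2) - low χ (j - 1)`, which is one on the shell
j. -/
lemma shellNorm_le_band (hχ : IsCutoff χ) (j : ℤ) {V : Dom d → E} (hV : AEStronglyMeasurable V) :
    shellNorm j V ≤ eLpNorm (fun ξ => ((band χ (j - 1) ξ : ℝ) : ℂ) • V ξ) 2 volume +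
      eLpNorm (fun ξ => ((band χ j ξ : ℝ) : ℂ) • V ξ) 2 volume +
      eLpNorm (fun ξ => ((band χ (j + 1) ξ : ℝ) : ℂ) • V ξ) 2 volume := by
  have hm := fun k => hχ.aestronglyMeasurable_band k hV
  refine le_trans ?_ ((eLpNorm_add_le ((hm _).add (hm _)) (hm _) (by norm_num)).trans
    (add_le_add (eLpNorm_add_le (hm _) (hm _) (by norm_num)) le_rfl))
  rw [shellNorm, ← eLpNorm_indicator_eq_eLpNorm_restrict (measurableSet_shell j)]
  refine eLpNorm_mono_ae (Eventually.of_forall fun ξ => ?_)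
  by_cases hξ : ξ ∈ shell d j
  · have hp : (0 : ℝ) < 2 ^ j := by positivity
    have h1 : (2 : ℝ) ^ (j - 1) = 2 ^ j / 2 := zpow_sub_one₀ two_ne_zero _
    have h2 : (2 : ℝ) ^ (j + 1) = 2 ^ j * 2 := zpow_add_one₀ two_ne_zero _
    have h3 : (2 : ℝ) ^ (j + 1 + 1) = 2 ^ j * 2 * 2 := by rw [zpow_add_one₀ two_ne_zero, h2]
    have hb := hξ.1
    have hb' := hξ.2
    rw [h2] at hb'
    have hone : low χ (j + 1 + 1) ξ = 1 := hχ.low_eq_one (by rw [h3]; linarith)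
    have hzero : low χ (j - 1) ξ = 0 := hχ.low_eq_zero (by rw [h1]; linarith)
    have hsum : band χ (j - 1) ξ + band χ j ξ + band χ (j + 1) ξ = 1 := by
      simp only [band_eq, sub_add_cancel, hone, hzero]; ring
    simp only [Pi.add_apply, ← add_smul, ← Complex.ofReal_add, hsum]
    simp [hξ]
  · simp [hξ]

lemma besovNorm_specDist_le (hχ : IsCutoff χ) (s : ℝ) {V : Dom d → CVal n} (hV : Integrable V) :
    besovNorm χ s (specDist V) ≤ shiftConst s * specNorm s V := by
  rw [besovNorm_specDist hχ s hV, specNorm, ← tsum_neighbours]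
  exact ENNReal.tsum_le_tsum fun j => by gcongr; exact eLpNorm_band_le hχ j hV.1

lemma specNorm_le_besovNorm (hχ : IsCutoff χ) (s : ℝ) {V : Dom d → CVal n} (hV : Integrable V) :
    specNorm s V ≤ shiftConst s * besovNorm χ s (specDist V) := by
  rw [besovNorm_specDist hχ s hV, specNorm, ← tsum_neighbours]
  exact ENNReal.tsum_le_tsum fun j => by gcongr; exact shellNorm_le_band hχ j hV.1

end Cutoff

section

/-! ### Elements of homogeneous Besov spaces have an integrable Fourier transform -/

open FourierTransform

section Structure

variable {d n : ℕ} [NeZero d] {χ : Dom d → ℝ}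

/-- Uniformity in K ≥ 0: each derivative of the dilated cut-off brings a factor 2^{-K} ≤ 1. -/
lemma IsCutoff.exists_bound_iteratedFDeriv_low (hχ : IsCutoff χ) (i : ℕ) :
    ∃ B : ℝ, 0 ≤ B ∧ ∀ (K : ℕ) (ξ : Dom d),
      ‖iteratedFDeriv ℝ i (fun ζ => low χ K ζ - 1) ξ‖ ≤ B := by
  have hs : ∀ K : ℕ, ContDiff ℝ (⊤ : ℕ∞) (low χ K) := fun K =>
    hχ.smooth.comp (contDiff_const_smul _)
  rcases Nat.eq_zero_or_pos i with rfl | hi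
  · refine ⟨1, zero_le_one, fun K ξ => ?_⟩
    rw [norm_iteratedFDeriv_zero, Real.norm_eq_abs, abs_le]
    constructor <;> linarith [hχ.low_nonneg K ξ, hχ.low_le_one K ξ]
  · obtain ⟨C, hC0, hC⟩ := (hχ.hasCompactSupport.toSchwartzMap hχ.smooth).decay 0 i
    refine ⟨C, hC0.le, fun K ξ => ?_⟩
    have e : iteratedFDeriv ℝ i (fun ζ => low χ K ζ - 1) ξ = iteratedFDeriv ℝ i (low χ K) ξ := by
      have h := iteratedFDeriv_sub_apply (𝕜 := ℝ) (i := i) (x := ξ) (f := low χ K)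
        (g := fun _ => (1 : ℝ)) ((hs K).of_le (by exact_mod_cast le_top)).contDiffAt
        contDiff_const.contDiffAt
      rw [iteratedFDeriv_const_of_ne hi.ne'] at h
      rw [Pi.zero_apply, sub_zero] at h
      exact h
    rw [e]
    have h2 := iteratedFDeriv_comp_const_smul (𝕜 := ℝ) (i := i) (f := χ) ((2 : ℝ) ^ (-(K : ℤ)))
      (hχ.smooth.of_le (by exact_mod_cast le_top))
    have h3 : low χ K = fun ζ => χ ((2 : ℝ) ^ (-(K : ℤ)) • ζ) := rfl
    rw [h3, h2]
    simp only [norm_smul, norm_pow]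
    refine (mul_le_of_le_one_left (norm_nonneg _) ?_).trans (by
      have h4 := hC ((2 : ℝ) ^ (-(K : ℤ)) • ξ)
      rw [pow_zero, one_mul] at h4
      exact h4)
    refine pow_le_one₀ (norm_nonneg _) ?_
    rw [Real.norm_of_nonneg (by positivity)]
    exact zpow_le_one_of_nonpos₀ one_le_two (by simp)

/-- The difference lives where |ξ| ≥ (3/4)2^K, so every seminorm is at most 2^{-K} times seminorms
with one more power of |ξ|. -/
lemma IsCutoff.tendsto_smulLeft_low (hχ : IsCutoff χ) (ψ : 𝓢(Dom d, ℂ)) :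
    Tendsto (fun K : ℕ => SchwartzMap.smulLeftCLM ℂ (fun ξ => ((low χ K ξ : ℝ) : ℂ)) ψ)
      atTop (𝓝 ψ) := by
  rw [(schwartz_withSeminorms ℝ (Dom d) ℂ).tendsto_nhds]
  rintro ⟨k, l⟩ ε hε
  choose B hB0 hB using fun i => hχ.exists_bound_iteratedFDeriv_low i
  set C : ℝ := ∑ i ∈ Finset.range (l + 1), (l.choose i : ℝ) * B i *
    SchwartzMap.seminorm ℝ (k + 1) (l - i) ψ
  have hC0 : 0 ≤ C := Finset.sum_nonneg fun i _ =>
    mul_nonneg (mul_nonneg (by positivity) (hB0 i)) (apply_nonneg _ _)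
  have hlim : Tendsto (fun K : ℕ => C * (4 / 3) * (1 / 2 : ℝ) ^ K) atTop (𝓝 0) := by
    simpa using (tendsto_pow_atTop_nhds_zero_of_lt_one (r := (1 / 2 : ℝ)) (by norm_num)
      (by norm_num)).const_mul (C * (4 / 3))
  filter_upwards [hlim.eventually_lt_const hε] with K hK
  refine lt_of_le_of_lt (SchwartzMap.seminorm_le_bound ℝ k l _ (by positivity) fun ξ => ?_) hK
  have hfun : ⇑(SchwartzMap.smulLeftCLM ℂ (fun ξ => ((low χ K ξ : ℝ) : ℂ)) ψ - ψ) =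
      fun ζ => (low χ K ζ - 1) • ψ ζ := by
    ext ζ
    rw [sub_apply, SchwartzMap.smulLeftCLM_apply_apply (hχ.low_hasTemperateGrowth K)]
    simp [sub_mul]
  rw [hfun]
  by_cases hξ : ‖ξ‖ < 3 / 4 * 2 ^ (K : ℤ)
  · have h0 : (fun ζ => (low χ K ζ - 1) • ψ ζ) =ᶠ[𝓝 ξ] fun _ => 0 := by
      filter_upwards [(isOpen_lt continuous_norm continuous_const).mem_nhds hξ] with ζ hζ
      rw [hχ.low_eq_one hζ, sub_self, zero_smul]
    rw [(h0.iteratedFDeriv ℝ l).eq_of_nhds]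
    have h1 : iteratedFDeriv ℝ l (fun _ : Dom d => (0 : ℂ)) ξ = 0 := by
      simp
    rw [h1, norm_zero, mul_zero]
    positivity
  · push Not at hξ
    have hL := norm_iteratedFDeriv_smul_le (𝕜 := ℝ) (N := ((⊤ : ℕ∞) : WithTop ℕ∞))
      (f := fun ζ => low χ K ζ - 1) (g := ψ) (n := l)
      ((hχ.smooth.comp (contDiff_const_smul _)).sub contDiff_const) (ψ.smooth _) ξ
      (by exact_mod_cast le_top)
    -- Inserting this factor costs one power of |ξ| and gains 2^{-K}.
    have hx : 1 ≤ (4 / 3) * (1 / 2 : ℝ) ^ K * ‖ξ‖ := by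
      rw [zpow_natCast] at hξ
      have : (1 / 2 : ℝ) ^ K * 2 ^ K = 1 := by rw [← mul_pow]; norm_num
      nlinarith [pow_pos (show (0 : ℝ) < 1 / 2 by norm_num) K]
    calc ‖ξ‖ ^ k * ‖iteratedFDeriv ℝ l (fun ζ => (low χ K ζ - 1) • ψ ζ) ξ‖
        ≤ ‖ξ‖ ^ k * ∑ i ∈ Finset.range (l + 1), (l.choose i : ℝ) *
          ‖iteratedFDeriv ℝ i (fun ζ => low χ K ζ - 1) ξ‖ * ‖iteratedFDeriv ℝ (l - i) ψ ξ‖ := by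
          gcongr
      _ ≤ ∑ i ∈ Finset.range (l + 1), (4 / 3) * (1 / 2 : ℝ) ^ K * ((l.choose i : ℝ) * B i *
          SchwartzMap.seminorm ℝ (k + 1) (l - i) ψ) := by
          rw [Finset.mul_sum]
          refine Finset.sum_le_sum fun i _ => ?_
          have h1 := SchwartzMap.le_seminorm ℝ (k + 1) (l - i) ψ ξ
          calc ‖ξ‖ ^ k * ((l.choose i : ℝ) * ‖iteratedFDeriv ℝ i (fun ζ => low χ K ζ - 1) ξ‖ *
                ‖iteratedFDeriv ℝ (l - i) ψ ξ‖)
              ≤ ((4 / 3) * (1 / 2 : ℝ) ^ K * ‖ξ‖) * (‖ξ‖ ^ k * ((l.choose i : ℝ) * B i *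
                ‖iteratedFDeriv ℝ (l - i) ψ ξ‖)) := by
                have hnn : 0 ≤ ‖ξ‖ ^ k * ((l.choose i : ℝ) * B i *
                    ‖iteratedFDeriv ℝ (l - i) ψ ξ‖) :=
                  mul_nonneg (by positivity) (mul_nonneg (mul_nonneg (by positivity) (hB0 i))
                    (norm_nonneg _))
                refine le_trans ?_ (le_mul_of_one_le_left hnn hx)
                gcongr
                exact hB i K ξ
            _ = (4 / 3) * (1 / 2 : ℝ) ^ K * ((l.choose i : ℝ) * B i *
                (‖ξ‖ ^ (k + 1) * ‖iteratedFDeriv ℝ (l - i) ψ ξ‖)) := by ring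
            _ ≤ _ := by
                have := hB0 i
                gcongr
      _ = C * (4 / 3) * (1 / 2 : ℝ) ^ K := by rw [← Finset.mul_sum]; ring

lemma sum_Ico_int_sub {M : Type*} [AddCommGroup M] (a : ℤ → M) (K : ℕ) :
    ∑ j ∈ Finset.Ico (-(K : ℤ)) K, (a (j + 1) - a j) = a K - a (-K) := by
  have h : ∀ (m : ℤ) (N : ℕ), ∑ j ∈ Finset.Ico m (m + N), (a (j + 1) - a j) = a (m + N) - a m := by
    intro m N
    induction N with
    | zero => simp
    | succ N ih =>
      have : Finset.Ico m (m + (N + 1 : ℕ)) = insert (m + N) (Finset.Ico m (m + N)) := by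
        ext x; simp only [Finset.mem_Ico, Finset.mem_insert]; push_cast; omega
      rw [this, Finset.sum_insert (by simp), ih]
      push_cast
      rw [← add_assoc]
      abel
  have h2 := h (-K) (2 * K)
  have e : (-(K : ℤ)) + (2 * K : ℕ) = K := by push_cast; ring
  rwa [e] at h2

/-- Through this bound the condition defining S'_h makes the low-frequency pairings with a test
function tend to zero. -/
lemma enorm_apply_le_distLpNorm_top {T : 𝓢'(Dom d, CVal n)} (hT : distLpNorm ⊤ T < ⊤)
    (φ : 𝓢(Dom d, ℂ)) : ‖T φ‖ₑ ≤ distLpNorm ⊤ T * ∫⁻ x, ‖φ x‖ₑ := by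
  obtain ⟨f, rfl⟩ := exists_of_distLpNorm_lt_top hT
  rw [distLpNorm_toTemperedDistribution, Lp.toTemperedDistribution_apply]
  refine (enorm_integral_le_lintegral_enorm _).trans ?_
  rw [← lintegral_const_mul _ φ.continuous.enorm.measurable]
  refine lintegral_mono_ae ?_
  have h : ∀ᵐ x, ‖f x‖ₑ ≤ ‖f‖ₑ := by
    rw [Lp.enorm_def, eLpNorm_exponent_top]
    exact enorm_ae_le_eLpNormEssSup f volume
  filter_upwards [h] with x hx
  rw [enorm_smul, mul_comm]
  gcongr

/-- Cauchy-Schwarz on the ball of radius 2^{j+3}, which contains the spectrum of the j-th block with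
room to spare. -/
lemma lintegral_enorm_le_of_ball {V : Dom d → CVal n} (hV : AEStronglyMeasurable V) (j : ℤ)
    (h : ∀ᵐ ξ, 2 ^ (j + 3) ≤ ‖ξ‖ → V ξ = 0) :
    ∫⁻ ξ, ‖V ξ‖ₑ ≤ (2 : ℝ≥0∞) ^ (3 * d / 2 : ℝ) *
      volume (Metric.ball (0 : Dom d) 1) ^ (1 / 2 : ℝ) *
      ((2 : ℝ≥0∞) ^ ((j : ℝ) * (d / 2)) * eLpNorm V 2 volume) := by
  set B := Metric.ball (0 : Dom d) ((2 : ℝ) ^ (j + 3))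
  have h1 : ∫⁻ ξ, ‖V ξ‖ₑ = ∫⁻ ξ in B, ‖V ξ‖ₑ := by
    rw [← lintegral_indicator Metric.isOpen_ball.measurableSet]
    refine lintegral_congr_ae ?_
    filter_upwards [h] with ξ hξ
    by_cases hB : ξ ∈ B
    · rw [indicator_of_mem hB]
    · have : (2 : ℝ) ^ (j + 3) ≤ ‖ξ‖ := by simpa [B] using hB
      rw [indicator_of_notMem hB, hξ this, enorm_zero]
  have h2 := eLpNorm_le_eLpNorm_mul_rpow_measure_univ (p := 1) (q := 2)
    (μ := volume.restrict B) (by norm_num) hV.restrict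
  rw [eLpNorm_one_eq_lintegral_enorm] at h2
  rw [h1]
  refine h2.trans ?_
  have h3 : eLpNorm V 2 (volume.restrict B) ≤ eLpNorm V 2 volume := eLpNorm_restrict_le _ _ _ _
  have h4 : (1 / (1 : ℝ≥0∞).toReal - 1 / (2 : ℝ≥0∞).toReal : ℝ) = 1 / 2 := by
    simp only [ENNReal.toReal_one, ENNReal.toReal_ofNat]; norm_num
  rw [h4, Measure.restrict_apply_univ, Measure.addHaar_ball_of_pos _ _ (by positivity),
    ENNReal.mul_rpow_of_nonneg _ _ (by norm_num)]
  simp only [finrank_euclideanSpace, Fintype.card_fin]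
  have h5 : ENNReal.ofReal (((2 : ℝ) ^ (j + 3)) ^ d) ^ (1 / 2 : ℝ) =
      2 ^ (3 * d / 2 : ℝ) * 2 ^ ((j : ℝ) * (d / 2)) := by
    rw [← Real.rpow_intCast, ← Real.rpow_natCast, ← Real.rpow_mul (by norm_num), ofReal_two_rpow,
      ← ENNReal.rpow_mul, ← two_rpow_add]
    congr 1
    push_cast
    ring
  rw [h5]
  calc _ ≤ eLpNorm V 2 volume * ((2 : ℝ≥0∞) ^ (3 * d / 2 : ℝ) * 2 ^ ((j : ℝ) * (d / 2)) *
        volume (Metric.ball (0 : Dom d) 1) ^ (1 / 2 : ℝ)) := by gcongr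
    _ = _ := by ring

/-- A distribution in `Ḃ^{d/2}_{2,1}` has an integrable Fourier transform. -/
theorem exists_eq_specDist (hχ : IsCutoff χ) {T : 𝓢'(Dom d, CVal n)}
    (hT : besovNorm χ (d / 2 : ℝ) T < ⊤) :
    ∃ V : Dom d → CVal n, StronglyMeasurable V ∧ Integrable V ∧ T = specDist V := by
  have hSh : InSh χ T := by
    by_contra h
    rw [besovNorm, if_neg h] at hT
    exact absurd hT (lt_irrefl _)
  rw [besovNorm, if_pos hSh] at hT
  have hblock : ∀ j, distLpNorm 2 (block χ j T) < ⊤ := fun j => by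
    by_contra h
    rw [not_lt, top_le_iff] at h
    refine absurd (ENNReal.le_tsum j) (not_le.2 (hT.trans_le ?_))
    rw [h, ENNReal.mul_top (two_rpow_ne_zero _)]
  choose g hg using fun j => exists_of_distLpNorm_lt_top (hblock j)
  set G : ℤ → Lp (CVal n) 2 (volume : Measure (Dom d)) := fun j => 𝓕 (g j)
  -- The low-frequency pairings: the pairing of the j-th block is `a (j + 1) ψ - a j ψ`, so sums
  -- over blocks telescope.
  set a : ℤ → 𝓢(Dom d, ℂ) → CVal n := fun j ψ =>
    (𝓕 T : 𝓢'(Dom d, CVal n)) (SchwartzMap.smulLeftCLM ℂ (fun ξ => ((low χ j ξ : ℝ) : ℂ)) ψ)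
  have hG : ∀ j (ψ : 𝓢(Dom d, ℂ)), ∫ ξ, ψ ξ • G j ξ =
      (𝓕 T : 𝓢'(Dom d, CVal n))
        (SchwartzMap.smulLeftCLM ℂ (fun ξ => ((band χ j ξ : ℝ) : ℂ)) ψ) := fun j ψ => by
    rw [← Lp.toTemperedDistribution_apply, ← Lp.fourier_toTemperedDistribution_eq, hg j, block,
      TemperedDistribution.fourierMultiplierCLM_apply, FourierTransform.fourier_fourierInv_eq]
    rfl
  have hGa : ∀ j (ψ : 𝓢(Dom d, ℂ)), ∫ ξ, ψ ξ • G j ξ = a (j + 1) ψ - a j ψ := fun j ψ => by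
    rw [hG]
    simp only [a, ← map_sub]
    congr 1
    ext ξ
    rw [sub_apply, SchwartzMap.smulLeftCLM_apply_apply (hχ.low_hasTemperateGrowth _),
      SchwartzMap.smulLeftCLM_apply_apply (hχ.low_hasTemperateGrowth _),
      SchwartzMap.smulLeftCLM_apply_apply (hχ.band_hasTemperateGrowth _), band_eq]
    simp [sub_mul]
  have hGnorm : ∀ j, eLpNorm (G j) 2 volume = distLpNorm 2 (block χ j T) := fun j => by
    rw [← hg j, distLpNorm_toTemperedDistribution, ← Lp.enorm_def, ← ofReal_norm, ← ofReal_norm,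
      Lp.norm_fourier_eq]
  -- The cut-off at level j + 2 is one for |ξ| < 3·2^j, hence on the j-th band, so multiplying by it
  -- does not change G j. It vanishes for |ξ| ≥ (4/3)2^{j+2}, hence for |ξ| ≥ 2^{j+3}.
  have hGsupp : ∀ j, ∀ᵐ ξ, 2 ^ (j + 3) ≤ ‖ξ‖ → G j ξ = 0 := fun j => by
    have hlow := Complex.continuous_ofReal.comp (hχ.continuous_low (j + 2))
    have h : (fun ξ => ((low χ (j + 2) ξ : ℝ) : ℂ) • G j ξ) =ᵐ[volume] G j := by
      refine ae_eq_of_schwartz ?_ ((Lp.memLp (G j)).locallyIntegrable (by norm_num)) fun ψ => ?_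
      · refine MemLp.locallyIntegrable (p := 2) ?_ (by norm_num)
        exact (Lp.memLp (G j)).of_le (hlow.aestronglyMeasurable.smul (Lp.memLp (G j)).1)
          (Eventually.of_forall (hχ.norm_low_smul_le (j + 2) (G j)))
      · have e : ∀ ξ, ψ ξ • ((low χ (j + 2) ξ : ℝ) : ℂ) • G j ξ =
            (SchwartzMap.smulLeftCLM ℂ (fun ξ => ((low χ (j + 2) ξ : ℝ) : ℂ)) ψ) ξ • G j ξ :=
          fun ξ => by
            rw [SchwartzMap.smulLeftCLM_apply_apply (hχ.low_hasTemperateGrowth _), smul_smul,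
              smul_eq_mul, mul_comm]
        simp only [e]
        rw [hG, hG]
        congr 1
        ext ξ
        simp only [SchwartzMap.smulLeftCLM_apply_apply (hχ.low_hasTemperateGrowth _),
          SchwartzMap.smulLeftCLM_apply_apply (hχ.band_hasTemperateGrowth _)]
        have hp : (0 : ℝ) < 2 ^ j := by positivity
        have h2 : (2 : ℝ) ^ (j + 2) = 2 ^ j * 4 := by
          rw [zpow_add₀ two_ne_zero]; norm_num
        by_cases hξ : 8 / 3 * 2 ^ j ≤ ‖ξ‖
        · rw [hχ.band_eq_zero_of_le hξ]; simp
        · rw [hχ.low_eq_one (j := j + 2)]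
          · simp
          · rw [h2]; linarith
    filter_upwards [h] with ξ hξ hle
    have h3 : (2 : ℝ) ^ (j + 3) = 2 ^ (j + 2) * 2 := by
      rw [← zpow_add_one₀ two_ne_zero]; congr 1; ring
    have hp : (0 : ℝ) < 2 ^ (j + 2) := by positivity
    rw [← hξ, hχ.low_eq_zero (by linarith)]
    simp
  set M : ℝ≥0∞ := (2 : ℝ≥0∞) ^ (3 * d / 2 : ℝ) *
      volume (Metric.ball (0 : Dom d) 1) ^ (1 / 2 : ℝ)
  have hM : M ≠ ⊤ := ENNReal.mul_ne_top (two_rpow_ne_top _)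
    (ENNReal.rpow_ne_top_of_nonneg (by norm_num) measure_ball_lt_top.ne)
  -- The blocks are absolutely summable in L¹ because the weight 2^{jd/2} of Bernstein's inequality
  -- is that of the Besov norm.
  have hmass : ∑' j, ∫⁻ ξ, ‖G j ξ‖ₑ < ⊤ := by
    refine lt_of_le_of_lt (ENNReal.tsum_le_tsum fun j =>
      lintegral_enorm_le_of_ball (Lp.memLp (G j)).1 j (hGsupp j)) ?_
    rw [ENNReal.tsum_mul_left]
    refine ENNReal.mul_lt_top hM.lt_top ?_
    simpa only [hGnorm] using hT
  have hGint : ∀ j, Integrable (G j) := fun j =>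
    ⟨(Lp.memLp (G j)).1, (ENNReal.le_tsum j).trans_lt hmass⟩
  set G1 : ℤ → Lp (CVal n) 1 (volume : Measure (Dom d)) := fun j =>
    (memLp_one_iff_integrable.2 (hGint j)).toLp _
  have hG1e : ∀ j, ‖G1 j‖ₑ = ∫⁻ ξ, ‖G j ξ‖ₑ := fun j => by
    rw [Lp.enorm_toLp, eLpNorm_one_eq_lintegral_enorm]
  have hsum : Summable G1 := by
    refine Summable.of_norm ?_
    have h := ENNReal.summable_toReal (f := fun j => ‖G1 j‖ₑ) (by simpa only [hG1e] using hmass.ne)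
    simpa using h
  set V1 := ∑' j, G1 j
  have hV1 : HasSum G1 V1 := hsum.hasSum
  have hV1int : Integrable V1 := memLp_one_iff_integrable.1 (Lp.memLp V1)
  have hint : ∀ ψ : 𝓢(Dom d, ℂ), HasSum (fun j => a (j + 1) ψ - a j ψ) (∫ ξ, ψ ξ • V1 ξ) := by
    intro ψ
    have h := (hV1.mapL (Lp.toTemperedDistributionCLM (CVal n) volume 1))
    have h2 := h.mapL (PointwiseConvergenceCLM.evalCLM (RingHom.id ℂ) (CVal n) ψ)
    have e : ∀ j, ∫ ξ, ψ ξ • G1 j ξ = ∫ ξ, ψ ξ • G j ξ := fun j => by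
      refine integral_congr_ae ?_
      filter_upwards [(memLp_one_iff_integrable.2 (hGint j)).coeFn_toLp] with ξ hξ
      rw [hξ]
    simp only [← hGa, ← e, ← Lp.toTemperedDistribution_apply]
    exact h2
  -- Over [-K, K) the blocks add up to `a K ψ - a (-K) ψ`. The first term tends to the pairing with
  -- the transform of T. The second tends to zero because T lies in S'_h; without that condition a
  -- polynomial could be left over.
  have hF : ∀ ψ : 𝓢(Dom d, ℂ), (𝓕 T : 𝓢'(Dom d, CVal n)) ψ = ∫ ξ, ψ ξ • V1 ξ := by
    intro ψ
    have hS : Tendsto (fun K : ℕ => Finset.Ico (-(K : ℤ)) K) atTop atTop := by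
      refine tendsto_atTop_finset_of_monotone (fun K L hKL => ?_) fun x => ⟨x.natAbs + 1, ?_⟩
      · exact Finset.Ico_subset_Ico (by simpa using hKL) (by exact_mod_cast hKL)
      · rw [Finset.mem_Ico]; omega
    have h1 := (hint ψ).comp hS
    simp only [Function.comp_def, sum_Ico_int_sub (fun j => a j ψ)] at h1
    have h2 : Tendsto (fun K : ℕ => a K ψ) atTop (𝓝 ((𝓕 T : 𝓢'(Dom d, CVal n)) ψ)) :=
      ((𝓕 T : 𝓢'(Dom d, CVal n)).continuous.tendsto ψ).comp (hχ.tendsto_smulLeft_low ψ)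
    have h3 : Tendsto (fun j : ℤ => a j ψ) atBot (𝓝 0) := by
      have hA : (∫⁻ x, ‖(𝓕 ψ : 𝓢(Dom d, ℂ)) x‖ₑ) ≠ ⊤ := (𝓕 ψ : 𝓢(Dom d, ℂ)).integrable.2.ne
      have h4 := ENNReal.Tendsto.mul_const (b := ∫⁻ x, ‖(𝓕 ψ : 𝓢(Dom d, ℂ)) x‖ₑ) hSh
        (Or.inr hA)
      rw [zero_mul] at h4
      rw [tendsto_iff_enorm_sub_tendsto_zero]
      refine tendsto_of_tendsto_of_tendsto_of_le_of_le' tendsto_const_nhds h4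
        (Eventually.of_forall fun _ => bot_le) ?_
      filter_upwards [hSh.eventually_lt_const (show (0 : ℝ≥0∞) < ⊤ by simp)] with j hj
      have h5 := enorm_apply_le_distLpNorm_top hj (𝓕 ψ)
      rw [lowCut, TemperedDistribution.fourierMultiplierCLM_apply_apply,
        FourierTransform.fourierInv_fourier_eq] at h5
      rw [sub_zero]
      exact h5
    have h6 : Tendsto (fun K : ℕ => a (-(K : ℤ)) ψ) atTop (𝓝 0) :=
      h3.comp (tendsto_neg_atTop_atBot.comp tendsto_natCast_atTop_atTop)
    have h7 := h2.sub h6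
    rw [sub_zero] at h7
    exact tendsto_nhds_unique h7 h1
  refine ⟨V1, Lp.stronglyMeasurable V1, hV1int, ?_⟩
  ext1 ψ
  rw [specDist_apply hV1int, ← hF, TemperedDistribution.fourier_apply,
    FourierTransform.fourier_fourierInv_eq]

end Structure

end

/-! ### Smooth divided differences -/

section Hadamard

variable {E F : Type*} [NormedAddCommGroup E] [NormedSpace ℝ E]
  [NormedAddCommGroup F] [NormedSpace ℝ F] [CompleteSpace F]

/-- The integral over (0, 1] is the value at 0 of the convolution of the indicator of (0, 1] with t
↦ η(t) g(p, -t). Here η is one on [-1, 1], so it does not change the integral and only makes the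
kernel compactly supported. -/
lemma contDiff_integral_param {g : E × ℝ → F} (hg : ContDiff ℝ (⊤ : ℕ∞) g) :
    ContDiff ℝ (⊤ : ℕ∞) fun p => ∫ τ in (0 : ℝ)..1, g (p, τ) := by
  let η : ContDiffBump (0 : ℝ) := ⟨1, 2, by norm_num, by norm_num⟩
  have h := contDiffOn_convolution_right_with_param_comp (𝕜 := ℝ) (n := (⊤ : ℕ∞))
    (μ := (volume : Measure ℝ)) (ContinuousLinearMap.lsmul ℝ ℝ) (s := (univ : Set E))
    (v := fun _ => (0 : ℝ)) contDiffOn_const (f := (Ioc (0 : ℝ) 1).indicator fun _ => (1 : ℝ))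
    (g := fun p t => η t • g (p, -t)) (k := Metric.closedBall 0 2) isOpen_univ
    (isCompact_closedBall 0 2)
    (fun p x _ hx => by
      have : 2 < dist x 0 := by simpa using hx
      simp [η.zero_of_le_dist this.le])
    ((integrable_indicator_iff measurableSet_Ioc).2
      (integrableOn_const (by simp))).locallyIntegrable
    (by
      refine ContDiff.contDiffOn ?_
      exact (η.contDiff.comp contDiff_snd).smul
        (hg.comp (contDiff_fst.prodMk contDiff_snd.neg)))
  rw [contDiffOn_univ] at h
  convert! h using 2 with p
  rw [intervalIntegral.integral_of_le zero_le_one, convolution_def, ← integral_indicator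
    measurableSet_Ioc]
  refine integral_congr_ae (Eventually.of_forall fun τ => ?_)
  by_cases hτ : τ ∈ Ioc (0 : ℝ) 1
  · have : η (-τ) = 1 := η.one_of_mem_closedBall (by
      simp only [mem_closedBall_zero_iff, norm_neg, Real.norm_eq_abs, abs_of_pos hτ.1]
      exact hτ.2)
    simp [hτ, this]
  · simp [hτ]

/-- The averaged derivative, with `g (x + y) - g x = divDiff g (x, y) y`. -/
def divDiff (g : E → F) (p : E × E) : E →L[ℝ] F :=
  ∫ τ in (0 : ℝ)..1, fderiv ℝ g (p.1 + τ • p.2)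

lemma contDiff_divDiff {g : E → F} (hg : ContDiff ℝ (⊤ : ℕ∞) g) :
    ContDiff ℝ (⊤ : ℕ∞) (divDiff g) := by
  refine contDiff_integral_param (g := fun q : (E × E) × ℝ =>
    fderiv ℝ g (q.1.1 + q.2 • q.1.2)) ?_
  exact (hg.fderiv_right (m := (⊤ : ℕ∞)) (by simp)).comp (by fun_prop)

lemma divDiff_apply {g : E → F} (hg : ContDiff ℝ (⊤ : ℕ∞) g) (x y : E) :
    divDiff g (x, y) y = g (x + y) - g x := by
  have hc : Continuous fun τ : ℝ => fderiv ℝ g (x + τ • y) :=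
    (hg.continuous_fderiv (by simp)).comp (by fun_prop)
  have h1 : ∀ τ ∈ uIcc (0 : ℝ) 1,
      HasDerivAt (fun τ : ℝ => g (x + τ • y)) (fderiv ℝ g (x + τ • y) y) τ := by
    intro τ _
    have h2 : HasDerivAt (fun τ : ℝ => x + τ • y) y τ := by
      simpa using ((hasDerivAt_id τ).smul_const y).const_add x
    exact ((hg.differentiable (by simp)) (x + τ • y)).hasFDerivAt.comp_hasDerivAt τ h2
  have h3 := intervalIntegral.integral_eq_sub_of_hasDerivAt h1
    ((hc.clm_apply continuous_const).intervalIntegrable _ _)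
  rw [divDiff, ContinuousLinearMap.intervalIntegral_apply (hc.intervalIntegrable _ _), h3]
  simp

lemma divDiff_zero (g : E → F) : divDiff g 0 = fderiv ℝ g 0 := by
  simp [divDiff]

end Hadamard

/-! ### Derivatives along lines -/

section Composition

variable {E G H : Type*} [NormedAddCommGroup E] [NormedSpace ℝ E] [NormedAddCommGroup G]
  [NormedSpace ℝ G] [NormedAddCommGroup H] [NormedSpace ℝ H]

lemma exists_bound_iteratedFDeriv [FiniteDimensional ℝ G] {M : G → H}
    (hM : ContDiff ℝ (⊤ : ℕ∞) M) (R : ℝ) (N : ℕ) :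
    ∃ B : ℝ, 0 ≤ B ∧ ∀ l ≤ N, ∀ z, ‖z‖ ≤ R → ‖iteratedFDeriv ℝ l M z‖ ≤ B := by
  have h : ∀ l : ℕ, ∃ B : ℝ, 0 ≤ B ∧ ∀ z, ‖z‖ ≤ R → ‖iteratedFDeriv ℝ l M z‖ ≤ B := fun l => by
    obtain ⟨B, hB⟩ := (isCompact_closedBall (0 : G) R).exists_bound_of_continuousOn
      (hM.continuous_iteratedFDeriv (m := l) (by exact_mod_cast le_top)).continuousOn
    exact ⟨max B 0, le_max_right _ _, fun z hz =>
      (hB z (by simpa using hz)).trans (le_max_left _ _)⟩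
  choose B hB0 hB using h
  refine ⟨∑ l ∈ Finset.range (N + 1), B l, Finset.sum_nonneg fun l _ => hB0 l,
    fun l hl z hz => (hB l z hz).trans ?_⟩
  exact Finset.single_le_sum (f := B) (fun l _ => hB0 l) (Finset.mem_range.2 (by omega))

/-- Derivatives of `M ∘ Y` for smooth `M` vanishing at zero, when `Y` oscillates at scale `1/D`
with amplitude `ε`. -/
lemma exists_bound_comp [FiniteDimensional ℝ G] {M : G → H} (hM : ContDiff ℝ (⊤ : ℕ∞) M)
    (hM0 : M 0 = 0) (R : ℝ) (N : ℕ) :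
    ∃ K : ℝ, 0 ≤ K ∧ ∀ ε, 0 < ε → ε ≤ R → ∀ (D : ℝ) (Y : ℝ → G) (t : ℝ),
      0 ≤ D → ContDiff ℝ (⊤ : ℕ∞) Y → (∀ l ≤ N, ‖iteratedFDeriv ℝ l Y t‖ ≤ ε * D ^ l) →
      ∀ l ≤ N, ‖iteratedFDeriv ℝ l (M ∘ Y) t‖ ≤ K * ε * D ^ l := by
  obtain ⟨B, hB0, hB⟩ := exists_bound_iteratedFDeriv hM R (N + 1)
  refine ⟨N.factorial * (B * max 1 R ^ N), by positivity, ?_⟩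
  intro ε hε hεR D Y t hD hY hYb l hl
  -- The composition is rescaled as M(ε ·) after ε⁻¹Y. Derivatives of ε⁻¹Y of order i are at most
  -- D^i, and all derivatives of M(ε ·) are O(ε): order zero by the mean value inequality and M 0 =
  -- 0, higher orders because ε^i ≤ max(1, R)^N ε. The bound for derivatives of compositions then
  -- gives ε D^l.
  have hC : ∀ i ≤ l, ‖iteratedFDeriv ℝ i (fun z => M (ε • z)) (ε⁻¹ • Y t)‖ ≤
      B * max 1 R ^ N * ε := by
    intro i hi
    have hYt : ‖Y t‖ ≤ ε := by simpa using hYb 0 (Nat.zero_le _)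
    have h1 : 1 ≤ max 1 R ^ N := one_le_pow₀ (le_max_left _ _)
    rcases Nat.eq_zero_or_pos i with rfl | hi0
    · rw [norm_iteratedFDeriv_zero, smul_inv_smul₀ hε.ne']
      have hmv := (convex_closedBall (0 : G) R).norm_image_sub_le_of_norm_fderiv_le (𝕜 := ℝ)
        (f := M) (C := B) (x := 0) (y := Y t)
        (fun z _ => (hM.differentiable (by simp)) z)
        (fun z hz => by
          have := hB 1 (by omega) z (by simpa using hz)
          rwa [← norm_iteratedFDeriv_fderiv, norm_iteratedFDeriv_zero] at this)
        (by simpa using hε.le.trans hεR) (by simpa using hYt.trans hεR)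
      rw [hM0, sub_zero, sub_zero] at hmv
      calc ‖M (Y t)‖ ≤ B * ε := hmv.trans (by gcongr)
        _ ≤ B * max 1 R ^ N * ε := by
          gcongr
          exact le_mul_of_one_le_right hB0 h1
    · rw [iteratedFDeriv_comp_const_smul ε (hM.of_le (by exact_mod_cast le_top))]
      simp only [norm_smul, norm_pow, Real.norm_of_nonneg hε.le, smul_inv_smul₀ hε.ne']
      have h2 : ε ^ i ≤ max 1 R ^ N * ε := by
        obtain ⟨k, rfl⟩ : ∃ k, i = k + 1 := ⟨i - 1, by omega⟩
        rw [pow_succ]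
        gcongr
        calc ε ^ k ≤ max 1 R ^ k := by gcongr; exact hεR.trans (le_max_right _ _)
          _ ≤ max 1 R ^ N := pow_le_pow_right₀ (le_max_left _ _) (by omega)
      calc ε ^ i * ‖iteratedFDeriv ℝ i M (Y t)‖ ≤ (max 1 R ^ N * ε) * B := by
            gcongr
            exact hB i (by omega) _ (hYt.trans hεR)
        _ = B * max 1 R ^ N * ε := by ring
  have hDb : ∀ i, 1 ≤ i → i ≤ l → ‖iteratedFDeriv ℝ i (fun s => ε⁻¹ • Y s) t‖ ≤ D ^ i := by
    intro i _ hi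
    rw [iteratedFDeriv_const_smul_apply' (hY.of_le (by exact_mod_cast le_top)).contDiffAt,
      norm_smul, norm_inv, Real.norm_of_nonneg hε.le, inv_mul_le_iff₀ hε]
    exact hYb i (hi.trans hl)
  have e : M ∘ Y = (fun z => M (ε • z)) ∘ fun s => ε⁻¹ • Y s := by
    ext s
    simp [smul_inv_smul₀ hε.ne']
  rw [e]
  have h := norm_iteratedFDeriv_comp_le (𝕜 := ℝ) (N := ((⊤ : ℕ∞) : WithTop ℕ∞))
    (hM.comp (contDiff_const_smul ε)) (hY.const_smul ε⁻¹) (by exact_mod_cast le_top) t hC hDb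
  refine h.trans ?_
  have : (l.factorial : ℝ) ≤ N.factorial := by exact_mod_cast Nat.factorial_le hl
  calc (l.factorial : ℝ) * (B * max 1 R ^ N * ε) * D ^ l
      ≤ N.factorial * (B * max 1 R ^ N * ε) * D ^ l := by gcongr
    _ = _ := by ring

/-- The derivative in the direction `e`. -/
def dirDeriv (e : E) (F : E → G) (x : E) : G := fderiv ℝ F x e

lemma contDiff_dirDeriv (e : E) {F : E → G} (hF : ContDiff ℝ (⊤ : ℕ∞) F) :
    ContDiff ℝ (⊤ : ℕ∞) (dirDeriv e F) :=
  (hF.fderiv_right (m := (⊤ : ℕ∞)) (by simp)).clm_apply contDiff_const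

lemma contDiff_iterate_dirDeriv (e : E) {F : E → G} (hF : ContDiff ℝ (⊤ : ℕ∞) F) (l : ℕ) :
    ContDiff ℝ (⊤ : ℕ∞) ((dirDeriv e)^[l] F) := by
  induction l with
  | zero => exact hF
  | succ l ih => rw [Function.iterate_succ_apply']; exact contDiff_dirDeriv e ih

lemma hasDerivAt_line (e : E) {F : E → G} (hF : ContDiff ℝ (⊤ : ℕ∞) F) (x : E) (s : ℝ) :
    HasDerivAt (fun s : ℝ => F (x + s • e)) (dirDeriv e F (x + s • e)) s := by
  have h2 : HasDerivAt (fun τ : ℝ => x + τ • e) e s := by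
    simpa using ((hasDerivAt_id s).smul_const e).const_add x
  exact ((hF.differentiable (by simp)) (x + s • e)).hasFDerivAt.comp_hasDerivAt s h2

lemma iteratedDeriv_line (e : E) {F : E → G} (hF : ContDiff ℝ (⊤ : ℕ∞) F) (x : E) (l : ℕ) :
    iteratedDeriv l (fun s : ℝ => F (x + s • e)) = fun s => (dirDeriv e)^[l] F (x + s • e) := by
  induction l with
  | zero => simp
  | succ l ih =>
    rw [iteratedDeriv_succ, ih, Function.iterate_succ_apply']
    ext s
    exact (hasDerivAt_line e (contDiff_iterate_dirDeriv e hF l) x s).deriv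

/-- Iterated directional derivatives become derivatives of a function of one real variable, to which
the composition and product estimates apply. -/
lemma norm_iteratedFDeriv_line (e : E) {F : E → G} (hF : ContDiff ℝ (⊤ : ℕ∞) F) (x : E) (l : ℕ) :
    ‖iteratedFDeriv ℝ l (fun s : ℝ => F (x + s • e)) 0‖ = ‖(dirDeriv e)^[l] F x‖ := by
  rw [norm_iteratedFDeriv_eq_norm_iteratedDeriv, iteratedDeriv_line e hF]
  simp

lemma contDiff_line (e : E) {F : E → G} (hF : ContDiff ℝ (⊤ : ℕ∞) F) (x : E) :
    ContDiff ℝ (⊤ : ℕ∞) fun s : ℝ => F (x + s • e) := hF.comp (by fun_prop)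

lemma dirDeriv_prodMk (e : E) {F₁ : E → G} {F₂ : E → H} (h₁ : ContDiff ℝ (⊤ : ℕ∞) F₁)
    (h₂ : ContDiff ℝ (⊤ : ℕ∞) F₂) (l : ℕ) :
    (dirDeriv e)^[l] (fun x => (F₁ x, F₂ x)) =
      fun x => ((dirDeriv e)^[l] F₁ x, (dirDeriv e)^[l] F₂ x) := by
  induction l with
  | zero => rfl
  | succ l ih =>
    simp only [Function.iterate_succ_apply', ih]
    ext1 x
    have d₁ := ((contDiff_iterate_dirDeriv e h₁ l).differentiable (by simp)) x
    have d₂ := ((contDiff_iterate_dirDeriv e h₂ l).differentiable (by simp)) x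
    rw [dirDeriv, (d₁.hasFDerivAt.prodMk d₂.hasFDerivAt).fderiv]
    rfl

/-- Derivatives of an increment `g (S + Δ) - g S` in terms of those of `Δ`. -/
lemma exists_bound_increment [FiniteDimensional ℝ G] [CompleteSpace H] {g : G → H}
    (hg : ContDiff ℝ (⊤ : ℕ∞) g) (R : ℝ) (N : ℕ) :
    ∃ K : ℝ, 0 ≤ K ∧ ∀ ε, 0 < ε → ε ≤ R → ∀ (D : ℝ) (S Δ : E → G) (e x : E),
      0 ≤ D → ContDiff ℝ (⊤ : ℕ∞) S → ContDiff ℝ (⊤ : ℕ∞) Δ →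
      (∀ l ≤ N, ‖(dirDeriv e)^[l] S x‖ ≤ ε * D ^ l) →
      (∀ l ≤ N, ‖(dirDeriv e)^[l] Δ x‖ ≤ ε * D ^ l) →
      ∀ L ≤ N, ‖(dirDeriv e)^[L] (fun x => g (S x + Δ x) - g (S x)) x‖ ≤
        ∑ l ∈ Finset.range (L + 1), (L.choose l : ℝ) *
          ((K * ε + ‖fderiv ℝ g 0‖) * D ^ l) * ‖(dirDeriv e)^[L - l] Δ x‖ := by
  have hM := contDiff_divDiff hg
  obtain ⟨K, hK0, hK⟩ := exists_bound_comp (M := fun p => divDiff g p - fderiv ℝ g 0)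
    (hM.sub contDiff_const) (by simp [divDiff_zero]) R N
  refine ⟨K, hK0, fun ε hε hεR D S Δ e x hD hS hΔ hSb hΔb L hL => ?_⟩
  have hF : ContDiff ℝ (⊤ : ℕ∞) fun x => g (S x + Δ x) - g (S x) :=
    (hg.comp (hS.add hΔ)).sub (hg.comp hS)
  rw [← norm_iteratedFDeriv_line e hF]
  set Y : ℝ → G × G := fun s => (S (x + s • e), Δ (x + s • e))
  have hY : ContDiff ℝ (⊤ : ℕ∞) Y := (contDiff_line e hS x).prodMk (contDiff_line e hΔ x)
  have hYb : ∀ l ≤ N, ‖iteratedFDeriv ℝ l Y 0‖ ≤ ε * D ^ l := fun l hl => by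
    have h := norm_iteratedFDeriv_line e (hS.prodMk hΔ) x l
    rw [dirDeriv_prodMk e hS hΔ] at h
    rw [h, Prod.norm_def]
    exact max_le (hSb l hl) (hΔb l hl)
  have hMY : ∀ l ≤ N, ‖iteratedFDeriv ℝ l (divDiff g ∘ Y) 0‖ ≤
      (K * ε + ‖fderiv ℝ g 0‖) * D ^ l := fun l hl => by
    have h1 := hK ε hε hεR D Y 0 hD hY hYb l hl
    -- The composition estimate requires a function vanishing at the origin; the constant taken away
    -- contributes at order zero only.
    have e1 : divDiff g ∘ Y = ((fun p => divDiff g p - fderiv ℝ g 0) ∘ Y) +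
        fun _ => fderiv ℝ g 0 := by
      ext s : 1
      simp
    rw [e1, iteratedFDeriv_add_apply
      (((hM.sub contDiff_const).comp hY).of_le (by exact_mod_cast le_top)).contDiffAt
      contDiff_const.contDiffAt]
    refine (norm_add_le _ _).trans ?_
    rw [add_mul]
    refine add_le_add h1 ?_
    rcases Nat.eq_zero_or_pos l with rfl | hl0
    · simp
    · rw [iteratedFDeriv_const_of_ne hl0.ne']
      simp only [Pi.zero_apply, norm_zero]
      positivity
  -- Hadamard's formula turns the increment into a linear operator applied to Δ, and the Leibniz
  -- rule follows.
  have e2 : (fun s : ℝ => g (S (x + s • e) + Δ (x + s • e)) - g (S (x + s • e))) =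
      fun s => (divDiff g ∘ Y) s (Δ (x + s • e)) := by
    ext1 s
    exact (divDiff_apply hg _ _).symm
  rw [e2]
  refine (norm_iteratedFDeriv_clm_apply (𝕜 := ℝ) (N := ((⊤ : ℕ∞) : WithTop ℕ∞)) (hM.comp hY)
    (contDiff_line e hΔ x) 0 (by exact_mod_cast le_top)).trans ?_
  refine Finset.sum_le_sum fun l hl => ?_
  rw [norm_iteratedFDeriv_line e hΔ]
  gcongr
  exact hMY l (by rw [Finset.mem_range] at hl; omega)

end Composition

section

open FourierTransform

/-! ### Derivatives of band-limited functions -/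

section BandLimited

variable {d : ℕ} {E : Type*} [NormedAddCommGroup E] [NormedSpace ℂ E]

/-- The Fourier symbol `2πi⟨ξ, e⟩` of the derivative in the direction `e`. -/
def derivSymbol (e ξ : Dom d) : ℂ := 2 * Real.pi * Complex.I * (inner ℝ ξ e : ℝ)

lemma continuous_derivSymbol (e : Dom d) : Continuous (derivSymbol e) := by
  unfold derivSymbol
  fun_prop

lemma norm_derivSymbol (e ξ : Dom d) : ‖derivSymbol e ξ‖ = 2 * Real.pi * |inner ℝ ξ e| := by
  simp [derivSymbol, abs_of_nonneg Real.pi_pos.le]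

lemma norm_derivSymbol_le {e : Dom d} (he : ‖e‖ = 1) (ξ : Dom d) :
    ‖derivSymbol e ξ‖ ≤ 2 * Real.pi * ‖ξ‖ := by
  rw [norm_derivSymbol]
  gcongr
  exact (abs_real_inner_le_norm ξ e).trans (by rw [he, mul_one])

lemma integrable_pow_mul_norm {U : Dom d → E} {R : ℝ} (hU : Integrable U)
    (hR : ∀ ξ, R ≤ ‖ξ‖ → U ξ = 0) (n : ℕ) : Integrable fun ξ => ‖ξ‖ ^ n * ‖U ξ‖ := by
  refine (hU.norm.const_mul (R ^ n)).mono'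
    ((by fun_prop : Continuous fun ξ : Dom d => ‖ξ‖ ^ n).aestronglyMeasurable.mul hU.1.norm) ?_
  refine Eventually.of_forall fun ξ => ?_
  rw [Real.norm_of_nonneg (by positivity)]
  by_cases h : R ≤ ‖ξ‖
  · simp [hR ξ h]
  · gcongr
    exact (not_le.1 h).le

lemma fourierInv_eq_fourier_comp_neg' (U : Dom d → E) : 𝓕⁻ U = fun x => 𝓕 U (-x) := by
  ext x
  exact Real.fourierInv_eq_fourier_neg U x

lemma contDiff_fourierInv {U : Dom d → E} {R : ℝ} (hU : Integrable U)
    (hR : ∀ ξ, R ≤ ‖ξ‖ → U ξ = 0) : ContDiff ℝ (⊤ : ℕ∞) (𝓕⁻ U) := by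
  rw [fourierInv_eq_fourier_comp_neg']
  exact (Real.contDiff_fourier fun n _ => integrable_pow_mul_norm hU hR n).comp contDiff_neg

lemma integrable_derivSymbol_pow_smul {U : Dom d → E} {R : ℝ} (hU : Integrable U)
    (hR : ∀ ξ, R ≤ ‖ξ‖ → U ξ = 0) (e : Dom d) (l : ℕ) :
    Integrable fun ξ => derivSymbol e ξ ^ l • U ξ := by
  refine ((integrable_pow_mul_norm hU hR l).const_mul ((2 * Real.pi * ‖e‖) ^ l)).mono'
    (((continuous_derivSymbol e).pow l).aestronglyMeasurable.smul hU.1)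
    (Eventually.of_forall fun ξ => ?_)
  rw [norm_smul, norm_pow, ← mul_assoc, ← mul_pow]
  gcongr
  rw [norm_derivSymbol, mul_assoc (2 * Real.pi), mul_comm ‖e‖]
  gcongr
  exact abs_real_inner_le_norm ξ e

lemma dirDeriv_fourierInv [CompleteSpace E] {U : Dom d → E} {R : ℝ} (hU : Integrable U)
    (hR : ∀ ξ, R ≤ ‖ξ‖ → U ξ = 0) (e : Dom d) :
    dirDeriv e (𝓕⁻ U) = 𝓕⁻ fun ξ => derivSymbol e ξ • U ξ := by
  have h1 : Integrable fun ξ => ‖ξ‖ * ‖U ξ‖ := by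
    simpa using integrable_pow_mul_norm hU hR 1
  ext x
  rw [fourierInv_eq_fourier_comp_neg', fourierInv_eq_fourier_comp_neg']
  have h := (Real.hasFDerivAt_fourier hU h1 (-x)).comp x (hasFDerivAt_id x).neg
  have h2 : Integrable (VectorFourier.fourierSMulRight (innerSL ℝ) U) := by
    refine (h1.const_mul (2 * Real.pi * ‖(innerSL ℝ : Dom d →L[ℝ] Dom d →L[ℝ] ℝ)‖)).mono'
      (hU.1.fourierSMulRight) (Eventually.of_forall fun ξ => ?_)
    exact (VectorFourier.norm_fourierSMulRight_le _ _ _).trans (by rw [mul_assoc])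
  change fderiv ℝ (𝓕 U ∘ Neg.neg) x e = _
  have h' : fderiv ℝ (𝓕 U ∘ Neg.neg) x = _ := HasFDerivAt.fderiv h
  rw [h']
  simp only [Real.fourier_eq, ContinuousLinearMap.comp_apply, neg_apply,
    ContinuousLinearMap.id_apply, map_neg]
  rw [ContinuousLinearMap.integral_apply, ← integral_neg]
  · refine integral_congr_ae (Eventually.of_forall fun ξ => ?_)
    simp only [Circle.smul_def, smul_apply,
      VectorFourier.fourierSMulRight_apply, derivSymbol]
    rw [← smul_neg]
    congr 1
    rw [neg_smul, neg_neg, ← Complex.coe_smul, smul_smul]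
    rfl
  · exact (Real.fourierIntegral_convergent_iff (-x)).2 h2

lemma dirDeriv_iterate_fourierInv [CompleteSpace E] {U : Dom d → E} {R : ℝ} (hU : Integrable U)
    (hR : ∀ ξ, R ≤ ‖ξ‖ → U ξ = 0) (e : Dom d) (l : ℕ) :
    (dirDeriv e)^[l] (𝓕⁻ U) = 𝓕⁻ fun ξ => derivSymbol e ξ ^ l • U ξ := by
  induction l with
  | zero => simp
  | succ l ih =>
    rw [Function.iterate_succ_apply', ih,
      dirDeriv_fourierInv (integrable_derivSymbol_pow_smul hU hR e l)
        (fun ξ h => by rw [hR ξ h, smul_zero])]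
    simp only [smul_smul, ← pow_succ']

/-- Bernstein's inequality: on the support of U the symbol of the derivative is at most 2πR. -/
lemma norm_dirDeriv_iterate_fourierInv_le [CompleteSpace E] {U : Dom d → E} {R ε : ℝ}
    (hR0 : 0 ≤ R) (hU : Integrable U)
    (hR : ∀ ξ, R ≤ ‖ξ‖ → U ξ = 0) (hε : ∫ ξ, ‖U ξ‖ ≤ ε) {e : Dom d} (he : ‖e‖ = 1) (l : ℕ)
    (x : Dom d) : ‖(dirDeriv e)^[l] (𝓕⁻ U) x‖ ≤ ε * (2 * Real.pi * R) ^ l := by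
  rw [dirDeriv_iterate_fourierInv hU hR]
  refine (norm_fourierInv_le _ x).trans ?_
  calc ∫ ξ, ‖derivSymbol e ξ ^ l • U ξ‖ ≤ ∫ ξ, (2 * Real.pi * R) ^ l * ‖U ξ‖ := by
        refine integral_mono (integrable_derivSymbol_pow_smul hU hR e l).norm
          (hU.norm.const_mul _) fun ξ => ?_
        by_cases h : R ≤ ‖ξ‖
        · simp [hR ξ h]
        · simp only [norm_smul, norm_pow]
          gcongr
          refine (norm_derivSymbol_le he ξ).trans ?_
          gcongr
          exact (not_le.1 h).le
    _ = (2 * Real.pi * R) ^ l * ∫ ξ, ‖U ξ‖ := integral_const_mul _ _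
    _ ≤ _ := by
        rw [mul_comm]
        gcongr

end BandLimited

/-! ### The Fourier transform of square integrable functions -/

section SquareIntegrable

variable {d : ℕ} {E : Type*} [NormedAddCommGroup E] [InnerProductSpace ℂ E] [CompleteSpace E]

lemma fourierInv_ae_eq_of_memLp_two {V : Dom d → E} (hV : Integrable V) (h2 : MemLp V 2 volume) :
    𝓕⁻ V =ᵐ[volume] (𝓕⁻ (h2.toLp V) : Lp E 2 (volume : Measure (Dom d))) := by
  refine ae_eq_of_schwartz (continuous_fourierInv hV).locallyIntegrable
    ((Lp.memLp _).locallyIntegrable (by norm_num)) fun ψ => ?_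
  rw [← specDist_apply' hV, specDist_eq_toTemperedDistribution_two hV h2,
    Lp.toTemperedDistribution_apply]

lemma eLpNorm_fourierInv {V : Dom d → E} (hV : Integrable V) (h2 : MemLp V 2 volume) :
    eLpNorm (𝓕⁻ V) 2 volume = eLpNorm V 2 volume := by
  rw [eLpNorm_congr_ae (fourierInv_ae_eq_of_memLp_two hV h2), ← Lp.enorm_def]
  have : ‖(𝓕⁻ (h2.toLp V) : Lp E 2 (volume : Measure (Dom d)))‖ = ‖h2.toLp V‖ :=
    (Lp.fourierTransformₗᵢ (Dom d) E).symm.norm_map _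
  rw [← ofReal_norm, this, ofReal_norm, Lp.enorm_def]
  exact eLpNorm_congr_ae h2.coeFn_toLp

open Classical in
/-- The Fourier transform of a square integrable function. -/
def l2Fourier (F : Dom d → E) : Dom d → E :=
  if h : MemLp F 2 (volume : Measure (Dom d)) then
    (𝓕 (h.toLp F) : Lp E 2 (volume : Measure (Dom d))) else 0

lemma stronglyMeasurable_l2Fourier (F : Dom d → E) : StronglyMeasurable (l2Fourier F) := by
  unfold l2Fourier
  split_ifs
  · exact Lp.stronglyMeasurable _
  · exact stronglyMeasurable_zero

lemma eLpNorm_l2Fourier {F : Dom d → E} (hF : MemLp F 2 volume) :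
    eLpNorm (l2Fourier F) 2 volume = eLpNorm F 2 volume := by
  rw [l2Fourier, dif_pos hF, ← Lp.enorm_def, ← ofReal_norm, Lp.norm_fourier_eq, ofReal_norm,
    Lp.enorm_def]
  exact eLpNorm_congr_ae hF.coeFn_toLp

lemma memLp_l2Fourier {F : Dom d → E} (hF : MemLp F 2 volume) :
    MemLp (l2Fourier F) 2 volume :=
  ⟨(stronglyMeasurable_l2Fourier F).aestronglyMeasurable, by rw [eLpNorm_l2Fourier hF]; exact hF.2⟩

lemma integral_smul_l2Fourier {F : Dom d → E} (hF : MemLp F 2 volume) (ψ : 𝓢(Dom d, ℂ)) :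
    ∫ ξ, ψ ξ • l2Fourier F ξ = ∫ x, (𝓕 ψ : 𝓢(Dom d, ℂ)) x • F x := by
  rw [l2Fourier, dif_pos hF, ← Lp.toTemperedDistribution_apply,
    ← Lp.fourier_toTemperedDistribution_eq, TemperedDistribution.fourier_apply,
    Lp.toTemperedDistribution_apply]
  refine integral_congr_ae ?_
  filter_upwards [hF.coeFn_toLp] with x hx
  rw [hx]

lemma integrable_schwartz_smul {F : Dom d → E} (hF : MemLp F 2 volume) (ψ : 𝓢(Dom d, ℂ)) :
    Integrable fun x => ψ x • F x :=
  memLp_one_iff_integrable.1 (hF.smul (r := 1) (p := 2) (q := 2) (ψ.memLp 2))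

/-- Integration by parts against a Schwartz function. No decay of F is needed beyond square
integrability of F and its derivative, which makes all the products integrable. -/
lemma l2Fourier_dirDeriv {F : Dom d → E} (hF : ContDiff ℝ (⊤ : ℕ∞) F) (e : Dom d)
    (h0 : MemLp F 2 volume) (h1 : MemLp (dirDeriv e F) 2 volume) :
    l2Fourier (dirDeriv e F) =ᵐ[volume] fun ξ => derivSymbol e ξ • l2Fourier F ξ := by
  refine ae_eq_of_schwartz ((memLp_l2Fourier h1).locallyIntegrable (by norm_num))
    (((memLp_l2Fourier h0).locallyIntegrable (by norm_num)).continuous_smul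
      (continuous_derivSymbol e)) fun ψ => ?_
  rw [integral_smul_l2Fourier h1]
  have hd := SchwartzMap.lineDerivOp_fourier_eq ψ e
  have hg : Function.HasTemperateGrowth (fun ξ : Dom d => (inner ℝ ξ e : ℝ)) := by fun_prop
  have key : ∫ x, (𝓕 ψ : 𝓢(Dom d, ℂ)) x • dirDeriv e F x =
      -∫ x, (∂_{e} (𝓕 ψ) : 𝓢(Dom d, ℂ)) x • F x :=
    integral_smul_fderiv_eq_neg_fderiv_smul_of_integrable
      (f := (𝓕 ψ : 𝓢(Dom d, ℂ))) (g := F) (v := e)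
      (integrable_schwartz_smul h0 (∂_{e} (𝓕 ψ))) (integrable_schwartz_smul h1 (𝓕 ψ))
      (integrable_schwartz_smul h0 (𝓕 ψ)) (fun x _ => (𝓕 ψ).differentiable x)
      (fun x _ => hF.differentiable (by simp) x)
  rw [key, hd, ← integral_smul_l2Fourier h0, ← integral_neg]
  refine integral_congr_ae (Eventually.of_forall fun ξ => ?_)
  simp only [smul_apply, SchwartzMap.smulLeftCLM_apply_apply hg, smul_smul,
    derivSymbol, ← neg_smul]
  congr 1
  simp
  ring

lemma l2Fourier_dirDeriv_iterate {F : Dom d → E} (hF : ContDiff ℝ (⊤ : ℕ∞) F) (e : Dom d) (N : ℕ)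
    (h : ∀ l ≤ N, MemLp ((dirDeriv e)^[l] F) 2 volume) :
    l2Fourier ((dirDeriv e)^[N] F) =ᵐ[volume] fun ξ => derivSymbol e ξ ^ N • l2Fourier F ξ := by
  induction N with
  | zero => simp
  | succ N ih =>
    have h1 := h (N + 1) le_rfl
    rw [Function.iterate_succ_apply'] at h1 ⊢
    filter_upwards [l2Fourier_dirDeriv (contDiff_iterate_dirDeriv e hF N) e
      (h N (by omega)) h1, ih fun l hl => h l (by omega)] with ξ h1 h2
    rw [h1, h2, smul_smul, pow_succ']

/-- The coordinate vectors. -/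
def coordVec (i : Fin d) : Dom d := EuclideanSpace.single i 1

lemma norm_coordVec (i : Fin d) : ‖coordVec i‖ = 1 := by simp [coordVec]

lemma inner_coordVec (i : Fin d) (ξ : Dom d) : inner ℝ ξ (coordVec i) = ξ i := by
  simp [coordVec, EuclideanSpace.inner_single_right]

lemma norm_pow_le_sum_coord (ξ : Dom d) {N : ℕ} (hN : N ≠ 0) :
    ‖ξ‖ ^ N ≤ (d : ℝ) ^ N * ∑ i, |ξ i| ^ N := by
  rcases Nat.eq_zero_or_pos d with rfl | hd
  · have : ξ = 0 := Subsingleton.elim _ _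
    simp [this, hN]
  have : Nonempty (Fin d) := ⟨⟨0, hd⟩⟩
  obtain ⟨m, -, hm⟩ := Finset.exists_max_image Finset.univ (fun i => |ξ i|) Finset.univ_nonempty
  have h1 : ‖ξ‖ ≤ d * |ξ m| := by
    calc ‖ξ‖ ≤ ∑ i, |ξ i| := by
          rw [EuclideanSpace.norm_eq]
          refine Real.sqrt_le_iff.2 ⟨by positivity, ?_⟩
          simp only [Real.norm_eq_abs]
          exact Finset.sum_sq_le_sq_sum_of_nonneg fun i _ => abs_nonneg _
      _ ≤ ∑ _i : Fin d, |ξ m| := Finset.sum_le_sum fun i hi => hm i hi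
      _ = d * |ξ m| := by simp
  calc ‖ξ‖ ^ N ≤ (d * |ξ m|) ^ N := by gcongr
    _ = d ^ N * |ξ m| ^ N := mul_pow _ _ _
    _ ≤ _ := by
      gcongr
      exact Finset.single_le_sum (f := fun i => |ξ i| ^ N) (fun i _ => by positivity)
        (Finset.mem_univ m)

lemma shellNorm_l2Fourier_le {F : Dom d → E} (hF : MemLp F 2 volume) (k : ℤ) :
    shellNorm k (l2Fourier F) ≤ eLpNorm F 2 volume := by
  rw [← eLpNorm_l2Fourier hF]
  exact eLpNorm_mono_measure _ Measure.restrict_le_self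

/-- N derivatives in L² give decay 2^{-kN} of the transform: |ξ| ≥ 2^k on the shell, and |ξ|^N is
dominated by the N-th powers of the coordinate symbols. -/
lemma two_pow_mul_shellNorm_l2Fourier_le {F : Dom d → E} (hF : ContDiff ℝ (⊤ : ℕ∞) F)
    {N : ℕ} (hN : N ≠ 0)
    (h : ∀ i : Fin d, ∀ l ≤ N, MemLp ((dirDeriv (coordVec i))^[l] F) 2 volume) (k : ℤ) :
    (2 : ℝ≥0∞) ^ ((k : ℝ) * N) * shellNorm k (l2Fourier F) ≤
      (d : ℝ≥0∞) ^ N * ∑ i : Fin d, eLpNorm ((dirDeriv (coordVec i))^[N] F) 2 volume := by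
  set G : Fin d → Dom d → ℝ := fun i ξ => ‖l2Fourier ((dirDeriv (coordVec i))^[N] F) ξ‖ with hG
  have hGm : ∀ i, AEStronglyMeasurable (G i) volume := fun i =>
    (stronglyMeasurable_l2Fourier _).norm.aestronglyMeasurable
  have hae : ∀ᵐ ξ, ‖ξ‖ ^ N * ‖l2Fourier F ξ‖ ≤ (d : ℝ) ^ N * ∑ i, G i ξ := by
    have : ∀ i : Fin d, ∀ᵐ ξ, G i ξ = ‖derivSymbol (coordVec i) ξ ^ N • l2Fourier F ξ‖ := fun i =>
      (l2Fourier_dirDeriv_iterate hF (coordVec i) N (h i)).mono fun ξ hξ => by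
        simp only [hG, hξ]
    filter_upwards [ae_all_iff.2 this] with ξ hξ
    simp only [hξ, norm_smul, norm_pow, norm_derivSymbol, inner_coordVec, ← Finset.sum_mul,
      ← mul_assoc]
    gcongr
    refine (norm_pow_le_sum_coord ξ hN).trans ?_
    gcongr with i
    have : (1 : ℝ) ≤ 2 * Real.pi := by linarith [Real.pi_gt_three]
    nlinarith [abs_nonneg (ξ i)]
  have h1 : (2 : ℝ≥0∞) ^ ((k : ℝ) * N) * shellNorm k (l2Fourier F) ≤
      eLpNorm (fun ξ => (d : ℝ) ^ N * ∑ i, G i ξ) 2 volume := by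
    have e1 : (2 : ℝ≥0∞) ^ ((k : ℝ) * N) = ‖(2 : ℝ) ^ ((k : ℝ) * N)‖ₑ := by
      rw [← ofReal_two_rpow, Real.enorm_eq_ofReal (by positivity)]
    rw [e1, shellNorm, ← eLpNorm_norm, ← eLpNorm_const_smul]
    refine (eLpNorm_mono_ae ?_).trans (eLpNorm_mono_measure _ Measure.restrict_le_self)
    filter_upwards [ae_restrict_of_ae hae, ae_restrict_mem (measurableSet_shell k)] with ξ hξ hs
    rw [Pi.smul_apply, smul_eq_mul, norm_mul, norm_norm, Real.norm_of_nonneg (by positivity)]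
    refine le_trans ?_ (hξ.trans (le_abs_self _))
    gcongr
    rw [Real.rpow_mul (by norm_num), Real.rpow_intCast, Real.rpow_natCast]
    gcongr
    exact hs.1
  refine h1.trans ?_
  have e2 : (fun ξ => (d : ℝ) ^ N * ∑ i, G i ξ) = ((d : ℝ) ^ N) • ∑ i, G i := by
    ext ξ
    simp [Finset.sum_apply]
  rw [e2, eLpNorm_const_smul]
  have e3 : ‖(d : ℝ) ^ N‖ₑ = (d : ℝ≥0∞) ^ N := by
    rw [Real.enorm_eq_ofReal (by positivity), ENNReal.ofReal_pow (by positivity),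
      ENNReal.ofReal_natCast]
  rw [e3]
  gcongr
  refine (eLpNorm_sum_le (fun i _ => hGm i) (by norm_num)).trans ?_
  refine Finset.sum_le_sum fun i _ => ?_
  rw [hG]
  simp only
  rw [eLpNorm_norm, eLpNorm_l2Fourier (h i N le_rfl)]

end SquareIntegrable

end

section

open FourierTransform

/-! ### Composition with smooth functions -/

section Pieces

variable {d : ℕ} {E : Type*} [NormedAddCommGroup E] [NormedSpace ℂ E]

/-- The function with Fourier transform `V` restricted to `‖ξ‖ < 2^j`. -/
def lowPart (V : Dom d → E) (j : ℤ) : Dom d → E := 𝓕⁻ ((Metric.ball 0 (2 ^ j)).indicator V)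

/-- The function with Fourier transform `V` restricted to the shell `j`. -/
def shellPart (V : Dom d → E) (j : ℤ) : Dom d → E := 𝓕⁻ ((shell d j).indicator V)

lemma ball_succ_eq (j : ℤ) :
    (Metric.ball 0 (2 ^ (j + 1)) : Set (Dom d)) = Metric.ball 0 (2 ^ j) ∪ shell d j := by
  have : (2 : ℝ) ^ j ≤ 2 ^ (j + 1) := zpow_le_zpow_right₀ (by norm_num) (by omega)
  ext ξ
  simp only [Metric.mem_ball, dist_zero_right, mem_union, shell, mem_ofPred_eq]
  constructor
  · intro h
    by_cases h' : ‖ξ‖ < 2 ^ j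
    · exact Or.inl h'
    · exact Or.inr ⟨not_lt.1 h', h⟩
  · rintro (h | h)
    · exact h.trans_le this
    · exact h.2

lemma disjoint_ball_shell (j : ℤ) : Disjoint (Metric.ball (0 : Dom d) (2 ^ j)) (shell d j) := by
  rw [Set.disjoint_left]
  intro ξ h h'
  simp only [Metric.mem_ball, dist_zero_right] at h
  exact absurd h'.1 (not_le.2 h)

variable {V : Dom d → E}

lemma lowPart_succ (hV : Integrable V) (j : ℤ) (x : Dom d) :
    lowPart V (j + 1) x = lowPart V j x + shellPart V j x := by
  rw [lowPart, ball_succ_eq, indicator_union_of_disjoint (disjoint_ball_shell j)]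
  exact fourierInv_add (hV.indicator measurableSet_ball)
    (hV.indicator (measurableSet_shell j)) x

/-- The radius 2^{j+1} is not sharp: it is that of `shellPart_support`, so that both pieces
oscillate at a common scale. -/
lemma lowPart_support (j : ℤ) (ξ : Dom d) (h : 2 ^ (j + 1) ≤ ‖ξ‖) :
    (Metric.ball 0 (2 ^ j)).indicator V ξ = 0 := by
  have : (2 : ℝ) ^ j ≤ 2 ^ (j + 1) := zpow_le_zpow_right₀ (by norm_num) (by omega)
  refine indicator_of_notMem ?_ V
  simpa using this.trans h

lemma shellPart_support (j : ℤ) (ξ : Dom d) (h : 2 ^ (j + 1) ≤ ‖ξ‖) :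
    (shell d j).indicator V ξ = 0 :=
  indicator_of_notMem (fun h' => absurd h'.2 (not_lt.2 h)) V

lemma tendsto_fourierInv_of_indicator {ι : Type*} {l : Filter ι} [l.IsCountablyGenerated]
    (hV : Integrable V) {A : ι → Set (Dom d)} (hA : ∀ k, MeasurableSet (A k)) {B : Set (Dom d)}
    (h : ∀ᵐ ξ, ∀ᶠ k in l, ξ ∈ A k ↔ ξ ∈ B) (x : Dom d) :
    Tendsto (fun k => 𝓕⁻ ((A k).indicator V) x) l (𝓝 (𝓕⁻ (B.indicator V) x)) := by
  simp only [Real.fourierInv_eq]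
  refine tendsto_integral_filter_of_dominated_convergence (fun ξ => ‖V ξ‖) ?_ ?_ hV.norm ?_
  · exact Eventually.of_forall fun k =>
      (integrable_fourierInv_integrand (hV.indicator (hA k)) x).1
  · refine Eventually.of_forall fun k => Eventually.of_forall fun ξ => ?_
    rw [Circle.norm_smul]
    exact norm_indicator_le_norm_self V ξ
  · filter_upwards [h] with ξ hξ
    refine tendsto_const_nhds.congr' ?_
    filter_upwards [hξ] with k hk
    by_cases hB : ξ ∈ B
    · rw [indicator_of_mem hB, indicator_of_mem (hk.2 hB)]
    · rw [indicator_of_notMem hB, indicator_of_notMem (fun h => hB (hk.1 h))]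

lemma tendsto_lowPart_atTop (hV : Integrable V) (x : Dom d) :
    Tendsto (fun K : ℕ => lowPart V K x) atTop (𝓝 (𝓕⁻ V x)) := by
  have := tendsto_fourierInv_of_indicator (l := atTop) (B := univ)
    (A := fun K : ℕ => Metric.ball (0 : Dom d) (2 ^ (K : ℤ))) hV (fun _ => measurableSet_ball)
    (Eventually.of_forall fun ξ => ?_) x
  · simpa [lowPart] using this
  · have h := tendsto_pow_atTop_atTop_of_one_lt (r := (2 : ℝ)) (by norm_num)
    filter_upwards [h.eventually_gt_atTop ‖ξ‖] with K hK
    simpa using hK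

lemma tendsto_lowPart_atBot [NeZero d] (hV : Integrable V) (x : Dom d) :
    Tendsto (fun K : ℕ => lowPart V (-(K : ℤ)) x) atTop (𝓝 0) := by
  have := tendsto_fourierInv_of_indicator (l := atTop) (B := ∅)
    (A := fun K : ℕ => Metric.ball (0 : Dom d) (2 ^ (-(K : ℤ)))) hV
    (fun _ => measurableSet_ball) ?_ x
  · have h0 : 𝓕⁻ (fun _ : Dom d => (0 : E)) x = 0 := by simp [Real.fourierInv_eq]
    simpa [lowPart, h0] using this
  · have h0 : ∀ᵐ ξ : Dom d, ξ ≠ 0 := by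
      simp [ae_iff, measure_singleton]
    filter_upwards [h0] with ξ hξ
    have h := tendsto_pow_atTop_nhds_zero_of_lt_one (r := (2 : ℝ)⁻¹) (by norm_num) (by norm_num)
    filter_upwards [h.eventually_lt_const (norm_pos_iff.2 hξ)] with K hK
    simp only [inv_pow] at hK
    simpa using hK.le

end Pieces

section Composition

variable {d : ℕ} {E H : Type*} [NormedAddCommGroup E] [InnerProductSpace ℂ E]
  [FiniteDimensional ℂ E] [NormedAddCommGroup H] [InnerProductSpace ℂ H] [CompleteSpace H]

/-- The increment of `g` between two consecutive low-frequency truncations. -/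
def increment (g : E → H) (V : Dom d → E) (j : ℤ) (x : Dom d) : H :=
  g (lowPart V j x + shellPart V j x) - g (lowPart V j x)

lemma contDiff_increment {g : E → H} (hg : ContDiff ℝ (⊤ : ℕ∞) g) {V : Dom d → E}
    (hV : Integrable V) (j : ℤ) : ContDiff ℝ (⊤ : ℕ∞) (increment g V j) := by
  have h1 := contDiff_fourierInv (hV.indicator (measurableSet_ball (x := (0 : Dom d))
    (ε := 2 ^ j))) (lowPart_support j)
  have h2 := contDiff_fourierInv (hV.indicator (measurableSet_shell j)) (shellPart_support j)
  exact (hg.comp (h1.add h2)).sub (hg.comp h1)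

lemma eLpNorm_indicator_shell (V : Dom d → E) (j : ℤ) :
    eLpNorm ((shell d j).indicator V) 2 volume = shellNorm j V :=
  eLpNorm_indicator_eq_eLpNorm_restrict (measurableSet_shell j)

/-- In the Leibniz bound for the increment, the low part and the shell part enter the averaged
derivative pointwise, while the remaining factor, the shell part, is measured in L² by Plancherel.
Each derivative costs 4π2^j, and the binomial coefficients add up to 2^L, whence 8π2^j. -/
lemma exists_eLpNorm_dirDeriv_increment_le {g : E → H} (hg : ContDiff ℝ (⊤ : ℕ∞) g) (R : ℝ)
    (N : ℕ) :
    ∃ K : ℝ, 0 ≤ K ∧ ∀ ε, 0 < ε → ε ≤ R → ∀ V : Dom d → E, Integrable V →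
      ∫ ξ, ‖V ξ‖ ≤ ε → ∀ j, shellNorm j V ≠ ⊤ → ∀ i : Fin d, ∀ L ≤ N,
      eLpNorm ((dirDeriv (coordVec i))^[L] (increment g V j)) 2 volume ≤
        ENNReal.ofReal ((K * ε + ‖fderiv ℝ g 0‖) * (8 * Real.pi * 2 ^ j) ^ L) * shellNorm j V := by
  obtain ⟨K, hK, hinc⟩ := exists_bound_increment (E := Dom d) hg R N
  refine ⟨K, hK, fun ε hε hεR V hV hVε j hj i L hL => ?_⟩
  set D : ℝ := 2 * Real.pi * 2 ^ (j + 1) with hD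
  have hD0 : 0 ≤ D := by positivity
  have hU1 := hV.indicator (measurableSet_ball (x := (0 : Dom d)) (ε := 2 ^ j))
  have hU2 := hV.indicator (measurableSet_shell (d := d) j)
  have hc1 := contDiff_fourierInv hU1 (lowPart_support j)
  have hc2 := contDiff_fourierInv hU2 (shellPart_support j)
  have hle : ∀ A : Set (Dom d), MeasurableSet A → ∫ ξ, ‖A.indicator V ξ‖ ≤ ε := fun A hA =>
    (integral_mono (hV.indicator hA).norm hV.norm fun ξ => norm_indicator_le_norm_self V ξ).trans hVε
  have hR0 : (0 : ℝ) ≤ 2 ^ (j + 1) := by positivity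
  have hb1 := fun l x => norm_dirDeriv_iterate_fourierInv_le hR0 hU1 (lowPart_support j)
    (hle _ measurableSet_ball) (norm_coordVec i) l x
  have hb2 := fun l x => norm_dirDeriv_iterate_fourierInv_le hR0 hU2 (shellPart_support j)
    (hle _ (measurableSet_shell j)) (norm_coordVec i) l x
  have hpt : ∀ x, ‖(dirDeriv (coordVec i))^[L] (increment g V j) x‖ ≤ _ := fun x =>
    hinc ε hε hεR D (lowPart V j) (shellPart V j) (coordVec i) x hD0 hc1 hc2
      (fun l _ => hb1 l x) (fun l _ => hb2 l x) L hL
  have hS2 : ∀ l, eLpNorm ((dirDeriv (coordVec i))^[l] (shellPart V j)) 2 volume ≤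
      ENNReal.ofReal (D ^ l) * shellNorm j V := by
    intro l
    have hle' : ∀ ξ, ‖derivSymbol (coordVec i) ξ ^ l • (shell d j).indicator V ξ‖ ≤
        D ^ l * ‖(shell d j).indicator V ξ‖ := by
      intro ξ
      by_cases h : 2 ^ (j + 1) ≤ ‖ξ‖
      · simp [shellPart_support (V := V) j ξ h]
      · rw [norm_smul, norm_pow]
        gcongr
        refine (norm_derivSymbol_le (norm_coordVec i) ξ).trans ?_
        rw [hD]
        gcongr
        exact (not_le.1 h).le
    have hm : MemLp ((shell d j).indicator V) 2 volume :=
      ⟨hU2.1, by rw [eLpNorm_indicator_shell]; exact lt_top_iff_ne_top.2 hj⟩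
    have hi := integrable_derivSymbol_pow_smul hU2 (shellPart_support j) (coordVec i) l
    rw [shellPart, dirDeriv_iterate_fourierInv hU2 (shellPart_support j), eLpNorm_fourierInv hi
      (MemLp.of_le_mul hm hi.1 (Eventually.of_forall hle')), ← eLpNorm_indicator_shell]
    exact eLpNorm_le_mul_eLpNorm_of_ae_le_mul (Eventually.of_forall hle') 2
  set A : ℝ := K * ε + ‖fderiv ℝ g 0‖ with hA
  have hA0 : 0 ≤ A := by positivity
  set G : ℕ → Dom d → ℝ := fun l x =>
    ((L.choose l : ℝ) * (A * D ^ l)) * ‖(dirDeriv (coordVec i))^[L - l] (shellPart V j) x‖ with hG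
  have hGm : ∀ l, AEStronglyMeasurable (G l) volume := fun l =>
    ((contDiff_iterate_dirDeriv (coordVec i) hc2 (L - l)).continuous.norm.const_mul
      _).aestronglyMeasurable
  calc eLpNorm ((dirDeriv (coordVec i))^[L] (increment g V j)) 2 volume
      ≤ eLpNorm (∑ l ∈ Finset.range (L + 1), G l) 2 volume := by
        refine eLpNorm_mono fun x => ?_
        refine (hpt x).trans (le_of_eq_of_le ?_ (le_abs_self _))
        rw [Finset.sum_apply]
    _ ≤ ∑ l ∈ Finset.range (L + 1), eLpNorm (G l) 2 volume :=
        eLpNorm_sum_le (fun l _ => hGm l) (by norm_num)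
    _ ≤ ∑ l ∈ Finset.range (L + 1), ENNReal.ofReal ((L.choose l : ℝ) * (A * D ^ L)) *
          shellNorm j V := by
        refine Finset.sum_le_sum fun l hl => ?_
        have hlL : l ≤ L := by simpa [Nat.lt_succ_iff] using hl
        have e : G l = ((L.choose l : ℝ) * (A * D ^ l)) •
          fun x => ‖(dirDeriv (coordVec i))^[L - l] (shellPart V j) x‖ := by
          ext x
          simp [hG]
        rw [e, eLpNorm_const_smul, eLpNorm_norm, Real.enorm_eq_ofReal (by positivity)]
        refine (mul_le_mul_right (hS2 (L - l)) _).trans ?_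
        rw [← mul_assoc, ← ENNReal.ofReal_mul (by positivity)]
        refine le_of_eq ?_
        congr 2
        rw [mul_assoc, mul_assoc, ← pow_add, Nat.add_sub_cancel' hlL]
    _ = _ := by
        rw [← Finset.sum_mul, ← ENNReal.ofReal_sum_of_nonneg (fun l _ => by positivity),
          ← Finset.sum_mul]
        congr 2
        have : (∑ l ∈ Finset.range (L + 1), (L.choose l : ℝ)) = 2 ^ L := by
          exact_mod_cast Nat.sum_range_choose L
        rw [this, mul_left_comm, ← mul_pow]
        congr 2
        rw [hD, zpow_add_one₀ (by norm_num)]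
        ring

/-- The decay factor of the Fourier transform of an increment away from its main frequency. -/
def decay (N : ℕ) (l : ℤ) : ℝ≥0∞ := min 1 (2 ^ (-((l : ℝ) * N)))

/-- Interpolates between no derivative, which gives the factor 1, and N derivatives, which give
2^{-(k-j)N}. The constant is linear in |g'(0)| + ε, hence of order ε when g'(0) = 0. -/
lemma exists_shellNorm_increment_le [NeZero d] {g : E → H} (hg : ContDiff ℝ (⊤ : ℕ∞) g) (R : ℝ)
    {N : ℕ} (hN : N ≠ 0) :
    ∃ K : ℝ, 0 ≤ K ∧ ∀ ε, 0 < ε → ε ≤ R → ∀ V : Dom d → E, Integrable V →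
      ∫ ξ, ‖V ξ‖ ≤ ε → ∀ j, shellNorm j V ≠ ⊤ → MemLp (increment g V j) 2 volume ∧ ∀ k,
      shellNorm k (l2Fourier (increment g V j)) ≤
        ENNReal.ofReal (K * (‖fderiv ℝ g 0‖ + ε)) * (decay N (k - j) * shellNorm j V) := by
  obtain ⟨K, hK, hinc⟩ := exists_eLpNorm_dirDeriv_increment_le (d := d) hg R N
  have hc : (0 : ℝ) ≤ (d : ℝ) ^ N * (d * (8 * Real.pi) ^ N) + 1 := by positivity
  refine ⟨((d : ℝ) ^ N * (d * (8 * Real.pi) ^ N) + 1) * (K + 1), by positivity,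
    fun ε hε hεR V hV hVε j hj => ?_⟩
  have hinc' := hinc ε hε hεR V hV hVε j hj
  set A : ℝ := K * ε + ‖fderiv ℝ g 0‖ with hA
  have hA0 : 0 ≤ A := by positivity
  have hA1 : A ≤ (K + 1) * (‖fderiv ℝ g 0‖ + ε) := by
    have := norm_nonneg (fderiv ℝ g 0)
    nlinarith
  have hF := contDiff_increment hg hV j
  have hmem : ∀ i : Fin d, ∀ L ≤ N,
      MemLp ((dirDeriv (coordVec i))^[L] (increment g V j)) 2 volume := fun i L hL =>
    ⟨(contDiff_iterate_dirDeriv _ hF L).continuous.aestronglyMeasurable,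
      (hinc' i L hL).trans_lt (ENNReal.mul_lt_top ENNReal.ofReal_lt_top hj.lt_top)⟩
  have hd : 0 < d := Nat.pos_of_neZero d
  have h0 := hmem ⟨0, hd⟩ 0 (Nat.zero_le _)
  refine ⟨h0, fun k => ?_⟩
  have b1 : shellNorm k (l2Fourier (increment g V j)) ≤ ENNReal.ofReal A * shellNorm j V := by
    refine (shellNorm_l2Fourier_le h0 k).trans ?_
    simpa using hinc' ⟨0, hd⟩ 0 (Nat.zero_le _)
  have b2 : shellNorm k (l2Fourier (increment g V j)) ≤
      ENNReal.ofReal ((d : ℝ) ^ N * (d * (8 * Real.pi) ^ N) * A) *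
        ((2 : ℝ≥0∞) ^ (-(((k - j : ℤ) : ℝ) * N)) * shellNorm j V) := by
    have h2 := two_pow_mul_shellNorm_l2Fourier_le hF hN hmem k
    have h3 : (d : ℝ≥0∞) ^ N * ∑ i : Fin d,
        eLpNorm ((dirDeriv (coordVec i))^[N] (increment g V j)) 2 volume ≤
        ENNReal.ofReal ((d : ℝ) ^ N * (d * (8 * Real.pi) ^ N) * A) *
        ((2 : ℝ≥0∞) ^ ((j : ℝ) * N) * shellNorm j V) := by
      calc _ ≤ (d : ℝ≥0∞) ^ N * ∑ i : Fin d,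
            ENNReal.ofReal (A * (8 * Real.pi * 2 ^ j) ^ N) * shellNorm j V := by
            gcongr with i
            exact hinc' i N le_rfl
        _ = _ := by
            rw [Finset.sum_const, Finset.card_univ, Fintype.card_fin, nsmul_eq_mul,
              ← ofReal_two_rpow, ← ENNReal.ofReal_natCast, ← ENNReal.ofReal_pow (by positivity),
              ← mul_assoc, ← mul_assoc, ← mul_assoc, ← ENNReal.ofReal_mul (by positivity),
              ← ENNReal.ofReal_mul (by positivity), ← ENNReal.ofReal_mul (by positivity)]
            congr 2
            rw [Real.rpow_mul (by norm_num), Real.rpow_intCast, Real.rpow_natCast, mul_pow]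
            ring
    have h4 := h2.trans h3
    have e : shellNorm k (l2Fourier (increment g V j)) = (2 : ℝ≥0∞) ^ (-((k : ℝ) * N)) *
        ((2 : ℝ≥0∞) ^ ((k : ℝ) * N) * shellNorm k (l2Fourier (increment g V j))) := by
      rw [← mul_assoc, ← two_rpow_add]
      simp
    rw [e]
    refine (mul_le_mul_right h4 _).trans (le_of_eq ?_)
    rw [mul_left_comm, ← mul_assoc (2 ^ (-((k : ℝ) * N))), ← two_rpow_add]
    congr 3
    push_cast
    ring
  rw [decay]
  rcases min_cases (1 : ℝ≥0∞) (2 ^ (-(((k - j : ℤ) : ℝ) * N))) with ⟨h, -⟩ | ⟨h, -⟩ <;> rw [h]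
  · rw [one_mul]
    refine b1.trans ?_
    gcongr
    refine hA1.trans ?_
    rw [mul_assoc]
    refine le_mul_of_one_le_left (by positivity) ?_
    have : (0 : ℝ) ≤ (d : ℝ) ^ N * (d * (8 * Real.pi) ^ N) := by positivity
    linarith
  · refine b2.trans (mul_le_mul_left (ENNReal.ofReal_le_ofReal ?_) _)
    rw [mul_assoc _ (K + 1)]
    exact mul_le_mul (by linarith) hA1 hA0 hc

/-- The sum of the series `∑ 2^{ls} min(1, 2^{-lN})`. -/
def geomConst (s : ℝ) (N : ℕ) : ℝ≥0∞ := ∑' l : ℤ, (2 : ℝ≥0∞) ^ ((l : ℝ) * s) * decay N l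

lemma tsum_two_rpow_neg_ne_top {r : ℝ} (hr : 0 < r) :
    ∑' n : ℕ, (2 : ℝ≥0∞) ^ (-((n : ℝ) * r)) ≠ ⊤ := by
  have h : ∀ n : ℕ, (2 : ℝ≥0∞) ^ (-((n : ℝ) * r)) = ((2 : ℝ≥0∞) ^ (-r)) ^ n := fun n => by
    rw [← ENNReal.rpow_natCast, ← ENNReal.rpow_mul]
    congr 1
    ring
  simp only [h, ENNReal.tsum_geometric]
  refine ENNReal.inv_ne_top.2 (tsub_pos_of_lt ?_).ne'
  exact ENNReal.rpow_lt_one_of_one_lt_of_neg (by norm_num) (by linarith)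

/-- For l ≥ 0 the decay 2^{-lN} beats 2^{ls} because s < N; for l < 0 the series converges because s
> 0. This is why composition is restricted to positive regularity. -/
lemma geomConst_ne_top {s : ℝ} {N : ℕ} (hs : 0 < s) (hN : s < N) : geomConst s N ≠ ⊤ := by
  have h := ENNReal.summable (f := fun l : ℤ => (2 : ℝ≥0∞) ^ ((l : ℝ) * s) * decay N l)
  rw [geomConst, tsum_of_nat_of_neg_add_one ENNReal.summable ENNReal.summable]
  refine ENNReal.add_ne_top.2 ⟨?_, ?_⟩
  · refine ne_top_of_le_ne_top (tsum_two_rpow_neg_ne_top (sub_pos.2 hN))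
      (ENNReal.tsum_le_tsum fun n => ?_)
    refine (mul_le_mul_right (min_le_right _ _) _).trans (le_of_eq ?_)
    rw [← two_rpow_add]
    congr 1
    push_cast
    ring
  · refine ne_top_of_le_ne_top (tsum_two_rpow_neg_ne_top hs)
      (ENNReal.tsum_le_tsum fun n => ?_)
    refine (mul_le_mul_right (min_le_left _ _) _).trans ?_
    rw [mul_one]
    refine ENNReal.rpow_le_rpow_of_exponent_le (by norm_num) ?_
    push_cast
    nlinarith

lemma specNorm_le_of_decay {V : Dom d → E} {H : Type*} [NormedAddCommGroup H] {F : Dom d → H}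
    {c : ℝ≥0∞} {N : ℕ} {j : ℤ} (s : ℝ)
    (h : ∀ k, shellNorm k F ≤ c * (decay N (k - j) * shellNorm j V)) :
    specNorm s F ≤ c * geomConst s N * (2 ^ ((j : ℝ) * s) * shellNorm j V) := by
  calc specNorm s F ≤ ∑' k : ℤ, (2 : ℝ≥0∞) ^ ((k : ℝ) * s) *
        (c * (decay N (k - j) * shellNorm j V)) :=
        ENNReal.tsum_le_tsum fun k => mul_le_mul_right (h k) _
    _ = ∑' l : ℤ, (2 : ℝ≥0∞) ^ (((l + j : ℤ) : ℝ) * s) * (c * (decay N l * shellNorm j V)) := by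
        rw [← (Equiv.addRight j).tsum_eq]
        simp
    _ = ∑' l : ℤ, (c * (2 ^ ((j : ℝ) * s) * shellNorm j V)) *
          ((2 : ℝ≥0∞) ^ ((l : ℝ) * s) * decay N l) := by
        refine tsum_congr fun l => ?_
        push_cast
        rw [add_mul, two_rpow_add]
        ring
    _ = _ := by
        rw [ENNReal.tsum_mul_left, geomConst]
        ring

/-- Minkowski's inequality with counting measure. -/
lemma shellNorm_tsum_le {F : ℤ → Dom d → H} (hF : ∀ j, StronglyMeasurable (F j)) (k : ℤ) :
    shellNorm k (fun ξ => ∑' j, F j ξ) ≤ ∑' j, shellNorm k (F j) := by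
  simp only [shellNorm_eq]
  have h := lintegral_sq_lintegral_le (μ := (Measure.count : Measure ℤ))
    (ν := volume.restrict (shell d k)) (f := fun j ξ => ‖F j ξ‖ₑ)
    (measurable_from_prod_countable_right fun j => (hF j).enorm)
  simp only [lintegral_count] at h
  refine le_trans ?_ h
  gcongr with ξ
  exact enorm_tsum_le_tsum_enorm

lemma specNorm_tsum_le {F : ℤ → Dom d → H} (hF : ∀ j, StronglyMeasurable (F j)) (s : ℝ) :
    specNorm s (fun ξ => ∑' j, F j ξ) ≤ ∑' j, specNorm s (F j) := by
  simp only [specNorm]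
  rw [ENNReal.tsum_comm]
  refine ENNReal.tsum_le_tsum fun k => ?_
  rw [ENNReal.tsum_mul_left]
  exact mul_le_mul_right (shellNorm_tsum_le hF k) _

lemma shellNorm_ne_top_of_specNorm {s : ℝ} {V : Dom d → E} (h : specNorm s V ≠ ⊤) (j : ℤ) :
    shellNorm j V ≠ ⊤ := by
  intro hj
  refine h (top_le_iff.1 (le_trans ?_ (ENNReal.le_tsum j)))
  rw [hj, ENNReal.mul_top (two_rpow_ne_zero _)]

lemma integrable_tsum {F : ℤ → Dom d → H} (hF : ∀ j, AEStronglyMeasurable (F j) volume)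
    (h : ∑' j, ∫⁻ ξ, ‖F j ξ‖ₑ ≠ ⊤) : Integrable (fun ξ => ∑' j, F j ξ) ∧
      ∀ᵐ ξ, HasSum (fun j => F j ξ) (∑' j, F j ξ) := by
  have h1 : ∀ᵐ ξ, HasSum (fun j => F j ξ) (∑' j, F j ξ) := by
    have : ∫⁻ ξ, ∑' j, ‖F j ξ‖ₑ ≠ ⊤ := by rwa [lintegral_tsum fun j => (hF j).enorm]
    filter_upwards [ae_lt_top' (AEMeasurable.tsum fun j => (hF j).enorm) this] with ξ hξ
    exact (Summable.of_enorm hξ.ne).hasSum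
  refine ⟨⟨?_, ?_⟩, h1⟩
  · refine aestronglyMeasurable_of_tendsto_ae (u := (atTop : Filter (Finset ℤ)))
      (f := fun s ξ => ∑ j ∈ s, F j ξ) (fun s => ?_) h1
    exact Finset.aestronglyMeasurable_fun_sum s fun j _ => hF j
  · refine lt_of_le_of_lt (lintegral_mono fun ξ => enorm_tsum_le_tsum_enorm) ?_
    rw [lintegral_tsum fun j => (hF j).enorm]
    exact lt_top_iff_ne_top.2 h

lemma hasSum_fourierInv {F : ℤ → Dom d → H} (hF : ∀ j, AEStronglyMeasurable (F j) volume)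
    (h : ∑' j, ∫⁻ ξ, ‖F j ξ‖ₑ ≠ ⊤) (x : Dom d) :
    HasSum (fun j => 𝓕⁻ (F j) x) (𝓕⁻ (fun ξ => ∑' j, F j ξ) x) := by
  have hint : ∀ j, Integrable (F j) := fun j =>
    ⟨hF j, lt_top_iff_ne_top.2 (ne_top_of_le_ne_top h (ENNReal.le_tsum j))⟩
  have hsum : Summable fun j => 𝓕⁻ (F j) x := by
    refine Summable.of_enorm (ne_top_of_le_ne_top h (ENNReal.tsum_le_tsum fun j => ?_))
    exact enorm_fourierInv_le _ x
  have : 𝓕⁻ (fun ξ => ∑' j, F j ξ) x = ∑' j, 𝓕⁻ (F j) x := by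
    simp only [Real.fourierInv_eq]
    rw [← integral_tsum (fun j => (integrable_fourierInv_integrand (hint j) x).1)]
    · refine integral_congr_ae ?_
      filter_upwards [(integrable_tsum hF h).2] with ξ hξ
      rw [← (hξ.const_smul (Real.fourierChar (inner ℝ ξ x))).tsum_eq]
    · have e : ∀ j ξ, ‖Real.fourierChar (inner ℝ ξ x) • F j ξ‖ₑ = ‖F j ξ‖ₑ := fun j ξ => by
        rw [← ofReal_norm, Circle.norm_smul, ofReal_norm]
      simpa only [e] using h
  rw [this]
  exact hsum.hasSum

lemma fourierInv_l2Fourier {F : Dom d → H} (hc : Continuous F) (hF : MemLp F 2 volume)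
    (hi : Integrable (l2Fourier F)) : 𝓕⁻ (l2Fourier F) = F := by
  refine ((continuous_fourierInv hi).ae_eq_iff_eq volume hc).1 ?_
  refine ae_eq_of_schwartz (continuous_fourierInv hi).locallyIntegrable hc.locallyIntegrable
    fun ψ => ?_
  rw [← specDist_apply' hi, specDist_apply hi, integral_smul_l2Fourier hF,
    FourierTransform.fourier_fourierInv_eq]

/-- Composition with a smooth function acts on functions with integrable Fourier transform, and is
bounded on all Besov spaces of positive index. -/
theorem exists_comp_bound [NeZero d] {g : E → H} (hg : ContDiff ℝ (⊤ : ℕ∞) g) (hg0 : g 0 = 0)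
    (R : ℝ) {N : ℕ} (hN : (d / 2 : ℝ) < N) :
    ∃ K : ℝ, 0 ≤ K ∧ ∀ ε, 0 < ε → ε ≤ R → ∀ V : Dom d → E, Integrable V →
      ∫ ξ, ‖V ξ‖ ≤ ε → specNorm (d / 2 : ℝ) V ≠ ⊤ →
      ∃ W : Dom d → H, Integrable W ∧ (∀ x, 𝓕⁻ W x = g (𝓕⁻ V x)) ∧
        ∀ s, specNorm s W ≤
          ENNReal.ofReal (K * (‖fderiv ℝ g 0‖ + ε)) * geomConst s N * specNorm s V := by
  have hd : (0 : ℝ) < d / 2 := by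
    have := Nat.pos_of_neZero d
    positivity
  have hN0 : N ≠ 0 := by
    rintro rfl
    norm_num at hN
    linarith
  obtain ⟨K, hK, hinc⟩ := exists_shellNorm_increment_le (d := d) hg R hN0
  refine ⟨K, hK, fun ε hε hεR V hV hVε hVs => ?_⟩
  set c : ℝ≥0∞ := ENNReal.ofReal (K * (‖fderiv ℝ g 0‖ + ε)) with hc
  have hj := fun j => hinc ε hε hεR V hV hVε j (shellNorm_ne_top_of_specNorm hVs j)
  set F : ℤ → Dom d → H := fun j => l2Fourier (increment g V j) with hF
  have hFm : ∀ j, StronglyMeasurable (F j) := fun j => stronglyMeasurable_l2Fourier _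
  have hFs : ∀ s j, specNorm s (F j) ≤ c * geomConst s N * (2 ^ ((j : ℝ) * s) * shellNorm j V) :=
    fun s j => specNorm_le_of_decay s (hj j).2
  have hsum : ∀ s, ∑' j, specNorm s (F j) ≤ c * geomConst s N * specNorm s V := fun s => by
    refine (ENNReal.tsum_le_tsum (hFs s)).trans ?_
    rw [ENNReal.tsum_mul_left, specNorm]
  have hfin : c * geomConst (d / 2 : ℝ) N * specNorm (d / 2 : ℝ) V ≠ ⊤ :=
    ENNReal.mul_ne_top (ENNReal.mul_ne_top ENNReal.ofReal_ne_top (geomConst_ne_top hd hN)) hVs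
  -- The index d/2 gives absolute summability in L¹, so the series may be inverted term by term,
  -- while all the other norms are bounded along the same series.
  have hL1 : ∑' j, ∫⁻ ξ, ‖F j ξ‖ₑ ≠ ⊤ := by
    refine ne_top_of_le_ne_top (ENNReal.mul_ne_top (massConst_ne_top (d := d))
      (ne_top_of_le_ne_top hfin (hsum _))) ?_
    rw [← ENNReal.tsum_mul_left]
    exact ENNReal.tsum_le_tsum fun j => lintegral_le_specNorm (hFm j).aestronglyMeasurable
  have hint : ∀ j, Integrable (F j) := fun j => ⟨(hFm j).aestronglyMeasurable,
    lt_top_iff_ne_top.2 (ne_top_of_le_ne_top hL1 (ENNReal.le_tsum j))⟩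
  refine ⟨fun ξ => ∑' j, F j ξ,
    (integrable_tsum (fun j => (hFm j).aestronglyMeasurable) hL1).1, fun x => ?_,
    fun s => (specNorm_tsum_le hFm s).trans (hsum s)⟩
  have hs := hasSum_fourierInv (fun j => (hFm j).aestronglyMeasurable) hL1 x
  have hFx : ∀ j, 𝓕⁻ (F j) x = g (lowPart V (j + 1) x) - g (lowPart V j x) := fun j => by
    rw [fourierInv_l2Fourier (contDiff_increment hg hV j).continuous (hj j).1 (hint j),
      increment, lowPart_succ hV]
  simp only [hFx] at hs
  have hIco : Tendsto (fun K : ℕ => Finset.Ico (-(K : ℤ)) K) atTop atTop := by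
    refine tendsto_atTop_finset_of_monotone (fun a b hab => ?_) fun m => ⟨m.natAbs + 1, ?_⟩
    · refine Finset.Ico_subset_Ico ?_ ?_ <;> simpa using hab
    · simp only [Finset.mem_Ico]
      omega
  have h1 := hs.comp hIco
  simp only [Function.comp_def] at h1
  -- The telescoped partial sums converge pointwise: high truncations recover the function, low ones
  -- tend to zero, and g 0 = 0.
  have h2 : Tendsto (fun K : ℕ => g (lowPart V K x) - g (lowPart V (-(K : ℤ)) x)) atTop
      (𝓝 (g (𝓕⁻ V x) - g 0)) :=
    ((hg.continuous.tendsto _).comp (tendsto_lowPart_atTop hV x)).sub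
      ((hg.continuous.tendsto _).comp (tendsto_lowPart_atBot hV x))
  rw [hg0, sub_zero] at h2
  refine tendsto_nhds_unique (h1.congr fun K => ?_) h2
  exact sum_Ico_int_sub (fun j => g (lowPart V j x)) K

end Composition

end

section

open FourierTransform

/-! ### Composition of real-valued functions -/

section RealComposition

variable {d n : ℕ}

/-- The inclusion of `ℝ^n` into `ℂ^n` as a real-linear map. -/
def complexifyL : Val n →L[ℝ] CVal n :=
  LinearMap.toContinuousLinearMap
    { toFun := complexify
      map_add' := complexify_add
      map_smul' := fun c y => by
        ext k
        simp [complexify] }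

@[simp] lemma complexifyL_apply (y : Val n) : complexifyL y = complexify y := rfl

/-- The real part of a vector of `ℂ^n`. -/
def realPart : CVal n →L[ℝ] Val n :=
  LinearMap.toContinuousLinearMap
    { toFun := fun z => WithLp.toLp 2 fun k => (z k).re
      map_add' := fun y z => by
        ext k
        simp
      map_smul' := fun c y => by
        ext k
        simp }

@[simp] lemma realPart_apply (z : CVal n) (k : Fin n) : realPart z k = (z k).re := rfl

@[simp] lemma realPart_complexify (y : Val n) : realPart (complexify y) = y := by
  ext k
  simp [complexify]

lemma complexify_injective : Function.Injective (complexify (n := n)) :=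
  Function.LeftInverse.injective realPart_complexify

@[simp] lemma complexify_zero : complexify (0 : Val n) = 0 := complexifyL.map_zero

lemma integral_norm_eq_toReal {E : Type*} [NormedAddCommGroup E] {V : Dom d → E}
    (hV : Integrable V) : ∫ ξ, ‖V ξ‖ = (∫⁻ ξ, ‖V ξ‖ₑ).toReal :=
  integral_norm_eq_lintegral_enorm hV.1

lemma integrable_of_lintegral_le {E : Type*} [NormedAddCommGroup E] {V : Dom d → E}
    (hV : AEStronglyMeasurable V) {R : ℝ} (h : ∫⁻ ξ, ‖V ξ‖ₑ ≤ ENNReal.ofReal R) : Integrable V :=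
  ⟨hV, h.trans_lt ENNReal.ofReal_lt_top⟩

variable [NeZero d]

lemma half_pos' : (0 : ℝ) < d / 2 := by
  have := Nat.pos_of_neZero d
  positivity

/-- Quadratic estimates in Besov spaces for compositions with functions that vanish to second
order. -/
theorem exists_comp_real_bound {g : Val n → Val n} (hg : ContDiff ℝ (⊤ : ℕ∞) g) (hg0 : g 0 = 0)
    (hg1 : fderiv ℝ g 0 = 0) {R : ℝ} (hR : 0 < R) :
    ∃ K : ℝ≥0∞, K ≠ ⊤ ∧ ∀ V : Dom d → CVal n, AEStronglyMeasurable V →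
      ∫⁻ ξ, ‖V ξ‖ₑ ≤ ENNReal.ofReal R → specNorm (d / 2 : ℝ) V ≠ ⊤ →
      ∃ W : Dom d → CVal n, Integrable W ∧
        (∀ x, 𝓕⁻ W x = complexify (g (realPart (𝓕⁻ V x)))) ∧
        specNorm (d / 2 : ℝ) W ≤ K * (∫⁻ ξ, ‖V ξ‖ₑ) * specNorm (d / 2 : ℝ) V ∧
        specNorm (d / 2 + 1 : ℝ) W ≤ K * (∫⁻ ξ, ‖V ξ‖ₑ) * specNorm (d / 2 + 1 : ℝ) V := by
  have hd := half_pos' (d := d)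
  -- The order N = d + 2 exceeds d/2 + 1, so both indices are admissible.
  have hN : (d / 2 : ℝ) < (d + 2 : ℕ) := by
    push_cast
    linarith
  have hN' : (d / 2 + 1 : ℝ) < (d + 2 : ℕ) := by
    push_cast
    linarith
  set G : CVal n → CVal n := fun z => complexifyL (g (realPart z)) with hG
  have hGs : ContDiff ℝ (⊤ : ℕ∞) G := complexifyL.contDiff.comp (hg.comp realPart.contDiff)
  have hG0 : G 0 = 0 := by simp [hG, hg0]
  have hG1 : fderiv ℝ G 0 = 0 := by
    have h1 : HasFDerivAt g (0 : Val n →L[ℝ] Val n) (realPart (0 : CVal n)) := by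
      rw [map_zero, ← hg1]
      exact (hg.differentiable (by simp) 0).hasFDerivAt
    have h2 := (complexifyL (n := n)).hasFDerivAt.comp (0 : CVal n)
      (h1.comp (0 : CVal n) (realPart (n := n)).hasFDerivAt)
    have h3 : HasFDerivAt G _ (0 : CVal n) := h2
    rw [h3.fderiv]
    ext z : 1
    simp
  obtain ⟨K, hK, hcomp⟩ := exists_comp_bound (d := d) hGs hG0 R hN
  rw [hG1, norm_zero] at hcomp
  refine ⟨ENNReal.ofReal K * (geomConst (d / 2 : ℝ) (d + 2) + geomConst (d / 2 + 1 : ℝ) (d + 2)),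
    ENNReal.mul_ne_top ENNReal.ofReal_ne_top (ENNReal.add_ne_top.2
      ⟨geomConst_ne_top hd hN, geomConst_ne_top (by linarith) hN'⟩), fun V hVm hVR hVs => ?_⟩
  have hV := integrable_of_lintegral_le hVm hVR
  have hfin : ∫⁻ ξ, ‖V ξ‖ₑ ≠ ⊤ := hV.2.ne
  -- The amplitude ε must be positive, so the case V = 0 is separate.
  by_cases h0 : ∫⁻ ξ, ‖V ξ‖ₑ = 0
  · have hV0 : V =ᵐ[volume] 0 := by
      filter_upwards [(lintegral_eq_zero_iff' hVm.enorm).1 h0] with ξ hξ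
      simpa using hξ
    obtain ⟨W, hW, hWx, hWs⟩ := hcomp R hR le_rfl V hV (by
      rw [integral_norm_eq_toReal hV, h0]
      simpa using hR.le) hVs
    have hz : ∀ s, specNorm s V = 0 := fun s => by
      rw [specNorm_congr hV0]
      simp [specNorm, shellNorm]
    refine ⟨W, hW, hWx, (hWs _).trans ?_, (hWs _).trans ?_⟩ <;> simp [hz]
  -- The amplitude ε is taken equal to the mass of V: since g'(0) = 0, the linear constant K(|g'(0)|
  -- + ε) becomes K∫|V|, which makes the estimate quadratic.
  · have hpos : 0 < (∫⁻ ξ, ‖V ξ‖ₑ).toReal := ENNReal.toReal_pos h0 hfin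
    obtain ⟨W, hW, hWx, hWs⟩ := hcomp _ hpos (ENNReal.toReal_le_of_le_ofReal hR.le hVR) V hV
      (integral_norm_eq_toReal hV).le hVs
    rw [zero_add, ENNReal.ofReal_mul hK, ENNReal.ofReal_toReal hfin] at hWs
    refine ⟨W, hW, hWx, (hWs _).trans ?_, (hWs _).trans ?_⟩
    · rw [mul_right_comm (ENNReal.ofReal K)]
      exact mul_le_mul_left (mul_le_mul_left (mul_le_mul_right le_self_add _) _) _
    · rw [mul_right_comm (ENNReal.ofReal K)]
      exact mul_le_mul_left (mul_le_mul_left (mul_le_mul_right le_add_self _) _) _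

lemma fourierInv_clm {E F : Type*} [NormedAddCommGroup E] [NormedSpace ℂ E]
    [NormedAddCommGroup F] [NormedSpace ℂ F] [CompleteSpace E] [CompleteSpace F] (L : E →L[ℂ] F)
    {V : Dom d → E} (hV : Integrable V) (x : Dom d) :
    𝓕⁻ (fun ξ => L (V ξ)) x = L (𝓕⁻ V x) := by
  rw [Real.fourierInv_eq, Real.fourierInv_eq,
    ← L.integral_comp_comm (integrable_fourierInv_integrand hV x)]
  simp only [Circle.smul_def, map_smul]

lemma fourierInv_sum {E ι : Type*} [NormedAddCommGroup E] [NormedSpace ℂ E] (t : Finset ι)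
    {V : ι → Dom d → E} (hV : ∀ i ∈ t, Integrable (V i)) (x : Dom d) :
    𝓕⁻ (fun ξ => ∑ i ∈ t, V i ξ) x = ∑ i ∈ t, 𝓕⁻ (V i) x := by
  simp only [Real.fourierInv_eq, Finset.smul_sum]
  exact integral_finsetSum t fun i hi => integrable_fourierInv_integrand (hV i hi) x

lemma norm_toLp_prod_le {E F : Type*} [NormedAddCommGroup E] [NormedAddCommGroup F] (x : E)
    (y : F) : ‖(WithLp.toLp 2 (x, y) : WithLp 2 (E × F))‖ ≤ ‖x‖ + ‖y‖ := by
  rw [WithLp.prod_norm_eq_of_L2]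
  refine Real.sqrt_le_iff.2 ⟨by positivity, ?_⟩
  change ‖x‖ ^ 2 + ‖y‖ ^ 2 ≤ _
  nlinarith [norm_nonneg x, norm_nonneg y]

lemma specNorm_norm {E : Type*} [NormedAddCommGroup E] (s : ℝ) (V : Dom d → E) :
    specNorm s (fun ξ => ‖V ξ‖) = specNorm s V :=
  le_antisymm (specNorm_mono s fun ξ => by simp) (specNorm_mono s fun ξ => by simp)

lemma sum_smul_complexify_single {A : Val n →L[ℝ] Val n} (y : Val n) :
    ∑ k, ((y k : ℝ) : ℂ) • complexify (A (EuclideanSpace.single k 1)) = complexify (A y) := by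
  have h : y = ∑ k, y k • EuclideanSpace.single k (1 : ℝ) := by
    ext l
    simp [Finset.sum_apply, Pi.single_apply]
  conv_rhs => rw [h, map_sum, ← complexifyL_apply, map_sum]
  refine Finset.sum_congr rfl fun k _ => ?_
  rw [map_smul, map_smul, complexifyL_apply, Complex.coe_smul]

/-- A product of two functions with integrable Fourier transforms. -/
lemma exists_fourierInv_smul {E : Type*} [NormedAddCommGroup E] [NormedSpace ℂ E] [CompleteSpace E]
    {δ : Dom d → ℂ} {Q : Dom d → E} (hδ : Integrable δ) (hQ : Integrable Q) :
    ∃ P : Dom d → E, Integrable P ∧ (∀ x, 𝓕⁻ P x = 𝓕⁻ δ x • 𝓕⁻ Q x) ∧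
      ∫⁻ ξ, ‖P ξ‖ₑ ≤ (∫⁻ ξ, ‖δ ξ‖ₑ) * ∫⁻ ξ, ‖Q ξ‖ₑ := by
  refine ⟨convolution δ Q (ContinuousLinearMap.lsmul ℂ ℂ) volume,
    hδ.integrable_convolution _ hQ, fun x => ?_, ?_⟩
  · simp only [fourierInv_eq_fourier_comp_neg']
    exact Real.fourier_smul_convolution_eq hδ hQ (-x)
  · have hm : AEStronglyMeasurable (fun p : Dom d × Dom d => δ p.2 • Q (p.1 - p.2))
        (volume.prod volume) := (hδ.convolution_integrand (ContinuousLinearMap.lsmul ℂ ℂ) hQ).1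
    calc ∫⁻ ξ, ‖convolution δ Q (ContinuousLinearMap.lsmul ℂ ℂ) volume ξ‖ₑ
        ≤ ∫⁻ ξ, ∫⁻ ζ, ‖δ ζ • Q (ξ - ζ)‖ₑ := lintegral_mono fun ξ => enorm_integral_le_lintegral_enorm _
      _ = ∫⁻ ζ, ∫⁻ ξ, ‖δ ζ • Q (ξ - ζ)‖ₑ := lintegral_lintegral_swap hm.enorm
      _ = ∫⁻ ζ, ‖δ ζ‖ₑ * ∫⁻ ξ, ‖Q ξ‖ₑ := by
          refine lintegral_congr fun ζ => ?_
          simp only [enorm_smul]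
          rw [lintegral_const_mul' _ _ enorm_ne_top,
            lintegral_sub_right_eq_self (fun ξ => ‖Q ξ‖ₑ) ζ]
      _ = _ := lintegral_mul_const'' _ hδ.1.enorm

/-! ### Divided differences and the Lipschitz estimate -/

/-- The divided difference `(x, y) ↦ ∫₀¹ ∂_k g(x + τy) dτ`, minus its value at the origin, on the
complexified space of pairs. -/
def slope (g : Val n → Val n) (k : Fin n) (z : WithLp 2 (CVal n × CVal n)) : CVal n :=
  complexifyL (divDiff g (realPart z.fst, realPart z.snd) (EuclideanSpace.single k 1)) -
    complexifyL (fderiv ℝ g 0 (EuclideanSpace.single k 1))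

lemma contDiff_slope {g : Val n → Val n} (hg : ContDiff ℝ (⊤ : ℕ∞) g) (k : Fin n) :
    ContDiff ℝ (⊤ : ℕ∞) (slope g k) := by
  have h1 : ContDiff ℝ (⊤ : ℕ∞) fun z : WithLp 2 (CVal n × CVal n) =>
      (realPart z.fst, realPart z.snd) :=
    (realPart.contDiff.comp (WithLp.fstL 2 ℝ (CVal n) (CVal n)).contDiff).prodMk
      (realPart.contDiff.comp (WithLp.sndL 2 ℝ (CVal n) (CVal n)).contDiff)
  exact (complexifyL.contDiff.comp (((contDiff_divDiff hg).comp h1).clm_apply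
    contDiff_const)).sub contDiff_const

lemma slope_zero (g : Val n → Val n) (k : Fin n) : slope g k 0 = 0 := by
  simp only [slope, WithLp.zero_fst, WithLp.zero_snd, map_zero]
  rw [show ((0 : Val n), (0 : Val n)) = 0 from rfl, divDiff_zero, sub_self]

lemma slope_toLp_complexify (g : Val n → Val n) (k : Fin n) (x y : Val n) :
    slope g k (WithLp.toLp 2 (complexify x, complexify y)) +
      complexify (fderiv ℝ g 0 (EuclideanSpace.single k 1)) =
    complexify (divDiff g (x, y) (EuclideanSpace.single k 1)) := by
  simp [slope]

/-- The pair `(V₂, V₁ - V₂)`. -/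
def pairUp (V₁ V₂ : Dom d → CVal n) (ξ : Dom d) : WithLp 2 (CVal n × CVal n) :=
  WithLp.toLp 2 (V₂ ξ, V₁ ξ - V₂ ξ)

lemma aestronglyMeasurable_pairUp {V₁ V₂ : Dom d → CVal n} (h₁ : AEStronglyMeasurable V₁)
    (h₂ : AEStronglyMeasurable V₂) : AEStronglyMeasurable (pairUp V₁ V₂) :=
  (WithLp.prod_continuous_toLp 2 (CVal n) (CVal n)).comp_aestronglyMeasurable
    (h₂.prodMk (h₁.sub h₂))

/-- The factor 3 comes from |V₂| + |V₁ - V₂| ≤ |V₁| + 2|V₂|. -/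
lemma specNorm_pairUp_le {V₁ V₂ : Dom d → CVal n} (h₁ : AEStronglyMeasurable V₁)
    (h₂ : AEStronglyMeasurable V₂) {s R : ℝ} (hR : 0 ≤ R)
    (hR₁ : specNorm s V₁ ≤ ENNReal.ofReal R) (hR₂ : specNorm s V₂ ≤ ENNReal.ofReal R) :
    specNorm s (pairUp V₁ V₂) ≤ ENNReal.ofReal (3 * R) := by
  have h : specNorm s (pairUp V₁ V₂) ≤
      specNorm s ((fun ξ => ‖V₁ ξ‖) + ((fun ξ => ‖V₂ ξ‖) + fun ξ => ‖V₂ ξ‖)) := by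
    refine specNorm_mono _ fun ξ => (norm_toLp_prod_le _ _).trans (le_trans ?_ (le_abs_self _))
    have := norm_sub_le (V₁ ξ) (V₂ ξ)
    simp only [Pi.add_apply]
    linarith
  refine h.trans ((specNorm_add_le _ h₁.norm (h₂.norm.add h₂.norm)).trans ?_)
  refine (add_le_add le_rfl (specNorm_add_le _ h₂.norm h₂.norm)).trans ?_
  simp only [specNorm_norm]
  refine (add_le_add hR₁ (add_le_add hR₂ hR₂)).trans (le_of_eq ?_)
  rw [← ENNReal.ofReal_add hR hR, ← ENNReal.ofReal_add hR (by positivity)]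
  congr 1
  ring

lemma fourierInv_pairUp {V₁ V₂ : Dom d → CVal n} (h₁ : Integrable V₁) (h₂ : Integrable V₂)
    (h : Integrable (pairUp V₁ V₂)) (x : Dom d) :
    𝓕⁻ (pairUp V₁ V₂) x = WithLp.toLp 2 (𝓕⁻ V₂ x, 𝓕⁻ V₁ x - 𝓕⁻ V₂ x) := by
  have e1 : (𝓕⁻ (pairUp V₁ V₂) x).fst = 𝓕⁻ V₂ x :=
    (fourierInv_clm (WithLp.fstL 2 ℂ (CVal n) (CVal n)) h x).symm
  have e2 : (𝓕⁻ (pairUp V₁ V₂) x).snd = 𝓕⁻ V₁ x - 𝓕⁻ V₂ x := by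
    rw [← fourierInv_sub h₁ h₂]
    exact (fourierInv_clm (WithLp.sndL 2 ℂ (CVal n) (CVal n)) h x).symm
  calc 𝓕⁻ (pairUp V₁ V₂) x =
        WithLp.toLp 2 ((𝓕⁻ (pairUp V₁ V₂) x).fst, (𝓕⁻ (pairUp V₁ V₂) x).snd) := rfl
    _ = _ := by rw [e1, e2]

/-- Lipschitz estimate for compositions, in the space of functions with integrable Fourier
transform. -/
theorem exists_comp_lipschitz {g : Val n → Val n} (hg : ContDiff ℝ (⊤ : ℕ∞) g) {R : ℝ}
    (hR : 0 < R) :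
    ∃ L : ℝ≥0∞, L ≠ ⊤ ∧ ∀ (V₁ V₂ W₁ W₂ : Dom d → CVal n) (v₁ v₂ : Dom d → Val n),
      AEStronglyMeasurable V₁ → AEStronglyMeasurable V₂ → Integrable W₁ → Integrable W₂ →
      specNorm (d / 2 : ℝ) V₁ ≤ ENNReal.ofReal R → specNorm (d / 2 : ℝ) V₂ ≤ ENNReal.ofReal R →
      (∀ x, 𝓕⁻ V₁ x = complexify (v₁ x)) → (∀ x, 𝓕⁻ V₂ x = complexify (v₂ x)) →
      (∀ x, 𝓕⁻ W₁ x = complexify (g (v₁ x))) → (∀ x, 𝓕⁻ W₂ x = complexify (g (v₂ x))) →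
      ∫⁻ ξ, ‖W₁ ξ - W₂ ξ‖ₑ ≤ L * ∫⁻ ξ, ‖V₁ ξ - V₂ ξ‖ₑ := by
  have hd := half_pos' (d := d)
  have hN : (d / 2 : ℝ) < (d + 2 : ℕ) := by
    push_cast
    linarith
  -- A fixed amplitude bounding the mass of the pair (V₂, V₁ - V₂); no smallness is sought here.
  set ε : ℝ := (massConst d * ENNReal.ofReal (3 * R)).toReal + 1 with hε
  have hε0 : 0 < ε := by positivity
  have hεR : massConst d * ENNReal.ofReal (3 * R) ≤ ENNReal.ofReal ε := by
    have hf : massConst d * ENNReal.ofReal (3 * R) ≠ ⊤ :=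
      ENNReal.mul_ne_top massConst_ne_top ENNReal.ofReal_ne_top
    rw [← ENNReal.ofReal_toReal hf]
    exact ENNReal.ofReal_le_ofReal (by linarith)
  choose K hK hcomp using fun k => exists_comp_bound (d := d) (contDiff_slope hg k) (slope_zero g k) ε hN
  -- The value of the divided difference at the origin, treated apart because a nonzero constant has
  -- no integrable transform.
  set b : Fin n → CVal n := fun k => complexify (fderiv ℝ g 0 (EuclideanSpace.single k 1)) with hb
  set B : Fin n → ℝ≥0∞ := fun k => massConst d * (ENNReal.ofReal (K k * (‖fderiv ℝ (slope g k) 0‖ + ε)) *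
    geomConst (d / 2 : ℝ) (d + 2) * ENNReal.ofReal (3 * R)) + ‖b k‖ₑ with hB
  have hBtop : ∀ k, B k ≠ ⊤ := fun k => ENNReal.add_ne_top.2 ⟨ENNReal.mul_ne_top massConst_ne_top
    (ENNReal.mul_ne_top (ENNReal.mul_ne_top ENNReal.ofReal_ne_top (geomConst_ne_top hd hN))
      ENNReal.ofReal_ne_top), enorm_ne_top⟩
  refine ⟨∑ k, B k, ENNReal.sum_ne_top.2 fun k _ => hBtop k,
    fun V₁ V₂ W₁ W₂ v₁ v₂ hm₁ hm₂ hW₁ hW₂ hR₁ hR₂ hv₁ hv₂ hw₁ hw₂ => ?_⟩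
  have hV₁ : Integrable V₁ := integrable_of_specNorm hm₁ (ne_top_of_le_ne_top ENNReal.ofReal_ne_top hR₁)
  have hV₂ : Integrable V₂ := integrable_of_specNorm hm₂ (ne_top_of_le_ne_top ENNReal.ofReal_ne_top hR₂)
  set Z : Dom d → WithLp 2 (CVal n × CVal n) := pairUp V₁ V₂ with hZ
  have hZm : AEStronglyMeasurable Z volume := aestronglyMeasurable_pairUp hm₁ hm₂
  have hZs : specNorm (d / 2 : ℝ) Z ≤ ENNReal.ofReal (3 * R) :=
    specNorm_pairUp_le hm₁ hm₂ hR.le hR₁ hR₂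
  have hZi : Integrable Z := integrable_of_specNorm hZm (ne_top_of_le_ne_top ENNReal.ofReal_ne_top hZs)
  have hZε : ∫ ξ, ‖Z ξ‖ ≤ ε := by
    rw [integral_norm_eq_toReal hZi]
    exact ENNReal.toReal_le_of_le_ofReal hε0.le
      ((lintegral_le_specNorm hZm).trans ((mul_le_mul_right hZs _).trans hεR))
  choose Q hQ hQx hQs using fun k => hcomp k ε hε0 le_rfl Z hZi hZε
    (ne_top_of_le_ne_top ENNReal.ofReal_ne_top hZs)
  have hV₁₂ : Integrable (V₁ - V₂) := hV₁.sub hV₂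
  set δ : Fin n → Dom d → ℂ := fun k ξ => (EuclideanSpace.proj k : CVal n →L[ℂ] ℂ) ((V₁ - V₂) ξ) with hδ
  have hδi : ∀ k, Integrable (δ k) := fun k => (EuclideanSpace.proj k : CVal n →L[ℂ] ℂ).integrable_comp hV₁₂
  have hδle : ∀ k, ∫⁻ ξ, ‖δ k ξ‖ₑ ≤ ∫⁻ ξ, ‖V₁ ξ - V₂ ξ‖ₑ := fun k => lintegral_mono fun ξ => by
    rw [← ofReal_norm, ← ofReal_norm]
    exact ENNReal.ofReal_le_ofReal (PiLp.norm_apply_le (V₁ ξ - V₂ ξ) k)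
  have hδx : ∀ k x, 𝓕⁻ (δ k) x = ((v₁ x - v₂ x) k : ℝ) := fun k x => by
    rw [hδ, fourierInv_clm _ hV₁₂, fourierInv_sub hV₁ hV₂, hv₁, hv₂, ← complexify_sub]
    rfl
  have hZx : ∀ x, 𝓕⁻ Z x = WithLp.toLp 2 (complexify (v₂ x), complexify (v₁ x - v₂ x)) := fun x => by
    rw [hZ, fourierInv_pairUp hV₁ hV₂ hZi, hv₁, hv₂, complexify_sub]
  choose P hP hPx hPle using fun k => exists_fourierInv_smul (hδi k) (hQ k)
  have hT : ∀ k, Integrable fun ξ => P k ξ + δ k ξ • b k := fun k =>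
    (hP k).add ((hδi k).smul_const (b k))
  have hTx : ∀ k x, 𝓕⁻ (fun ξ => P k ξ + δ k ξ • b k) x = ((v₁ x - v₂ x) k : ℂ) •
      complexify (divDiff g (v₂ x, v₁ x - v₂ x) (EuclideanSpace.single k 1)) := fun k x => by
    have e1 := fourierInv_add (hP k) ((hδi k).smul_const (b k)) x
    have e2 := fourierInv_clm ((ContinuousLinearMap.id ℂ ℂ).smulRight (b k)) (hδi k) x
    simp only [ContinuousLinearMap.smulRight_apply, ContinuousLinearMap.id_apply] at e2
    have e3 : 𝓕⁻ (fun ξ => P k ξ + δ k ξ • b k) x = 𝓕⁻ (P k) x + 𝓕⁻ (δ k) x • b k := by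
      rw [← e2]
      exact e1
    rw [e3, hPx, hQx, hδx, hZx, ← smul_add]
    congr 1
    exact slope_toLp_complexify g k _ _
  -- Both sides have inverse transform g(v₁) - g(v₂) = ∑ (v₁ - v₂)_k ∫₀¹ ∂_k g(v₂ + τ(v₁ - v₂)) dτ,
  -- and integrable transforms are determined by their inverses.
  have hae : W₁ - W₂ =ᵐ[volume] fun ξ => ∑ k, (P k ξ + δ k ξ • b k) := by
    refine fourierInv_injective (hW₁.sub hW₂) (integrable_finsetSum _ fun k _ => hT k) fun x => ?_
    rw [fourierInv_sub hW₁ hW₂, fourierInv_sum _ fun k _ => hT k, hw₁, hw₂, ← complexify_sub]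
    simp only [hTx]
    rw [sum_smul_complexify_single, divDiff_apply hg, add_sub_cancel]
  calc ∫⁻ ξ, ‖W₁ ξ - W₂ ξ‖ₑ = ∫⁻ ξ, ‖∑ k, (P k ξ + δ k ξ • b k)‖ₑ :=
        lintegral_congr_ae (hae.mono fun ξ hξ => by simp only [← hξ, Pi.sub_apply])
    _ ≤ ∫⁻ ξ, ∑ k, ‖P k ξ + δ k ξ • b k‖ₑ := lintegral_mono fun ξ => enorm_sum_le _ _
    _ = ∑ k, ∫⁻ ξ, ‖P k ξ + δ k ξ • b k‖ₑ := lintegral_finsetSum' _ fun k _ => (hT k).1.enorm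
    _ ≤ ∑ k, B k * ∫⁻ ξ, ‖V₁ ξ - V₂ ξ‖ₑ := by
        refine Finset.sum_le_sum fun k _ => ?_
        calc ∫⁻ ξ, ‖P k ξ + δ k ξ • b k‖ₑ ≤ ∫⁻ ξ, (‖P k ξ‖ₑ + ‖δ k ξ‖ₑ * ‖b k‖ₑ) :=
              lintegral_mono fun ξ => (enorm_add_le _ _).trans (by rw [enorm_smul])
          _ = (∫⁻ ξ, ‖P k ξ‖ₑ) + (∫⁻ ξ, ‖δ k ξ‖ₑ) * ‖b k‖ₑ := by
              rw [lintegral_add_left' (hP k).1.enorm, lintegral_mul_const' _ _ enorm_ne_top]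
          _ ≤ (∫⁻ ξ, ‖δ k ξ‖ₑ) * (∫⁻ ξ, ‖Q k ξ‖ₑ) + (∫⁻ ξ, ‖δ k ξ‖ₑ) * ‖b k‖ₑ := by
              gcongr
              exact hPle k
          _ = ((∫⁻ ξ, ‖Q k ξ‖ₑ) + ‖b k‖ₑ) * ∫⁻ ξ, ‖δ k ξ‖ₑ := by ring
          _ ≤ B k * ∫⁻ ξ, ‖V₁ ξ - V₂ ξ‖ₑ := by
              refine mul_le_mul' (add_le_add ?_ le_rfl) (hδle k)
              refine (lintegral_le_specNorm (hQ k).1).trans (mul_le_mul_right ?_ _)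
              exact (hQs k _).trans (mul_le_mul_right hZs _)
    _ = _ := (Finset.sum_mul _ _ _).symm

end RealComposition

end

section

open FourierTransform

/-! ### A canonical representative of the Fourier transform -/

section Representative

variable {d n : ℕ}

/-- Bump functions concentrating at the origin. -/
def bump (d k : ℕ) : ContDiffBump (0 : Dom d) where
  rIn := 1 / (k + 1)
  rOut := 2 / (k + 1)
  rIn_pos := by positivity
  rIn_lt_rOut := by
    gcongr
    norm_num

/-- The normalized bump functions, as Schwartz functions. -/
def mollifier (d k : ℕ) : 𝓢(Dom d, ℂ) :=
  HasCompactSupport.toSchwartzMap (f := fun ξ => (((bump d k).normed volume ξ : ℝ) : ℂ))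
    ((bump d k).hasCompactSupport_normed.comp_left Complex.ofReal_zero)
    (Complex.ofRealCLM.contDiff.comp (bump d k).contDiff_normed)

lemma mollifier_apply (k : ℕ) (ξ : Dom d) :
    mollifier d k ξ = (((bump d k).normed volume ξ : ℝ) : ℂ) := rfl

variable {E : Type*} [NormedAddCommGroup E] [NormedSpace ℂ E]

/-- The Fourier transform of the mollified function. -/
def approxSpec (k : ℕ) (h : Dom d → E) (ξ : Dom d) : E :=
  ∫ x, Real.fourierChar (-inner ℝ x ξ) • ((𝓕 (mollifier d k) : 𝓢(Dom d, ℂ)) x • h x)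

/-- The Fourier transform of `h`, as a function defined everywhere. -/
def specOf [Nonempty E] (h : Dom d → E) (ξ : Dom d) : E := limUnder atTop fun k => approxSpec k h ξ

variable [CompleteSpace E]

/-- Multiplication by the transform of a bump in physical space is convolution with the bump in
frequency. -/
lemma approxSpec_fourierInv (k : ℕ) {H : Dom d → E} (hH : Integrable H) (ξ : Dom d) :
    approxSpec k (𝓕⁻ H) ξ =
      convolution ((bump d k).normed volume) H (ContinuousLinearMap.lsmul ℝ ℝ) volume ξ := by
  set ψ : Dom d → ℂ := fun x =>
    Real.fourierChar (-inner ℝ x ξ) • (𝓕 (mollifier d k) : 𝓢(Dom d, ℂ)) x with hψ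
  have hψi : Integrable ψ :=
    (Real.fourierIntegral_convergent_iff ξ).2 (𝓕 (mollifier d k) : 𝓢(Dom d, ℂ)).integrable
  have e1 : approxSpec k (𝓕⁻ H) ξ = ∫ x, ψ x • 𝓕⁻ H x := by
    refine integral_congr_ae (Eventually.of_forall fun x => ?_)
    simp only [hψ, Circle.smul_def, smul_assoc]
  have e2 : ∀ η, 𝓕⁻ ψ η = mollifier d k (η - ξ) := fun η => by
    have h1 : (𝓕⁻ (𝓕 (mollifier d k)) : 𝓢(Dom d, ℂ)) (η - ξ) = mollifier d k (η - ξ) := by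
      rw [FourierTransform.fourierInv_fourier_eq]
    rw [← h1, SchwartzMap.fourierInv_coe, Real.fourierInv_eq, Real.fourierInv_eq]
    refine integral_congr_ae (Eventually.of_forall fun x => ?_)
    simp only [hψ, smul_smul, ← AddChar.map_add_eq_mul, inner_sub_right]
    congr 2
  rw [e1, ← integral_fourierInv_smul hψi hH, convolution_eq_swap]
  refine integral_congr_ae (Eventually.of_forall fun η => ?_)
  simp only [e2, mollifier_apply, ContinuousLinearMap.lsmul_apply, Complex.coe_smul]
  rw [← neg_sub ξ η, ContDiffBump.normed_neg]

/-- Lebesgue's differentiation theorem. The bumps have outer radius twice the inner one; this fixed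
ratio is the constant 2. -/
lemma tendsto_approxSpec {H : Dom d → E} (hH : Integrable H) :
    ∀ᵐ ξ, Tendsto (fun k => approxSpec k (𝓕⁻ H) ξ) atTop (𝓝 (H ξ)) := by
  simp only [approxSpec_fourierInv _ hH]
  refine ContDiffBump.ae_convolution_tendsto_right_of_locallyIntegrable (K := 2) ?_ ?_
    hH.locallyIntegrable
  · have h := (tendsto_const_div_atTop_nhds_zero_nat (2 : ℝ)).comp (tendsto_add_atTop_nat 1)
    refine h.congr fun k => ?_
    simp [bump]
  · refine Eventually.of_forall fun k => le_of_eq ?_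
    simp only [bump]
    ring

lemma specOf_fourierInv {H : Dom d → E} (hH : Integrable H) : specOf (𝓕⁻ H) =ᵐ[volume] H := by
  filter_upwards [tendsto_approxSpec hH] with ξ hξ using hξ.limUnder_eq

/-- The purpose of `specOf`: choosing a representative of the transform separately at each time
would give no joint measurability, whereas a limit of explicit integrals does. -/
lemma stronglyMeasurable_specOf {α : Type*} [MeasurableSpace α] {h : α → Dom d → E}
    (hh : StronglyMeasurable (Function.uncurry h)) :
    StronglyMeasurable fun p : α × Dom d => specOf (h p.1) p.2 := by
  refine StronglyMeasurable.limUnder fun k => ?_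
  refine StronglyMeasurable.integral_prod_right' (f := fun q : (α × Dom d) × Dom d =>
    Real.fourierChar (-inner ℝ q.2 q.1.2) •
      ((𝓕 (mollifier d k) : 𝓢(Dom d, ℂ)) q.2 • h q.1.1 q.2)) ?_
  have h1 : StronglyMeasurable fun q : (α × Dom d) × Dom d =>
      ((Real.fourierChar (-inner ℝ q.2 q.1.2) : Circle) : ℂ) := by
    have hc : Continuous fun r : Dom d × Dom d =>
        ((Real.fourierChar (-inner ℝ r.2 r.1) : Circle) : ℂ) := by fun_prop
    exact hc.stronglyMeasurable.comp_measurable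
      (g := fun q : (α × Dom d) × Dom d => (q.1.2, q.2))
      ((measurable_snd.comp measurable_fst).prodMk measurable_snd)
  have h2 : StronglyMeasurable fun q : (α × Dom d) × Dom d =>
      (𝓕 (mollifier d k) : 𝓢(Dom d, ℂ)) q.2 :=
    (𝓕 (mollifier d k) : 𝓢(Dom d, ℂ)).continuous.stronglyMeasurable.comp_measurable measurable_snd
  have h3 : StronglyMeasurable fun q : (α × Dom d) × Dom d => h q.1.1 q.2 :=
    hh.comp_measurable (g := fun q : (α × Dom d) × Dom d => (q.1.1, q.2))
      ((measurable_fst.comp measurable_fst).prodMk measurable_snd)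
  exact h1.smul (h2.smul h3)

lemma stronglyMeasurable_fourierInv {α : Type*} [MeasurableSpace α] {V : α → Dom d → E}
    (hV : StronglyMeasurable (Function.uncurry V)) :
    StronglyMeasurable fun p : α × Dom d => 𝓕⁻ (V p.1) p.2 := by
  simp only [Real.fourierInv_eq]
  refine StronglyMeasurable.integral_prod_right' (f := fun q : (α × Dom d) × Dom d =>
    Real.fourierChar (inner ℝ q.2 q.1.2) • V q.1.1 q.2) ?_
  have h1 : StronglyMeasurable fun q : (α × Dom d) × Dom d =>
      ((Real.fourierChar (inner ℝ q.2 q.1.2) : Circle) : ℂ) := by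
    have hc : Continuous fun r : Dom d × Dom d =>
        ((Real.fourierChar (inner ℝ r.2 r.1) : Circle) : ℂ) := by fun_prop
    exact hc.stronglyMeasurable.comp_measurable
      (g := fun q : (α × Dom d) × Dom d => (q.1.2, q.2))
      ((measurable_snd.comp measurable_fst).prodMk measurable_snd)
  exact h1.smul (hV.comp_measurable (g := fun q : (α × Dom d) × Dom d => (q.1.1, q.2))
    ((measurable_fst.comp measurable_fst).prodMk measurable_snd))

end Representative

/-! ### Hermitian symmetry -/

section Hermitian

variable {d n : ℕ} [NeZero d]

/-- Complex conjugation of vectors. -/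
def conjVec : CVal n →L[ℝ] CVal n :=
  LinearMap.toContinuousLinearMap
    { toFun := fun z => WithLp.toLp 2 fun k => star (z k)
      map_add' := fun y z => by
        ext k
        simp
      map_smul' := fun c y => by
        ext k
        simp }

@[simp] lemma conjVec_apply (z : CVal n) (k : Fin n) : conjVec z k = star (z k) := rfl

@[simp] lemma conjVec_conjVec (z : CVal n) : conjVec (conjVec z) = z := by
  ext k
  simp

lemma conjVec_smul (c : ℂ) (z : CVal n) : conjVec (c • z) = star c • conjVec z := by
  ext k
  simp

lemma conjVec_complexify (y : Val n) : conjVec (complexify y) = complexify y := by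
  ext k
  simp [complexify]

lemma eq_complexify_iff (z : CVal n) : z = complexify (realPart z) ↔ conjVec z = z := by
  constructor
  · intro h
    rw [h, conjVec_complexify]
  · intro h
    ext k
    have := congrArg (fun w : CVal n => w k) h
    simp only [conjVec_apply] at this
    rw [← Complex.conj_eq_iff_re.1 this]
    rfl

/-- Hermitian symmetry, that is, the symmetry of the Fourier transform of real functions. -/
def IsHerm (Z : Dom d → CVal n) : Prop := ∀ ξ, Z (-ξ) = conjVec (Z ξ)

/-- The Hermitian part of a function. -/
def hermPart (Z : Dom d → CVal n) (ξ : Dom d) : CVal n :=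
  (2⁻¹ : ℂ) • (Z ξ + conjVec (Z (-ξ)))

lemma isHerm_hermPart (Z : Dom d → CVal n) : IsHerm (hermPart Z) := fun ξ => by
  simp [hermPart, conjVec_smul, add_comm]

lemma fourierInv_conj {Z : Dom d → CVal n} (hZ : Integrable Z) (x : Dom d) :
    𝓕⁻ (fun ξ => conjVec (Z (-ξ))) x = conjVec (𝓕⁻ Z x) := by
  rw [Real.fourierInv_eq, Real.fourierInv_eq,
    ← conjVec.integral_comp_comm (integrable_fourierInv_integrand hZ x),
    ← integral_neg_eq_self]
  refine integral_congr_ae (Eventually.of_forall fun ξ => ?_)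
  simp only [neg_neg, Circle.smul_def, conjVec_smul, inner_neg_left]
  congr 1
  rw [AddChar.map_neg_eq_inv, Circle.coe_inv_eq_conj]
  rfl

lemma integrable_conj {Z : Dom d → CVal n} (hZ : Integrable Z) :
    Integrable fun ξ => conjVec (Z (-ξ)) :=
  conjVec.integrable_comp hZ.comp_neg

lemma fourierInv_hermPart {Z : Dom d → CVal n} (hZ : Integrable Z) (x : Dom d) :
    𝓕⁻ (hermPart Z) x = complexify (realPart (𝓕⁻ Z x)) := by
  have h1 := fourierInv_clm ((2⁻¹ : ℂ) • ContinuousLinearMap.id ℂ (CVal n))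
    (hZ.add (integrable_conj hZ)) x
  have h2 := fourierInv_add hZ (integrable_conj hZ) x
  have h3 : 𝓕⁻ (hermPart Z) x = (2⁻¹ : ℂ) • (𝓕⁻ Z x + conjVec (𝓕⁻ Z x)) := by
    rw [← fourierInv_conj hZ, ← h2]
    exact h1
  rw [h3]
  ext k
  simp [complexify, Complex.ext_iff]
  ring

lemma integrable_hermPart {Z : Dom d → CVal n} (hZ : Integrable Z) : Integrable (hermPart Z) :=
  (hZ.add (integrable_conj hZ)).smul (2⁻¹ : ℂ)

lemma hermPart_ae_eq {Z : Dom d → CVal n} (hZ : Integrable Z)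
    (h : ∀ x, 𝓕⁻ Z x = complexify (realPart (𝓕⁻ Z x))) : hermPart Z =ᵐ[volume] Z :=
  fourierInv_injective (integrable_hermPart hZ) hZ fun x => by rw [fourierInv_hermPart hZ, ← h]

lemma hermPart_congr {Z Z' : Dom d → CVal n} (h : Z =ᵐ[volume] Z') :
    hermPart Z =ᵐ[volume] hermPart Z' := by
  have h' : ∀ᵐ ξ, Z (-ξ) = Z' (-ξ) :=
    (Measure.measurePreserving_neg (volume : Measure (Dom d))).quasiMeasurePreserving.ae h
  filter_upwards [h, h'] with ξ h1 h2
  rw [hermPart, hermPart, h1, h2]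

lemma IsHerm.fourierInv_eq {Z : Dom d → CVal n} (hZ : Integrable Z) (h : IsHerm Z) (x : Dom d) :
    𝓕⁻ Z x = complexify (realPart (𝓕⁻ Z x)) := by
  rw [eq_complexify_iff, ← fourierInv_conj hZ]
  have : (fun ξ => conjVec (Z (-ξ))) = Z := funext fun ξ => by rw [h ξ, conjVec_conjVec]
  rw [this]

lemma stronglyMeasurable_hermPart {α : Type*} [MeasurableSpace α] {Z : α → Dom d → CVal n}
    (hZ : StronglyMeasurable (Function.uncurry Z)) :
    StronglyMeasurable fun p : α × Dom d => hermPart (Z p.1) p.2 := by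
  have h1 : StronglyMeasurable fun p : α × Dom d => Z p.1 (-p.2) :=
    hZ.comp_measurable (measurable_fst.prodMk measurable_snd.neg)
  exact (hZ.add (conjVec.continuous.comp_stronglyMeasurable h1)).const_smul (2⁻¹ : ℂ)

end Hermitian

/-! ### The nonlinear map on the Fourier side -/

section Nonlin

variable {d n : ℕ} [NeZero d]

/-- The Fourier transform of `g(v)`, where `V` is the Fourier transform of `v`. -/
def nonlin (g : Val n → Val n) (V : Dom d → CVal n) : Dom d → CVal n :=
  hermPart (specOf fun x => complexify (g (realPart (𝓕⁻ V x))))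

lemma isHerm_nonlin (g : Val n → Val n) (V : Dom d → CVal n) : IsHerm (nonlin g V) :=
  isHerm_hermPart _

/-- `nonlin` makes sense for every V; this identifies it as soon as some integrable W has the right
inverse transform. Taking the Hermitian part changes nothing because g takes real values. -/
lemma nonlin_ae_eq {g : Val n → Val n} {V W : Dom d → CVal n} (hW : Integrable W)
    (h : ∀ x, 𝓕⁻ W x = complexify (g (realPart (𝓕⁻ V x)))) : nonlin g V =ᵐ[volume] W := by
  have h1 : (fun x => complexify (g (realPart (𝓕⁻ V x)))) = 𝓕⁻ W := (funext h).symm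
  rw [nonlin, h1]
  refine (hermPart_congr (specOf_fourierInv hW)).trans (hermPart_ae_eq hW fun x => ?_)
  rw [h, realPart_complexify]

/-- Equality holds at every frequency, because `nonlin` sees V only through its inverse transform.
This later gives a fixed point without exceptional sets. -/
lemma nonlin_congr {g : Val n → Val n} {V W : Dom d → CVal n} (h : V =ᵐ[volume] W) :
    nonlin g V = nonlin g W := by
  have : 𝓕⁻ V = 𝓕⁻ W := by
    ext1 x
    simp only [Real.fourierInv_eq]
    exact integral_congr_ae (h.mono fun ξ hξ => by simp only [hξ])
  rw [nonlin, nonlin, this]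

lemma stronglyMeasurable_nonlin {g : Val n → Val n} (hg : Continuous g) {α : Type*}
    [MeasurableSpace α] {V : α → Dom d → CVal n} (hV : StronglyMeasurable (Function.uncurry V)) :
    StronglyMeasurable fun p : α × Dom d => nonlin g (V p.1) p.2 := by
  have hc : Continuous fun z : CVal n => complexify (g (realPart z)) :=
    continuous_complexify.comp (hg.comp realPart.continuous)
  set h : α → Dom d → CVal n := fun t x => 𝓕⁻ (V t) x with hh
  have h0 : StronglyMeasurable (Function.uncurry h) := stronglyMeasurable_fourierInv hV
  have h1 : StronglyMeasurable (Function.uncurry fun t x => complexify (g (realPart (h t x)))) :=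
    hc.comp_stronglyMeasurable h0
  have h2 := stronglyMeasurable_specOf h1
  set Z : α → Dom d → CVal n := fun t => specOf fun x => complexify (g (realPart (h t x))) with hZ
  have h3 : StronglyMeasurable (Function.uncurry Z) := h2
  have h4 := stronglyMeasurable_hermPart h3
  exact h4

/-- The quadratic and Lipschitz estimates for `nonlin g`. -/
theorem exists_nonlin_bound {g : Val n → Val n} (hg : ContDiff ℝ (⊤ : ℕ∞) g) (hg0 : g 0 = 0)
    (hg1 : fderiv ℝ g 0 = 0) {R : ℝ} (hR : 0 < R) :
    ∃ K : ℝ≥0∞, K ≠ ⊤ ∧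
      (∀ V : Dom d → CVal n, AEStronglyMeasurable V → specNorm (d / 2 : ℝ) V ≤ ENNReal.ofReal R →
        Integrable (nonlin g V) ∧
        (∀ x, 𝓕⁻ (nonlin g V) x = complexify (g (realPart (𝓕⁻ V x)))) ∧
        specNorm (d / 2 : ℝ) (nonlin g V) ≤ K * specNorm (d / 2 : ℝ) V * specNorm (d / 2 : ℝ) V ∧
        specNorm (d / 2 + 1 : ℝ) (nonlin g V) ≤
          K * specNorm (d / 2 : ℝ) V * specNorm (d / 2 + 1 : ℝ) V) ∧
      ∀ V W : Dom d → CVal n, AEStronglyMeasurable V → AEStronglyMeasurable W →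
        specNorm (d / 2 : ℝ) V ≤ ENNReal.ofReal R → specNorm (d / 2 : ℝ) W ≤ ENNReal.ofReal R →
        (∀ x, 𝓕⁻ V x = complexify (realPart (𝓕⁻ V x))) →
        (∀ x, 𝓕⁻ W x = complexify (realPart (𝓕⁻ W x))) →
        ∫⁻ ξ, ‖nonlin g V ξ - nonlin g W ξ‖ₑ ≤ K * ∫⁻ ξ, ‖V ξ - W ξ‖ₑ := by
  -- A bound for the mass of every V in the ball of radius R of Ḃ^{d/2}_{2,1}; the added 1 makes it
  -- positive.
  set R' : ℝ := (massConst d * ENNReal.ofReal R).toReal + 1 with hR'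
  have hf : massConst d * ENNReal.ofReal R ≠ ⊤ :=
    ENNReal.mul_ne_top massConst_ne_top ENNReal.ofReal_ne_top
  obtain ⟨K, hK, hKb⟩ := exists_comp_real_bound (d := d) hg hg0 hg1 (R := R') (by positivity)
  obtain ⟨L, hL, hLb⟩ := exists_comp_lipschitz (d := d) hg hR
  have key : ∀ V : Dom d → CVal n, AEStronglyMeasurable V →
      specNorm (d / 2 : ℝ) V ≤ ENNReal.ofReal R →
      Integrable (nonlin g V) ∧
        (∀ x, 𝓕⁻ (nonlin g V) x = complexify (g (realPart (𝓕⁻ V x)))) ∧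
        specNorm (d / 2 : ℝ) (nonlin g V) ≤ K * (∫⁻ ξ, ‖V ξ‖ₑ) * specNorm (d / 2 : ℝ) V ∧
        specNorm (d / 2 + 1 : ℝ) (nonlin g V) ≤
          K * (∫⁻ ξ, ‖V ξ‖ₑ) * specNorm (d / 2 + 1 : ℝ) V := by
    intro V hV hVR
    have h1 : ∫⁻ ξ, ‖V ξ‖ₑ ≤ ENNReal.ofReal R' := by
      refine (lintegral_le_specNorm hV).trans ((mul_le_mul_right hVR _).trans ?_)
      rw [← ENNReal.ofReal_toReal hf]
      exact ENNReal.ofReal_le_ofReal (by linarith)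
    obtain ⟨W, hW, hWx, hW1, hW2⟩ := hKb V hV h1 (ne_top_of_le_ne_top ENNReal.ofReal_ne_top hVR)
    have hae := nonlin_ae_eq hW hWx
    refine ⟨hW.congr hae.symm, fun x => ?_, ?_, ?_⟩
    · rw [← hWx]
      simp only [Real.fourierInv_eq]
      exact integral_congr_ae (hae.mono fun ξ hξ => by simp only [hξ])
    · rwa [specNorm_congr hae]
    · rwa [specNorm_congr hae]
  refine ⟨K * massConst d + L, ENNReal.add_ne_top.2 ⟨ENNReal.mul_ne_top hK massConst_ne_top, hL⟩,
    fun V hV hVR => ?_, fun V W hV hW hVR hWR hVx hWx => ?_⟩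
  · obtain ⟨h1, h2, h3, h4⟩ := key V hV hVR
    have hb : ∀ s : ℝ, K * (∫⁻ ξ, ‖V ξ‖ₑ) * specNorm s V ≤
        (K * massConst d + L) * specNorm (d / 2 : ℝ) V * specNorm s V := fun s => by
      refine mul_le_mul_left ?_ _
      refine (mul_le_mul_right (lintegral_le_specNorm hV) _).trans ?_
      rw [← mul_assoc]
      exact mul_le_mul_left le_self_add _
    exact ⟨h1, h2, h3.trans (hb _), h4.trans (hb _)⟩
  · obtain ⟨h1, h2, -⟩ := key V hV hVR
    obtain ⟨h1', h2', -⟩ := key W hW hWR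
    refine (hLb V W _ _ _ _ hV hW h1 h1' hVR hWR hVx hWx h2 h2').trans ?_
    exact mul_le_mul_left le_add_self _

end Nonlin

end

section

open FourierTransform

/-! ### The heat semigroup and Duhamel's formula -/

section Duhamel

variable {d n : ℕ}

/-- The symbol of `-∑ a_i ∂_i^2`. -/
def heat (a : Fin d → ℝ) (ξ : Dom d) : ℝ := 4 * Real.pi ^ 2 * ∑ i, a i * ξ i ^ 2

lemma continuous_heat (a : Fin d → ℝ) : Continuous (heat a) := by
  unfold heat
  fun_prop

lemma exists_heat_bounds {a : Fin d → ℝ} (ha : ∀ i, 0 < a i) :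
    ∃ c C : ℝ, 0 < c ∧ 0 < C ∧ ∀ ξ : Dom d, c * ‖ξ‖ ^ 2 ≤ heat a ξ ∧ heat a ξ ≤ C * ‖ξ‖ ^ 2 := by
  have hm : ∃ m : ℝ, 0 < m ∧ ∀ i, m ≤ a i := by
    rcases Nat.eq_zero_or_pos d with rfl | hd
    · exact ⟨1, one_pos, fun i => i.elim0⟩
    · have : Nonempty (Fin d) := ⟨⟨0, hd⟩⟩
      obtain ⟨m, -, h⟩ := Finset.exists_min_image Finset.univ a Finset.univ_nonempty
      exact ⟨a m, ha m, fun i => h i (Finset.mem_univ i)⟩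
  obtain ⟨m, hm0, hm⟩ := hm
  have hM : ∀ i, a i ≤ ∑ k, a k + 1 := fun i =>
    (Finset.single_le_sum (f := a) (fun k _ => (ha k).le) (Finset.mem_univ i)).trans (by linarith)
  have hM0 : 0 < ∑ k, a k + 1 := by
    have : 0 ≤ ∑ k, a k := Finset.sum_nonneg fun k _ => (ha k).le
    linarith
  refine ⟨4 * Real.pi ^ 2 * m, 4 * Real.pi ^ 2 * (∑ k, a k + 1), by positivity, by positivity,
    fun ξ => ?_⟩
  rw [heat, EuclideanSpace.norm_sq_eq]
  simp only [Real.norm_eq_abs, sq_abs, mul_assoc, Finset.mul_sum]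
  constructor <;> gcongr with i
  · exact hm i
  · exact hM i

lemma heat_nonneg {a : Fin d → ℝ} (ha : ∀ i, 0 < a i) (ξ : Dom d) : 0 ≤ heat a ξ := by
  unfold heat
  have := fun i => (ha i).le
  refine mul_nonneg (by positivity) (Finset.sum_nonneg fun i _ => mul_nonneg (this i) (sq_nonneg _))

/-- Duhamel's formula for the heat equation with initial datum `V₀` and forcing `-F`, on the Fourier
side. -/
def duhamel (a : Fin d → ℝ) (V₀ : Dom d → CVal n) (F : ℝ → Dom d → CVal n) (t : ℝ) (ξ : Dom d) :
    CVal n :=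
  Real.exp (-(heat a ξ * t)) • V₀ ξ - ∫ s in Ioc 0 t, Real.exp (-(heat a ξ * (t - s))) • F s ξ

lemma stronglyMeasurable_duhamelIntegral (a : Fin d → ℝ) {F : ℝ → Dom d → CVal n}
    (hF : StronglyMeasurable (Function.uncurry F)) :
    StronglyMeasurable fun p : ℝ × Dom d =>
      ∫ s in Ioc 0 p.1, Real.exp (-(heat a p.2 * (p.1 - s))) • F s p.2 := by
  have h : (fun p : ℝ × Dom d =>
      ∫ s in Ioc 0 p.1, Real.exp (-(heat a p.2 * (p.1 - s))) • F s p.2) =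
      fun p => ∫ s, {q : (ℝ × Dom d) × ℝ | 0 < q.2 ∧ q.2 ≤ q.1.1}.indicator
        (fun q => Real.exp (-(heat a q.1.2 * (q.1.1 - q.2))) • F q.2 q.1.2) (p, s) := by
    ext1 p
    rw [← integral_indicator measurableSet_Ioc]
    rfl
  rw [h]
  refine StronglyMeasurable.integral_prod_right' (StronglyMeasurable.indicator ?_ ?_)
  · have h1 : Continuous fun q : (ℝ × Dom d) × ℝ => Real.exp (-(heat a q.1.2 * (q.1.1 - q.2))) := by
      have := continuous_heat a
      fun_prop
    have h2 : StronglyMeasurable fun q : (ℝ × Dom d) × ℝ => F q.2 q.1.2 :=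
      hF.comp_measurable (g := fun q : (ℝ × Dom d) × ℝ => (q.2, q.1.2))
        (measurable_snd.prodMk (measurable_snd.comp measurable_fst))
    exact h1.stronglyMeasurable.smul h2
  · exact (measurableSet_lt measurable_const measurable_snd).inter
      (measurableSet_le measurable_snd (measurable_fst.comp measurable_fst))

lemma stronglyMeasurable_duhamel (a : Fin d → ℝ) {V₀ : Dom d → CVal n} {F : ℝ → Dom d → CVal n}
    (hV₀ : StronglyMeasurable V₀) (hF : StronglyMeasurable (Function.uncurry F)) :
    StronglyMeasurable (Function.uncurry (duhamel a V₀ F)) := by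
  have h1 : Continuous fun p : ℝ × Dom d => Real.exp (-(heat a p.2 * p.1)) := by
    have := continuous_heat a
    fun_prop
  exact (h1.stronglyMeasurable.smul (hV₀.comp_measurable measurable_snd)).sub
    (stronglyMeasurable_duhamelIntegral a hF)

lemma stronglyMeasurable_slice {E : Type*} [NormedAddCommGroup E] {V : ℝ → Dom d → E}
    (hV : StronglyMeasurable (Function.uncurry V)) (t : ℝ) : StronglyMeasurable (V t) :=
  hV.comp_measurable measurable_prodMk_left

/-- On the shell j the heat multiplier is at most e^{-c4^j t}, and Minkowski's inequality brings the
shell norm inside the time integral. -/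
lemma shellNorm_duhamel_le {a : Fin d → ℝ} {c : ℝ}
    (hc : ∀ ξ : Dom d, c * ‖ξ‖ ^ 2 ≤ heat a ξ) (hc0 : 0 < c) {V₀ : Dom d → CVal n}
    {F : ℝ → Dom d → CVal n} (hV₀ : StronglyMeasurable V₀)
    (hF : StronglyMeasurable (Function.uncurry F)) (j : ℤ) {t : ℝ} (ht : 0 ≤ t) :
    shellNorm j (duhamel a V₀ F t) ≤ ENNReal.ofReal (Real.exp (-(c * 4 ^ j * t))) * shellNorm j V₀ +
      ∫⁻ s in Ioc 0 t, ENNReal.ofReal (Real.exp (-(c * 4 ^ j * (t - s)))) * shellNorm j (F s) := by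
  have hexp : ∀ ξ ∈ shell d j, ∀ r : ℝ, 0 ≤ r →
      Real.exp (-(heat a ξ * r)) ≤ Real.exp (-(c * 4 ^ j * r)) := by
    intro ξ hξ r hr
    refine Real.exp_le_exp.2 (neg_le_neg (mul_le_mul_of_nonneg_right ((le_trans ?_ (hc ξ))) hr))
    gcongr
    have h4 : (4 : ℝ) ^ j = (2 ^ j) ^ 2 := by
      rw [← zpow_natCast, ← zpow_mul, mul_comm, zpow_mul]
      norm_num
    rw [h4]
    exact pow_le_pow_left₀ (by positivity) hξ.1 2
  have hm1 : AEStronglyMeasurable (fun ξ => Real.exp (-(heat a ξ * t)) • V₀ ξ) volume := by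
    have h1 : Continuous fun ξ : Dom d => Real.exp (-(heat a ξ * t)) := by
      have := continuous_heat a
      fun_prop
    exact (h1.stronglyMeasurable.smul hV₀).aestronglyMeasurable
  have hm2 : AEStronglyMeasurable (fun ξ =>
      ∫ s in Ioc 0 t, Real.exp (-(heat a ξ * (t - s))) • F s ξ) volume :=
    ((stronglyMeasurable_duhamelIntegral a hF).comp_measurable
      (measurable_prodMk_left (x := t))).aestronglyMeasurable
  refine (shellNorm_sub_le hm1 hm2 j).trans (add_le_add ?_ ?_)
  · refine shellNorm_le_of_le fun ξ hξ => ?_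
    rw [norm_smul, Real.norm_of_nonneg (Real.exp_pos _).le]
    exact mul_le_mul_of_nonneg_right (hexp ξ hξ t ht) (norm_nonneg _)
  · have hm3 : StronglyMeasurable (Function.uncurry fun (s : ℝ) (ξ : Dom d) =>
        Real.exp (-(c * 4 ^ j * (t - s))) • F s ξ) := by
      have h1 : Continuous fun p : ℝ × Dom d => Real.exp (-(c * 4 ^ j * (t - p.1))) := by fun_prop
      exact h1.stronglyMeasurable.smul hF
    refine (shellNorm_le_lintegral hm3 j (Ioc 0 t) fun ξ hξ => ?_).trans
      (lintegral_mono fun s => ?_)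
    · refine (enorm_integral_le_lintegral_enorm _).trans
        (setLIntegral_mono' measurableSet_Ioc fun s hs => ?_)
      rw [enorm_smul, enorm_smul]
      gcongr
      rw [Real.enorm_eq_ofReal (Real.exp_pos _).le, Real.enorm_eq_ofReal (Real.exp_pos _).le]
      exact ENNReal.ofReal_le_ofReal (hexp ξ hξ _ (by linarith [hs.2]))
    · refine shellNorm_le_of_le fun ξ _ => ?_
      rw [norm_smul, Real.norm_of_nonneg (Real.exp_pos _).le]

/-- The supremum over time of a shell norm. -/
def shellSup {E : Type*} [NormedAddCommGroup E] (j : ℤ) (V : ℝ → Dom d → E) : ℝ≥0∞ :=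
  ⨆ (t : ℝ) (_ : 0 ≤ t), shellNorm j (V t)

/-- The integral over time of a shell norm. -/
def shellInt {E : Type*} [NormedAddCommGroup E] (j : ℤ) (V : ℝ → Dom d → E) : ℝ≥0∞ :=
  ∫⁻ t in Ioi 0, shellNorm j (V t)

lemma shellNorm_le_shellSup {E : Type*} [NormedAddCommGroup E] (j : ℤ) (V : ℝ → Dom d → E) {t : ℝ}
    (ht : 0 ≤ t) : shellNorm j (V t) ≤ shellSup j V :=
  le_iSup₂ (f := fun (t : ℝ) (_ : 0 ≤ t) => shellNorm j (V t)) t ht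

lemma lintegral_exp_neg_mul {b : ℝ} (hb : 0 < b) :
    ∫⁻ t in Ioi (0 : ℝ), ENNReal.ofReal (Real.exp (-(b * t))) = ENNReal.ofReal b⁻¹ := by
  have h := integral_exp_mul_Ioi (a := -b) (by linarith) 0
  have hi := integrableOn_exp_mul_Ioi (a := -b) (by linarith) 0
  simp only [neg_mul] at h hi
  rw [← ofReal_integral_eq_lintegral_ofReal hi (Eventually.of_forall fun t => (Real.exp_pos _).le), h]
  simp

lemma shellSup_duhamel_le {a : Fin d → ℝ} {c : ℝ}
    (hc : ∀ ξ : Dom d, c * ‖ξ‖ ^ 2 ≤ heat a ξ) (hc0 : 0 < c) {V₀ : Dom d → CVal n}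
    {F : ℝ → Dom d → CVal n} (hV₀ : StronglyMeasurable V₀)
    (hF : StronglyMeasurable (Function.uncurry F)) (j : ℤ) :
    shellSup j (duhamel a V₀ F) ≤ shellNorm j V₀ + shellInt j F := by
  have h1 : ∀ r : ℝ, 0 ≤ r → ENNReal.ofReal (Real.exp (-(c * 4 ^ j * r))) ≤ 1 := fun r hr => by
    rw [ENNReal.ofReal_le_one, Real.exp_le_one_iff]
    have : 0 ≤ c * 4 ^ j * r := by positivity
    linarith
  refine iSup₂_le fun t ht => (shellNorm_duhamel_le hc hc0 hV₀ hF j ht).trans (add_le_add ?_ ?_)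
  · exact mul_le_of_le_one_left' (h1 t ht)
  · refine (setLIntegral_mono' measurableSet_Ioc fun s hs => ?_).trans
      (lintegral_mono_set Ioc_subset_Ioi_self)
    exact mul_le_of_le_one_left' (h1 _ (by linarith [hs.2]))

/-- Young's inequality for two integrable functions, the exponential having mass 1/b. -/
lemma lintegral_conv_exp_le {b : ℝ} (hb : 0 < b) {φ : ℝ → ℝ≥0∞} (hφ : Measurable φ) :
    ∫⁻ t in Ioi (0 : ℝ), ∫⁻ s in Ioc 0 t, ENNReal.ofReal (Real.exp (-(b * (t - s)))) * φ s ≤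
      ENNReal.ofReal b⁻¹ * ∫⁻ s in Ioi 0, φ s := by
  set k : ℝ → ℝ → ℝ≥0∞ := fun t s => {p : ℝ × ℝ | p.2 ≤ p.1}.indicator
    (fun p => ENNReal.ofReal (Real.exp (-(b * (p.1 - p.2)))) * φ p.2) (t, s) with hk
  have hkm : Measurable (Function.uncurry k) := by
    refine Measurable.indicator ?_ (measurableSet_le measurable_snd measurable_fst)
    exact (by fun_prop : Measurable fun p : ℝ × ℝ =>
      ENNReal.ofReal (Real.exp (-(b * (p.1 - p.2))))).mul (hφ.comp measurable_snd)
  calc ∫⁻ t in Ioi (0 : ℝ), ∫⁻ s in Ioc 0 t, ENNReal.ofReal (Real.exp (-(b * (t - s)))) * φ s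
      ≤ ∫⁻ t in Ioi (0 : ℝ), ∫⁻ s in Ioi 0, k t s := by
        refine lintegral_mono fun t => ?_
        refine (setLIntegral_mono' measurableSet_Ioc fun s hs => ?_).trans
          (lintegral_mono_set Ioc_subset_Ioi_self)
        simp only [hk]
        rw [indicator_of_mem (show (t, s) ∈ {p : ℝ × ℝ | p.2 ≤ p.1} from hs.2)]
    _ = ∫⁻ s in Ioi 0, ∫⁻ t in Ioi (0 : ℝ), k t s := lintegral_lintegral_swap hkm.aemeasurable
    _ ≤ ∫⁻ s in Ioi 0, ENNReal.ofReal b⁻¹ * φ s := by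
        refine setLIntegral_mono' measurableSet_Ioi fun s _ => ?_
        have h1 : ∀ t, k t s = (Ici (0 : ℝ)).indicator
            (fun r => ENNReal.ofReal (Real.exp (-(b * r))) * φ s) (t - s) := fun t => by
          simp only [hk, indicator, mem_ofPred_eq, mem_Ici, sub_nonneg]
        calc ∫⁻ t in Ioi (0 : ℝ), k t s ≤ ∫⁻ t, k t s := setLIntegral_le_lintegral _ _
          _ = ∫⁻ r, (Ici (0 : ℝ)).indicator
                (fun r => ENNReal.ofReal (Real.exp (-(b * r))) * φ s) r := by
              simp only [h1]
              exact lintegral_sub_right_eq_self (fun r => (Ici (0 : ℝ)).indicator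
                (fun r => ENNReal.ofReal (Real.exp (-(b * r))) * φ s) r) s
          _ = ENNReal.ofReal b⁻¹ * φ s := by
              rw [lintegral_indicator measurableSet_Ici, setLIntegral_congr Ioi_ae_eq_Ici.symm,
                lintegral_mul_const _ (by fun_prop), lintegral_exp_neg_mul hb]
          _ ≤ _ := le_rfl
    _ = _ := lintegral_const_mul _ hφ

/-- The gain of 4^{-j} is the parabolic smoothing by two derivatives. -/
lemma shellInt_duhamel_le {a : Fin d → ℝ} {c : ℝ}
    (hc : ∀ ξ : Dom d, c * ‖ξ‖ ^ 2 ≤ heat a ξ) (hc0 : 0 < c) {V₀ : Dom d → CVal n}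
    {F : ℝ → Dom d → CVal n} (hV₀ : StronglyMeasurable V₀)
    (hF : StronglyMeasurable (Function.uncurry F)) (j : ℤ) :
    shellInt j (duhamel a V₀ F) ≤
      ENNReal.ofReal (c * 4 ^ j)⁻¹ * (shellNorm j V₀ + shellInt j F) := by
  have hb : 0 < c * 4 ^ j := by positivity
  calc shellInt j (duhamel a V₀ F) ≤ ∫⁻ t in Ioi (0 : ℝ),
        (ENNReal.ofReal (Real.exp (-(c * 4 ^ j * t))) * shellNorm j V₀ +
          ∫⁻ s in Ioc 0 t, ENNReal.ofReal (Real.exp (-(c * 4 ^ j * (t - s)))) * shellNorm j (F s)) :=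
        setLIntegral_mono' measurableSet_Ioi fun t ht =>
          shellNorm_duhamel_le hc hc0 hV₀ hF j (le_of_lt ht)
    _ = ENNReal.ofReal (c * 4 ^ j)⁻¹ * shellNorm j V₀ + ∫⁻ t in Ioi (0 : ℝ),
          ∫⁻ s in Ioc 0 t, ENNReal.ofReal (Real.exp (-(c * 4 ^ j * (t - s)))) * shellNorm j (F s) := by
        rw [lintegral_add_left (by fun_prop), lintegral_mul_const _ (by fun_prop),
          lintegral_exp_neg_mul hb]
    _ ≤ _ := by
        rw [mul_add]
        exact add_le_add le_rfl (lintegral_conv_exp_le hb (measurable_shellNorm hF j))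

end Duhamel

end

section

open FourierTransform

/-! ### The energy estimate -/

section Energy

variable {d n : ℕ}

/-- The weight of the shell `j` in the norm of `Ḃ^{d/2-1}_{2,1} ∩ Ḃ^{d/2}_{2,1}`. -/
def weight (d : ℕ) (j : ℤ) : ℝ≥0∞ :=
  (2 : ℝ≥0∞) ^ ((j : ℝ) * (d / 2 - 1)) + (2 : ℝ≥0∞) ^ ((j : ℝ) * (d / 2))

/-- The norm of `Ḃ^{d/2-1}_{2,1} ∩ Ḃ^{d/2}_{2,1}`, on the Fourier side. -/
def dataNorm {E : Type*} [NormedAddCommGroup E] (V : Dom d → E) : ℝ≥0∞ :=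
  specNorm (d / 2 - 1 : ℝ) V + specNorm (d / 2 : ℝ) V

/-- The norm controlling solutions: the Chemin-Lerner norm with two levels of parabolic
smoothing. -/
def energy {E : Type*} [NormedAddCommGroup E] (V : ℝ → Dom d → E) : ℝ≥0∞ :=
  ∑' j : ℤ, weight d j * (shellSup j V + (2 : ℝ≥0∞) ^ ((j : ℝ) * 2) * shellInt j V)

variable {E : Type*} [NormedAddCommGroup E]

lemma dataNorm_eq (V : Dom d → E) : dataNorm V = ∑' j : ℤ, weight d j * shellNorm j V := by
  simp only [dataNorm, specNorm, weight, add_mul]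
  exact ENNReal.tsum_add.symm

lemma weight_mul_two_sq (j : ℤ) : weight d j * (2 : ℝ≥0∞) ^ ((j : ℝ) * 2) =
    (2 : ℝ≥0∞) ^ ((j : ℝ) * (d / 2 + 1)) + (2 : ℝ≥0∞) ^ ((j : ℝ) * (d / 2 + 2)) := by
  rw [weight, add_mul, ← two_rpow_add, ← two_rpow_add]
  congr 2 <;> ring

lemma dataNorm_le_energy (V : ℝ → Dom d → E) {t : ℝ} (ht : 0 ≤ t) : dataNorm (V t) ≤ energy V := by
  rw [dataNorm_eq]
  refine ENNReal.tsum_le_tsum fun j => mul_le_mul_right ?_ _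
  exact (shellNorm_le_shellSup j V ht).trans le_self_add

lemma specNorm_le_energy (V : ℝ → Dom d → E) {t : ℝ} (ht : 0 ≤ t) :
    specNorm (d / 2 : ℝ) (V t) ≤ energy V :=
  le_add_self.trans (dataNorm_le_energy V ht)

lemma lintegral_specNorm_eq {V : ℝ → Dom d → E} (hV : StronglyMeasurable (Function.uncurry V))
    (s : ℝ) : ∫⁻ t in Ioi 0, specNorm s (V t) =
      ∑' j : ℤ, (2 : ℝ≥0∞) ^ ((j : ℝ) * s) * shellInt j V := by
  simp only [specNorm]
  rw [lintegral_tsum fun j => ((measurable_shellNorm hV j).const_mul _).aemeasurable]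
  exact tsum_congr fun j => lintegral_const_mul _ (measurable_shellNorm hV j)

lemma lintegral_dataNorm_eq {V : ℝ → Dom d → E} (hV : StronglyMeasurable (Function.uncurry V)) :
    ∫⁻ t in Ioi 0, dataNorm (V t) = ∑' j : ℤ, weight d j * shellInt j V := by
  simp only [dataNorm]
  rw [lintegral_add_left (measurable_specNorm hV _), lintegral_specNorm_eq hV,
    lintegral_specNorm_eq hV, ← ENNReal.tsum_add]
  simp only [weight, add_mul]

lemma lintegral_specNorm_le_energy {V : ℝ → Dom d → E}
    (hV : StronglyMeasurable (Function.uncurry V)) :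
    ∫⁻ t in Ioi 0, (specNorm (d / 2 + 1 : ℝ) (V t) + specNorm (d / 2 + 2 : ℝ) (V t)) ≤ energy V := by
  rw [lintegral_add_left (measurable_specNorm hV _), lintegral_specNorm_eq hV,
    lintegral_specNorm_eq hV, ← ENNReal.tsum_add]
  refine ENNReal.tsum_le_tsum fun j => ?_
  rw [← add_mul, ← weight_mul_two_sq, mul_assoc]
  exact mul_le_mul_right le_add_self _

/-- The weight 2^{2j} of the time integral cancels the gain 4^{-j}/c, so the supremum contributes 1
and the integral contributes 1/c. -/
lemma energy_duhamel_le {a : Fin d → ℝ} {c : ℝ}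
    (hc : ∀ ξ : Dom d, c * ‖ξ‖ ^ 2 ≤ heat a ξ) (hc0 : 0 < c) {V₀ : Dom d → CVal n}
    {F : ℝ → Dom d → CVal n} (hV₀ : StronglyMeasurable V₀)
    (hF : StronglyMeasurable (Function.uncurry F)) :
    energy (duhamel a V₀ F) ≤
      ENNReal.ofReal (1 + c⁻¹) * (dataNorm V₀ + ∫⁻ t in Ioi 0, dataNorm (F t)) := by
  rw [dataNorm_eq, lintegral_dataNorm_eq hF, ← ENNReal.tsum_add, ← ENNReal.tsum_mul_left]
  refine ENNReal.tsum_le_tsum fun j => ?_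
  have h4 : (2 : ℝ≥0∞) ^ ((j : ℝ) * 2) * ENNReal.ofReal (c * 4 ^ j)⁻¹ = ENNReal.ofReal c⁻¹ := by
    rw [← ofReal_two_rpow, ← ENNReal.ofReal_mul (by positivity)]
    congr 1
    have : (2 : ℝ) ^ ((j : ℝ) * 2) = 4 ^ j := by
      rw [mul_comm, Real.rpow_mul (by norm_num), Real.rpow_intCast]
      norm_num
    rw [this, mul_inv]
    field_simp
  rw [← mul_add, mul_left_comm]
  refine mul_le_mul_right ?_ _
  calc shellSup j (duhamel a V₀ F) + (2 : ℝ≥0∞) ^ ((j : ℝ) * 2) * shellInt j (duhamel a V₀ F)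
      ≤ (shellNorm j V₀ + shellInt j F) + (2 : ℝ≥0∞) ^ ((j : ℝ) * 2) *
          (ENNReal.ofReal (c * 4 ^ j)⁻¹ * (shellNorm j V₀ + shellInt j F)) :=
        add_le_add (shellSup_duhamel_le hc hc0 hV₀ hF j)
          (mul_le_mul_right (shellInt_duhamel_le hc hc0 hV₀ hF j) _)
    _ = _ := by
        rw [← mul_assoc, h4, ENNReal.ofReal_add zero_le_one (by positivity), ENNReal.ofReal_one]
        ring

/-! ### The nonlinear forcing and the solution map -/

/-- The fluxes of the perturbation equation: they vanish to second order at the origin. -/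
structure IsFlux (g : Fin d → Val n → Val n) : Prop where
  smooth : ∀ i, ContDiff ℝ (⊤ : ℕ∞) (g i)
  map_zero : ∀ i, g i 0 = 0
  fderiv_zero : ∀ i, fderiv ℝ (g i) 0 = 0

/-- The Fourier transform of `∑ ∂_i g_i(v)`. -/
def force (g : Fin d → Val n → Val n) (V : Dom d → CVal n) (ξ : Dom d) : CVal n :=
  ∑ i, derivSymbol (coordVec i) ξ • nonlin (g i) V ξ

variable [NeZero d]

lemma stronglyMeasurable_force {g : Fin d → Val n → Val n} (hg : IsFlux g)
    {V : ℝ → Dom d → CVal n} (hV : StronglyMeasurable (Function.uncurry V)) :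
    StronglyMeasurable (Function.uncurry fun t => force g (V t)) := by
  have h : ∀ i ∈ (Finset.univ : Finset (Fin d)), StronglyMeasurable fun p : ℝ × Dom d =>
      derivSymbol (coordVec i) p.2 • nonlin (g i) (V p.1) p.2 := fun i _ => by
    have h1 : StronglyMeasurable fun p : ℝ × Dom d => derivSymbol (coordVec i) p.2 :=
      (continuous_derivSymbol (coordVec i)).stronglyMeasurable.comp_measurable measurable_snd
    exact h1.smul (stronglyMeasurable_nonlin (hg.smooth i).continuous hV)
  exact Finset.stronglyMeasurable_fun_sum Finset.univ h

lemma stronglyMeasurable_nonlin_slice {g : Fin d → Val n → Val n} (hg : IsFlux g) (i : Fin d)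
    {V : Dom d → CVal n} (hV : StronglyMeasurable V) : StronglyMeasurable (nonlin (g i) V) := by
  have h1 : StronglyMeasurable (Function.uncurry fun _ : Unit => V) :=
    hV.comp_measurable measurable_snd
  have h2 := stronglyMeasurable_nonlin (hg.smooth i).continuous h1
  have h3 := h2.comp_measurable (measurable_prodMk_left (x := ()))
  exact h3

lemma specNorm_force_le {g : Fin d → Val n → Val n} (hg : IsFlux g) (s : ℝ) {V : Dom d → CVal n}
    (hV : StronglyMeasurable V) : specNorm s (force g V) ≤
      ENNReal.ofReal (4 * Real.pi) * ∑ i, specNorm (s + 1) (nonlin (g i) V) := by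
  have e : force g V = ∑ i, fun ξ => derivSymbol (coordVec i) ξ • nonlin (g i) V ξ := by
    ext1 ξ
    rw [Finset.sum_apply]
    rfl
  rw [e, Finset.mul_sum]
  refine (specNorm_sum_le s _ fun i _ => ((continuous_derivSymbol (coordVec i)).stronglyMeasurable.smul
    (stronglyMeasurable_nonlin_slice hg i hV)).aestronglyMeasurable).trans
    (Finset.sum_le_sum fun i _ => ?_)
  have h := specNorm_mul_pow_le (V := nonlin (g i) V)
    (W := fun ξ => derivSymbol (coordVec i) ξ • nonlin (g i) V ξ) (c := 2 * Real.pi)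
    (by positivity) 1 s fun ξ => by
      rw [norm_smul, pow_one]
      gcongr
      exact norm_derivSymbol_le (norm_coordVec i) ξ
  refine h.trans (le_of_eq ?_)
  rw [Nat.cast_one]
  congr 2
  ring

/-- Uniform version of `exists_nonlin_bound`. -/
lemma IsFlux.exists_bound {g : Fin d → Val n → Val n} (hg : IsFlux g) {R : ℝ} (hR : 0 < R) :
    ∃ K : ℝ≥0∞, K ≠ ⊤ ∧
      (∀ V : Dom d → CVal n, AEStronglyMeasurable V → specNorm (d / 2 : ℝ) V ≤ ENNReal.ofReal R →
        ∀ i, Integrable (nonlin (g i) V) ∧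
        (∀ x, 𝓕⁻ (nonlin (g i) V) x = complexify (g i (realPart (𝓕⁻ V x)))) ∧
        specNorm (d / 2 : ℝ) (nonlin (g i) V) ≤
          K * specNorm (d / 2 : ℝ) V * specNorm (d / 2 : ℝ) V ∧
        specNorm (d / 2 + 1 : ℝ) (nonlin (g i) V) ≤
          K * specNorm (d / 2 : ℝ) V * specNorm (d / 2 + 1 : ℝ) V) ∧
      ∀ V W : Dom d → CVal n, AEStronglyMeasurable V → AEStronglyMeasurable W →
        specNorm (d / 2 : ℝ) V ≤ ENNReal.ofReal R → specNorm (d / 2 : ℝ) W ≤ ENNReal.ofReal R →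
        (∀ x, 𝓕⁻ V x = complexify (realPart (𝓕⁻ V x))) →
        (∀ x, 𝓕⁻ W x = complexify (realPart (𝓕⁻ W x))) → ∀ i,
        ∫⁻ ξ, ‖nonlin (g i) V ξ - nonlin (g i) W ξ‖ₑ ≤ K * ∫⁻ ξ, ‖V ξ - W ξ‖ₑ := by
  choose K hK h1 h2 using fun i =>
    exists_nonlin_bound (d := d) (hg.smooth i) (hg.map_zero i) (hg.fderiv_zero i) hR
  have hle : ∀ i, K i ≤ ∑ i, K i := fun i =>
    Finset.single_le_sum (f := K) (fun _ _ => zero_le) (Finset.mem_univ i)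
  refine ⟨∑ i, K i, ENNReal.sum_ne_top.2 fun i _ => hK i, fun V hV hVR i => ?_,
    fun V W hV hW hVR hWR hVx hWx i => ?_⟩
  · obtain ⟨b1, b2, b3, b4⟩ := h1 i V hV hVR
    refine ⟨b1, b2, b3.trans ?_, b4.trans ?_⟩ <;>
    exact mul_le_mul_left (mul_le_mul_left (hle i) _) _
  · exact (h2 i V W hV hW hVR hWR hVx hWx).trans (mul_le_mul_left (hle i) _)

/-- The divergence shifts the indices d/2 - 1 and d/2 of the forcing to d/2 and d/2 + 1 for the
fluxes. At index d/2 the flux is bounded by ‖V‖²_{d/2}, which interpolation turns into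
‖V‖_{d/2-1}‖V‖_{d/2+1}; thus every bound contains one factor ‖V‖_{d/2+1}, which is integrable in
time. -/
lemma IsFlux.exists_dataNorm_force_le {g : Fin d → Val n → Val n} (hg : IsFlux g) {R : ℝ}
    (hR : 0 < R) :
    ∃ K : ℝ≥0∞, K ≠ ⊤ ∧ ∀ V : Dom d → CVal n, StronglyMeasurable V →
      specNorm (d / 2 : ℝ) V ≤ ENNReal.ofReal R →
      dataNorm (force g V) ≤ K * (dataNorm V * specNorm (d / 2 + 1 : ℝ) V) ∧
      ∀ i, specNorm (d / 2 : ℝ) (nonlin (g i) V) + specNorm (d / 2 + 1 : ℝ) (nonlin (g i) V) ≤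
        K * (dataNorm V * specNorm (d / 2 + 1 : ℝ) V) := by
  obtain ⟨K, hK, hb, -⟩ := hg.exists_bound hR
  refine ⟨(ENNReal.ofReal (4 * Real.pi) * d + 1) * K, ENNReal.mul_ne_top (ENNReal.add_ne_top.2
    ⟨ENNReal.mul_ne_top ENNReal.ofReal_ne_top (by simp), by simp⟩) hK, fun V hV hVR => ?_⟩
  have hi : ∀ i, specNorm (d / 2 : ℝ) (nonlin (g i) V) + specNorm (d / 2 + 1 : ℝ) (nonlin (g i) V) ≤
      K * (dataNorm V * specNorm (d / 2 + 1 : ℝ) V) := fun i => by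
    obtain ⟨-, -, h1, h2⟩ := hb V hV.aestronglyMeasurable hVR i
    refine (add_le_add h1 h2).trans ?_
    have h3 := specNorm_sq_le (d / 2 : ℝ) V
    rw [mul_assoc, mul_assoc, ← mul_add, ← sq]
    refine mul_le_mul_right ((add_le_add h3 le_rfl).trans (le_of_eq ?_)) _
    rw [dataNorm]
    ring
  constructor
  · have h1 := specNorm_force_le hg (d / 2 - 1 : ℝ) hV
    have h2 := specNorm_force_le hg (d / 2 : ℝ) hV
    rw [sub_add_cancel] at h1
    refine (add_le_add h1 h2).trans ?_
    rw [← mul_add, ← Finset.sum_add_distrib]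
    calc ENNReal.ofReal (4 * Real.pi) * ∑ i, (specNorm (d / 2 : ℝ) (nonlin (g i) V) +
          specNorm (d / 2 + 1 : ℝ) (nonlin (g i) V))
        ≤ ENNReal.ofReal (4 * Real.pi) *
          ∑ _i : Fin d, K * (dataNorm V * specNorm (d / 2 + 1 : ℝ) V) :=
          mul_le_mul_right (Finset.sum_le_sum fun i _ => hi i) _
      _ = ENNReal.ofReal (4 * Real.pi) * d * K * (dataNorm V * specNorm (d / 2 + 1 : ℝ) V) := by
          rw [Finset.sum_const, Finset.card_univ, Fintype.card_fin, nsmul_eq_mul]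
          ring
      _ ≤ _ := mul_le_mul_left (mul_le_mul_left le_self_add _) _
  · intro i
    refine (hi i).trans (mul_le_mul_left ?_ _)
    nth_rewrite 1 [← one_mul K]
    exact mul_le_mul_left le_add_self _

/-- The solution map of the linear problem with the nonlinear forcing. -/
def picard (a : Fin d → ℝ) (g : Fin d → Val n → Val n) (V₀ : Dom d → CVal n)
    (V : ℝ → Dom d → CVal n) : ℝ → Dom d → CVal n :=
  duhamel a V₀ fun t => force g (V t)

lemma stronglyMeasurable_picard (a : Fin d → ℝ) {g : Fin d → Val n → Val n} (hg : IsFlux g)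
    {V₀ : Dom d → CVal n} {V : ℝ → Dom d → CVal n} (hV₀ : StronglyMeasurable V₀)
    (hV : StronglyMeasurable (Function.uncurry V)) :
    StronglyMeasurable (Function.uncurry (picard a g V₀ V)) :=
  stronglyMeasurable_duhamel a hV₀ (stronglyMeasurable_force hg hV)

/-- One factor is taken in L^∞ in time, the other in L¹; the energy controls both. -/
lemma lintegral_dataNorm_force_le {g : Fin d → Val n → Val n} {K : ℝ≥0∞} {R : ℝ}
    (hK : ∀ V : Dom d → CVal n, StronglyMeasurable V → specNorm (d / 2 : ℝ) V ≤ ENNReal.ofReal R →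
      dataNorm (force g V) ≤ K * (dataNorm V * specNorm (d / 2 + 1 : ℝ) V))
    {V : ℝ → Dom d → CVal n} (hV : StronglyMeasurable (Function.uncurry V))
    (hR : energy V ≤ ENNReal.ofReal R) :
    ∫⁻ t in Ioi 0, dataNorm (force g (V t)) ≤ K * energy V ^ 2 := by
  calc ∫⁻ t in Ioi 0, dataNorm (force g (V t))
      ≤ ∫⁻ t in Ioi 0, K * energy V * specNorm (d / 2 + 1 : ℝ) (V t) := by
        refine setLIntegral_mono' measurableSet_Ioi fun t ht => ?_
        refine (hK (V t) (stronglyMeasurable_slice hV t)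
          ((specNorm_le_energy V (le_of_lt ht)).trans hR)).trans ?_
        rw [mul_assoc]
        exact mul_le_mul_right (mul_le_mul_left (dataNorm_le_energy V (le_of_lt ht)) _) _
    _ = K * energy V * ∫⁻ t in Ioi 0, specNorm (d / 2 + 1 : ℝ) (V t) :=
        lintegral_const_mul _ (measurable_specNorm hV _)
    _ ≤ K * energy V * energy V := by
        refine mul_le_mul_right ((lintegral_mono fun t => le_self_add).trans
          (lintegral_specNorm_le_energy hV)) _
    _ = _ := by ring

end Energy

end

section

open FourierTransform

/-! ### The contraction property -/

section Contraction

variable {d n : ℕ} [NeZero d]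

/-- Bounded trajectories, on the Fourier side, of real-valued functions. -/
structure IsTraj (R : ℝ) (V : ℝ → Dom d → CVal n) : Prop where
  sm : StronglyMeasurable (Function.uncurry V)
  real : ∀ t, 0 ≤ t → ∀ x, 𝓕⁻ (V t) x = complexify (realPart (𝓕⁻ (V t) x))
  bound : ∀ t, 0 ≤ t → specNorm (d / 2 : ℝ) (V t) ≤ ENNReal.ofReal R

/-- The exponentially weighted distance of two trajectories. -/
def wdist (l : ℝ) (V W : ℝ → Dom d → CVal n) : ℝ≥0∞ :=
  ⨆ (t : ℝ) (_ : 0 ≤ t), ENNReal.ofReal (Real.exp (-(l * t))) * ∫⁻ ξ, ‖V t ξ - W t ξ‖ₑ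

lemma lintegral_sub_le_wdist (l : ℝ) (V W : ℝ → Dom d → CVal n) {t : ℝ} (ht : 0 ≤ t) :
    ∫⁻ ξ, ‖V t ξ - W t ξ‖ₑ ≤ ENNReal.ofReal (Real.exp (l * t)) * wdist l V W := by
  have h : ENNReal.ofReal (Real.exp (-(l * t))) * ∫⁻ ξ, ‖V t ξ - W t ξ‖ₑ ≤ wdist l V W :=
    le_iSup₂ (f := fun (t : ℝ) (_ : 0 ≤ t) =>
      ENNReal.ofReal (Real.exp (-(l * t))) * ∫⁻ ξ, ‖V t ξ - W t ξ‖ₑ) t ht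
  calc ∫⁻ ξ, ‖V t ξ - W t ξ‖ₑ = ENNReal.ofReal (Real.exp (l * t)) *
        (ENNReal.ofReal (Real.exp (-(l * t))) * ∫⁻ ξ, ‖V t ξ - W t ξ‖ₑ) := by
        rw [← mul_assoc, ← ENNReal.ofReal_mul (Real.exp_pos _).le, ← Real.exp_add]
        simp
    _ ≤ _ := mul_le_mul_right h _

lemma IsTraj.lintegral_le {R : ℝ} {V : ℝ → Dom d → CVal n} (h : IsTraj R V) {t : ℝ} (ht : 0 ≤ t) :
    ∫⁻ ξ, ‖V t ξ‖ₑ ≤ massConst d * ENNReal.ofReal R :=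
  (lintegral_le_specNorm (stronglyMeasurable_slice h.sm t).aestronglyMeasurable).trans
    (mul_le_mul_right (h.bound t ht) _)

/-- Without finiteness, D ≤ D/2 would not force D = 0. -/
lemma wdist_lt_top {l R : ℝ} (hl : 0 ≤ l) {V W : ℝ → Dom d → CVal n} (hV : IsTraj R V)
    (hW : IsTraj R W) : wdist l V W ≤ 2 * (massConst d * ENNReal.ofReal R) := by
  refine iSup₂_le fun t ht => ?_
  have h1 : ENNReal.ofReal (Real.exp (-(l * t))) ≤ 1 := by
    rw [ENNReal.ofReal_le_one, Real.exp_le_one_iff]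
    have : 0 ≤ l * t := by positivity
    linarith
  refine (mul_le_of_le_one_left' h1).trans ?_
  refine (lintegral_mono fun ξ => enorm_sub_le).trans ?_
  rw [lintegral_add_left (stronglyMeasurable_slice hV.sm t).enorm, two_mul]
  exact add_le_add (hV.lintegral_le ht) (hW.lintegral_le ht)

/-- A function with integrable slices in frequency has, for almost every frequency, integrable
slices in time. -/
lemma ae_integrableOn_of_lintegral {E : Type*} [NormedAddCommGroup E] {F : ℝ → Dom d → E}
    (hF : StronglyMeasurable (Function.uncurry F))
    (hb : ∀ T : ℝ, ∫⁻ s in Ioc 0 T, ∫⁻ ξ, ‖F s ξ‖ₑ ≠ ⊤) :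
    ∀ᵐ ξ, ∀ T : ℝ, IntegrableOn (fun s => F s ξ) (Ioc 0 T) := by
  have h : ∀ᵐ ξ, ∀ N : ℕ, ∫⁻ s in Ioc 0 (N : ℝ), ‖F s ξ‖ₑ < ⊤ := by
    refine ae_all_iff.2 fun N => ?_
    have hm : Measurable fun p : Dom d × ℝ => ‖F p.2 p.1‖ₑ :=
      (hF.comp_measurable measurable_swap).enorm
    refine ae_lt_top hm.lintegral_prod_right' ?_
    rw [lintegral_lintegral_swap hm.aemeasurable]
    exact hb N
  filter_upwards [h] with ξ hξ T
  obtain ⟨N, hN⟩ := exists_nat_ge T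
  have hs : StronglyMeasurable fun s => F s ξ :=
    hF.comp_measurable (g := fun s : ℝ => (s, ξ)) measurable_prodMk_right
  exact IntegrableOn.mono_set (t := Ioc 0 (N : ℝ)) ⟨hs.aestronglyMeasurable, hξ N⟩
    (Ioc_subset_Ioc_right hN)

lemma setLIntegral_ne_top_of_bound {φ : ℝ → ℝ≥0∞} {B : ℝ≥0∞} (hB : B ≠ ⊤)
    (h : ∀ t, 0 ≤ t → φ t ≤ B) (T : ℝ) : ∫⁻ s in Ioc 0 T, φ s ≠ ⊤ := by
  refine ne_top_of_le_ne_top ?_ (setLIntegral_mono' measurableSet_Ioc fun s hs => h s hs.1.le)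
  simp [ENNReal.mul_eq_top, hB]

/-- The forcing itself need not have finite mass, since the symbol of the derivative is unbounded.
For a fixed frequency the symbol is a constant, so integrability in time follows from that of
`nonlin`. -/
lemma ae_integrableOn_force {g : Fin d → Val n → Val n} (hg : IsFlux g) {R : ℝ} (hR : 0 < R)
    {V : ℝ → Dom d → CVal n} (hV : IsTraj R V) :
    ∀ᵐ ξ, ∀ T : ℝ, IntegrableOn (fun s => force g (V s) ξ) (Ioc 0 T) := by
  obtain ⟨K, hK, hb, -⟩ := hg.exists_bound (d := d) hR
  have h : ∀ᵐ ξ, ∀ i, ∀ T : ℝ, IntegrableOn (fun s => nonlin (g i) (V s) ξ) (Ioc 0 T) := by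
    refine ae_all_iff.2 fun i => ae_integrableOn_of_lintegral
      (stronglyMeasurable_nonlin (hg.smooth i).continuous hV.sm) ?_
    refine setLIntegral_ne_top_of_bound
      (B := massConst d * (K * ENNReal.ofReal R * ENNReal.ofReal R))
      (ENNReal.mul_ne_top massConst_ne_top (by finiteness)) fun t ht => ?_
    have hVt := stronglyMeasurable_slice hV.sm t
    obtain ⟨-, -, h1, -⟩ := hb (V t) hVt.aestronglyMeasurable (hV.bound t ht) i
    refine (lintegral_le_specNorm
      (stronglyMeasurable_nonlin_slice hg i hVt).aestronglyMeasurable).trans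
      (mul_le_mul_right (h1.trans ?_) _)
    have := hV.bound t ht
    gcongr
  filter_upwards [h] with ξ hξ T
  exact integrable_finsetSum _ fun i _ => (hξ i T).smul (derivSymbol (coordVec i) ξ)

lemma integrableOn_exp_smul {E : Type*} [NormedAddCommGroup E] [NormedSpace ℝ E] {b t : ℝ}
    {φ : ℝ → E} (hφ : IntegrableOn φ (Ioc 0 t)) :
    IntegrableOn (fun s => Real.exp (-(b * (t - s))) • φ s) (Ioc 0 t) := by
  refine IntegrableOn.continuousOn_smul_of_subset (K := Icc 0 t) ?_ hφ isCompact_Icc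
    measurableSet_Ioc Ioc_subset_Icc_self
  fun_prop

/-- z e^{-z²} ≤ 1 with z = x(cr)^{1/2}: one factor |ξ| is traded for an integrable singularity in
time. -/
lemma exp_mul_le_rpow {c r x : ℝ} (hc : 0 < c) (hr : 0 < r) :
    Real.exp (-(c * x ^ 2 * r)) * x ≤ (c * r) ^ (-(1 / 2) : ℝ) := by
  have hcr : 0 < c * r := by positivity
  set y := (c * r) ^ (1 / 2 : ℝ) with hy
  have hy0 : 0 < y := by positivity
  have hyy : y ^ 2 = c * r := by
    rw [hy, ← Real.rpow_natCast, ← Real.rpow_mul hcr.le]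
    norm_num
  rw [Real.rpow_neg hcr.le, ← hy, ← one_div, le_div_iff₀ hy0, mul_assoc]
  have h1 : x * y ≤ Real.exp (c * x ^ 2 * r) := by
    have h2 := Real.add_one_le_exp (c * x ^ 2 * r)
    have h3 : c * x ^ 2 * r = (x * y) ^ 2 := by rw [mul_pow, hyy]; ring
    rw [h3] at h2 ⊢
    nlinarith [sq_nonneg (x * y - 1)]
  rw [Real.exp_neg, inv_mul_le_iff₀ (Real.exp_pos _), mul_one]
  exact h1

lemma lintegral_rpow_mul_exp {l : ℝ} (hl : 0 < l) :
    ∫⁻ r in Ioi (0 : ℝ), ENNReal.ofReal (r ^ (-(1 / 2) : ℝ) * Real.exp (-(l * r))) =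
      ENNReal.ofReal (Real.sqrt (Real.pi / l)) := by
  have h := Real.integral_rpow_mul_exp_neg_mul_Ioi (a := 1 / 2) (r := l) (by norm_num) hl
  have e : (1 / 2 - 1 : ℝ) = -(1 / 2) := by norm_num
  rw [e] at h
  have hpos : 0 < Real.sqrt (Real.pi / l) := Real.sqrt_pos.2 (by positivity)
  have hv : ∫ r in Ioi (0 : ℝ), r ^ (-(1 / 2) : ℝ) * Real.exp (-(l * r)) =
      Real.sqrt (Real.pi / l) := by
    rw [h, Real.Gamma_one_half_eq, ← Real.sqrt_eq_rpow, ← Real.sqrt_mul (by positivity)]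
    congr 1
    ring
  rw [← hv]
  refine (ofReal_integral_eq_lintegral_ofReal ?_ ?_).symm
  -- Integrability comes for free: the integral of a non-integrable function is zero by convention,
  -- while the value found is positive.
  · by_contra hni
    rw [integral_undef hni] at hv
    exact hpos.ne hv
  · filter_upwards [ae_restrict_mem measurableSet_Ioi] with r hr
    have : (0 : ℝ) < r := hr
    positivity

/-- The solution map is a contraction for the weighted distance. -/
theorem exists_contraction {a : Fin d → ℝ} (ha : ∀ i, 0 < a i) {g : Fin d → Val n → Val n}
    (hg : IsFlux g) {R : ℝ} (hR : 0 < R) :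
    ∃ l : ℝ, 0 < l ∧ ∀ (V₀ : Dom d → CVal n) (V W : ℝ → Dom d → CVal n),
      IsTraj R V → IsTraj R W →
      wdist l (picard a g V₀ V) (picard a g V₀ W) ≤ 2⁻¹ * wdist l V W := by
  obtain ⟨c, C, hc0, -, hc⟩ := exists_heat_bounds ha
  obtain ⟨K, hK, -, hL⟩ := hg.exists_bound (d := d) hR
  -- κ gathers the symbol, the smoothing and the Lipschitz constants of the d fluxes. The choice of
  -- l gives √(π/l) = 1/(2(κ + 1)), hence a factor κ√(π/l) ≤ 1/2.
  set κ : ℝ := 2 * Real.pi * c ^ (-(1 / 2) : ℝ) * (d * K.toReal) with hκ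
  have hκ0 : 0 ≤ κ := by positivity
  set l : ℝ := 4 * Real.pi * (κ + 1) ^ 2 with hl
  have hl0 : 0 < l := by positivity
  refine ⟨l, hl0, fun V₀ V W hV hW => iSup₂_le fun t ht => ?_⟩
  set D := wdist l V W with hD
  set N : Fin d → ℝ → Dom d → CVal n := fun i s ξ =>
    nonlin (g i) (V s) ξ - nonlin (g i) (W s) ξ with hN
  have hNm : ∀ i, StronglyMeasurable (Function.uncurry (N i)) := fun i =>
    (stronglyMeasurable_nonlin (hg.smooth i).continuous hV.sm).sub
      (stronglyMeasurable_nonlin (hg.smooth i).continuous hW.sm)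
  have hNb : ∀ s, 0 ≤ s → ∑ i, ∫⁻ ξ, ‖N i s ξ‖ₑ ≤
      d * K * (ENNReal.ofReal (Real.exp (l * s)) * D) := fun s hs => by
    calc ∑ i, ∫⁻ ξ, ‖N i s ξ‖ₑ ≤ ∑ _i : Fin d, K * (ENNReal.ofReal (Real.exp (l * s)) * D) :=
          Finset.sum_le_sum fun i _ =>
            (hL (V s) (W s) (stronglyMeasurable_slice hV.sm s).aestronglyMeasurable
              (stronglyMeasurable_slice hW.sm s).aestronglyMeasurable (hV.bound s hs)
              (hW.bound s hs) (hV.real s hs) (hW.real s hs) i).trans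
              (mul_le_mul_right (lintegral_sub_le_wdist l V W hs) _)
      _ = _ := by
          rw [Finset.sum_const, Finset.card_univ, Fintype.card_fin, nsmul_eq_mul, mul_assoc (d : ℝ≥0∞)]
  set k : ℝ → ℝ≥0∞ := fun s => ENNReal.ofReal (2 * Real.pi * (c * (t - s)) ^ (-(1 / 2) : ℝ)) with hk
  have hkm : Measurable k := by fun_prop
  -- The datum cancels. The open interval is used because the smoothing estimate needs t - s > 0.
  have hpt : ∀ᵐ ξ, ‖picard a g V₀ V t ξ - picard a g V₀ W t ξ‖ₑ ≤
      ∫⁻ s in Ioo 0 t, k s * ∑ i, ‖N i s ξ‖ₑ := by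
    filter_upwards [ae_integrableOn_force hg hR hV, ae_integrableOn_force hg hR hW] with ξ h1 h2
    have e : picard a g V₀ V t ξ - picard a g V₀ W t ξ =
        -∫ s in Ioc 0 t, Real.exp (-(heat a ξ * (t - s))) •
          ∑ i, derivSymbol (coordVec i) ξ • N i s ξ := by
      rw [picard, picard, duhamel, duhamel, sub_sub_sub_cancel_left, ← neg_sub,
        ← integral_sub (integrableOn_exp_smul (h1 t)) (integrableOn_exp_smul (h2 t))]
      simp only [hN, force, ← smul_sub, ← Finset.sum_sub_distrib]
    rw [e, enorm_neg, ← integral_Ioc_eq_integral_Ioo.symm]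
    refine (enorm_integral_le_lintegral_enorm _).trans ?_
    refine setLIntegral_mono' measurableSet_Ioo fun s hs => ?_
    have hr : 0 < t - s := sub_pos.2 hs.2
    rw [enorm_smul]
    calc ‖Real.exp (-(heat a ξ * (t - s)))‖ₑ * ‖∑ i, derivSymbol (coordVec i) ξ • N i s ξ‖ₑ
        ≤ ENNReal.ofReal (Real.exp (-(c * ‖ξ‖ ^ 2 * (t - s)))) *
          ∑ i, ENNReal.ofReal (2 * Real.pi * ‖ξ‖) * ‖N i s ξ‖ₑ := by
          gcongr
          · rw [Real.enorm_eq_ofReal (Real.exp_pos _).le]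
            refine ENNReal.ofReal_le_ofReal (Real.exp_le_exp.2 (neg_le_neg ?_))
            exact mul_le_mul_of_nonneg_right (hc ξ).1 hr.le
          · refine (enorm_sum_le _ _).trans (Finset.sum_le_sum fun i _ => ?_)
            rw [enorm_smul]
            gcongr
            rw [← ofReal_norm]

            exact ENNReal.ofReal_le_ofReal (norm_derivSymbol_le (norm_coordVec i) ξ)
      _ = ENNReal.ofReal (2 * Real.pi * (Real.exp (-(c * ‖ξ‖ ^ 2 * (t - s))) * ‖ξ‖)) *
            ∑ i, ‖N i s ξ‖ₑ := by
          rw [← Finset.mul_sum, ← mul_assoc, ← ENNReal.ofReal_mul (Real.exp_pos _).le]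
          congr 2
          ring
      _ ≤ _ := by
          refine mul_le_mul_left (ENNReal.ofReal_le_ofReal ?_) _
          exact mul_le_mul_of_nonneg_left (exp_mul_le_rpow hc0 hr) (by positivity)
  have hNm' : ∀ i, Measurable fun p : Dom d × ℝ => ‖N i p.2 p.1‖ₑ := fun i =>
    ((hNm i).comp_measurable measurable_swap).enorm
  have hsl : ∀ i s, Measurable fun ξ => ‖N i s ξ‖ₑ := fun i s =>
    (stronglyMeasurable_slice (hNm i) s).enorm
  have hjm : Measurable fun p : Dom d × ℝ => k p.2 * ∑ i, ‖N i p.2 p.1‖ₑ :=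
    (hkm.comp measurable_snd).mul (Finset.measurable_fun_sum _ fun i _ => hNm' i)
  have hint : ∫⁻ ξ, ‖picard a g V₀ V t ξ - picard a g V₀ W t ξ‖ₑ ≤
      ∫⁻ s in Ioo 0 t, k s * (d * K * (ENNReal.ofReal (Real.exp (l * s)) * D)) := by
    refine (lintegral_mono_ae hpt).trans ?_
    rw [lintegral_lintegral_swap hjm.aemeasurable]
    refine setLIntegral_mono' measurableSet_Ioo fun s hs => ?_
    rw [lintegral_const_mul _ (Finset.measurable_fun_sum _ fun i _ => hsl i s),
      lintegral_finsetSum _ fun i _ => hsl i s]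
    exact mul_le_mul_right (hNb s hs.1.le) _
  calc ENNReal.ofReal (Real.exp (-(l * t))) *
        ∫⁻ ξ, ‖picard a g V₀ V t ξ - picard a g V₀ W t ξ‖ₑ
      ≤ ENNReal.ofReal (Real.exp (-(l * t))) *
        ∫⁻ s in Ioo 0 t, k s * (d * K * (ENNReal.ofReal (Real.exp (l * s)) * D)) :=
        mul_le_mul_right hint _
    _ = ∫⁻ s in Ioo 0 t, ENNReal.ofReal κ * D * ENNReal.ofReal
          ((t - s) ^ (-(1 / 2) : ℝ) * Real.exp (-(l * (t - s)))) := by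
        rw [← lintegral_const_mul _ (by fun_prop)]
        refine setLIntegral_congr_fun measurableSet_Ioo fun s hs => ?_
        have hr : 0 < t - s := sub_pos.2 hs.2
        have hKe : (d : ℝ≥0∞) * K = ENNReal.ofReal (d * K.toReal) := by
          rw [ENNReal.ofReal_mul (by positivity), ENNReal.ofReal_natCast, ENNReal.ofReal_toReal hK]
        simp only [hk, hκ]
        rw [hKe, Real.mul_rpow hc0.le hr.le]
        have e2 : Real.exp (-(l * (t - s))) = Real.exp (-(l * t)) * Real.exp (l * s) := by
          rw [← Real.exp_add]
          congr 1
          ring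
        rw [e2]
        have p1 := (Real.exp_pos (-(l * t))).le
        have p2 := (Real.exp_pos (l * s)).le
        rw [mul_right_comm _ D, ← ENNReal.ofReal_mul (by positivity)]
        rw [← mul_assoc (ENNReal.ofReal (d * K.toReal)), ← mul_assoc, ← mul_assoc,
          ← ENNReal.ofReal_mul (by positivity), ← ENNReal.ofReal_mul (by positivity),
          ← ENNReal.ofReal_mul (by positivity)]
        congr 2
        ring
    _ = ENNReal.ofReal κ * D * ∫⁻ s in Ioo 0 t, ENNReal.ofReal
          ((t - s) ^ (-(1 / 2) : ℝ) * Real.exp (-(l * (t - s)))) :=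
        lintegral_const_mul _ (by fun_prop)
    _ ≤ ENNReal.ofReal κ * D * ENNReal.ofReal (Real.sqrt (Real.pi / l)) := by
        refine mul_le_mul_right ?_ _
        rw [← lintegral_rpow_mul_exp hl0, ← lintegral_indicator measurableSet_Ioo,
          ← lintegral_indicator measurableSet_Ioi]
        rw [← lintegral_sub_left_eq_self (fun r => (Ioi (0 : ℝ)).indicator (fun r =>
          ENNReal.ofReal (r ^ (-(1 / 2) : ℝ) * Real.exp (-(l * r)))) r) t]
        refine lintegral_mono fun s => ?_
        by_cases hs : s ∈ Ioo 0 t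
        · rw [indicator_of_mem hs, indicator_of_mem (show t - s ∈ Ioi (0 : ℝ) from sub_pos.2 hs.2)]
        · rw [indicator_of_notMem hs]
          exact zero_le
    _ ≤ 2⁻¹ * D := by
        rw [mul_right_comm, ← ENNReal.ofReal_mul hκ0]
        refine mul_le_mul_left ?_ _
        rw [← ENNReal.ofReal_ofNat, ← ENNReal.ofReal_inv_of_pos (by norm_num)]
        refine ENNReal.ofReal_le_ofReal ?_
        have e3 : Real.sqrt (Real.pi / l) = 2⁻¹ * (κ + 1)⁻¹ := by
          rw [Real.sqrt_eq_iff_mul_self_eq_of_pos (by positivity), hl]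
          field_simp
          ring
        rw [e3, mul_left_comm]
        have : κ * (κ + 1)⁻¹ ≤ 1 := by
          rw [← div_eq_mul_inv, div_le_one (by positivity)]
          linarith
        linarith

end Contraction

end

section

open FourierTransform

/-! ### Construction of the solution on the Fourier side -/

section Iteration

variable {d n : ℕ}

lemma const_mul_liminf_le (c : ℝ≥0∞) (u : ℕ → ℝ≥0∞) :
    c * liminf u atTop ≤ liminf (fun k => c * u k) atTop := by
  have h := ENNReal.le_liminf_mul (f := atTop) (u := fun _ : ℕ => c) (v := u)
  rwa [liminf_const] at h

lemma add_liminf_le (u v : ℕ → ℝ≥0∞) :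
    liminf u atTop + liminf v atTop ≤ liminf (fun k => u k + v k) atTop := by
  have hmono : ∀ w : ℕ → ℝ≥0∞, Monotone fun n => ⨅ i ≥ n, w i := fun w m n hmn =>
    biInf_mono fun i hi => le_trans hmn hi
  simp only [liminf_eq_iSup_iInf_of_nat]
  rw [ENNReal.iSup_add_iSup_of_monotone (hmono u) (hmono v)]
  exact iSup_mono fun n => le_iInf₂ fun i hi => add_le_add (iInf₂_le i hi) (iInf₂_le i hi)

/-- Lower semicontinuity of the energy. -/
lemma energy_le_liminf {V : ℕ → ℝ → Dom d → CVal n}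
    (hV : ∀ k, StronglyMeasurable (Function.uncurry (V k))) {W : ℝ → Dom d → CVal n}
    (h : ∀ t, 0 ≤ t → ∀ᵐ ξ, Tendsto (fun k => V k t ξ) atTop (𝓝 (W t ξ))) :
    energy W ≤ liminf (fun k => energy (V k)) atTop := by
  have hsh : ∀ j : ℤ, ∀ t, 0 ≤ t → shellNorm j (W t) ≤
      liminf (fun k => shellNorm j (V k t)) atTop := fun j t ht =>
    Lp.eLpNorm_lim_le_liminf_eLpNorm
      (fun k => (stronglyMeasurable_slice (hV k) t).aestronglyMeasurable) _
      (ae_restrict_of_ae (h t ht))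
  have hsup : ∀ j : ℤ, shellSup j W ≤ liminf (fun k => shellSup j (V k)) atTop := fun j =>
    iSup₂_le fun t ht => (hsh j t ht).trans
      (liminf_le_liminf (Eventually.of_forall fun k => shellNorm_le_shellSup j (V k) ht))
  have hint : ∀ j : ℤ, shellInt j W ≤ liminf (fun k => shellInt j (V k)) atTop := fun j =>
    (setLIntegral_mono' measurableSet_Ioi fun t ht => hsh j t (le_of_lt ht)).trans
      (lintegral_liminf_le fun k => measurable_shellNorm (hV k) j)
  have hterm : ∀ j : ℤ, weight d j * (shellSup j W + (2 : ℝ≥0∞) ^ ((j : ℝ) * 2) * shellInt j W) ≤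
      liminf (fun k => weight d j *
        (shellSup j (V k) + (2 : ℝ≥0∞) ^ ((j : ℝ) * 2) * shellInt j (V k))) atTop := fun j => by
    refine le_trans (mul_le_mul_right ?_ _) (const_mul_liminf_le _ _)
    exact (add_le_add (hsup j) ((mul_le_mul_right (hint j) _).trans (const_mul_liminf_le _ _))).trans
      (add_liminf_le _ _)
  simp only [energy, ← lintegral_count]
  exact (lintegral_mono hterm).trans (lintegral_liminf_le fun k => measurable_from_top)

lemma heat_neg (a : Fin d → ℝ) (ξ : Dom d) : heat a (-ξ) = heat a ξ := by simp [heat]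

variable [NeZero d]

lemma conjVec_real_smul (c : ℝ) (z : CVal n) : conjVec (c • z) = c • conjVec z := map_smul _ _ _

/-- Conjugation is an invertible linear map, so it commutes with integrals without any
integrability. -/
lemma integral_conjVec (S : Set ℝ) (φ : ℝ → CVal n) :
    ∫ s in S, conjVec (φ s) = conjVec (∫ s in S, φ s) := by
  let e : CVal n ≃L[ℝ] CVal n := ContinuousLinearEquiv.equivOfInverse conjVec conjVec
    conjVec_conjVec conjVec_conjVec
  exact e.integral_comp_comm φ

lemma isHerm_duhamel (a : Fin d → ℝ) {V₀ : Dom d → CVal n} {F : ℝ → Dom d → CVal n}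
    (hV₀ : IsHerm V₀) (hF : ∀ t, IsHerm (F t)) (t : ℝ) : IsHerm (duhamel a V₀ F t) := fun ξ => by
  rw [duhamel, duhamel, map_sub, conjVec_real_smul, ← integral_conjVec, hV₀ ξ, heat_neg]
  simp only [conjVec_real_smul, hF _ ξ]

lemma derivSymbol_neg (e ξ : Dom d) : derivSymbol e (-ξ) = star (derivSymbol e ξ) := by
  simp [derivSymbol]

lemma isHerm_force (g : Fin d → Val n → Val n) (V : Dom d → CVal n) : IsHerm (force g V) :=
  fun ξ => by
    simp only [force, map_sum, conjVec_smul, derivSymbol_neg, isHerm_nonlin _ _ ξ]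

lemma isHerm_picard (a : Fin d → ℝ) (g : Fin d → Val n → Val n) {V₀ : Dom d → CVal n}
    (hV₀ : IsHerm V₀) (V : ℝ → Dom d → CVal n) (t : ℝ) : IsHerm (picard a g V₀ V t) :=
  isHerm_duhamel a hV₀ (fun _ => isHerm_force g _) t

lemma isTraj_of_isHerm {R : ℝ} {V : ℝ → Dom d → CVal n}
    (hV : StronglyMeasurable (Function.uncurry V)) (h : ∀ t, IsHerm (V t))
    (hR : energy V ≤ ENNReal.ofReal R) : IsTraj R V where
  sm := hV
  bound _ ht := (specNorm_le_energy V ht).trans hR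
  real _ ht x := (h _).fourierInv_eq (integrable_of_specNorm
    (stronglyMeasurable_slice hV _).aestronglyMeasurable
    (ne_top_of_le_ne_top ENNReal.ofReal_ne_top ((specNorm_le_energy V ht).trans hR))) x

lemma energy_zero : energy (fun _ _ => 0 : ℝ → Dom d → CVal n) = 0 := by
  have h : ∀ j : ℤ, shellNorm j (fun _ => 0 : Dom d → CVal n) = 0 := fun j => eLpNorm_zero'
  simp [energy, shellSup, shellInt, h]

/-- The energy is preserved by the solution map, for small data. -/
lemma exists_energy_picard_le {a : Fin d → ℝ} (ha : ∀ i, 0 < a i) {g : Fin d → Val n → Val n}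
    (hg : IsFlux g) :
    ∃ (η : ℝ) (C : ℝ≥0∞), 0 < η ∧ C ≠ ⊤ ∧ C * ENNReal.ofReal η ≤ 1 ∧
      ∀ (V₀ : Dom d → CVal n) (V : ℝ → Dom d → CVal n), StronglyMeasurable V₀ →
        dataNorm V₀ ≤ ENNReal.ofReal η → StronglyMeasurable (Function.uncurry V) →
        energy V ≤ C * dataNorm V₀ → energy (picard a g V₀ V) ≤ C * dataNorm V₀ := by
  obtain ⟨c, B, hc0, -, hc⟩ := exists_heat_bounds ha
  obtain ⟨K, hK, hb⟩ := hg.exists_dataNorm_force_le (d := d) one_pos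
  set A : ℝ := 1 + c⁻¹ with hA
  have hA0 : 0 < A := by positivity
  -- Two conditions are met: 2Aη ≤ 1 keeps the energy below 1, where the flux estimates hold, and
  -- 4A²Kη ≤ 1 lets the quadratic term be absorbed by the datum, giving the constant C = 2A.
  set η : ℝ := (2 * A + 4 * A ^ 2 * K.toReal + 1)⁻¹ with hη
  have hη0 : 0 < η := by positivity
  have hη1 : (2 * A + 4 * A ^ 2 * K.toReal + 1) * η = 1 := mul_inv_cancel₀ (by positivity)
  have hC : (2 * ENNReal.ofReal A) * ENNReal.ofReal η ≤ 1 := by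
    rw [← ENNReal.ofReal_ofNat, ← ENNReal.ofReal_mul (by positivity),
      ← ENNReal.ofReal_mul (by positivity), ENNReal.ofReal_le_one, ← hη1]
    gcongr
    have : 0 ≤ 4 * A ^ 2 * K.toReal := by positivity
    linarith
  have hKη : K * (4 * ENNReal.ofReal A ^ 2) * ENNReal.ofReal η ≤ 1 := by
    rw [← ENNReal.ofReal_toReal hK, ← ENNReal.ofReal_ofNat, ← ENNReal.ofReal_pow (by positivity),
      ← ENNReal.ofReal_mul (by positivity), ← ENNReal.ofReal_mul (by positivity),
      ← ENNReal.ofReal_mul (by positivity), ENNReal.ofReal_le_one, ← hη1]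
    gcongr
    linarith
  refine ⟨η, 2 * ENNReal.ofReal A, hη0, by finiteness, hC, fun V₀ V hV₀ hE hV hM => ?_⟩
  have hM1 : energy V ≤ ENNReal.ofReal 1 := by
    rw [ENNReal.ofReal_one]
    exact hM.trans ((mul_le_mul_right hE _).trans hC)
  have h1 := energy_duhamel_le (fun ξ => (hc ξ).1) hc0 hV₀ (stronglyMeasurable_force hg hV)
  have h2 := lintegral_dataNorm_force_le (fun V hV hR => (hb V hV hR).1) hV hM1
  refine h1.trans ?_
  have h3 : K * energy V ^ 2 ≤ dataNorm V₀ := by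
    calc K * energy V ^ 2 ≤ K * (2 * ENNReal.ofReal A * dataNorm V₀) ^ 2 := by gcongr
      _ = K * (4 * ENNReal.ofReal A ^ 2) * dataNorm V₀ * dataNorm V₀ := by ring
      _ ≤ 1 * dataNorm V₀ := by
          refine mul_le_mul_left ((mul_le_mul_right hE _).trans hKη) _
      _ = _ := one_mul _
  calc ENNReal.ofReal A * (dataNorm V₀ + ∫⁻ t in Ioi 0, dataNorm (force g (V t)))
      ≤ ENNReal.ofReal A * (dataNorm V₀ + dataNorm V₀) := by
        gcongr
        exact h2.trans h3
    _ = _ := by ring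

lemma picard_congr (a : Fin d → ℝ) (g : Fin d → Val n → Val n) (V₀ : Dom d → CVal n)
    {V W : ℝ → Dom d → CVal n} (h : ∀ t, 0 ≤ t → V t =ᵐ[volume] W t) (t : ℝ) :
    picard a g V₀ V t = picard a g V₀ W t := by
  ext1 ξ
  rw [picard, picard, duhamel, duhamel]
  congr 1
  refine setIntegral_congr_fun measurableSet_Ioc fun s hs => ?_
  simp only [force, nonlin_congr (h s hs.1.le)]

/-- A fixed point of the solution map, for small data. -/
theorem exists_fixedPoint {a : Fin d → ℝ} (ha : ∀ i, 0 < a i) {g : Fin d → Val n → Val n}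
    (hg : IsFlux g) :
    ∃ (η : ℝ) (C : ℝ≥0∞), 0 < η ∧ C ≠ ⊤ ∧ C * ENNReal.ofReal η ≤ 1 ∧
      ∀ V₀ : Dom d → CVal n, StronglyMeasurable V₀ → IsHerm V₀ →
        dataNorm V₀ ≤ ENNReal.ofReal η →
        ∃ V : ℝ → Dom d → CVal n, IsTraj 1 V ∧ energy V ≤ C * dataNorm V₀ ∧
          ∀ t, V t = picard a g V₀ V t := by
  obtain ⟨η, C, hη, hC, hCη, hE⟩ := exists_energy_picard_le ha hg
  obtain ⟨l, hl, hcon⟩ := exists_contraction ha hg one_pos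
  refine ⟨η, C, hη, hC, hCη, fun V₀ hV₀ hVh hV₀η => ?_⟩
  have hM : C * dataNorm V₀ ≤ ENNReal.ofReal 1 := by
    rw [ENNReal.ofReal_one]
    exact (mul_le_mul_right hV₀η _).trans hCη
  -- Picard iterates from zero: bounded in the strong norm by the energy estimate, and Cauchy in the
  -- weak weighted distance by the contraction.
  set U : ℕ → ℝ → Dom d → CVal n := fun k => (picard a g V₀)^[k] fun _ _ => 0 with hU
  have hUs : ∀ k, U (k + 1) = picard a g V₀ (U k) := fun k => Function.iterate_succ_apply' _ _ _
  have hUm : ∀ k, StronglyMeasurable (Function.uncurry (U k)) := fun k => by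
    induction k with
    | zero => exact stronglyMeasurable_const (b := (0 : CVal n))
    | succ k ih => rw [hUs]; exact stronglyMeasurable_picard a hg hV₀ ih
  have hUE : ∀ k, energy (U k) ≤ C * dataNorm V₀ := fun k => by
    induction k with
    | zero =>
      refine le_trans (le_of_eq ?_) zero_le
      exact energy_zero
    | succ k ih => rw [hUs]; exact hE V₀ _ hV₀ hV₀η (hUm k) ih
  have hUh : ∀ k t, IsHerm (U k t) := fun k t => by
    cases k with
    | zero => intro ξ; exact (map_zero conjVec).symm
    | succ k => rw [hUs]; exact isHerm_picard a g hVh _ t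
  have hUT : ∀ k, IsTraj 1 (U k) := fun k =>
    isTraj_of_isHerm (hUm k) (hUh k) ((hUE k).trans hM)
  set D := wdist l (U 1) (U 0) with hD
  have hDt : D ≠ ⊤ := ne_top_of_le_ne_top
    (ENNReal.mul_ne_top (by simp) (ENNReal.mul_ne_top massConst_ne_top ENNReal.ofReal_ne_top))
    (wdist_lt_top hl.le (hUT 1) (hUT 0))
  have hstep : ∀ k, wdist l (U (k + 1)) (U k) ≤ 2⁻¹ ^ k * D := fun k => by
    induction k with
    | zero => simp [hD]
    | succ k ih =>
      rw [hUs (k + 1)]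
      nth_rewrite 2 [hUs k]
      refine (hcon V₀ _ _ (hUT (k + 1)) (hUT k)).trans ?_
      rw [pow_succ', mul_assoc]
      exact mul_le_mul_right ih _
  have hstep' : ∀ k t, 0 ≤ t → ∫⁻ ξ, ‖U (k + 1) t ξ - U k t ξ‖ₑ ≤
      ENNReal.ofReal (Real.exp (l * t)) * (2⁻¹ ^ k * D) := fun k t ht =>
    (lintegral_sub_le_wdist l _ _ ht).trans (mul_le_mul_right (hstep k) _)
  have hmeas : ∀ k t, Measurable fun ξ => ‖U (k + 1) t ξ - U k t ξ‖ₑ := fun k t =>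
    ((stronglyMeasurable_slice (hUm (k + 1)) t).sub (stronglyMeasurable_slice (hUm k) t)).enorm
  have htail : ∀ k t, 0 ≤ t → ∑' m, ∫⁻ ξ, ‖U (k + m + 1) t ξ - U (k + m) t ξ‖ₑ ≤
      ENNReal.ofReal (Real.exp (l * t)) * (2⁻¹ ^ k * (2 * D)) := fun k t ht => by
    calc ∑' m, ∫⁻ ξ, ‖U (k + m + 1) t ξ - U (k + m) t ξ‖ₑ
        ≤ ∑' m : ℕ, ENNReal.ofReal (Real.exp (l * t)) * (2⁻¹ ^ (k + m) * D) :=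
          ENNReal.tsum_le_tsum fun m => hstep' (k + m) t ht
      _ = ENNReal.ofReal (Real.exp (l * t)) * (2⁻¹ ^ k * ((∑' m : ℕ, 2⁻¹ ^ m) * D)) := by
          rw [ENNReal.tsum_mul_left, ENNReal.tsum_mul_right]
          simp only [pow_add, ENNReal.tsum_mul_left, mul_assoc]
      _ = _ := by rw [ENNReal.tsum_geometric_two]
  -- A pointwise limit, hence jointly measurable. For each t ≥ 0 it is a true limit for almost every
  -- frequency, since the successive differences are summable there.
  set L : ℝ → Dom d → CVal n := fun t ξ => limUnder atTop fun k => U k t ξ with hL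
  have hLm : StronglyMeasurable (Function.uncurry L) :=
    StronglyMeasurable.limUnder (f := fun k (p : ℝ × Dom d) => U k p.1 p.2) fun k => hUm k
  have hlim : ∀ t, 0 ≤ t → ∀ᵐ ξ, Tendsto (fun k => U k t ξ) atTop (𝓝 (L t ξ)) := fun t ht => by
    have h := htail 0 t ht
    simp only [zero_add] at h
    rw [← lintegral_tsum fun m => (hmeas m t).aemeasurable] at h
    filter_upwards [ae_lt_top (Measurable.tsum fun m => hmeas m t)
      (ne_top_of_le_ne_top (by finiteness) h)] with ξ hξ
    refine (cauchySeq_of_edist_le_of_tsum_ne_top _ (fun m => le_of_eq ?_) hξ.ne).tendsto_limUnder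
    rw [edist_comm, edist_eq_enorm_sub]
  have hdist : ∀ k t, 0 ≤ t → ∫⁻ ξ, ‖U k t ξ - L t ξ‖ₑ ≤
      ENNReal.ofReal (Real.exp (l * t)) * (2⁻¹ ^ k * (2 * D)) := fun k t ht => by
    refine le_trans ?_ (htail k t ht)
    rw [← lintegral_tsum fun m => (hmeas (k + m) t).aemeasurable]
    refine lintegral_mono_ae ((hlim t ht).mono fun ξ hξ => ?_)
    rw [← edist_eq_enorm_sub]
    refine edist_le_tsum_of_edist_le_of_tendsto (fun m => ‖U (m + 1) t ξ - U m t ξ‖ₑ)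
      (fun m => le_of_eq ?_) hξ k
    rw [edist_comm, edist_eq_enorm_sub]
  -- Convergence is known only in the weak distance; lower semicontinuity recovers the strong bound.
  have hLE : energy L ≤ C * dataNorm V₀ := by
    refine (energy_le_liminf hUm hlim).trans ?_
    refine (liminf_le_liminf (Eventually.of_forall hUE)).trans (le_of_eq (liminf_const _))
  have hgeom : ∀ B : ℝ≥0∞, B ≠ ⊤ → Tendsto (fun k : ℕ => 2⁻¹ ^ k * B) atTop (𝓝 0) := fun B hB => by
    have h := ENNReal.Tendsto.mul_const (b := B) (ENNReal.tendsto_pow_atTop_nhds_zero_of_lt_one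
      (r := 2⁻¹) (by simp)) (Or.inr hB)
    rwa [zero_mul] at h
  have hint : ∀ {Z : ℝ → Dom d → CVal n}, StronglyMeasurable (Function.uncurry Z) →
      energy Z ≤ C * dataNorm V₀ → ∀ t, 0 ≤ t → Integrable (Z t) := fun hZ hZE t ht =>
    integrable_of_specNorm (stronglyMeasurable_slice hZ t).aestronglyMeasurable
      (ne_top_of_le_ne_top ENNReal.ofReal_ne_top
        ((specNorm_le_energy _ ht).trans (hZE.trans hM)))
  have hLT : IsTraj 1 L := by
    refine ⟨hLm, fun t ht x => ?_, fun t ht => (specNorm_le_energy L ht).trans (hLE.trans hM)⟩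
    have h0 : Tendsto (fun k => 𝓕⁻ (U k t) x) atTop (𝓝 (𝓕⁻ (L t) x)) := by
      rw [tendsto_iff_edist_tendsto_0]
      refine tendsto_of_tendsto_of_tendsto_of_le_of_le tendsto_const_nhds
        (hgeom (2 * D * ENNReal.ofReal (Real.exp (l * t))) (by finiteness)) (fun _ => zero_le)
        fun k => ?_
      show edist _ _ ≤ _
      rw [edist_eq_enorm_sub, ← fourierInv_sub (hint (hUm k) (hUE k) t ht) (hint hLm hLE t ht)]
      refine (enorm_fourierInv_le _ x).trans ((hdist k t ht).trans (le_of_eq ?_))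
      ring
    have h1 : Tendsto (fun k => conjVec (𝓕⁻ (U k t) x)) atTop (𝓝 (conjVec (𝓕⁻ (L t) x))) :=
      (conjVec.continuous.tendsto _).comp h0
    rw [eq_complexify_iff]
    refine tendsto_nhds_unique h1 (h0.congr fun k => ?_)
    exact ((eq_complexify_iff _).1 ((hUT k).real t ht x)).symm
  have hae : ∀ t, 0 ≤ t → picard a g V₀ L t =ᵐ[volume] L t := fun t ht => by
    have h0 : ∫⁻ ξ, ‖picard a g V₀ L t ξ - L t ξ‖ₑ = 0 := by
      have hB : ENNReal.ofReal (Real.exp (l * t)) * (2 * D) ≠ ⊤ := by finiteness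
      refine le_antisymm (ge_of_tendsto' (hgeom _ hB) fun k => ?_) zero_le
      have hwd : wdist l (U k) L ≤ 2⁻¹ ^ k * (2 * D) := iSup₂_le fun s hs => by
        refine (mul_le_mul_right (hdist k s hs) _).trans (le_of_eq ?_)
        rw [← mul_assoc, ← ENNReal.ofReal_mul (Real.exp_pos _).le, ← Real.exp_add]
        simp
      have hc1 : ∫⁻ ξ, ‖picard a g V₀ (U k) t ξ - picard a g V₀ L t ξ‖ₑ ≤
          ENNReal.ofReal (Real.exp (l * t)) * (2⁻¹ * (2⁻¹ ^ k * (2 * D))) :=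
        (lintegral_sub_le_wdist l _ _ ht).trans (mul_le_mul_right
          ((hcon V₀ _ _ (hUT k) hLT).trans (mul_le_mul_right hwd _)) _)
      have hc2 := hdist (k + 1) t ht
      rw [hUs] at hc2
      have hpm := stronglyMeasurable_slice (stronglyMeasurable_picard a hg hV₀ (hUm k)) t
      have hLs := stronglyMeasurable_slice (stronglyMeasurable_picard a hg hV₀ hLm) t
      calc ∫⁻ ξ, ‖picard a g V₀ L t ξ - L t ξ‖ₑ
          ≤ ∫⁻ ξ, (‖picard a g V₀ (U k) t ξ - picard a g V₀ L t ξ‖ₑ +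
              ‖picard a g V₀ (U k) t ξ - L t ξ‖ₑ) := lintegral_mono fun ξ => by
            have e : picard a g V₀ L t ξ - L t ξ = -(picard a g V₀ (U k) t ξ -
              picard a g V₀ L t ξ) + (picard a g V₀ (U k) t ξ - L t ξ) := by abel
            rw [e]
            refine (enorm_add_le _ _).trans ?_
            rw [enorm_neg]
        _ = (∫⁻ ξ, ‖picard a g V₀ (U k) t ξ - picard a g V₀ L t ξ‖ₑ) +
              ∫⁻ ξ, ‖picard a g V₀ (U k) t ξ - L t ξ‖ₑ := lintegral_add_left (hpm.sub hLs).enorm _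
        _ ≤ ENNReal.ofReal (Real.exp (l * t)) * (2⁻¹ * (2⁻¹ ^ k * (2 * D))) +
              ENNReal.ofReal (Real.exp (l * t)) * (2⁻¹ ^ (k + 1) * (2 * D)) := add_le_add hc1 hc2
        _ = (2⁻¹ + 2⁻¹) * (2⁻¹ ^ k * (ENNReal.ofReal (Real.exp (l * t)) * (2 * D))) := by ring
        _ = _ := by rw [ENNReal.inv_two_add_inv_two, one_mul]
    have h1 := (lintegral_eq_zero_iff ((stronglyMeasurable_slice
      (stronglyMeasurable_picard a hg hV₀ hLm) t).sub (stronglyMeasurable_slice hLm t)).enorm).1 h0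
    filter_upwards [h1] with ξ hξ
    simpa [sub_eq_zero] using hξ
  have hPm := stronglyMeasurable_picard a hg hV₀ hLm
  have hPE := hE V₀ L hV₀ hV₀η hLm hLE
  -- L is a fixed point only up to null sets. Its image under the solution map is Hermitian and
  -- satisfies the fixed-point identity at every frequency, since the map does not see null sets.
  exact ⟨picard a g V₀ L, isTraj_of_isHerm hPm (isHerm_picard a g hVh L) (hPE.trans hM), hPE,
    fun t => picard_congr a g V₀ (fun s hs => (hae s hs).symm) t⟩

end Iteration

end

section

open FourierTransform

/-! ### Duhamel's formula and the integrated equation -/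

section Volterra

variable {E : Type*} [NormedAddCommGroup E] [NormedSpace ℝ E] [CompleteSpace E]

/-- Fubini's theorem on the triangle 0 < r ≤ s ≤ t, where the kernel is bounded by compactness. -/
lemma integral_triangle {K : ℝ → ℝ → ℝ} (hK : Continuous (Function.uncurry K)) {φ : ℝ → E} {t : ℝ}
    (hφ : IntegrableOn φ (Ioc 0 t)) :
    ∫ s in Ioc 0 t, ∫ r in Ioc 0 s, K s r • φ r =
      ∫ r in Ioc 0 t, (∫ s in Ioc r t, K s r) • φ r := by
  set μ : Measure ℝ := volume.restrict (Ioc 0 t) with hμ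
  set k : ℝ → ℝ → E := fun s r => {p : ℝ × ℝ | p.2 ≤ p.1}.indicator (fun p => K p.1 p.2 • φ p.2) (s, r)
    with hk
  have hms : MeasurableSet {p : ℝ × ℝ | p.2 ≤ p.1} := measurableSet_le measurable_snd measurable_fst
  obtain ⟨B, hB⟩ := (isCompact_Icc (a := (0 : ℝ)) (b := t)).prod isCompact_Icc
    |>.exists_bound_of_continuousOn hK.continuousOn
  have hi : Integrable (Function.uncurry k) (μ.prod μ) := by
    have h1 : Integrable (fun p : ℝ × ℝ => φ p.2) (μ.prod μ) := hφ.comp_snd μ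
    have h2 : Integrable (fun p : ℝ × ℝ => K p.1 p.2 • φ p.2) (μ.prod μ) := by
      refine (h1.norm.const_mul B).mono' (hK.aestronglyMeasurable.smul h1.1) ?_
      rw [hμ, Measure.prod_restrict]
      filter_upwards [ae_restrict_mem (measurableSet_Ioc.prod measurableSet_Ioc)] with p hp
      rw [norm_smul]
      exact mul_le_mul_of_nonneg_right (hB p ⟨Ioc_subset_Icc_self hp.1, Ioc_subset_Icc_self hp.2⟩)
        (norm_nonneg _)
    exact h2.indicator hms
  have e1 : ∫ s in Ioc 0 t, ∫ r in Ioc 0 s, K s r • φ r = ∫ s, ∫ r, k s r ∂μ ∂μ := by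
    refine setIntegral_congr_fun measurableSet_Ioc fun s hs => ?_
    have e : ∀ r, k s r = (Iic s).indicator (fun r => K s r • φ r) r := fun r => rfl
    simp only [e]
    rw [integral_indicator measurableSet_Iic, hμ, Measure.restrict_restrict measurableSet_Iic]
    congr 2
    ext r
    simp only [mem_Ioc, mem_inter_iff, mem_Iic]
    exact ⟨fun h => ⟨h.2, h.1, h.2.trans hs.2⟩, fun h => ⟨h.2.1, h.1⟩⟩
  rw [e1, integral_integral_swap hi]
  refine setIntegral_congr_fun measurableSet_Ioc fun r hr => ?_
  have e : ∀ s, k s r = (Ici r).indicator (fun s => K s r • φ r) s := fun s => rfl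
  simp only [e]
  rw [integral_indicator measurableSet_Ici, hμ, Measure.restrict_restrict measurableSet_Ici,
    ← integral_smul_const]
  have e2 : Ici r ∩ Ioc 0 t = Icc r t := by
    ext s
    simp only [mem_Ioc, mem_inter_iff, mem_Ici, mem_Icc]
    exact ⟨fun h => ⟨h.1, h.2.2⟩, fun h => ⟨h.1, hr.1.trans_le h.1, h.2⟩⟩
  rw [e2, integral_Icc_eq_integral_Ioc]

lemma integral_exp_sub_left (b r t : ℝ) (h : r ≤ t) :
    ∫ s in Ioc r t, b * Real.exp (-(b * (s - r))) = 1 - Real.exp (-(b * (t - r))) := by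
  rw [← intervalIntegral.integral_of_le h]
  rw [intervalIntegral.integral_eq_sub_of_hasDerivAt (f := fun s => -Real.exp (-(b * (s - r))))]
  · simp only [sub_self, mul_zero, neg_zero, Real.exp_zero]
    ring
  · intro s _
    have h1 : HasDerivAt (fun s => -(b * (s - r))) (-(b * 1)) s :=
      (((hasDerivAt_id s).sub_const r).const_mul b).neg
    have h2 : HasDerivAt (fun s => -Real.exp (-(b * (s - r))))
        (-(Real.exp (-(b * (s - r))) * -(b * 1))) s := h1.exp.neg
    exact h2.congr_deriv (by ring)
  · exact (by fun_prop : Continuous _).intervalIntegrable _ _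

lemma integral_exp_sub_right (b r t : ℝ) (h : r ≤ t) :
    ∫ s in Ioc r t, b * Real.exp (-(b * (t - s))) = 1 - Real.exp (-(b * (t - r))) := by
  rw [← intervalIntegral.integral_of_le h]
  rw [intervalIntegral.integral_eq_sub_of_hasDerivAt (f := fun s => Real.exp (-(b * (t - s))))]
  · simp only [sub_self, mul_zero, neg_zero, Real.exp_zero]
  · intro s _
    have h1 : HasDerivAt (fun s => -(b * (t - s))) (-(b * -1)) s :=
      (((hasDerivAt_id s).const_sub t).const_mul b).neg
    have h2 : HasDerivAt (fun s => Real.exp (-(b * (t - s))))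
        (Real.exp (-(b * (t - s))) * -(b * -1)) s := h1.exp
    exact h2.congr_deriv (by ring)
  · exact (by fun_prop : Continuous _).intervalIntegrable _ _

/-- Duhamel's formula solves the integrated equation. -/
lemma duhamel_integrated (b : ℝ) (y₀ : E) {y φ : ℝ → E} {t : ℝ} (ht : 0 ≤ t)
    (hφ : IntegrableOn φ (Ioc 0 t)) (hyi : IntegrableOn y (Ioc 0 t))
    (hy : ∀ s ∈ Ioc 0 t, y s = Real.exp (-(b * s)) • y₀ -
      ∫ r in Ioc 0 s, Real.exp (-(b * (s - r))) • φ r) :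
    Real.exp (-(b * t)) • y₀ - ∫ r in Ioc 0 t, Real.exp (-(b * (t - r))) • φ r =
      y₀ - ∫ s in Ioc 0 t, (b • y s + φ s) := by
  have hby : IntegrableOn (fun s => b • y s) (Ioc 0 t) := hyi.smul b
  have hexp : IntegrableOn (fun s => b * Real.exp (-(b * s))) (Ioc 0 t) :=
    (Continuous.integrableOn_Icc (by fun_prop)).mono_set Ioc_subset_Icc_self
  have h1 : ∫ s in Ioc 0 t, b • y s = (1 - Real.exp (-(b * t))) • y₀ -
      ∫ r in Ioc 0 t, (1 - Real.exp (-(b * (t - r)))) • φ r := by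
    -- The order of integration is exchanged, and the inner integral of b e^{-b(s-r)} over s is
    -- explicit.
    have e2 : ∫ s in Ioc 0 t, b • ∫ r in Ioc 0 s, Real.exp (-(b * (s - r))) • φ r =
        ∫ r in Ioc 0 t, (1 - Real.exp (-(b * (t - r)))) • φ r := by
      have h := integral_triangle (K := fun s r => b * Real.exp (-(b * (s - r))))
        (by fun_prop) hφ
      refine Eq.trans ?_ (h.trans ?_)
      · simp only [mul_smul, integral_smul]
      · refine setIntegral_congr_fun measurableSet_Ioc fun r hr => ?_
        simp only [integral_exp_sub_left b r t hr.2]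
    have e3 : ∫ s in Ioc 0 t, (b * Real.exp (-(b * s))) • y₀ = (1 - Real.exp (-(b * t))) • y₀ := by
      rw [integral_smul_const]
      have := integral_exp_sub_left b 0 t ht
      simp only [sub_zero] at this
      rw [this]
    have e4 : ∀ s ∈ Ioc 0 t, (b * Real.exp (-(b * s))) • y₀ - b • y s =
        b • ∫ r in Ioc 0 s, Real.exp (-(b * (s - r))) • φ r := fun s hs => by
      rw [hy s hs, smul_sub, smul_smul, sub_sub_cancel]
    rw [← e3, ← e2, ← setIntegral_congr_fun measurableSet_Ioc e4,
      integral_sub (hexp.smul_const y₀) hby, sub_sub_cancel]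
  have h2 : ∫ r in Ioc 0 t, (1 - Real.exp (-(b * (t - r)))) • φ r =
      (∫ r in Ioc 0 t, φ r) - ∫ r in Ioc 0 t, Real.exp (-(b * (t - r))) • φ r := by
    rw [← integral_sub hφ (integrableOn_exp_smul hφ)]
    simp only [sub_smul, one_smul]
  rw [integral_add hby hφ, h1, h2, sub_smul, one_smul]
  abel

/-- Solutions of the integrated equation are given by Duhamel's formula. -/
lemma eq_duhamel_of_integrated (b : ℝ) (y₀ : E) {y φ : ℝ → E} {t : ℝ} (ht : 0 ≤ t)
    (hφ : IntegrableOn φ (Ioc 0 t)) (hyi : IntegrableOn y (Ioc 0 t))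
    (hy : ∀ᵐ s, s ∈ Ioc 0 t → y s = y₀ - ∫ r in Ioc 0 s, (b • y r + φ r)) :
    y₀ - ∫ s in Ioc 0 t, (b • y s + φ s) =
      Real.exp (-(b * t)) • y₀ - ∫ r in Ioc 0 t, Real.exp (-(b * (t - r))) • φ r := by
  set ψ : ℝ → E := fun s => b • y s + φ s with hψ
  have hψi : IntegrableOn ψ (Ioc 0 t) := (hyi.smul b).add hφ
  have hyi' : IntegrableOn (fun s => Real.exp (-(b * (t - s))) • (b • y s)) (Ioc 0 t) :=
    integrableOn_exp_smul (hyi.smul b)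
  have h1 : ∫ s in Ioc 0 t, Real.exp (-(b * (t - s))) • φ s =
      (∫ s in Ioc 0 t, Real.exp (-(b * (t - s))) • ψ s) -
        ∫ s in Ioc 0 t, Real.exp (-(b * (t - s))) • (b • y s) := by
    rw [← integral_sub (integrableOn_exp_smul hψi) hyi']
    simp only [hψ, ← smul_sub, add_sub_cancel_left]
  have hexp : IntegrableOn (fun s => b * Real.exp (-(b * (t - s)))) (Ioc 0 t) :=
    (Continuous.integrableOn_Icc (by fun_prop)).mono_set Ioc_subset_Icc_self
  -- The integrated equation is inserted for y under the weight b e^{-b(t-s)}; only its validity for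
  -- almost every s matters.
  have h2 : ∫ s in Ioc 0 t, Real.exp (-(b * (t - s))) • (b • y s) =
      (1 - Real.exp (-(b * t))) • y₀ -
        ∫ r in Ioc 0 t, (1 - Real.exp (-(b * (t - r)))) • ψ r := by
    have e2 : ∫ s in Ioc 0 t, ∫ r in Ioc 0 s, (b * Real.exp (-(b * (t - s)))) • ψ r =
        ∫ r in Ioc 0 t, (1 - Real.exp (-(b * (t - r)))) • ψ r := by
      rw [integral_triangle (K := fun s _ => b * Real.exp (-(b * (t - s)))) (by fun_prop) hψi]
      refine setIntegral_congr_fun measurableSet_Ioc fun r hr => ?_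
      simp only [integral_exp_sub_right b r t hr.2]
    have e3 : ∫ s in Ioc 0 t, (b * Real.exp (-(b * (t - s)))) • y₀ =
        (1 - Real.exp (-(b * t))) • y₀ := by
      rw [integral_smul_const]
      have := integral_exp_sub_right b 0 t ht
      simp only [sub_zero] at this
      rw [this]
    have e4 : ∀ᵐ s, s ∈ Ioc 0 t → (b * Real.exp (-(b * (t - s)))) • y₀ -
        Real.exp (-(b * (t - s))) • (b • y s) =
        ∫ r in Ioc 0 s, (b * Real.exp (-(b * (t - s)))) • ψ r := hy.mono fun s h hs => by
      rw [h hs, integral_smul, smul_smul, mul_comm b, smul_sub, sub_sub_cancel]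
    rw [← e3, ← e2, ← setIntegral_congr_ae measurableSet_Ioc e4,
      integral_sub (hexp.smul_const y₀) hyi', sub_sub_cancel]
  have h3 : ∫ r in Ioc 0 t, (1 - Real.exp (-(b * (t - r)))) • ψ r =
      (∫ r in Ioc 0 t, ψ r) - ∫ r in Ioc 0 t, Real.exp (-(b * (t - r))) • ψ r := by
    rw [← integral_sub hψi (integrableOn_exp_smul hψi)]
    simp only [sub_smul, one_smul]
  rw [h1, h2, h3, sub_smul, one_smul]
  abel

end Volterra

/-! ### The integrated equation for trajectories -/

section Drift

variable {d n : ℕ}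

/-- The operator `-∑ a_i ∂_i^2 v + ∑ ∂_i g_i(v)`, on the Fourier side. -/
def drift (a : Fin d → ℝ) (g : Fin d → Val n → Val n) (V : Dom d → CVal n) (ξ : Dom d) : CVal n :=
  heat a ξ • V ξ + force g V ξ

variable [NeZero d]

lemma stronglyMeasurable_drift (a : Fin d → ℝ) {g : Fin d → Val n → Val n} (hg : IsFlux g)
    {V : ℝ → Dom d → CVal n} (hV : StronglyMeasurable (Function.uncurry V)) :
    StronglyMeasurable (Function.uncurry fun t => drift a g (V t)) := by
  have h1 : StronglyMeasurable fun p : ℝ × Dom d => heat a p.2 :=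
    (continuous_heat a).stronglyMeasurable.comp_measurable measurable_snd
  exact (h1.smul hV).add (stronglyMeasurable_force hg hV)

lemma IsTraj.ae_integrableOn {R : ℝ} {V : ℝ → Dom d → CVal n} (hV : IsTraj R V) :
    ∀ᵐ ξ, ∀ T : ℝ, IntegrableOn (fun s => V s ξ) (Ioc 0 T) :=
  ae_integrableOn_of_lintegral hV.sm (setLIntegral_ne_top_of_bound
    (ENNReal.mul_ne_top massConst_ne_top ENNReal.ofReal_ne_top) fun _ ht => hV.lintegral_le ht)

lemma IsTraj.ae_integrableOn_drift (a : Fin d → ℝ) {g : Fin d → Val n → Val n} (hg : IsFlux g)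
    {R : ℝ} (hR : 0 < R) {V : ℝ → Dom d → CVal n} (hV : IsTraj R V) :
    ∀ᵐ ξ, ∀ T : ℝ, IntegrableOn (fun s => drift a g (V s) ξ) (Ioc 0 T) := by
  filter_upwards [hV.ae_integrableOn, ae_integrableOn_force hg hR hV] with ξ h1 h2 T
  exact ((h1 T).smul (heat a ξ)).add (h2 T)

/-- Fixed points of the solution map solve the integrated equation. -/
lemma IsTraj.integrated {a : Fin d → ℝ} {g : Fin d → Val n → Val n} (hg : IsFlux g)
    {R : ℝ} (hR : 0 < R) {V₀ : Dom d → CVal n} {V : ℝ → Dom d → CVal n} (hV : IsTraj R V)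
    (h : ∀ t, V t = picard a g V₀ V t) :
    ∀ᵐ ξ, ∀ t, 0 ≤ t → V t ξ = V₀ ξ - ∫ s in Ioc 0 t, drift a g (V s) ξ := by
  filter_upwards [hV.ae_integrableOn, ae_integrableOn_force hg hR hV] with ξ h1 h2 t ht
  have h3 := duhamel_integrated (heat a ξ) (V₀ ξ) (y := fun s => V s ξ) ht (h2 t) (h1 t)
    fun s _ => congrFun (h s) ξ
  rw [h t]
  exact h3

/-- Solutions of the integrated equation are fixed points of the solution map. -/
lemma IsTraj.eq_picard {a : Fin d → ℝ} {g : Fin d → Val n → Val n} (hg : IsFlux g)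
    {R : ℝ} (hR : 0 < R) {V₀ : Dom d → CVal n} (hV₀ : StronglyMeasurable V₀)
    {V : ℝ → Dom d → CVal n} (hV : IsTraj R V)
    (h : ∀ t, 0 ≤ t → ∀ᵐ ξ, V t ξ = V₀ ξ - ∫ s in Ioc 0 t, drift a g (V s) ξ) (t : ℝ) (ht : 0 ≤ t) :
    V t =ᵐ[volume] picard a g V₀ V t := by
  have hD := stronglyMeasurable_drift a hg hV.sm
  have hI : StronglyMeasurable fun p : Dom d × ℝ => ∫ s in Ioc 0 p.2, drift a g (V s) p.1 := by
    have e : (fun p : Dom d × ℝ => ∫ s in Ioc 0 p.2, drift a g (V s) p.1) = fun p =>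
        ∫ s, {q : (Dom d × ℝ) × ℝ | 0 < q.2 ∧ q.2 ≤ q.1.2}.indicator
          (fun q => drift a g (V q.2) q.1.1) (p, s) := by
      ext1 p
      rw [← integral_indicator measurableSet_Ioc]
      rfl
    rw [e]
    refine StronglyMeasurable.integral_prod_right' (StronglyMeasurable.indicator ?_ ?_)
    · have hm : Measurable fun q : (Dom d × ℝ) × ℝ => (q.2, q.1.1) :=
        measurable_snd.prodMk (measurable_fst.comp measurable_fst)
      have h4 := hD.comp_measurable hm
      exact h4
    · exact (measurableSet_lt measurable_const measurable_snd).inter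
        (measurableSet_le measurable_snd (measurable_snd.comp measurable_fst))
  -- The exceptional set of frequencies depends on the time. As the equation defines a measurable
  -- set of pairs, the two quantifiers can be exchanged at the cost of almost every time.
  have hae : ∀ᵐ ξ, ∀ᵐ s, 0 ≤ s → V s ξ = V₀ ξ - ∫ r in Ioc 0 s, drift a g (V r) ξ := by
    have hm : MeasurableSet {p : Dom d × ℝ |
        0 ≤ p.2 → V p.2 p.1 = V₀ p.1 - ∫ r in Ioc 0 p.2, drift a g (V r) p.1} := by
      have h5 : StronglyMeasurable fun p : Dom d × ℝ => V p.2 p.1 :=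
        hV.sm.comp_measurable measurable_swap
      have h6 : StronglyMeasurable fun p : Dom d × ℝ =>
          V₀ p.1 - ∫ r in Ioc 0 p.2, drift a g (V r) p.1 :=
        (hV₀.comp_measurable measurable_fst).sub hI
      have h7 := h5.measurableSet_eq_fun h6
      have h8 : MeasurableSet {p : Dom d × ℝ | 0 ≤ p.2} :=
        measurableSet_le measurable_const measurable_snd
      exact h8.himp h7
    rw [Measure.ae_ae_comm hm]
    refine Eventually.of_forall fun s => ?_
    by_cases hs : 0 ≤ s
    · exact (h s hs).mono fun ξ hξ _ => hξ
    · exact Eventually.of_forall fun ξ h => absurd h hs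
  filter_upwards [hae, h t ht, hV.ae_integrableOn, ae_integrableOn_force hg hR hV]
    with ξ h1 h2 h3 h4
  rw [h2]
  exact eq_duhamel_of_integrated (heat a ξ) (V₀ ξ) (y := fun s => V s ξ) ht (h4 t) (h3 t)
    (h1.mono fun s h hs => h hs.1.le)

end Drift

end

section

open FourierTransform

/-! ### Continuity in time -/

section TimeContinuity

variable {d n : ℕ}

lemma shellNorm_sub_comm (j : ℤ) (V W : Dom d → CVal n) :
    shellNorm j (V - W) = shellNorm j (W - V) := eLpNorm_sub_comm _ _ _ _

lemma shellNorm_sub_le_lintegral {G V : ℝ → Dom d → CVal n} {V₀ : Dom d → CVal n}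
    (hG : StronglyMeasurable (Function.uncurry G))
    (hGi : ∀ᵐ ξ, ∀ T : ℝ, IntegrableOn (fun s => G s ξ) (Ioc 0 T))
    (h : ∀ᵐ ξ, ∀ t, 0 ≤ t → V t ξ = V₀ ξ - ∫ s in Ioc 0 t, G s ξ) (j : ℤ) {t₀ t : ℝ}
    (ht₀ : 0 ≤ t₀) (ht : t₀ ≤ t) :
    shellNorm j (V t - V t₀) ≤ ∫⁻ s in Ioc t₀ t, shellNorm j (G s) := by
  have e : V t - V t₀ =ᵐ[volume] fun ξ => -∫ s in Ioc t₀ t, G s ξ := by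
    filter_upwards [h, hGi] with ξ h1 h2
    rw [Pi.sub_apply, h1 t (ht₀.trans ht), h1 t₀ ht₀, ← Ioc_union_Ioc_eq_Ioc ht₀ ht,
      setIntegral_union (Ioc_disjoint_Ioc_of_le le_rfl) measurableSet_Ioc (h2 t₀)
        ((h2 t).mono_set (Ioc_subset_Ioc_left ht₀))]
    abel
  rw [shellNorm_congr e]
  refine shellNorm_le_lintegral hG j _ fun ξ _ => ?_
  rw [enorm_neg]
  exact enorm_integral_le_lintegral_enorm _

/-- Absolute continuity of the integral; the minimum and maximum treat times before and after t
together. -/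
lemma tendsto_lintegral_Ioc_zero {φ : ℝ → ℝ≥0∞} {t : ℝ} (ht : 0 ≤ t)
    (hφ : ∫⁻ s in Ioc 0 (t + 1), φ s ≠ ⊤) :
    Tendsto (fun τ => ∫⁻ s in Ioc (min τ t) (max τ t), φ s) (𝓝[Ici 0] t) (𝓝 0) := by
  have hvol : Tendsto (fun τ : ℝ => volume (Ioc (min τ t) (max τ t))) (𝓝[Ici 0] t) (𝓝 0) := by
    have h1 : Continuous fun τ : ℝ => ENNReal.ofReal (max τ t - min τ t) :=
      ENNReal.continuous_ofReal.comp (by fun_prop)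
    have h2 := (h1.tendsto t).mono_left (nhdsWithin_le_nhds (s := Ici 0))
    simp only [max_self, min_self, sub_self, ENNReal.ofReal_zero] at h2
    simpa only [Real.volume_Ioc] using h2
  have h3 := tendsto_setLIntegral_zero (μ := volume.restrict (Ioc 0 (t + 1))) (f := φ) hφ
    (s := fun τ : ℝ => Ioc (min τ t) (max τ t)) (l := 𝓝[Ici 0] t)
    (tendsto_of_tendsto_of_tendsto_of_le_of_le tendsto_const_nhds hvol (fun _ => zero_le)
      fun τ => Measure.restrict_apply_le _ _)
  refine h3.congr' ?_
  have h4 : ∀ᶠ τ in 𝓝[Ici 0] t, τ < t + 1 :=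
    nhdsWithin_le_nhds (Iio_mem_nhds (lt_add_one t))
  filter_upwards [h4, self_mem_nhdsWithin] with τ h5 h6
  rw [Measure.restrict_restrict measurableSet_Ioc, inter_eq_left.2]
  exact Ioc_subset_Ioc (le_min h6 ht) (max_le h5.le (by linarith))

lemma shellNorm_heat_smul_le {a : Fin d → ℝ} {C : ℝ} (hC0 : 0 < C)
    (hC : ∀ ξ : Dom d, 0 ≤ heat a ξ ∧ heat a ξ ≤ C * ‖ξ‖ ^ 2) (j : ℤ) (V : Dom d → CVal n) :
    shellNorm j (fun ξ => heat a ξ • V ξ) ≤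
      ENNReal.ofReal (C * (2 ^ (j + 1)) ^ 2) * shellNorm j V := by
  refine shellNorm_le_of_le fun ξ hξ => ?_
  rw [norm_smul, Real.norm_of_nonneg (hC ξ).1]
  refine mul_le_mul_of_nonneg_right ((hC ξ).2.trans ?_) (norm_nonneg _)
  have := hξ.2
  gcongr

variable [NeZero d]

lemma weight_ne_zero (d : ℕ) (j : ℤ) : weight d j ≠ 0 := by
  rw [weight]
  have : (0 : ℝ≥0∞) < (2 : ℝ≥0∞) ^ ((j : ℝ) * (d / 2)) := ENNReal.rpow_pos (by simp) (by simp)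
  exact (this.trans_le le_add_self).ne'

lemma weight_ne_top (d : ℕ) (j : ℤ) : weight d j ≠ ⊤ := by
  rw [weight]
  exact ENNReal.add_ne_top.2 ⟨ENNReal.rpow_ne_top_of_ne_zero (by simp) (by simp),
    ENNReal.rpow_ne_top_of_ne_zero (by simp) (by simp)⟩

lemma shellSup_ne_top {V : ℝ → Dom d → CVal n} (hE : energy V ≠ ⊤) (j : ℤ) : shellSup j V ≠ ⊤ := by
  intro h
  have := ENNReal.ne_top_of_tsum_ne_top hE j
  rw [h, top_add, ENNReal.mul_top (weight_ne_zero d j)] at this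
  exact this rfl

/-- Solutions of the integrated equation with finite energy are continuous in time. -/
lemma tendsto_dataNorm_sub {a : Fin d → ℝ} (ha : ∀ i, 0 < a i) {g : Fin d → Val n → Val n}
    (hg : IsFlux g) {R : ℝ} (hR : 0 < R) {V : ℝ → Dom d → CVal n} (hV : IsTraj R V)
    {V₀ : Dom d → CVal n} (hE : energy V ≠ ⊤)
    (hF : ∫⁻ t in Ioi 0, dataNorm (force g (V t)) ≠ ⊤)
    (h : ∀ᵐ ξ, ∀ t, 0 ≤ t → V t ξ = V₀ ξ - ∫ s in Ioc 0 t, drift a g (V s) ξ) {t : ℝ} (ht : 0 ≤ t) :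
    Tendsto (fun τ => dataNorm (V τ - V t)) (𝓝[Ici 0] t) (𝓝 0) := by
  obtain ⟨c, C, hc0, hC0, hc⟩ := exists_heat_bounds ha
  have hfm := stronglyMeasurable_force hg hV.sm
  -- On a single shell the heat symbol is bounded, so the shell norm of the drift is locally
  -- integrable in time.
  have hshell : ∀ j : ℤ, Tendsto (fun τ => shellNorm j (V τ - V t)) (𝓝[Ici 0] t) (𝓝 0) := by
    intro j
    have hFj : shellInt j (fun s => force g (V s)) ≠ ⊤ := by
      intro hj
      rw [lintegral_dataNorm_eq hfm] at hF
      have := ENNReal.ne_top_of_tsum_ne_top hF j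
      rw [hj, ENNReal.mul_top (weight_ne_zero d j)] at this
      exact this rfl
    set φ : ℝ → ℝ≥0∞ := fun s => shellNorm j (drift a g (V s)) with hφ
    have hφb : ∀ s, 0 ≤ s → φ s ≤ ENNReal.ofReal (C * (2 ^ (j + 1)) ^ 2) * shellSup j V +
        shellNorm j (force g (V s)) := fun s hs => by
      have hm1 : AEStronglyMeasurable (fun ξ => heat a ξ • V s ξ) volume :=
        ((continuous_heat a).stronglyMeasurable.smul
          (stronglyMeasurable_slice hV.sm s)).aestronglyMeasurable
      refine (shellNorm_add_le hm1
        (stronglyMeasurable_slice hfm s).aestronglyMeasurable j).trans (add_le_add ?_ le_rfl)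
      exact (shellNorm_heat_smul_le hC0 (fun ξ => ⟨heat_nonneg ha ξ, (hc ξ).2⟩) j (V s)).trans
        (mul_le_mul_right (shellNorm_le_shellSup j V hs) _)
    have hφi : ∫⁻ s in Ioc 0 (t + 1), φ s ≠ ⊤ := by
      refine ne_top_of_le_ne_top ?_ (setLIntegral_mono' measurableSet_Ioc fun s hs => hφb s hs.1.le)
      rw [lintegral_add_left measurable_const]
      refine ENNReal.add_ne_top.2 ⟨?_, ne_top_of_le_ne_top hFj
        (lintegral_mono_set Ioc_subset_Ioi_self)⟩
      have := shellSup_ne_top hE j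
      rw [setLIntegral_const, Real.volume_Ioc]
      finiteness
    refine tendsto_of_tendsto_of_tendsto_of_le_of_le' tendsto_const_nhds
      (tendsto_lintegral_Ioc_zero ht hφi) (Eventually.of_forall fun _ => zero_le) ?_
    filter_upwards [self_mem_nhdsWithin] with τ hτ
    have hsub := fun {t₀ t : ℝ} (h₀ : 0 ≤ t₀) (h₁ : t₀ ≤ t) =>
      shellNorm_sub_le_lintegral (stronglyMeasurable_drift a hg hV.sm)
        (hV.ae_integrableOn_drift a hg hR) h j h₀ h₁
    rcases le_total t τ with h1 | h1
    · rw [min_eq_right h1, max_eq_left h1]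
      exact hsub ht h1
    · rw [min_eq_left h1, max_eq_right h1, shellNorm_sub_comm]
      exact hsub hτ h1
  -- The energy takes the supremum in time before the sum over shells. It therefore supplies a
  -- summable bound independent of τ, and dominated convergence over j concludes.
  have hdom : ∀ τ ∈ Ici (0 : ℝ), ∀ j : ℤ, weight d j * shellNorm j (V τ - V t) ≤
      2 * (weight d j * (shellSup j V + (2 : ℝ≥0∞) ^ ((j : ℝ) * 2) * shellInt j V)) := by
    intro τ hτ j
    have hs := fun s => (stronglyMeasurable_slice hV.sm s).aestronglyMeasurable (μ := volume)
    rw [mul_left_comm]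
    refine mul_le_mul_right ?_ _
    refine (shellNorm_sub_le (hs τ) (hs t) j).trans ?_
    rw [two_mul]
    exact add_le_add ((shellNorm_le_shellSup j V hτ).trans le_self_add)
      ((shellNorm_le_shellSup j V ht).trans le_self_add)
  simp only [dataNorm_eq, ← lintegral_count]
  rw [← lintegral_zero (μ := (Measure.count : Measure ℤ))]
  refine tendsto_lintegral_filter_of_dominated_convergence _
    (Eventually.of_forall fun τ => measurable_from_top)
    (eventually_mem_nhdsWithin.mono fun τ hτ => Eventually.of_forall (hdom τ hτ)) ?_
    (Eventually.of_forall fun j => ?_)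
  · rw [lintegral_count, ENNReal.tsum_mul_left]
    exact ENNReal.mul_ne_top (by simp) hE
  · have h1 := ENNReal.Tendsto.const_mul (hshell j) (Or.inr (weight_ne_top d j))
    rwa [mul_zero] at h1

lemma tendsto_lintegral_sub {V : ℝ → Dom d → CVal n} (hV : StronglyMeasurable (Function.uncurry V))
    {l : Filter ℝ} {t : ℝ} (h : Tendsto (fun τ => dataNorm (V τ - V t)) l (𝓝 0)) :
    Tendsto (fun τ => ∫⁻ ξ, ‖V τ ξ - V t ξ‖ₑ) l (𝓝 0) := by
  have h1 := ENNReal.Tendsto.const_mul h (Or.inr (massConst_ne_top (d := d)))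
  rw [mul_zero] at h1
  refine tendsto_of_tendsto_of_tendsto_of_le_of_le tendsto_const_nhds h1 (fun _ => zero_le)
    fun τ => ?_
  have hm := ((stronglyMeasurable_slice hV τ).sub (stronglyMeasurable_slice hV t))
  exact (lintegral_le_specNorm hm.aestronglyMeasurable).trans (mul_le_mul_right le_add_self _)

end TimeContinuity

/-! ### The weak form of the equation -/

section Weak

variable {d n : ℕ} [NeZero d]

/-- The decay of a Schwartz function absorbs the quadratic growth of the heat symbol and the linear
growth of the derivatives. -/
lemma exists_pairing_bound {a : Fin d → ℝ} (ha : ∀ i, 0 < a i) (m : 𝓢(Dom d, ℂ)) :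
    ∃ B : ℝ≥0∞, B ≠ ⊤ ∧ ∀ (ξ : Dom d) (x : CVal n) (y : Fin d → CVal n),
      ‖m ξ • (heat a ξ • x + ∑ i, derivSymbol (coordVec i) ξ • y i)‖ₑ ≤
        B * (‖x‖ₑ + ∑ i, ‖y i‖ₑ) := by
  obtain ⟨c, C, hc0, hC0, hc⟩ := exists_heat_bounds ha
  obtain ⟨D1, hD1, h1⟩ := m.decay 1 0
  obtain ⟨D2, hD2, h2⟩ := m.decay 2 0
  simp only [norm_iteratedFDeriv_zero, pow_one] at h1 h2
  set B : ℝ := C * D2 + 2 * Real.pi * D1 with hB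
  refine ⟨ENNReal.ofReal B, ENNReal.ofReal_ne_top, fun ξ x y => ?_⟩
  rw [smul_add, Finset.smul_sum, mul_add, Finset.mul_sum]
  refine (enorm_add_le _ _).trans (add_le_add ?_ ((enorm_sum_le _ _).trans
    (Finset.sum_le_sum fun i _ => ?_)))
  · rw [enorm_smul, enorm_smul, ← mul_assoc]
    refine mul_le_mul_left ?_ _
    rw [Real.enorm_eq_ofReal (heat_nonneg ha ξ), ← ofReal_norm,
      ← ENNReal.ofReal_mul (norm_nonneg _)]
    refine ENNReal.ofReal_le_ofReal ?_
    calc ‖m ξ‖ * heat a ξ ≤ ‖m ξ‖ * (C * ‖ξ‖ ^ 2) := by gcongr; exact (hc ξ).2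
      _ = C * (‖ξ‖ ^ 2 * ‖m ξ‖) := by ring
      _ ≤ C * D2 := by gcongr; exact h2 ξ
      _ ≤ B := by
        have := Real.pi_pos
        have : 0 ≤ 2 * Real.pi * D1 := by positivity
        linarith
  · rw [enorm_smul, enorm_smul, ← mul_assoc]
    refine mul_le_mul_left ?_ _
    rw [← ofReal_norm, ← ofReal_norm, ← ENNReal.ofReal_mul (norm_nonneg _)]
    refine ENNReal.ofReal_le_ofReal ?_
    calc ‖m ξ‖ * ‖derivSymbol (coordVec i) ξ‖ ≤ ‖m ξ‖ * (2 * Real.pi * ‖ξ‖) := by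
          gcongr; exact norm_derivSymbol_le (norm_coordVec i) ξ
      _ = 2 * Real.pi * (‖ξ‖ * ‖m ξ‖) := by ring
      _ ≤ 2 * Real.pi * D1 := by gcongr; exact h1 ξ
      _ ≤ B := by
        have : 0 ≤ C * D2 := by positivity
        linarith

variable {a : Fin d → ℝ} {g : Fin d → Val n → Val n} {R : ℝ} {V : ℝ → Dom d → CVal n}

lemma IsTraj.exists_pairing_le (ha : ∀ i, 0 < a i) (hg : IsFlux g) (hR : 0 < R) (hV : IsTraj R V)
    (m : 𝓢(Dom d, ℂ)) :
    ∃ B : ℝ≥0∞, B ≠ ⊤ ∧ ∀ t, 0 ≤ t → ∫⁻ ξ, ‖m ξ • drift a g (V t) ξ‖ₑ ≤ B := by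
  obtain ⟨B, hB, hb⟩ := exists_pairing_bound (n := n) ha m
  obtain ⟨K, hK, hk, -⟩ := hg.exists_bound (d := d) hR
  refine ⟨B * (massConst d * ENNReal.ofReal R +
    ∑ _i : Fin d, massConst d * (K * ENNReal.ofReal R * ENNReal.ofReal R)), ?_, fun t ht => ?_⟩
  · have := massConst_ne_top (d := d)
    refine ENNReal.mul_ne_top hB (ENNReal.add_ne_top.2 ⟨by finiteness,
      ENNReal.sum_ne_top.2 fun _ _ => by finiteness⟩)
  · have hs := stronglyMeasurable_slice hV.sm t
    have hn := fun i => stronglyMeasurable_nonlin_slice hg i hs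
    refine (lintegral_mono fun ξ => hb ξ (V t ξ) fun i => nonlin (g i) (V t) ξ).trans ?_
    rw [lintegral_const_mul' _ _ hB,
      lintegral_add_left hs.enorm, lintegral_finsetSum _ fun i _ => (hn i).enorm]
    refine mul_le_mul_right (add_le_add (hV.lintegral_le ht) (Finset.sum_le_sum fun i _ => ?_)) _
    refine (lintegral_le_specNorm (hn i).aestronglyMeasurable).trans (mul_le_mul_right ?_ _)
    refine (hk (V t) hs.aestronglyMeasurable (hV.bound t ht) i).2.2.1.trans ?_
    have := hV.bound t ht
    gcongr

lemma IsTraj.stronglyMeasurable_pairing (hg : IsFlux g) (hV : IsTraj R V) (m : 𝓢(Dom d, ℂ)) :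
    StronglyMeasurable fun p : ℝ × Dom d => m p.2 • drift a g (V p.1) p.2 := by
  have h1 : StronglyMeasurable fun p : ℝ × Dom d => m p.2 :=
    m.continuous.stronglyMeasurable.comp_measurable measurable_snd
  exact h1.smul (stronglyMeasurable_drift a hg hV.sm)

lemma IsTraj.integrable_pairing (ha : ∀ i, 0 < a i) (hg : IsFlux g) (hR : 0 < R) (hV : IsTraj R V)
    (m : 𝓢(Dom d, ℂ)) {t : ℝ} (ht : 0 ≤ t) : Integrable fun ξ => m ξ • drift a g (V t) ξ := by
  obtain ⟨B, hB, hb⟩ := hV.exists_pairing_le ha hg hR m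
  exact ⟨((hV.stronglyMeasurable_pairing hg m).comp_measurable
    measurable_prodMk_left).aestronglyMeasurable, (hb t ht).trans_lt hB.lt_top⟩

lemma IsTraj.integrable_pairing_prod (ha : ∀ i, 0 < a i) (hg : IsFlux g) (hR : 0 < R)
    (hV : IsTraj R V) (m : 𝓢(Dom d, ℂ)) (t : ℝ) :
    Integrable (Function.uncurry fun (s : ℝ) (ξ : Dom d) => m ξ • drift a g (V s) ξ)
      ((volume.restrict (Ioc 0 t)).prod volume) := by
  obtain ⟨B, hB, hb⟩ := hV.exists_pairing_le ha hg hR m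
  have hm := hV.stronglyMeasurable_pairing (a := a) hg m
  refine ⟨hm.aestronglyMeasurable, ?_⟩
  have hm' : Measurable fun p : ℝ × Dom d => ‖(Function.uncurry fun (s : ℝ) (ξ : Dom d) =>
      m ξ • drift a g (V s) ξ) p‖ₑ := hm.enorm
  rw [HasFiniteIntegral, lintegral_prod _ hm'.aemeasurable]
  exact (setLIntegral_ne_top_of_bound hB hb t).lt_top

/-- The pairing of the integrated drift with a test function. -/
lemma IsTraj.integral_pairing (ha : ∀ i, 0 < a i) (hg : IsFlux g) (hR : 0 < R)
    (hV : IsTraj R V) (m : 𝓢(Dom d, ℂ)) (t : ℝ) :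
    ∫ s in Ioc 0 t, ∫ ξ, m ξ • drift a g (V s) ξ =
      ∫ ξ, m ξ • ∫ s in Ioc 0 t, drift a g (V s) ξ := by
  rw [integral_integral_swap (hV.integrable_pairing_prod ha hg hR m t)]
  simp only [integral_smul]

lemma IsTraj.integrable_pairing_integral (ha : ∀ i, 0 < a i) (hg : IsFlux g) (hR : 0 < R)
    (hV : IsTraj R V) (m : 𝓢(Dom d, ℂ)) (t : ℝ) :
    Integrable fun ξ => m ξ • ∫ s in Ioc 0 t, drift a g (V s) ξ := by
  have h := (hV.integrable_pairing_prod ha hg hR m t).integral_prod_right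
  simpa only [Function.uncurry, integral_smul] using h

/-- The paired drift depends on V in a Lipschitz way for the L¹ norm, because the nonlinear maps do.
-/
lemma IsTraj.continuousOn_pairing (ha : ∀ i, 0 < a i) (hg : IsFlux g) (hR : 0 < R)
    (hV : IsTraj R V)
    (hcont : ∀ t, 0 ≤ t → Tendsto (fun τ => ∫⁻ ξ, ‖V τ ξ - V t ξ‖ₑ) (𝓝[Ici 0] t) (𝓝 0))
    (m : 𝓢(Dom d, ℂ)) : ContinuousOn (fun s => ∫ ξ, m ξ • drift a g (V s) ξ) (Ici 0) := by
  obtain ⟨B, hB, hb⟩ := exists_pairing_bound (n := n) ha m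
  obtain ⟨K, hK, -, hL⟩ := hg.exists_bound (d := d) hR
  intro t ht
  have h1 := ENNReal.Tendsto.const_mul (a := B * (1 + d * K)) (hcont t ht)
    (Or.inr (ENNReal.mul_ne_top hB (by finiteness)))
  rw [mul_zero] at h1
  refine tendsto_iff_edist_tendsto_0.2 (tendsto_of_tendsto_of_tendsto_of_le_of_le'
    tendsto_const_nhds h1 (Eventually.of_forall fun _ => zero_le) ?_)
  filter_upwards [self_mem_nhdsWithin] with τ hτ
  have hs := fun s => stronglyMeasurable_slice hV.sm s
  have hn := fun s i => stronglyMeasurable_nonlin_slice hg i (hs s)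
  rw [edist_eq_enorm_sub, ← integral_sub (hV.integrable_pairing ha hg hR m hτ)
    (hV.integrable_pairing ha hg hR m ht)]
  refine (enorm_integral_le_lintegral_enorm _).trans ?_
  have e : ∀ ξ, m ξ • drift a g (V τ) ξ - m ξ • drift a g (V t) ξ =
      m ξ • (heat a ξ • (V τ ξ - V t ξ) + ∑ i, derivSymbol (coordVec i) ξ •
        (nonlin (g i) (V τ) ξ - nonlin (g i) (V t) ξ)) := fun ξ => by
    simp only [drift, force, ← smul_sub]
    congr 1
    simp only [smul_sub, Finset.sum_sub_distrib]
    abel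
  simp only [e]
  refine (lintegral_mono fun ξ => hb ξ _ _).trans ?_
  have hnm : ∀ i, Measurable fun ξ => ‖nonlin (g i) (V τ) ξ - nonlin (g i) (V t) ξ‖ₑ := fun i =>
    ((hn τ i).sub (hn t i)).enorm
  have hsm : Measurable fun ξ => ‖V τ ξ - V t ξ‖ₑ := ((hs τ).sub (hs t)).enorm
  rw [lintegral_const_mul' _ _ hB,
    lintegral_add_left hsm, lintegral_finsetSum _ fun i _ => hnm i, mul_assoc]
  refine mul_le_mul_right ?_ _
  rw [add_mul, one_mul]
  refine add_le_add le_rfl ?_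
  calc ∑ i, ∫⁻ ξ, ‖nonlin (g i) (V τ) ξ - nonlin (g i) (V t) ξ‖ₑ
      ≤ ∑ _i : Fin d, K * ∫⁻ ξ, ‖V τ ξ - V t ξ‖ₑ := Finset.sum_le_sum fun i _ =>
        hL _ _ (hs τ).aestronglyMeasurable (hs t).aestronglyMeasurable (hV.bound τ hτ)
          (hV.bound t ht) (hV.real τ hτ) (hV.real t ht) i
    _ = _ := by
        rw [Finset.sum_const, Finset.card_univ, Fintype.card_fin, nsmul_eq_mul, mul_assoc]

lemma integrable_schwartzMap_smul (m : 𝓢(Dom d, ℂ)) {U : Dom d → CVal n} (hU : Integrable U) :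
    Integrable fun ξ => m ξ • U ξ := by
  obtain ⟨C, -, hC⟩ := m.decay 0 0
  exact hU.bdd_smul C m.continuous.aestronglyMeasurable
    (Eventually.of_forall fun ξ => by simpa using hC ξ)

lemma IsTraj.integrable (hV : IsTraj R V) {t : ℝ} (ht : 0 ≤ t) : Integrable (V t) :=
  integrable_of_specNorm (stronglyMeasurable_slice hV.sm t).aestronglyMeasurable
    (ne_top_of_le_ne_top ENNReal.ofReal_ne_top (hV.bound t ht))

/-- The integrated equation implies the weak form. -/
lemma IsTraj.hasDerivAt_pairing (ha : ∀ i, 0 < a i) (hg : IsFlux g) (hR : 0 < R)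
    (hV : IsTraj R V)
    (hcont : ∀ t, 0 ≤ t → Tendsto (fun τ => ∫⁻ ξ, ‖V τ ξ - V t ξ‖ₑ) (𝓝[Ici 0] t) (𝓝 0))
    {V₀ : Dom d → CVal n} (hV₀ : Integrable V₀)
    (h : ∀ᵐ ξ, ∀ t, 0 ≤ t → V t ξ = V₀ ξ - ∫ s in Ioc 0 t, drift a g (V s) ξ)
    (m : 𝓢(Dom d, ℂ)) {t : ℝ} (ht : 0 < t) :
    HasDerivAt (fun τ => ∫ ξ, m ξ • V τ ξ) (-∫ ξ, m ξ • drift a g (V t) ξ) t := by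
  have hc := hV.continuousOn_pairing ha hg hR hcont m
  set G : ℝ → CVal n := fun s => ∫ ξ, m ξ • drift a g (V s) ξ with hG
  have e : ∀ τ, 0 ≤ τ → ∫ ξ, m ξ • V τ ξ = (∫ ξ, m ξ • V₀ ξ) - ∫ s in (0 : ℝ)..τ, G s := by
    intro τ hτ
    rw [intervalIntegral.integral_of_le hτ, hV.integral_pairing ha hg hR m τ,
      ← integral_sub (integrable_schwartzMap_smul m hV₀)
        (hV.integrable_pairing_integral ha hg hR m τ)]
    exact integral_congr_ae (h.mono fun ξ hξ => by simp only [hξ τ hτ, smul_sub])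
  have h1 : HasDerivAt (fun τ => ∫ s in (0 : ℝ)..τ, G s) (G t) t := by
    refine intervalIntegral.integral_hasDerivAt_right ?_ ?_ (hc.continuousAt (Ici_mem_nhds ht))
    · exact (hc.mono (by rw [uIcc_of_le ht.le]; exact Icc_subset_Ici_self)).intervalIntegrable
    · exact (hc.mono Ioi_subset_Ici_self).stronglyMeasurableAtFilter isOpen_Ioi t ht
  refine (h1.const_sub (∫ ξ, m ξ • V₀ ξ)).congr_of_eventuallyEq ?_
  filter_upwards [Ici_mem_nhds ht] with τ hτ using e τ hτ

/-- The weak form implies the integrated equation. -/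
lemma IsTraj.integrated_of_hasDerivAt (ha : ∀ i, 0 < a i) (hg : IsFlux g) (hR : 0 < R)
    (hV : IsTraj R V)
    (hcont : ∀ t, 0 ≤ t → Tendsto (fun τ => ∫⁻ ξ, ‖V τ ξ - V t ξ‖ₑ) (𝓝[Ici 0] t) (𝓝 0))
    (h : ∀ (m : 𝓢(Dom d, ℂ)) (t : ℝ), 0 < t →
      HasDerivAt (fun τ => ∫ ξ, m ξ • V τ ξ) (-∫ ξ, m ξ • drift a g (V t) ξ) t)
    {t : ℝ} (ht : 0 ≤ t) :
    ∀ᵐ ξ, V t ξ = V 0 ξ - ∫ s in Ioc 0 t, drift a g (V s) ξ := by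
  have hint : ∀ m : 𝓢(Dom d, ℂ), ∫ ξ, m ξ • (V 0 ξ - V t ξ) =
      ∫ ξ, m ξ • ∫ s in Ioc 0 t, drift a g (V s) ξ := by
    intro m
    have hc := hV.continuousOn_pairing ha hg hR hcont m
    have hcV : ContinuousOn (fun τ => ∫ ξ, m ξ • V τ ξ) (Icc 0 t) := by
      obtain ⟨C, hC0, hC⟩ := m.decay 0 0
      simp only [pow_zero, one_mul, norm_iteratedFDeriv_zero] at hC
      intro s hs
      have h1 := ENNReal.Tendsto.const_mul (a := ENNReal.ofReal C) (hcont s hs.1)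
        (Or.inr ENNReal.ofReal_ne_top)
      rw [mul_zero] at h1
      refine ContinuousWithinAt.mono (t := Ici 0) ?_ Icc_subset_Ici_self
      refine tendsto_iff_edist_tendsto_0.2 (tendsto_of_tendsto_of_tendsto_of_le_of_le'
        tendsto_const_nhds h1 (Eventually.of_forall fun _ => zero_le) ?_)
      filter_upwards [self_mem_nhdsWithin] with τ hτ
      rw [edist_eq_enorm_sub, ← integral_sub (integrable_schwartzMap_smul m (hV.integrable hτ))
        (integrable_schwartzMap_smul m (hV.integrable hs.1))]
      refine (enorm_integral_le_lintegral_enorm _).trans ?_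
      rw [← lintegral_const_mul' _ _ ENNReal.ofReal_ne_top]
      refine lintegral_mono fun ξ => ?_
      rw [← smul_sub, enorm_smul]
      refine mul_le_mul_left ?_ _
      rw [← ofReal_norm]
      exact ENNReal.ofReal_le_ofReal (hC ξ)
    -- The weak equation is known for positive times only; continuity up to time zero makes the
    -- fundamental theorem of calculus valid on [0, t].
    have h2 := intervalIntegral.integral_eq_sub_of_hasDerivAt_of_le ht hcV
      (fun s hs => h m s hs.1)
      (hc.neg.mono (by rw [uIcc_of_le ht]; exact Icc_subset_Ici_self)).intervalIntegrable
    rw [intervalIntegral.integral_neg, intervalIntegral.integral_of_le ht,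
      hV.integral_pairing ha hg hR m t] at h2
    have h3 := integral_sub (integrable_schwartzMap_smul m (hV.integrable le_rfl))
      (integrable_schwartzMap_smul m (hV.integrable ht))
    simp only [smul_sub]
    rw [h3, ← neg_sub, ← h2, neg_neg]
  -- The drift may have infinite mass. Integrability is known after multiplication by a Schwartz
  -- function, and a bump equal to one near a point gives it locally.
  have hloc : LocallyIntegrable fun ξ => ∫ s in Ioc 0 t, drift a g (V s) ξ := by
    intro ξ₀
    obtain ⟨φ, hφ1, -, hφc, hφ⟩ : ∃ φ : Dom d → ℝ, (∀ ξ ∈ Metric.closedBall ξ₀ 1, φ ξ = 1) ∧ True ∧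
        HasCompactSupport φ ∧ ContDiff ℝ (⊤ : ℕ∞) φ := by
      let b : ContDiffBump ξ₀ := ⟨1, 2, one_pos, one_lt_two⟩
      exact ⟨b, fun ξ hξ => b.one_of_mem_closedBall hξ, trivial, b.hasCompactSupport, b.contDiff⟩
    have hφ₁ : HasCompactSupport (Complex.ofRealCLM ∘ φ) := hφc.comp_left rfl
    have hφ₂ : ContDiff ℝ (⊤ : ℕ∞) (Complex.ofRealCLM ∘ φ) := by fun_prop
    have h1 := hV.integrable_pairing_integral (a := a) ha hg hR (hφ₁.toSchwartzMap hφ₂) t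
    refine ⟨Metric.closedBall ξ₀ 1, Metric.closedBall_mem_nhds ξ₀ one_pos, ?_⟩
    refine h1.integrableOn.congr_fun (fun ξ hξ => ?_) Metric.isClosed_closedBall.measurableSet
    have : (hφ₁.toSchwartzMap hφ₂ : 𝓢(Dom d, ℂ)) ξ = 1 := by
      change ((φ ξ : ℝ) : ℂ) = 1
      rw [hφ1 ξ hξ, Complex.ofReal_one]
    simp only [this, one_smul]

  have h4 := ae_eq_of_schwartz
    ((hV.integrable le_rfl).sub (hV.integrable ht)).locallyIntegrable hloc hint
  filter_upwards [h4] with ξ hξ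
  rw [← hξ, Pi.sub_apply, sub_sub_cancel]

end Weak

end

section

open FourierTransform

/-! ### The terms of the equation on the Fourier side -/

section Terms

variable {d n : ℕ}

/-- The minus sign in the distributional derivative compensates that of the inverse transform,
leaving exactly the symbol. -/
lemma fourierInv_neg_lineDeriv (e : Dom d) (ψ : 𝓢(Dom d, ℂ)) (ξ : Dom d) :
    (𝓕⁻ (-∂_{e} ψ) : 𝓢(Dom d, ℂ)) ξ = derivSymbol e ξ * (𝓕⁻ ψ : 𝓢(Dom d, ℂ)) ξ := by
  have ht : (fun ξ : Dom d => (inner ℝ ξ e : ℝ)).HasTemperateGrowth := by fun_prop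
  have h1 : 𝓕⁻ (-∂_{e} ψ) = -(𝓕⁻ (∂_{e} ψ) : 𝓢(Dom d, ℂ)) := by
    simp
  rw [h1, SchwartzMap.fourierInv_lineDerivOp_eq]
  simp [SchwartzMap.smulLeftCLM_apply_apply ht, derivSymbol, mul_assoc]

lemma partialD_apply (i : Fin d) (T : 𝓢'(Dom d, CVal n)) (ψ : 𝓢(Dom d, ℂ)) :
    partialD i T ψ = T (-∂_{coordVec i} ψ) := rfl

lemma partialD_specDist_apply (i : Fin d) {V : Dom d → CVal n} (hV : Integrable V)
    (ψ : 𝓢(Dom d, ℂ)) : partialD i (specDist V) ψ =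
      ∫ ξ, (𝓕⁻ ψ : 𝓢(Dom d, ℂ)) ξ • derivSymbol (coordVec i) ξ • V ξ := by
  rw [partialD_apply, specDist_apply hV]
  simp only [fourierInv_neg_lineDeriv, smul_smul, mul_comm]

lemma partialD_add (i : Fin d) (S T : 𝓢'(Dom d, CVal n)) :
    partialD i (S + T) = partialD i S + partialD i T := by
  ext1 ψ
  rfl

lemma integral_lineDeriv_eq_zero (e : Dom d) (ψ : 𝓢(Dom d, ℂ)) : ∫ x, (∂_{e} ψ) x = 0 := by
  have h : (𝓕⁻ (-∂_{e} ψ) : 𝓢(Dom d, ℂ)) 0 = ∫ x, (-∂_{e} ψ) x := by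
    rw [SchwartzMap.fourierInv_coe, Real.fourierInv_eq]
    simp
  rw [fourierInv_neg_lineDeriv] at h
  have h0 : derivSymbol e 0 = 0 := by simp [derivSymbol]
  rw [h0, zero_mul] at h
  have h1 : ∫ x, (-∂_{e} ψ) x = -∫ x, (∂_{e} ψ) x := integral_neg _
  rw [h1] at h
  simpa using h.symm

lemma partialD_constDist (i : Fin d) (y : Val n) : partialD i (constDist d y) = 0 := by
  ext1 ψ
  rw [partialD_apply, map_neg, constDist, distOf_apply]
  simp only [BoundedContinuousFunction.const_apply]
  rw [integral_smul_const, integral_lineDeriv_eq_zero, zero_smul, neg_zero]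
  rfl

/-- The bounded continuous function with values in `ℝ^n` obtained by adding a constant to the
inverse Fourier transform of an integrable function. -/
def stateOf (ubar : Val n) (V : Dom d → CVal n) (hV : Integrable V) : Dom d →ᵇ Val n :=
  BoundedContinuousFunction.ofNormedAddCommGroup (fun x => ubar + realPart (𝓕⁻ V x))
    (continuous_const.add (realPart.continuous.comp (continuous_fourierInv hV)))
    (‖ubar‖ + ‖(realPart : CVal n →L[ℝ] Val n)‖ * ∫ ξ, ‖V ξ‖) fun x => by
      refine (norm_add_le _ _).trans ?_
      gcongr
      exact (realPart.le_opNorm _).trans (by gcongr; exact norm_fourierInv_le V x)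

@[simp] lemma stateOf_apply (ubar : Val n) (V : Dom d → CVal n) (hV : Integrable V) (x : Dom d) :
    stateOf ubar V hV x = ubar + realPart (𝓕⁻ V x) := rfl

/-- The flux of the perturbation `y = u - ubar`. -/
def fluxPert (f : Fin d → C(Val n, Val n)) (ubar : Val n) (i : Fin d) (y : Val n) : Val n :=
  f i (ubar + y) - f i ubar

lemma isFlux_fluxPert {f : Fin d → C(Val n, Val n)} (hf : ∀ i, ContDiff ℝ (⊤ : ℕ∞) (f i))
    {ubar : Val n} (hf1 : ∀ i, fderiv ℝ (f i) ubar = 0) : IsFlux (fluxPert f ubar) where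
  smooth i := ((hf i).comp (contDiff_const.add contDiff_id)).sub contDiff_const
  map_zero i := by simp [fluxPert]
  fderiv_zero i := by
    have h : fluxPert f ubar i = fun y => f i (ubar + y) - f i ubar := rfl
    rw [h, fderiv_sub_const, fderiv_comp_add_left, add_zero, hf1 i]

variable {ubar : Val n} {v : Dom d →ᵇ Val n} {V : Dom d → CVal n}

lemma distOf_sub_constDist (hV : Integrable V) (h : ∀ x, complexify (v x - ubar) = 𝓕⁻ V x) :
    distOf v - constDist d ubar = specDist V := by
  rw [constDist, distOf_sub, distOf_eq_specDist_iff hV]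
  exact h

lemma distOf_eq_add (hV : Integrable V) (h : ∀ x, complexify (v x - ubar) = 𝓕⁻ V x) :
    distOf v = constDist d ubar + specDist V := by
  rw [← distOf_sub_constDist hV h, add_sub_cancel]

variable {f : Fin d → C(Val n, Val n)} {i : Fin d} {N : Dom d → CVal n}

lemma distOf_comp_sub_constDist (h : ∀ x, complexify (v x - ubar) = 𝓕⁻ V x) (hN : Integrable N)
    (hNx : ∀ x, 𝓕⁻ N x = complexify (fluxPert f ubar i (realPart (𝓕⁻ V x)))) :
    distOf (comp (f i) v) - constDist d (f i ubar) = specDist N := by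
  refine distOf_sub_constDist hN fun x => ?_
  rw [hNx, ← h, realPart_complexify, fluxPert, add_sub_cancel, comp_apply]

lemma convection_eq (h : ∀ x, complexify (v x - ubar) = 𝓕⁻ V x) (hN : Integrable N)
    (hNx : ∀ x, 𝓕⁻ N x = complexify (fluxPert f ubar i (realPart (𝓕⁻ V x)))) :
    convection f i v = partialD i (specDist N) := by
  rw [convection, ← distOf_comp_sub_constDist h hN hNx]
  conv_lhs => rw [← sub_add_cancel (distOf (comp (f i) v)) (constDist d (f i ubar))]
  rw [partialD_add, partialD_constDist, add_zero]

lemma diffusion_eq (a : Fin d → ℝ) (hV : Integrable V)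
    (h : ∀ x, complexify (v x - ubar) = 𝓕⁻ V x) :
    diffusion a i v = partialD i ((a i : ℂ) • partialD i (specDist V)) := by
  rw [diffusion, distOf_eq_add hV h, partialD_add, partialD_constDist, zero_add]

lemma derivSymbol_coordVec (i : Fin d) (ξ : Dom d) :
    derivSymbol (coordVec i) ξ = 2 * Real.pi * Complex.I * (ξ i : ℝ) := by
  rw [derivSymbol, inner_coordVec]

lemma heat_eq_sum (a : Fin d → ℝ) (ξ : Dom d) :
    ((heat a ξ : ℝ) : ℂ) = -∑ i, (a i : ℂ) * derivSymbol (coordVec i) ξ ^ 2 := by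
  simp only [derivSymbol_coordVec, heat]
  push_cast
  rw [Finset.mul_sum, ← Finset.sum_neg_distrib]
  refine Finset.sum_congr rfl fun i _ => ?_
  linear_combination (4 * (a i : ℂ) * Real.pi ^ 2 * (ξ i : ℂ) ^ 2) * Complex.I_sq

variable [NeZero d]

/-- The spatial part of the equation, tested against a Schwartz function. -/
lemma rhs_apply (a : Fin d → ℝ) (hV : Integrable V)
    (h : ∀ x, complexify (v x - ubar) = 𝓕⁻ V x)
    (hN : ∀ i, Integrable (nonlin (fluxPert f ubar i) V))
    (hNx : ∀ i x, 𝓕⁻ (nonlin (fluxPert f ubar i) V) x =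
      complexify (fluxPert f ubar i (realPart (𝓕⁻ V x)))) (ψ : 𝓢(Dom d, ℂ)) :
    (∑ i, diffusion a i v - ∑ i, convection f i v) ψ =
      -∫ ξ, (𝓕⁻ ψ : 𝓢(Dom d, ℂ)) ξ • drift a (fluxPert f ubar) V ξ := by
  set m : 𝓢(Dom d, ℂ) := 𝓕⁻ ψ with hm
  have hd : ∀ i, diffusion a i v ψ =
      ∫ ξ, (m ξ * ((a i : ℂ) * derivSymbol (coordVec i) ξ ^ 2)) • V ξ := fun i => by
    rw [diffusion_eq a hV h, partialD_apply]
    change (a i : ℂ) • (partialD i (specDist V) (-∂_{coordVec i} ψ)) = _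
    rw [partialD_specDist_apply i hV, ← integral_smul]
    simp only [fourierInv_neg_lineDeriv, smul_smul]
    refine integral_congr_ae (Eventually.of_forall fun ξ => ?_)
    simp only [hm]
    congr 1
    ring
  have hdi : ∀ i, Integrable fun ξ =>
      (m ξ * ((a i : ℂ) * derivSymbol (coordVec i) ξ ^ 2)) • V ξ := fun i => by
    have h1 := (integrable_schwartzMap_smul
      (𝓕⁻ (-∂_{coordVec i} (-∂_{coordVec i} ψ)) : 𝓢(Dom d, ℂ)) hV).smul (a i : ℂ)
    refine h1.congr (Eventually.of_forall fun ξ => ?_)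
    simp only [Pi.smul_apply, fourierInv_neg_lineDeriv, smul_smul, hm]
    congr 1
    ring
  have hc : ∀ i, convection f i v ψ =
      ∫ ξ, m ξ • derivSymbol (coordVec i) ξ • nonlin (fluxPert f ubar i) V ξ := fun i => by
    rw [convection_eq h (hN i) (hNx i), partialD_specDist_apply i (hN i)]
  have hci : ∀ i, Integrable fun ξ =>
      m ξ • derivSymbol (coordVec i) ξ • nonlin (fluxPert f ubar i) V ξ := fun i => by
    have h1 := integrable_schwartzMap_smul (𝓕⁻ (-∂_{coordVec i} ψ) : 𝓢(Dom d, ℂ)) (hN i)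
    refine h1.congr (Eventually.of_forall fun ξ => ?_)
    simp only [fourierInv_neg_lineDeriv, smul_smul, hm, mul_comm]
  have hsum : (∑ i, diffusion a i v - ∑ i, convection f i v) ψ =
      ∑ i, diffusion a i v ψ - ∑ i, convection f i v ψ := by
    have hs : ∀ T : Fin d → 𝓢'(Dom d, CVal n), (∑ i, T i) ψ = ∑ i, T i ψ := fun T => by
      induction (Finset.univ : Finset (Fin d)) using Finset.induction_on with
      | empty => rfl
      | insert i s hi ih => rw [Finset.sum_insert hi, Finset.sum_insert hi, ← ih]; rfl
    rw [← hs, ← hs]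
    rfl
  rw [hsum]
  simp only [hd, hc]
  rw [← integral_finsetSum _ fun i _ => hdi i, ← integral_finsetSum _ fun i _ => hci i,
    ← integral_sub (integrable_finsetSum _ fun i _ => hdi i)
      (integrable_finsetSum _ fun i _ => hci i), ← integral_neg]
  refine integral_congr_ae (Eventually.of_forall fun ξ => ?_)
  simp only [drift, force]
  rw [← Finset.sum_smul, ← Finset.mul_sum, ← Finset.smul_sum, ← Complex.coe_smul (heat a ξ),
    heat_eq_sum, smul_add, neg_add, neg_smul, smul_neg, neg_neg, smul_smul, sub_eq_add_neg]

end Terms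

/-! ### Besov norms of the terms of the equation -/

section TermNorms

variable {d n : ℕ} {χ : Dom d → ℝ}

lemma specNorm_derivSymbol_smul_le (i : Fin d) (s : ℝ) (V : Dom d → CVal n) :
    specNorm s (fun ξ => derivSymbol (coordVec i) ξ • V ξ) ≤
      ENNReal.ofReal (4 * Real.pi) * specNorm (s + 1) V := by
  have h := specNorm_mul_pow_le (V := V) (W := fun ξ => derivSymbol (coordVec i) ξ • V ξ)
    (c := 2 * Real.pi) (by positivity) 1 s fun ξ => by
      rw [norm_smul, pow_one]
      gcongr
      exact norm_derivSymbol_le (norm_coordVec i) ξ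
  refine h.trans (le_of_eq ?_)
  rw [Nat.cast_one]
  congr 2
  ring

variable [NeZero d]

lemma capNorm_specDist_le (hχ : IsCutoff χ) (s s' : ℝ) {V : Dom d → CVal n} (hV : Integrable V) :
    capNorm χ s s' (specDist V) ≤
      (shiftConst s + shiftConst s') * (specNorm s V + specNorm s' V) := by
  refine (add_le_add (besovNorm_specDist_le hχ s hV) (besovNorm_specDist_le hχ s' hV)).trans ?_
  rw [mul_add]
  exact add_le_add (mul_le_mul_left le_self_add _) (mul_le_mul_left le_add_self _)

lemma dataNorm_le_capNorm (hχ : IsCutoff χ) {V : Dom d → CVal n} (hV : Integrable V) :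
    dataNorm V ≤ (shiftConst ((d : ℝ) / 2 - 1) + shiftConst ((d : ℝ) / 2)) *
      capNorm χ ((d : ℝ) / 2 - 1) ((d : ℝ) / 2) (specDist V) := by
  refine (add_le_add (specNorm_le_besovNorm hχ _ hV) (specNorm_le_besovNorm hχ _ hV)).trans ?_
  rw [capNorm, mul_add]
  exact add_le_add (mul_le_mul_left le_self_add _) (mul_le_mul_left le_add_self _)

lemma integrable_derivSymbol_smul (i : Fin d) {V : Dom d → CVal n} (hV : AEStronglyMeasurable V)
    (h : specNorm (d / 2 + 1 : ℝ) V ≠ ⊤) :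
    Integrable fun ξ => derivSymbol (coordVec i) ξ • V ξ :=
  integrable_of_specNorm ((continuous_derivSymbol (coordVec i)).aestronglyMeasurable.smul hV)
    (ne_top_of_le_ne_top (ENNReal.mul_ne_top ENNReal.ofReal_ne_top h)
      (specNorm_derivSymbol_smul_le i _ V))

lemma partialD_specDist_eq (i : Fin d) {V : Dom d → CVal n} (hV : Integrable V)
    (h : specNorm (d / 2 + 1 : ℝ) V ≠ ⊤) :
    partialD i (specDist V) = specDist fun ξ => derivSymbol (coordVec i) ξ • V ξ :=
  lineDeriv_specDist _ hV (integrable_derivSymbol_smul i hV.1 h)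

lemma smul_specDist (c : ℂ) {V : Dom d → CVal n} (hV : Integrable V) :
    c • specDist V = specDist fun ξ => c • V ξ := by
  have hcV : Integrable fun ξ => c • V ξ := hV.smul c
  ext1 ψ
  rw [specDist_apply hcV]
  change c • specDist V ψ = _
  rw [specDist_apply hV, ← integral_smul]
  simp only [smul_comm c]

lemma specNorm_const_smul_le (c : ℂ) (s : ℝ) (V : Dom d → CVal n) :
    specNorm s (fun ξ => c • V ξ) ≤ ‖c‖ₑ * specNorm s V := by
  rw [specNorm, specNorm, ← ENNReal.tsum_mul_left]
  refine ENNReal.tsum_le_tsum fun j => ?_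
  rw [mul_left_comm]
  exact mul_le_mul_right (eLpNorm_const_smul_le (c := c) (f := V)) _

/-- The Besov norm of a first derivative. -/
lemma capNorm_partialD_le (hχ : IsCutoff χ) (i : Fin d) (s s' : ℝ) {V : Dom d → CVal n}
    (hV : Integrable V) (h : specNorm (d / 2 + 1 : ℝ) V ≠ ⊤) :
    capNorm χ s s' (partialD i (specDist V)) ≤ (shiftConst s + shiftConst s') *
      (ENNReal.ofReal (4 * Real.pi) * (specNorm (s + 1) V + specNorm (s' + 1) V)) := by
  rw [partialD_specDist_eq i hV h]
  refine (capNorm_specDist_le hχ s s' (integrable_derivSymbol_smul i hV.1 h)).trans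
    (mul_le_mul_right ?_ _)
  rw [mul_add]
  exact add_le_add (specNorm_derivSymbol_smul_le i s V) (specNorm_derivSymbol_smul_le i s' V)

/-- The Besov norm of a second derivative. -/
lemma capNorm_partialD_smul_partialD_le (hχ : IsCutoff χ) (i : Fin d) (c : ℂ)
    {V : Dom d → CVal n} (hV : Integrable V)
    (h : specNorm (d / 2 + 1 : ℝ) V + specNorm (d / 2 + 2 : ℝ) V ≠ ⊤) :
    capNorm χ ((d : ℝ) / 2 - 1) ((d : ℝ) / 2) (partialD i (c • partialD i (specDist V))) ≤
      (shiftConst ((d : ℝ) / 2 - 1) + shiftConst ((d : ℝ) / 2)) * (ENNReal.ofReal (4 * Real.pi) *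
        (‖c‖ₑ * (ENNReal.ofReal (4 * Real.pi) *
          (specNorm (d / 2 + 1 : ℝ) V + specNorm (d / 2 + 2 : ℝ) V)))) := by
  have h1 := (ENNReal.add_ne_top.1 h).1
  have h2 := (ENNReal.add_ne_top.1 h).2
  have hi := integrable_derivSymbol_smul i hV.1 h1
  have hs : ∀ s : ℝ, specNorm s (fun ξ => c • derivSymbol (coordVec i) ξ • V ξ) ≤
      ‖c‖ₑ * (ENNReal.ofReal (4 * Real.pi) * specNorm (s + 1) V) := fun s =>
    (specNorm_const_smul_le c s _).trans
      (mul_le_mul_right (specNorm_derivSymbol_smul_le i s V) _)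
  have e2 : (d / 2 + 1 + 1 : ℝ) = d / 2 + 2 := by ring
  rw [partialD_specDist_eq i hV h1, smul_specDist c hi]
  refine (capNorm_partialD_le hχ i _ _ (hi.smul c) ?_).trans
    (mul_le_mul_right (mul_le_mul_right ?_ _) _)
  · refine ne_top_of_le_ne_top ?_ (hs _)
    rw [e2]
    finiteness
  · rw [sub_add_cancel, mul_add, mul_add]
    have h3 := hs (d / 2 : ℝ)
    have h4 := hs (d / 2 + 1 : ℝ)
    rw [e2] at h4
    exact add_le_add h3 h4

end TermNorms

end

section

open FourierTransform

/-! ### Real-valued distributions -/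

section RealValued

variable {d n : ℕ} [NeZero d]

lemma IsRealValued.conjVec_eq {T : 𝓢'(Dom d, CVal n)} (hT : IsRealValued T) {ψ : 𝓢(Dom d, ℂ)}
    (hψ : ∀ x, (ψ x).im = 0) : conjVec (T ψ) = T ψ := by
  ext k
  rw [conjVec_apply]
  exact Complex.conj_eq_iff_im.2 (hT ψ hψ k)

lemma isRealValued_distOf (g : Dom d →ᵇ Val n) : IsRealValued (distOf g : 𝓢'(Dom d, CVal n)) := by
  intro ψ hψ k
  have h : conjVec (distOf g ψ) = distOf g ψ := by
    rw [distOf_apply, ← conjVec.integral_comp_comm (integrable_schwartz_smul_complexify g ψ)]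
    refine integral_congr_ae (Eventually.of_forall fun x => ?_)
    simp only [conjVec_smul, conjVec_complexify]
    rw [Complex.star_def, Complex.conj_eq_iff_im.2 (hψ x)]
  have h1 := congrArg (fun z : CVal n => z k) h
  exact Complex.conj_eq_iff_im.1 h1

lemma IsRealValued.sub {S T : 𝓢'(Dom d, CVal n)} (hS : IsRealValued S) (hT : IsRealValued T) :
    IsRealValued (S - T) := fun ψ hψ k => by
  change (S ψ k - T ψ k).im = 0
  rw [Complex.sub_im, hS ψ hψ k, hT ψ hψ k, sub_zero]

/-- Real test functions suffice to identify a continuous function with its conjugate. -/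
lemma IsRealValued.fourierInv_eq {V : Dom d → CVal n} (hV : Integrable V)
    (h : IsRealValued (specDist V)) (x : Dom d) : 𝓕⁻ V x = complexify (realPart (𝓕⁻ V x)) := by
  rw [eq_complexify_iff]
  have hc := continuous_fourierInv hV
  have hloc : LocallyIntegrable (𝓕⁻ V) := hc.locallyIntegrable
  have hloc' : LocallyIntegrable fun x => conjVec (𝓕⁻ V x) :=
    (conjVec.continuous.comp hc).locallyIntegrable
  have hae : (fun x => conjVec (𝓕⁻ V x)) =ᵐ[volume] 𝓕⁻ V := by
    refine ae_eq_of_integral_contDiff_smul_eq hloc' hloc fun g hg hgc => ?_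
    have hg₁ : HasCompactSupport (Complex.ofRealCLM ∘ g) := hgc.comp_left rfl
    have hg₂ : ContDiff ℝ (⊤ : ℕ∞) (Complex.ofRealCLM ∘ g) := by fun_prop
    have h1 := h.conjVec_eq (ψ := hg₁.toSchwartzMap hg₂) fun x => Complex.ofReal_im _
    rw [specDist_apply' hV] at h1
    have e : ∀ x, (hg₁.toSchwartzMap hg₂ : 𝓢(Dom d, ℂ)) x • 𝓕⁻ V x = g x • 𝓕⁻ V x := fun x =>
      Complex.coe_smul (g x) (𝓕⁻ V x)
    simp only [e] at h1
    have hi : Integrable fun x => g x • 𝓕⁻ V x :=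
      (hg.continuous.smul hc).integrable_of_hasCompactSupport hgc.smul_right
    rw [← conjVec.integral_comp_comm hi] at h1
    simpa only [conjVec_real_smul] using h1
  exact congrFun ((conjVec.continuous.comp hc).ae_eq_iff_eq volume hc |>.1 hae) x

/-- Real-valued data are represented by Hermitian functions. -/
lemma exists_herm_eq_specDist {χ : Dom d → ℝ} (hχ : IsCutoff χ) {T : 𝓢'(Dom d, CVal n)}
    (hT : IsRealValued T) (h : besovNorm χ (d / 2 : ℝ) T < ⊤) :
    ∃ V : Dom d → CVal n, StronglyMeasurable V ∧ IsHerm V ∧ Integrable V ∧ T = specDist V := by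
  obtain ⟨V, hVm, hVi, rfl⟩ := exists_eq_specDist hχ h
  have hae := hermPart_ae_eq hVi (hT.fourierInv_eq hVi)
  have h1 : StronglyMeasurable (Function.uncurry fun _ : Unit => V) :=
    hVm.comp_measurable measurable_snd
  have h2 := (stronglyMeasurable_hermPart h1).comp_measurable (measurable_prodMk_left (x := ()))
  have h3 := integrable_hermPart hVi
  exact ⟨hermPart V, h2, isHerm_hermPart V, h3, specDist_congr hVi h3 hae.symm⟩

end RealValued

/-! ### Solutions in physical space -/

section Physical

variable {d n : ℕ} [NeZero d]

/-- The function `u` of time is represented by `V` on the Fourier side. -/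
structure IsRep (R : ℝ) (ubar : Val n) (u : ℝ → (Dom d →ᵇ Val n)) (V : ℝ → Dom d → CVal n) :
    Prop where
  traj : IsTraj R V
  eq : ∀ t, 0 ≤ t → ∀ x, complexify (u t x - ubar) = 𝓕⁻ (V t) x

variable {R : ℝ} {ubar : Val n} {u : ℝ → (Dom d →ᵇ Val n)} {V : ℝ → Dom d → CVal n}
  {a : Fin d → ℝ} {f : Fin d → C(Val n, Val n)}

lemma IsRep.pert_eq (h : IsRep R ubar u V) {t : ℝ} (ht : 0 ≤ t) :
    pert ubar u t = specDist (V t) :=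
  distOf_sub_constDist (h.traj.integrable ht) (h.eq t ht)

lemma IsRep.nonlin (h : IsRep R ubar u V) (hg : IsFlux (fluxPert f ubar)) (hR : 0 < R) {t : ℝ}
    (ht : 0 ≤ t) (i : Fin d) : Integrable (nonlin (fluxPert f ubar i) (V t)) ∧
      ∀ x, 𝓕⁻ (JinXin.nonlin (fluxPert f ubar i) (V t)) x =
        complexify (fluxPert f ubar i (realPart (𝓕⁻ (V t) x))) := by
  obtain ⟨K, -, hk, -⟩ := hg.exists_bound (d := d) hR
  obtain ⟨h1, h2, -⟩ := hk (V t) (stronglyMeasurable_slice h.traj.sm t).aestronglyMeasurable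
    (h.traj.bound t ht) i
  exact ⟨h1, h2⟩

lemma IsRep.rhs_apply (h : IsRep R ubar u V) (a : Fin d → ℝ) (hg : IsFlux (fluxPert f ubar))
    (hR : 0 < R) {t : ℝ} (ht : 0 ≤ t) (ψ : 𝓢(Dom d, ℂ)) :
    (∑ i, diffusion a i (u t) - ∑ i, convection f i (u t)) ψ =
      -∫ ξ, (𝓕⁻ ψ : 𝓢(Dom d, ℂ)) ξ • drift a (fluxPert f ubar) (V t) ξ :=
  JinXin.rhs_apply a (h.traj.integrable ht) (h.eq t ht) (fun i => (h.nonlin hg hR ht i).1)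
    (fun i => (h.nonlin hg hR ht i).2) ψ

lemma IsRep.distOf_apply (h : IsRep R ubar u V) {t : ℝ} (ht : 0 ≤ t) (ψ : 𝓢(Dom d, ℂ)) :
    distOf (u t) ψ = constDist d ubar ψ + ∫ ξ, (𝓕⁻ ψ : 𝓢(Dom d, ℂ)) ξ • V t ξ := by
  rw [distOf_eq_add (h.traj.integrable ht) (h.eq t ht), ← specDist_apply (h.traj.integrable ht)]
  rfl

lemma IsRep.hasDerivAt_distOf (h : IsRep R ubar u V) (hg : IsFlux (fluxPert f ubar)) (hR : 0 < R)
    {t : ℝ} (ht : 0 < t) (ψ : 𝓢(Dom d, ℂ))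
    (hm : HasDerivAt (fun τ => ∫ ξ, (𝓕⁻ ψ : 𝓢(Dom d, ℂ)) ξ • V τ ξ)
      (-∫ ξ, (𝓕⁻ ψ : 𝓢(Dom d, ℂ)) ξ • drift a (fluxPert f ubar) (V t) ξ) t) :
    HasDerivAt (fun τ => distOf (u τ) ψ)
      ((∑ i, diffusion a i (u t) - ∑ i, convection f i (u t)) ψ) t := by
  rw [h.rhs_apply a hg hR ht.le]
  refine (hm.const_add (constDist d ubar ψ)).congr_of_eventuallyEq ?_
  filter_upwards [Ici_mem_nhds ht] with τ hτ using h.distOf_apply hτ ψ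

lemma IsRep.hasDerivAt_pairing (h : IsRep R ubar u V) (hg : IsFlux (fluxPert f ubar)) (hR : 0 < R)
    {t : ℝ} (ht : 0 < t) (m : 𝓢(Dom d, ℂ))
    (hψ : HasDerivAt (fun τ => distOf (u τ) (𝓕 m : 𝓢(Dom d, ℂ)))
      ((∑ i, diffusion a i (u t) - ∑ i, convection f i (u t)) (𝓕 m : 𝓢(Dom d, ℂ))) t) :
    HasDerivAt (fun τ => ∫ ξ, m ξ • V τ ξ)
      (-∫ ξ, m ξ • drift a (fluxPert f ubar) (V t) ξ) t := by
  rw [h.rhs_apply a hg hR ht.le, FourierTransform.fourierInv_fourier_eq] at hψ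
  refine (hψ.sub_const (constDist d ubar (𝓕 m : 𝓢(Dom d, ℂ)))).congr_of_eventuallyEq ?_
  filter_upwards [Ici_mem_nhds ht] with τ hτ
  rw [h.distOf_apply hτ, FourierTransform.fourierInv_fourier_eq, add_sub_cancel_left]

variable {χ : Dom d → ℝ}

/-- The constant in the comparison of the norms of `Ḃ^{s}_{2,1} ∩ Ḃ^{s'}_{2,1}`. -/
def capConst (s s' : ℝ) : ℝ≥0∞ := shiftConst s + shiftConst s'

lemma capConst_ne_top (s s' : ℝ) : capConst s s' ≠ ⊤ :=
  ENNReal.add_ne_top.2 ⟨shiftConst_ne_top s, shiftConst_ne_top s'⟩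

lemma IsRep.capNorm_pert_le (h : IsRep R ubar u V) (hχ : IsCutoff χ) {t : ℝ} (ht : 0 ≤ t) :
    capNorm χ ((d : ℝ) / 2 - 1) ((d : ℝ) / 2) (pert ubar u t) ≤
      capConst (d / 2 - 1) (d / 2) * energy V := by
  rw [h.pert_eq ht]
  exact (capNorm_specDist_le hχ _ _ (h.traj.integrable ht)).trans
    (mul_le_mul_right (dataNorm_le_energy V ht) _)

/-- The comparison of bands with neighbouring shells holds at each time, so the supremum may be
taken before summing. -/
lemma IsRep.cheminLernerNorm_le (h : IsRep R ubar u V) (hχ : IsCutoff χ) {s : ℝ}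
    (hs : ∀ j : ℤ, (2 : ℝ≥0∞) ^ ((j : ℝ) * s) ≤ weight d j) :
    cheminLernerNorm χ s (pert ubar u) ≤ shiftConst s * energy V := by
  calc cheminLernerNorm χ s (pert ubar u)
      ≤ ∑' j : ℤ, (2 : ℝ≥0∞) ^ ((j : ℝ) * s) *
          (shellSup (j - 1) V + shellSup j V + shellSup (j + 1) V) := by
        refine ENNReal.tsum_le_tsum fun j => mul_le_mul_right (iSup₂_le fun t ht => ?_) _
        rw [h.pert_eq ht, distLpNorm_block hχ j (h.traj.integrable ht)]
        refine (eLpNorm_band_le hχ j (h.traj.integrable ht).1).trans ?_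
        exact add_le_add (add_le_add (shellNorm_le_shellSup _ V ht) (shellNorm_le_shellSup _ V ht))
          (shellNorm_le_shellSup _ V ht)
    _ = shiftConst s * ∑' j : ℤ, (2 : ℝ≥0∞) ^ ((j : ℝ) * s) * shellSup j V :=
        tsum_neighbours s fun j => shellSup j V
    _ ≤ _ := by
        refine mul_le_mul_right (ENNReal.tsum_le_tsum fun j => ?_) _
        exact mul_le_mul' (hs j) le_self_add

/-- Solutions with finite energy belong to the space `C_b`. -/
lemma IsRep.inCb (h : IsRep R ubar u V) (hχ : IsCutoff χ) (hE : energy V ≠ ⊤)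
    (hcont : ∀ t, 0 ≤ t → Tendsto (fun τ => dataNorm (V τ - V t)) (𝓝[Ici 0] t) (𝓝 0)) :
    InCb χ ((d : ℝ) / 2 - 1) ((d : ℝ) / 2) (pert ubar u) where
  mem t ht := (h.capNorm_pert_le hχ ht).trans_lt
    (ENNReal.mul_lt_top (capConst_ne_top _ _).lt_top hE.lt_top)
  cont t ht := by
    have h1 := ENNReal.Tendsto.const_mul (hcont t ht)
      (Or.inr (capConst_ne_top ((d : ℝ) / 2 - 1) ((d : ℝ) / 2)))
    rw [mul_zero] at h1
    refine tendsto_of_tendsto_of_tendsto_of_le_of_le' tendsto_const_nhds h1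
      (Eventually.of_forall fun _ => zero_le) ?_
    filter_upwards [self_mem_nhdsWithin] with τ hτ
    have hi := h.traj.integrable hτ
    have hi' := h.traj.integrable ht
    rw [h.pert_eq ht, h.pert_eq hτ, specDist_sub hi hi']
    exact capNorm_specDist_le hχ _ _ (hi.sub hi')
  bdd := (h.cheminLernerNorm_le hχ fun _ => le_self_add).trans_lt
    (ENNReal.mul_lt_top (shiftConst_ne_top _).lt_top hE.lt_top)
  bdd' := (h.cheminLernerNorm_le hχ fun _ => le_add_self).trans_lt
    (ENNReal.mul_lt_top (shiftConst_ne_top _).lt_top hE.lt_top)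

lemma IsRep.supNorm_le (h : IsRep R ubar u V) (hχ : IsCutoff χ) (t : ℝ) :
    supNorm χ ((d : ℝ) / 2 - 1) ((d : ℝ) / 2) t (pert ubar u) ≤
      capConst (d / 2 - 1) (d / 2) * energy V :=
  iSup₂_le fun _ hτ => h.capNorm_pert_le hχ hτ.1

/-- The part of the norm of a solution which is integrated over time. -/
def dissipation (V : Dom d → CVal n) : ℝ≥0∞ :=
  specNorm (d / 2 + 1 : ℝ) V + specNorm (d / 2 + 2 : ℝ) V

lemma measurable_dissipation (hV : StronglyMeasurable (Function.uncurry V)) :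
    Measurable fun t => dissipation (V t) :=
  (measurable_specNorm hV _).add (measurable_specNorm hV _)

lemma lintegral_dissipation_le (hV : StronglyMeasurable (Function.uncurry V)) (t : ℝ) :
    ∫⁻ s in Ioc 0 t, dissipation (V s) ≤ energy V :=
  (lintegral_mono_set Ioc_subset_Ioi_self).trans (lintegral_specNorm_le_energy hV)

/-- Bounds which hold wherever the dissipation is finite can be integrated over time. -/
lemma IsRep.intNorm_le (h : IsRep R ubar u V) (hE : energy V ≠ ⊤) {s s' t : ℝ} {C : ℝ≥0∞}
    (hC : C ≠ ⊤) {w : ℝ → 𝓢'(Dom d, CVal n)}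
    (hw : ∀ τ, 0 ≤ τ → dissipation (V τ) ≠ ⊤ → capNorm χ s s' (w τ) ≤ C * dissipation (V τ)) :
    intNorm χ s s' t w ≤ C * energy V := by
  have hm := measurable_dissipation h.traj.sm
  have hle := lintegral_dissipation_le h.traj.sm t
  have hae : ∀ᵐ τ ∂(volume.restrict (Ioc 0 t)), dissipation (V τ) < ⊤ :=
    ae_lt_top hm (ne_top_of_le_ne_top hE hle)
  calc intNorm χ s s' t w ≤ ∫⁻ τ in Ioc 0 t, C * dissipation (V τ) := by
        refine lintegral_mono_ae ?_
        filter_upwards [hae, ae_restrict_mem measurableSet_Ioc] with τ h1 h2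
        exact hw τ h2.1.le h1.ne
    _ = C * ∫⁻ τ in Ioc 0 t, dissipation (V τ) := lintegral_const_mul' _ _ hC
    _ ≤ _ := mul_le_mul_right hle _

lemma IsRep.capNorm_pert_le_dissipation (h : IsRep R ubar u V) (hχ : IsCutoff χ) {t : ℝ}
    (ht : 0 ≤ t) :
    capNorm χ ((d : ℝ) / 2 + 1) ((d : ℝ) / 2 + 2) (pert ubar u t) ≤
      capConst (d / 2 + 1) (d / 2 + 2) * dissipation (V t) := by
  rw [h.pert_eq ht]
  exact capNorm_specDist_le hχ _ _ (h.traj.integrable ht)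

lemma IsRep.capNorm_diffusion_le (h : IsRep R ubar u V) (hχ : IsCutoff χ) (a : Fin d → ℝ)
    (i : Fin d) {t : ℝ} (ht : 0 ≤ t) (hD : dissipation (V t) ≠ ⊤) :
    capNorm χ ((d : ℝ) / 2 - 1) ((d : ℝ) / 2) (diffusion a i (u t)) ≤
      capConst (d / 2 - 1) (d / 2) * (ENNReal.ofReal (4 * Real.pi) * (‖(a i : ℂ)‖ₑ *
        ENNReal.ofReal (4 * Real.pi))) * dissipation (V t) := by
  rw [diffusion_eq a (h.traj.integrable ht) (h.eq t ht)]
  refine (capNorm_partialD_smul_partialD_le hχ i (a i) (h.traj.integrable ht) hD).trans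
    (le_of_eq ?_)
  simp only [capConst, dissipation, mul_assoc]

/-- The quadratic bound of the fluxes, for trajectories with energy at most one. -/
def HasFluxBound (K : ℝ≥0∞) (g : Fin d → Val n → Val n) : Prop :=
  ∀ V : Dom d → CVal n, StronglyMeasurable V → specNorm (d / 2 : ℝ) V ≤ ENNReal.ofReal 1 →
    ∀ i, specNorm (d / 2 : ℝ) (JinXin.nonlin (g i) V) +
      specNorm (d / 2 + 1 : ℝ) (JinXin.nonlin (g i) V) ≤
        K * (dataNorm V * specNorm (d / 2 + 1 : ℝ) V)

lemma IsRep.specNorm_nonlin_le (h : IsRep 1 ubar u V) {K : ℝ≥0∞} {g : Fin d → Val n → Val n}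
    (hK : HasFluxBound K g) (hE : energy V ≤ 1) (i : Fin d) {t : ℝ} (ht : 0 ≤ t) :
    specNorm (d / 2 : ℝ) (JinXin.nonlin (g i) (V t)) +
      specNorm (d / 2 + 1 : ℝ) (JinXin.nonlin (g i) (V t)) ≤ K * dissipation (V t) := by
  refine (hK (V t) (stronglyMeasurable_slice h.traj.sm t) (h.traj.bound t ht) i).trans
    (mul_le_mul_right ?_ _)
  have h1 : dataNorm (V t) ≤ 1 := (dataNorm_le_energy V ht).trans hE
  exact (mul_le_of_le_one_left' h1).trans le_self_add

lemma IsRep.capNorm_convection_le (h : IsRep 1 ubar u V) (hχ : IsCutoff χ)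
    (hg : IsFlux (fluxPert f ubar)) {K : ℝ≥0∞} (hK0 : K ≠ ⊤)
    (hK : HasFluxBound K (fluxPert f ubar)) (hE : energy V ≤ 1)
    (i : Fin d) {t : ℝ} (ht : 0 ≤ t) (hD : dissipation (V t) ≠ ⊤) :
    capNorm χ ((d : ℝ) / 2 - 1) ((d : ℝ) / 2) (convection f i (u t)) ≤
      capConst (d / 2 - 1) (d / 2) * (ENNReal.ofReal (4 * Real.pi) * K) *
        dissipation (V t) := by
  obtain ⟨hN, hNx⟩ := h.nonlin hg one_pos ht i
  have hb := h.specNorm_nonlin_le hK hE i ht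
  rw [convection_eq (h.eq t ht) hN hNx]
  refine (capNorm_partialD_le hχ i _ _ hN
    (ne_top_of_le_ne_top (ENNReal.mul_ne_top hK0 hD) (le_add_self.trans hb))).trans ?_
  rw [sub_add_cancel, capConst, mul_assoc, mul_assoc]
  exact mul_le_mul_right (mul_le_mul_right hb _) _

/-- The linear part -A_i ∂_i u costs one derivative, which the dissipation covers. The flux is
quadratic, but with energy at most 1 one factor is dropped and the same bound applies. -/
lemma IsRep.capNorm_darcy_le (h : IsRep 1 ubar u V) (hχ : IsCutoff χ)
    (hg : IsFlux (fluxPert f ubar)) {K : ℝ≥0∞}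
    (hK : HasFluxBound K (fluxPert f ubar)) (hE : energy V ≤ 1) (a : Fin d → ℝ)
    (i : Fin d) {t : ℝ} (ht : 0 ≤ t) (hD : dissipation (V t) ≠ ⊤) :
    capNorm χ ((d : ℝ) / 2) ((d : ℝ) / 2 + 1) (darcy a f i u t - constDist d (f i ubar)) ≤
      capConst (d / 2) (d / 2 + 1) * (K + ‖(a i : ℂ)‖ₑ * ENNReal.ofReal (4 * Real.pi)) *
        dissipation (V t) := by
  obtain ⟨hN, hNx⟩ := h.nonlin hg one_pos ht i
  have hb := h.specNorm_nonlin_le hK hE i ht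
  have hV := h.traj.integrable ht
  have h1 : specNorm (d / 2 + 1 : ℝ) (V t) ≠ ⊤ := ne_top_of_le_ne_top hD le_self_add
  have hi := integrable_derivSymbol_smul i hV.1 h1
  have hci : Integrable fun ξ => (a i : ℂ) • derivSymbol (coordVec i) ξ • V t ξ := hi.smul (a i : ℂ)
  have e : darcy a f i u t - constDist d (f i ubar) = specDist (JinXin.nonlin (fluxPert f ubar i)
      (V t) - fun ξ => (a i : ℂ) • derivSymbol (coordVec i) ξ • V t ξ) := by
    rw [← specDist_sub hN hci, ← smul_specDist _ hi, ← partialD_specDist_eq i hV h1,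
      ← distOf_comp_sub_constDist (h.eq t ht) hN hNx, darcy, distOf_eq_add hV (h.eq t ht),
      partialD_add, partialD_constDist, zero_add]
    abel
  rw [e]
  refine (capNorm_specDist_le hχ _ _ (hN.sub hci)).trans ?_
  rw [mul_assoc]
  refine mul_le_mul_right ?_ _
  have hs : ∀ s : ℝ, specNorm s (fun ξ => (a i : ℂ) • derivSymbol (coordVec i) ξ • V t ξ) ≤
      ‖(a i : ℂ)‖ₑ * (ENNReal.ofReal (4 * Real.pi) * specNorm (s + 1) (V t)) := fun s =>
    (specNorm_const_smul_le _ s _).trans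
      (mul_le_mul_right (specNorm_derivSymbol_smul_le i s _) _)
  have e2 : (d / 2 + 1 + 1 : ℝ) = d / 2 + 2 := by ring
  have hs1 := hs (d / 2 : ℝ)
  have hs2 := hs (d / 2 + 1 : ℝ)
  rw [e2] at hs2
  calc specNorm (d / 2 : ℝ) (JinXin.nonlin (fluxPert f ubar i) (V t) -
          fun ξ => (a i : ℂ) • derivSymbol (coordVec i) ξ • V t ξ) +
        specNorm (d / 2 + 1 : ℝ) (JinXin.nonlin (fluxPert f ubar i) (V t) -
          fun ξ => (a i : ℂ) • derivSymbol (coordVec i) ξ • V t ξ)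
      ≤ (specNorm (d / 2 : ℝ) (JinXin.nonlin (fluxPert f ubar i) (V t)) +
          ‖(a i : ℂ)‖ₑ * (ENNReal.ofReal (4 * Real.pi) * specNorm (d / 2 + 1 : ℝ) (V t))) +
        (specNorm (d / 2 + 1 : ℝ) (JinXin.nonlin (fluxPert f ubar i) (V t)) +
          ‖(a i : ℂ)‖ₑ * (ENNReal.ofReal (4 * Real.pi) * specNorm (d / 2 + 2 : ℝ) (V t))) :=
        add_le_add ((specNorm_sub_le _ hN.1 hci.1).trans (add_le_add le_rfl hs1))
          ((specNorm_sub_le _ hN.1 hci.1).trans (add_le_add le_rfl hs2))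
    _ = (specNorm (d / 2 : ℝ) (JinXin.nonlin (fluxPert f ubar i) (V t)) +
          specNorm (d / 2 + 1 : ℝ) (JinXin.nonlin (fluxPert f ubar i) (V t))) +
        ‖(a i : ℂ)‖ₑ * ENNReal.ofReal (4 * Real.pi) * dissipation (V t) := by
        rw [dissipation]
        ring
    _ ≤ _ := by
        rw [add_mul]
        exact add_le_add hb le_rfl

end Physical

end

section

open FourierTransform

/-! ### Uniqueness -/

section Uniqueness

variable {d n : ℕ} [NeZero d]

lemma IsTraj.mono {R R' : ℝ} (hR : R ≤ R') {V : ℝ → Dom d → CVal n} (h : IsTraj R V) :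
    IsTraj R' V where
  sm := h.sm
  real := h.real
  bound t ht := (h.bound t ht).trans (ENNReal.ofReal_le_ofReal hR)

lemma fourierInv_congr {V W : Dom d → CVal n} (h : V =ᵐ[volume] W) (x : Dom d) :
    𝓕⁻ V x = 𝓕⁻ W x := by
  simp only [Real.fourierInv_eq]
  exact integral_congr_ae (h.mono fun ξ hξ => by simp only [hξ])

/-- Two trajectories which are fixed points of the solution map with the same datum agree. -/
lemma ae_eq_of_fixedPoint {a : Fin d → ℝ} (ha : ∀ i, 0 < a i) {g : Fin d → Val n → Val n}
    (hg : IsFlux g) {R : ℝ} (hR : 0 < R) {V₀ : Dom d → CVal n} {V W : ℝ → Dom d → CVal n}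
    (hV : IsTraj R V) (hW : IsTraj R W) (hVp : ∀ t, 0 ≤ t → V t =ᵐ[volume] picard a g V₀ V t)
    (hWp : ∀ t, 0 ≤ t → W t =ᵐ[volume] picard a g V₀ W t) {t : ℝ} (ht : 0 ≤ t) :
    V t =ᵐ[volume] W t := by
  obtain ⟨l, hl, hcon⟩ := exists_contraction ha hg hR
  have h1 : wdist l V W ≤ 2⁻¹ * wdist l V W := by
    refine le_trans (iSup₂_mono fun t ht => ?_) (hcon V₀ V W hV hW)
    refine mul_le_mul_right (le_of_eq (lintegral_congr_ae ?_)) _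
    filter_upwards [hVp t ht, hWp t ht] with ξ h1 h2
    rw [h1, h2]
  have hfin : wdist l V W ≠ ⊤ := ne_top_of_le_ne_top
    (ENNReal.mul_ne_top (by simp) (ENNReal.mul_ne_top massConst_ne_top ENNReal.ofReal_ne_top))
    (wdist_lt_top hl.le hV hW)
  -- A finite number not exceeding half of itself vanishes.
  have h0 : wdist l V W = 0 := by
    by_contra hne
    have h2 : 2⁻¹ * wdist l V W < wdist l V W := by
      rw [mul_comm, ← div_eq_mul_inv]
      exact ENNReal.half_lt_self hne hfin
    exact absurd h1 (not_le.2 h2)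
  have h3 : ∫⁻ ξ, ‖V t ξ - W t ξ‖ₑ = 0 := by
    have := lintegral_sub_le_wdist l V W ht
    rw [h0, mul_zero] at this
    exact le_antisymm this zero_le
  have h4 := (lintegral_eq_zero_iff ((stronglyMeasurable_slice hV.sm t).sub
    (stronglyMeasurable_slice hW.sm t)).enorm).1 h3
  filter_upwards [h4] with ξ hξ
  simpa [sub_eq_zero] using hξ

variable {χ : Dom d → ℝ} {ubar : Val n} {w : ℝ → (Dom d →ᵇ Val n)}

lemma besovNorm_le_cheminLernerNorm (hχ : IsCutoff χ) (s : ℝ) {W : Dom d → CVal n}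
    (hW : Integrable W) {T : ℝ → 𝓢'(Dom d, CVal n)} {t : ℝ} (ht : 0 ≤ t) (h : T t = specDist W) :
    besovNorm χ s (T t) ≤ cheminLernerNorm χ s T := by
  rw [besovNorm, if_pos (h ▸ inSh_specDist hχ hW)]
  exact ENNReal.tsum_le_tsum fun j => mul_le_mul_right
    (le_iSup₂ (f := fun (t : ℝ) (_ : 0 ≤ t) => distLpNorm 2 (block χ j (T t))) t ht) _

/-- A continuous function of time with values in the bounded continuous functions is jointly
strongly measurable, after extension by its value at time zero. -/
lemma stronglyMeasurable_complexify_sub {w : ℝ → (Dom d →ᵇ Val n)}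
    (hw : ∀ t, 0 ≤ t → Tendsto w (𝓝[Ici 0] t) (𝓝 (w t))) (y : Val n) :
    StronglyMeasurable (Function.uncurry fun (t : ℝ) (x : Dom d) =>
      complexify (w (max t 0) x - y)) := by
  have hwcont : Continuous fun t : ℝ => w (max t 0) := by
    refine continuous_iff_continuousAt.2 fun t => ?_
    refine (hw (max t 0) (le_max_right _ _)).comp (tendsto_nhdsWithin_iff.2 ⟨?_, ?_⟩)
    · exact (by fun_prop : Continuous fun t : ℝ => max t 0).tendsto t
    · exact Eventually.of_forall fun τ => mem_Ici.2 (le_max_right _ _)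
  have h1 : Continuous fun p : ℝ × Dom d => w (max p.1 0) p.2 :=
    (hwcont.comp continuous_fst).eval continuous_snd
  exact (continuous_complexify.comp (h1.sub continuous_const)).stronglyMeasurable

/-- A jointly measurable Hermitian representative of the Fourier transform of `w - ubar`. -/
lemma exists_measurable_representative
    (hw : ∀ t, 0 ≤ t → Tendsto w (𝓝[Ici 0] t) (𝓝 (w t))) {Z : ℝ → Dom d → CVal n}
    (hZ : ∀ t, 0 ≤ t → Integrable (Z t))
    (hZx : ∀ t, 0 ≤ t → ∀ x, complexify (w t x - ubar) = 𝓕⁻ (Z t) x) :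
    ∃ W : ℝ → Dom d → CVal n, StronglyMeasurable (Function.uncurry W) ∧
      ∀ t, 0 ≤ t → W t =ᵐ[volume] Z t := by
  have hsm := stronglyMeasurable_complexify_sub hw ubar
  have hY := stronglyMeasurable_specOf hsm
  have hW := stronglyMeasurable_hermPart
    (Z := fun (t : ℝ) => specOf fun x => complexify (w (max t 0) x - ubar)) hY
  refine ⟨fun t => hermPart (specOf fun x => complexify (w (max t 0) x - ubar)), hW,
    fun t ht => ?_⟩
  have e : (fun x => complexify (w (max t 0) x - ubar)) = 𝓕⁻ (Z t) := by
    rw [max_eq_left ht]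
    exact funext (hZx t ht)
  have h1 : specOf (fun x => complexify (w (max t 0) x - ubar)) =ᵐ[volume] Z t := by
    rw [e]
    exact specOf_fourierInv (hZ t ht)
  refine (hermPart_congr h1).trans (hermPart_ae_eq (hZ t ht) fun x => ?_)
  rw [← hZx t ht, realPart_complexify]

/-- The Fourier transforms of the elements of `C_b`. -/
lemma exists_spectral_family (hχ : IsCutoff χ)
    (hw : InCb χ ((d : ℝ) / 2 - 1) ((d : ℝ) / 2) (pert ubar w)) :
    ∃ Z : ℝ → Dom d → CVal n, (∀ t, 0 ≤ t → Integrable (Z t)) ∧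
      (∀ t, 0 ≤ t → pert ubar w t = specDist (Z t)) ∧
      (∀ t, 0 ≤ t → ∀ x, complexify (w t x - ubar) = 𝓕⁻ (Z t) x) ∧
      ∀ t, 0 ≤ t → Tendsto (fun τ => ∫⁻ ξ, ‖Z τ ξ - Z t ξ‖ₑ) (𝓝[Ici 0] t) (𝓝 0) := by
  -- The transforms are chosen time by time, with no measurability in time yet; negative times
  -- receive a default value.
  have hex : ∀ t, ∃ W : Dom d → CVal n, 0 ≤ t → Integrable W ∧ pert ubar w t = specDist W := by
    intro t
    by_cases ht : 0 ≤ t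
    · obtain ⟨W, -, hW, hWt⟩ := exists_eq_specDist hχ (le_add_self.trans_lt (hw.mem t ht))
      exact ⟨W, fun _ => ⟨hW, hWt⟩⟩
    · exact ⟨0, fun h => absurd h ht⟩
  choose Z hZ using hex
  refine ⟨Z, fun t ht => (hZ t ht).1, fun t ht => (hZ t ht).2, fun t ht => ?_, fun t ht => ?_⟩
  · have h1 := (hZ t ht).2
    rw [pert, constDist, distOf_sub, distOf_eq_specDist_iff (hZ t ht).1] at h1
    exact h1
  · have h1 := ENNReal.Tendsto.const_mul (a := massConst d * shiftConst ((d : ℝ) / 2))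
      (hw.cont t ht) (Or.inr (ENNReal.mul_ne_top massConst_ne_top (shiftConst_ne_top _)))
    rw [mul_zero] at h1
    refine tendsto_of_tendsto_of_tendsto_of_le_of_le' tendsto_const_nhds h1
      (Eventually.of_forall fun _ => zero_le) ?_
    filter_upwards [self_mem_nhdsWithin] with τ hτ
    have hi := (hZ τ hτ).1.sub (hZ t ht).1
    refine (lintegral_le_specNorm hi.1).trans ?_
    rw [mul_assoc]
    refine mul_le_mul_right ((specNorm_le_besovNorm hχ _ hi).trans (mul_le_mul_right ?_ _)) _
    rw [← specDist_sub (hZ τ hτ).1 (hZ t ht).1, ← (hZ τ hτ).2, ← (hZ t ht).2]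
    exact le_add_self

/-- L¹ convergence of the transforms is stronger than uniform convergence of the functions. The
resulting continuity in time makes w jointly measurable, which allows a measurable representative.
-/
lemma tendsto_of_tendsto_lintegral {Z : ℝ → Dom d → CVal n}
    (hZ : ∀ t, 0 ≤ t → Integrable (Z t))
    (hZx : ∀ t, 0 ≤ t → ∀ x, complexify (w t x - ubar) = 𝓕⁻ (Z t) x) {t : ℝ} (ht : 0 ≤ t)
    (h : Tendsto (fun τ => ∫⁻ ξ, ‖Z τ ξ - Z t ξ‖ₑ) (𝓝[Ici 0] t) (𝓝 0)) :
    Tendsto w (𝓝[Ici 0] t) (𝓝 (w t)) := by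
  have h1 := (ENNReal.tendsto_toReal ENNReal.zero_ne_top).comp h
  rw [ENNReal.toReal_zero] at h1
  refine tendsto_iff_dist_tendsto_zero.2 (squeeze_zero' (Eventually.of_forall fun _ =>
    dist_nonneg) ?_ h1)
  filter_upwards [self_mem_nhdsWithin] with τ hτ
  have hi := (hZ τ hτ).sub (hZ t ht)
  have e : ∫⁻ ξ, ‖Z τ ξ - Z t ξ‖ₑ = ∫⁻ ξ, ‖(Z τ - Z t) ξ‖ₑ := rfl
  rw [Function.comp_apply, e, ← integral_norm_eq_lintegral_enorm hi.1]
  refine (BoundedContinuousFunction.dist_le (integral_nonneg fun _ => norm_nonneg _)).2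
    fun x => ?_
  rw [dist_eq_norm, ← sub_sub_sub_cancel_right _ _ ubar, ← norm_complexify, complexify_sub,
    hZx τ hτ, hZx t ht, ← fourierInv_sub (hZ τ hτ) (hZ t ht)]
  exact norm_fourierInv_le _ x

/-- Elements of `C_b` are represented by trajectories which are continuous in `L^1`. -/
lemma exists_isRep (hχ : IsCutoff χ)
    (hw : InCb χ ((d : ℝ) / 2 - 1) ((d : ℝ) / 2) (pert ubar w)) :
    ∃ (R : ℝ) (W : ℝ → Dom d → CVal n), 1 ≤ R ∧ IsRep R ubar w W ∧
      ∀ t, 0 ≤ t → Tendsto (fun τ => ∫⁻ ξ, ‖W τ ξ - W t ξ‖ₑ) (𝓝[Ici 0] t) (𝓝 0) := by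
  obtain ⟨Z, hZi, hZd, hZx, hZc⟩ := exists_spectral_family hχ hw
  obtain ⟨W, hWm, hae⟩ := exists_measurable_representative
    (fun t ht => tendsto_of_tendsto_lintegral hZi hZx ht (hZc t ht)) hZi hZx
  -- A bound uniform in time, of arbitrary size. The maximum with 1 lets the constructed solution
  -- share the same radius.
  let M := shiftConst ((d : ℝ) / 2) * cheminLernerNorm χ ((d : ℝ) / 2) (pert ubar w)
  have hMt : M ≠ ⊤ := ENNReal.mul_ne_top (shiftConst_ne_top _) hw.bdd'.ne
  refine ⟨max 1 M.toReal, W, le_max_left _ _, ⟨⟨hWm, fun t ht x => ?_, fun t ht => ?_⟩,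
    fun t ht x => ?_⟩, fun t ht => ?_⟩
  · rw [fourierInv_congr (hae t ht), ← hZx t ht, realPart_complexify]
  · rw [specNorm_congr (hae t ht)]
    refine (specNorm_le_besovNorm hχ _ (hZi t ht)).trans ?_
    rw [← hZd t ht]
    refine (mul_le_mul_right (besovNorm_le_cheminLernerNorm hχ _ (hZi t ht) ht (hZd t ht)) _).trans
      ?_
    exact (ENNReal.ofReal_toReal hMt).ge.trans (ENNReal.ofReal_le_ofReal (le_max_right _ _))
  · rw [hZx t ht, fourierInv_congr (hae t ht)]
  · refine (hZc t ht).congr' ?_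
    filter_upwards [self_mem_nhdsWithin] with τ hτ
    refine lintegral_congr_ae ?_
    filter_upwards [hae τ hτ, hae t ht] with ξ h1 h2
    rw [h1, h2]

lemma picard_congr_left (a : Fin d → ℝ) (g : Fin d → Val n → Val n) {V₀ W₀ : Dom d → CVal n}
    (h : V₀ =ᵐ[volume] W₀) (V : ℝ → Dom d → CVal n) (t : ℝ) :
    picard a g V₀ V t =ᵐ[volume] picard a g W₀ V t := by
  filter_upwards [h] with ξ hξ
  rw [picard, picard, duhamel, duhamel, hξ]

/-- Uniqueness of solutions in `C_b`. -/
theorem eq_of_isSolution (hχ : IsCutoff χ) {a : Fin d → ℝ} (ha : ∀ i, 0 < a i)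
    {f : Fin d → C(Val n, Val n)} (hg : IsFlux (fluxPert f ubar)) {V₀ : Dom d → CVal n}
    (hV₀ : Integrable V₀) {u₀ : 𝓢'(Dom d, CVal n)} (hu₀ : u₀ - constDist d ubar = specDist V₀)
    {u : ℝ → (Dom d →ᵇ Val n)} {V : ℝ → Dom d → CVal n} (hV : IsRep 1 ubar u V)
    (hVp : ∀ t, V t = picard a (fluxPert f ubar) V₀ V t) (hw : IsSolution a f u₀ w)
    (hwC : InCb χ ((d : ℝ) / 2 - 1) ((d : ℝ) / 2) (pert ubar w)) {t : ℝ} (ht : 0 ≤ t) :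
    w t = u t := by
  obtain ⟨R, W, hR, hW, hcont⟩ := exists_isRep hχ hwC
  have hR0 : 0 < R := by linarith
  have hint : ∀ t, 0 ≤ t → ∀ᵐ ξ, W t ξ = W 0 ξ - ∫ s in Ioc 0 t, drift a (fluxPert f ubar) (W s) ξ :=
    fun t ht => hW.traj.integrated_of_hasDerivAt ha hg hR0 hcont
      (fun m t ht => hW.hasDerivAt_pairing hg hR0 ht m (hw.eqn t ht _)) ht
  have hp := hW.traj.eq_picard hg hR0 (stronglyMeasurable_slice hW.traj.sm 0) hint
  have h0 : W 0 =ᵐ[volume] V₀ := by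
    refine specDist_injective (hW.traj.integrable le_rfl) hV₀ ?_
    rw [← hu₀, ← hW.pert_eq le_rfl, pert, hw.init]
  have hae := ae_eq_of_fixedPoint ha hg hR0 (hV.traj.mono hR) hW.traj
    (fun s _ => by rw [← hVp s]) (fun s hs => (hp s hs).trans (picard_congr_left a _ h0 W s)) ht
  ext1 x
  have h1 : complexify (w t x - ubar) = complexify (u t x - ubar) := by
    rw [hW.eq t ht, hV.eq t ht, fourierInv_congr hae]
  exact sub_left_injective (complexify_injective h1)

end Uniqueness

end

section

open FourierTransform

/-! ### Global existence -/

section Existence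

variable {d n : ℕ} [NeZero d]

lemma IsTraj.exists_isRep {R : ℝ} {V : ℝ → Dom d → CVal n} (hV : IsTraj R V) (ubar : Val n) :
    ∃ u : ℝ → (Dom d →ᵇ Val n), IsRep R ubar u V := by
  classical
  -- Only nonnegative times matter; the value 0 elsewhere is a default.
  refine ⟨fun t => if ht : 0 ≤ t then stateOf ubar (V t) (hV.integrable ht) else 0, hV,
    fun t ht x => ?_⟩
  rw [dif_pos ht, stateOf_apply, add_sub_cancel_left]
  exact (hV.real t ht x).symm

variable {χ : Dom d → ℝ} {a : Fin d → ℝ} {ubar : Val n} {f : Fin d → C(Val n, Val n)}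
  {V₀ : Dom d → CVal n} {u₀ : 𝓢'(Dom d, CVal n)} {u : ℝ → (Dom d →ᵇ Val n)}
  {V : ℝ → Dom d → CVal n} {K : ℝ≥0∞}

/-- Fixed points of the solution map with finite energy are strong solutions. -/
lemma IsRep.isStrongSolution (h : IsRep 1 ubar u V) (hχ : IsCutoff χ) (ha : ∀ i, 0 < a i)
    (hg : IsFlux (fluxPert f ubar)) (hK0 : K ≠ ⊤) (hK : HasFluxBound K (fluxPert f ubar))
    (hE : energy V ≤ 1)
    (hcont : ∀ t, 0 ≤ t → Tendsto (fun τ => dataNorm (V τ - V t)) (𝓝[Ici 0] t) (𝓝 0))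
    (hV₀ : Integrable V₀) (hu₀ : u₀ - constDist d ubar = specDist V₀)
    (hint : ∀ᵐ ξ, ∀ t, 0 ≤ t →
      V t ξ = V₀ ξ - ∫ s in Ioc 0 t, drift a (fluxPert f ubar) (V s) ξ) :
    IsStrongSolution a f χ u₀ u where
  init := by
    have h0 : V 0 =ᵐ[volume] V₀ := hint.mono fun ξ hξ => by
      rw [hξ 0 le_rfl, Ioc_self, setIntegral_empty, sub_zero]
    rw [distOf_eq_add (h.traj.integrable le_rfl) (h.eq 0 le_rfl),
      specDist_congr (h.traj.integrable le_rfl) hV₀ h0, ← hu₀, add_sub_cancel]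
  eqn t ht ψ := h.hasDerivAt_distOf hg one_pos ht ψ
    (h.traj.hasDerivAt_pairing ha hg one_pos
      (fun t ht => tendsto_lintegral_sub h.traj.sm (hcont t ht)) hV₀ hint _ ht)
  diffusion_int T hT i := by
    have hE' : energy V ≠ ⊤ := ne_top_of_le_ne_top ENNReal.one_ne_top hE
    have hC : capConst ((d : ℝ) / 2 - 1) (d / 2) * (ENNReal.ofReal (4 * Real.pi) *
        (‖(a i : ℂ)‖ₑ * ENNReal.ofReal (4 * Real.pi))) ≠ ⊤ :=
      ENNReal.mul_ne_top (capConst_ne_top _ _) (ENNReal.mul_ne_top ENNReal.ofReal_ne_top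
        (ENNReal.mul_ne_top enorm_ne_top ENNReal.ofReal_ne_top))
    exact (h.intNorm_le hE' hC fun τ hτ hD => h.capNorm_diffusion_le hχ a i hτ hD).trans_lt
      (ENNReal.mul_lt_top hC.lt_top hE'.lt_top)
  convection_int T hT i := by
    have hE' : energy V ≠ ⊤ := ne_top_of_le_ne_top ENNReal.one_ne_top hE
    have hC : capConst ((d : ℝ) / 2 - 1) (d / 2) * (ENNReal.ofReal (4 * Real.pi) * K) ≠ ⊤ :=
      ENNReal.mul_ne_top (capConst_ne_top _ _) (ENNReal.mul_ne_top ENNReal.ofReal_ne_top hK0)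
    exact (h.intNorm_le hE' hC fun τ hτ hD =>
      h.capNorm_convection_le hχ hg hK0 hK hE i hτ hD).trans_lt
      (ENNReal.mul_lt_top hC.lt_top hE'.lt_top)

/-- The constant which bounds the norms of a solution in terms of its energy. -/
def boundConst (a : Fin d → ℝ) (K : ℝ≥0∞) : ℝ≥0∞ :=
  capConst ((d : ℝ) / 2 - 1) (d / 2) + capConst ((d : ℝ) / 2 + 1) (d / 2 + 2) +
    ∑ i, capConst ((d : ℝ) / 2) (d / 2 + 1) *
      (K + ‖(a i : ℂ)‖ₑ * ENNReal.ofReal (4 * Real.pi))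

lemma darcyConst_ne_top (a : Fin d → ℝ) (hK : K ≠ ⊤) (i : Fin d) :
    capConst ((d : ℝ) / 2) (d / 2 + 1) *
      (K + ‖(a i : ℂ)‖ₑ * ENNReal.ofReal (4 * Real.pi)) ≠ ⊤ :=
  ENNReal.mul_ne_top (capConst_ne_top _ _)
    (ENNReal.add_ne_top.2 ⟨hK, ENNReal.mul_ne_top enorm_ne_top ENNReal.ofReal_ne_top⟩)

lemma boundConst_ne_top (a : Fin d → ℝ) (hK : K ≠ ⊤) : boundConst a K ≠ ⊤ :=
  ENNReal.add_ne_top.2 ⟨ENNReal.add_ne_top.2 ⟨capConst_ne_top _ _, capConst_ne_top _ _⟩,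
    ENNReal.sum_ne_top.2 fun i _ => darcyConst_ne_top a hK i⟩

lemma IsRep.norms_le (h : IsRep 1 ubar u V) (hχ : IsCutoff χ)
    (hg : IsFlux (fluxPert f ubar)) (hK0 : K ≠ ⊤) (hK : HasFluxBound K (fluxPert f ubar))
    (hE : energy V ≤ 1) (a : Fin d → ℝ) (t : ℝ) :
    supNorm χ ((d : ℝ) / 2 - 1) ((d : ℝ) / 2) t (pert ubar u) +
        intNorm χ ((d : ℝ) / 2 + 1) ((d : ℝ) / 2 + 2) t (pert ubar u) +
        ∑ i, intNorm χ ((d : ℝ) / 2) ((d : ℝ) / 2 + 1) t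
          (fun τ => darcy a f i u τ - constDist d (f i ubar)) ≤ boundConst a K * energy V := by
  have hE' : energy V ≠ ⊤ := ne_top_of_le_ne_top ENNReal.one_ne_top hE
  rw [boundConst, add_mul, add_mul, Finset.sum_mul]
  refine add_le_add (add_le_add (h.supNorm_le hχ t) ?_) (Finset.sum_le_sum fun i _ => ?_)
  · exact h.intNorm_le hE' (capConst_ne_top _ _) fun τ hτ _ => h.capNorm_pert_le_dissipation hχ hτ
  · exact h.intNorm_le hE' (darcyConst_ne_top a hK0 i) fun τ hτ hD =>
      h.capNorm_darcy_le hχ hg hK hE a i hτ hD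

/-- Global well-posedness for small data, with constants in `[0, ∞]`. -/
theorem exists_isStrongSolution (hχ : IsCutoff χ) (ha : ∀ i, 0 < a i)
    (hg : IsFlux (fluxPert f ubar)) :
    ∃ (η : ℝ) (C : ℝ≥0∞), 0 < η ∧ C ≠ ⊤ ∧ ∀ u₀ : 𝓢'(Dom d, CVal n), IsRealValued u₀ →
      capNorm χ ((d : ℝ) / 2 - 1) ((d : ℝ) / 2) (u₀ - constDist d ubar) < ⊤ →
      capConst ((d : ℝ) / 2 - 1) (d / 2) *
        capNorm χ ((d : ℝ) / 2 - 1) ((d : ℝ) / 2) (u₀ - constDist d ubar) ≤ ENNReal.ofReal η →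
      ∃ u : ℝ → (Dom d →ᵇ Val n), IsStrongSolution a f χ u₀ u ∧
        InCb χ ((d : ℝ) / 2 - 1) ((d : ℝ) / 2) (pert ubar u) ∧
        (∀ w : ℝ → (Dom d →ᵇ Val n), IsSolution a f u₀ w →
          InCb χ ((d : ℝ) / 2 - 1) ((d : ℝ) / 2) (pert ubar w) → ∀ t, 0 ≤ t → w t = u t) ∧
        ∀ t, supNorm χ ((d : ℝ) / 2 - 1) ((d : ℝ) / 2) t (pert ubar u) +
          intNorm χ ((d : ℝ) / 2 + 1) ((d : ℝ) / 2 + 2) t (pert ubar u) +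
          ∑ i, intNorm χ ((d : ℝ) / 2) ((d : ℝ) / 2 + 1) t
            (fun τ => darcy a f i u τ - constDist d (f i ubar)) ≤
          C * capNorm χ ((d : ℝ) / 2 - 1) ((d : ℝ) / 2) (u₀ - constDist d ubar) := by
  obtain ⟨η, C, hη, hC, hCη, hfix⟩ := exists_fixedPoint (d := d) ha hg
  obtain ⟨K, hK0, hKb⟩ := hg.exists_dataNorm_force_le (d := d) one_pos
  have hK : HasFluxBound K (fluxPert f ubar) := fun V hV hVR => (hKb V hV hVR).2
  refine ⟨η, boundConst a K * (C * capConst ((d : ℝ) / 2 - 1) (d / 2)), hη,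
    ENNReal.mul_ne_top (boundConst_ne_top a hK0) (ENNReal.mul_ne_top hC (capConst_ne_top _ _)),
    fun u₀ hu₀ hfin hsmall => ?_⟩
  obtain ⟨V₀, hV₀m, hV₀h, hV₀, e₀⟩ := exists_herm_eq_specDist hχ
    (hu₀.sub (isRealValued_distOf _)) (le_add_self.trans_lt hfin)
  have hdata := dataNorm_le_capNorm hχ hV₀
  rw [← e₀] at hdata
  obtain ⟨V, hV, hVE, hVp⟩ := hfix V₀ hV₀m hV₀h (hdata.trans hsmall)
  obtain ⟨u, h⟩ := hV.exists_isRep ubar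
  have hE : energy V ≤ 1 :=
    hVE.trans ((mul_le_mul_right (hdata.trans hsmall) _).trans hCη)
  have hE' : energy V ≠ ⊤ := ne_top_of_le_ne_top ENNReal.one_ne_top hE
  have hint := hV.integrated hg one_pos hVp
  have hF : ∫⁻ t in Ioi 0, dataNorm (force (fluxPert f ubar) (V t)) ≠ ⊤ :=
    ne_top_of_le_ne_top (ENNReal.mul_ne_top hK0 (ENNReal.pow_ne_top hE'))
      (lintegral_dataNorm_force_le (fun V hV hR => (hKb V hV hR).1) hV.sm
        (by rwa [ENNReal.ofReal_one]))
  have hcont : ∀ t, 0 ≤ t → Tendsto (fun τ => dataNorm (V τ - V t)) (𝓝[Ici 0] t) (𝓝 0) :=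
    fun t ht => tendsto_dataNorm_sub ha hg one_pos hV hE' hF hint ht
  refine ⟨u, h.isStrongSolution hχ ha hg hK0 hK hE hcont hV₀ e₀ hint, h.inCb hχ hE' hcont,
    fun w hw hwC t ht => eq_of_isSolution hχ ha hg hV₀ e₀ h hVp hw hwC ht, fun t => ?_⟩
  refine (h.norms_le hχ hg hK0 hK hE a t).trans ?_
  rw [mul_assoc, mul_assoc]
  exact mul_le_mul_right (hVE.trans (mul_le_mul_right hdata _)) _

end Existence

end

end JinXin

end

/-! ### The theorem with real constants -/

open JinXin

theorem theorem2 (d n : ℕ) (hd : 2 ≤ d) (hn : 1 ≤ n)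
    (χ : Dom d → ℝ) (hχ : IsCutoff χ)
    (a : Fin d → ℝ) (ha : ∀ i, 0 < a i)
    (ubar : Val n) (vbar : Fin d → Val n)
    (f : Fin d → C(Val n, Val n)) (hf : ∀ i, ContDiff ℝ (⊤ : ℕ∞) (f i))
    (hf0 : ∀ i, f i ubar = vbar i) (hf1 : ∀ i, fderiv ℝ (f i) ubar = 0) :
    ∃ η C : ℝ, 0 < η ∧ 0 < C ∧
      ∀ u₀ : 𝓢'(Dom d, CVal n), IsRealValued u₀ →
        capNorm χ ((d : ℝ) / 2 - 1) ((d : ℝ) / 2) (u₀ - constDist d ubar) ≤ ENNReal.ofReal η →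
        ∃ u : ℝ → (Dom d →ᵇ Val n),
          IsStrongSolution a f χ u₀ u ∧
          InCb χ ((d : ℝ) / 2 - 1) ((d : ℝ) / 2) (pert ubar u) ∧
          (∀ w : ℝ → (Dom d →ᵇ Val n), IsSolution a f u₀ w →
            InCb χ ((d : ℝ) / 2 - 1) ((d : ℝ) / 2) (pert ubar w) → ∀ t, 0 ≤ t → w t = u t) ∧
          ∀ t, 0 ≤ t →
            supNorm χ ((d : ℝ) / 2 - 1) ((d : ℝ) / 2) t (pert ubar u) +
              intNorm χ ((d : ℝ) / 2 + 1) ((d : ℝ) / 2 + 2) t (pert ubar u) +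
              ∑ i, intNorm χ ((d : ℝ) / 2) ((d : ℝ) / 2 + 1) t
                (fun τ => darcy a f i u τ - constDist d (vbar i)) ≤
            ENNReal.ofReal C *
              capNorm χ ((d : ℝ) / 2 - 1) ((d : ℝ) / 2) (u₀ - constDist d ubar) := by
  have : NeZero d := ⟨by omega⟩
  obtain ⟨η, C, hη, hC, h⟩ := exists_isStrongSolution hχ ha (isFlux_fluxPert hf hf1)
  set S : ℝ≥0∞ := capConst ((d : ℝ) / 2 - 1) (d / 2) with hS
  have hSt : S ≠ ⊤ := capConst_ne_top _ _
  -- S converts the Besov norm of the datum into its norm on shells, so the threshold is divided by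
  -- S; the added ones keep the denominator and the final constant positive.
  refine ⟨η / (S.toReal + 1), C.toReal + 1, by positivity, by positivity, fun u₀ hu₀ hsmall => ?_⟩
  have hSη : S * ENNReal.ofReal (η / (S.toReal + 1)) ≤ ENNReal.ofReal η := by
    rw [← ENNReal.ofReal_toReal hSt, ← ENNReal.ofReal_mul ENNReal.toReal_nonneg,
      ENNReal.toReal_ofReal ENNReal.toReal_nonneg]
    refine ENNReal.ofReal_le_ofReal ?_
    rw [mul_div_assoc', div_le_iff₀ (by positivity)]
    nlinarith [ENNReal.toReal_nonneg (a := S)]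
  obtain ⟨u, h1, h2, h3, h4⟩ := h u₀ hu₀ (hsmall.trans_lt ENNReal.ofReal_lt_top)
    ((mul_le_mul_right hsmall _).trans hSη)
  refine ⟨u, h1, h2, h3, fun t _ => ?_⟩
  simp only [← hf0]
  refine (h4 t).trans (mul_le_mul_left ?_ _)
  exact (ENNReal.ofReal_toReal hC).ge.trans (ENNReal.ofReal_le_ofReal (by linarith))
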